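/- Work over $\mathbb Q$, with homological grading and the Koszul sign rule; for a graded space $V$ put $V[n]_k=V_{k+n}$, and transport an operator $\varphi:V\to V\otimes V$ to $V[n]$ as $(s\otimes s)\varphi s^{-1}$, where $s:V\to V[n]$ is the shift. **Setting.** Let $C$ be a DG open Frobenius algebra of degree $m\in\mathbb Z$: a chain complex $(C,d)$ with a counital, coassociative, graded cocommutative DG coalgebra structure $x\mapsto x'\otimes x''$ (counit $\varepsilon$), a coaugmentation $\mathbb Q\hookrightarrow C$, $1\mapsto e$ (so $e\in C_0$, $de=0$, $e'\otimes e''=e\otimes e$, $\varepsilon(e)=1$), and a product of degree $-m$ which is a commutative DG product in the sense of the Koszul rule (i.e. $x\bullet y=(-1)^{m|x|}xy$ makes $C[m]$ a commutative, not necessarily unital, DG algebra), such that $$(xy)'\otimes(xy)''=xy'\otimes y''=(-1)^{m|x'|}x'\otimes x''y .$$ Let $\overline C=\ker\varepsilon\cong C/\mathbb Q$ with the reduced coproduct, $\Sigma\overline C$ its desuspension ($|[a]|=|a|-1$, $d[a]=-[da]$), and let $\widetilde{CC}_*(C)=\prod_{n\ge1}C\otimes(\Sigma\overline C)^{\otimes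 n}$ be the reduced normalized cocyclic cobar complex (in each degree, the product of the parts of that degree), with differential $$\begin{aligned}b(a_0[a_1|\cdots|a_n])={}&da_0[a_1|\cdots|a_n]-\sum_i(-1)^{|a_0|+|[a_1|\cdots|a_{i-1}]|}a_0[a_1|\cdots|da_i|\cdots|a_n]\\&+\sum_i(-1)^{|a_0|+|[a_1|\cdots|a_{i-1}|a_i']|}a_0[a_1|\cdots|a_i'|a_i''|\cdots|a_n]\\&+(-1)^{|a_0'|}a_0'\big([a_0''|a_1|\cdots|a_n]-(-1)^{(|a_0''|-1)|[a_1|\cdots|a_n]|}[a_1|\cdots|a_n|a_0'']\big),\end{aligned}$$ and let $\widetilde{HH}_*(C)$ be its homology. Define $$\vee(a_0[a_1|\cdots|a_n])=\sum_{i=2}^{n-1}(-1)^{|a_0|+(1+|a_i|+|(a_0a_i)''|)|[a_1|\cdots|a_{i-1}]|}(a_0a_i)'[a_1|\cdots|a_{i-1}]\otimes(a_0a_i)''[a_{i+1}|\cdots|a_n],$$ $$h(a_0[a_1|\cdots|a_n])=\sum_{i<j}(-1)^{\eta}\,a_0[L|R]\otimes a_ia_j[M],\qquad L=a_1|\cdots|a_{i-1},\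 M=a_{i+1}|\cdots|a_{j-1},\ R=a_{j+1}|\cdots|a_n,$$ the second sum being over the $i<j$ for which both $[L|R]$ and $[M]$ are non-empty, with $\eta=m(|a_0|+|[L]|)+|a_i|+(|a_j|-1)|[M]|+(|a_ia_j|+|[M]|)|[R]|$, and $$S=h-\tau h,$$ $\tau$ being the signed flip of $\widetilde{CC}_*(C)[2-m]$. These maps take values in the completed tensor square $\widetilde{CC}\mathbin{\hat\otimes}\widetilde{CC}=\prod_{p,q\ge1}\big(C\otimes(\Sigma\overline C)^{\otimes p}\big)\otimes\big(C\otimes(\Sigma\overline C)^{\otimes q}\big)$ (again degreewise). **Gerstenhaber coalgebras.** $(V,\vee,S)$ is a Gerstenhaber coalgebra if (i) $(V,\vee)$ is a graded cocommutative, coassociative coalgebra, $\vee$ of degree $0$; (ii) $S$ has degree $1$ and makes $V[1]$ a graded Lie coalgebra: it is skew-symmetric and satisfies $(1+\sigma+\sigma^2)(S\otimes \mathrm{id})S=0$, $\sigma$ the cyclic permutation; (iii) $(\vee\otimes \mathrm{id})S=\big((\mathrm{id}\otimes\tau)(S\otimes \mathrm{id})+\mathrm{id}\otimes S\big)\vee$.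 **Theorem.** $(\widetilde{HH}_*(C)[1-m],\vee,S)$ is a Gerstenhaber coalgebra. In detail: 1. For every $C$, the maps $\vee$ (of degree $0$) and $S$ (of degree $1$) on $\widetilde{CC}_*(C)[1-m]$, and $\vee\otimes\mathrm{id}$, $\mathrm{id}\otimes\vee$, $S\otimes\mathrm{id}$, $\mathrm{id}\otimes S$, commute in the graded sense with the differentials of the completed tensor powers of $\widetilde{CC}_*(C)[1-m]$, and the induced maps satisfy (i)–(iii) on homology, tensor powers of $\widetilde{HH}$ being replaced by the homology of the completed tensor powers of the complex; the skew-symmetry and the co-Jacobi identity in (ii) hold already on the complex. 2. If moreover $C$ is simply connected, i.e. $\overline C_i=0$ for $i\le1$, then there is a unique pair of linear maps $\vee,S:\widetilde{HH}_*(C)[1-m]\to\widetilde{HH}_*(C)[1-m]\otimes\widetilde{HH}_*(C)[1-m]$ (ordinary tensor product) which corresponds to the maps of part 1 under $[x]\otimes[y]\mapsto[x\otimes y]$, and it makes $\widetilde{HH}_*(C)[1-m]$ a Gerstenhaber coalgebra. -/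

import Mathlib

open scoped TensorProduct DirectSum

noncomputable section

namespace HochCog

/-! ### Koszul signs

A grading enters the sign rules only through the operator `γ` that multiplies a homogeneous
element of degree `k` by `(-1)^k`. -/

section Koszul

variable {A B D : Type*} [AddCommGroup A] [Module ℚ A] [AddCommGroup B] [Module ℚ B]
  [AddCommGroup D] [Module ℚ D]

/-- The operator `γ ^ n`, for an involution `γ` and an integer `n`. -/
def gpow (γ : A →ₗ[ℚ] A) (n : ℤ) : A →ₗ[ℚ] A := if Even n then LinearMap.id else γ

theorem gpow_apply {γ : A →ₗ[ℚ] A} {a : A} {i : ℤ} (ha : γ a = (-1 : ℚ) ^ i • a) (n : ℤ) :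
    gpow γ n a = (-1 : ℚ) ^ (n * i) • a := by
  rcases Int.even_or_odd n with hn | hn
  · rw [gpow, if_pos hn, (hn.mul_right i).neg_one_zpow]; simp
  · rw [gpow, if_neg (Int.not_even_iff_odd.2 hn), ha, zpow_mul, hn.neg_one_zpow]

/-- `a ⊗ b ↦ (-1)^(|a| |b|) a ⊗ b`. -/
def koszul (γA : A →ₗ[ℚ] A) (γB : B →ₗ[ℚ] B) : A ⊗[ℚ] B →ₗ[ℚ] A ⊗[ℚ] B :=
  (1 / 2 : ℚ) • (LinearMap.id + TensorProduct.map γA LinearMap.id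
    + TensorProduct.map LinearMap.id γB - TensorProduct.map γA γB)

/-- The Koszul flip `a ⊗ b ↦ (-1)^(|a| |b|) b ⊗ a`. -/
def kflip (γA : A →ₗ[ℚ] A) (γB : B →ₗ[ℚ] B) : A ⊗[ℚ] B →ₗ[ℚ] B ⊗[ℚ] A :=
  (TensorProduct.comm ℚ A B).toLinearMap ∘ₗ koszul γA γB

theorem koszul_tmul {γA : A →ₗ[ℚ] A} {γB : B →ₗ[ℚ] B} {a : A} {b : B} {i j : ℤ}
    (ha : γA a = (-1 : ℚ) ^ i • a) (hb : γB b = (-1 : ℚ) ^ j • b) :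
    koszul γA γB (a ⊗ₜ b) = (-1 : ℚ) ^ (i * j) • (a ⊗ₜ[ℚ] b) := by
  have key : (1 / 2 : ℚ) * (1 + (-1 : ℚ) ^ i + (-1 : ℚ) ^ j - (-1 : ℚ) ^ i * (-1 : ℚ) ^ j)
      = (-1 : ℚ) ^ (i * j) := by
    rcases Int.even_or_odd i with hi | hi <;> rcases Int.even_or_odd j with hj | hj
    · rw [hi.neg_one_zpow, hj.neg_one_zpow, (hi.mul_right j).neg_one_zpow]; norm_num
    · rw [hi.neg_one_zpow, hj.neg_one_zpow, (hi.mul_right j).neg_one_zpow]; norm_num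
    · rw [hi.neg_one_zpow, hj.neg_one_zpow, (hj.mul_left i).neg_one_zpow]; norm_num
    · rw [hi.neg_one_zpow, hj.neg_one_zpow, (hi.mul hj).neg_one_zpow]; norm_num
  rw [← key]
  simp only [koszul, LinearMap.smul_apply, LinearMap.sub_apply, LinearMap.add_apply,
    LinearMap.id_apply, TensorProduct.map_tmul, ha, hb, TensorProduct.tmul_smul,
    ← TensorProduct.smul_tmul', smul_smul]
  module

theorem kflip_tmul {γA : A →ₗ[ℚ] A} {γB : B →ₗ[ℚ] B} {a : A} {b : B} {i j : ℤ}
    (ha : γA a = (-1 : ℚ) ^ i • a) (hb : γB b = (-1 : ℚ) ^ j • b) :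
    kflip γA γB (a ⊗ₜ b) = (-1 : ℚ) ^ (i * j) • (b ⊗ₜ[ℚ] a) := by
  simp [kflip, koszul_tmul ha hb]

/-- `a ⊗ (b ⊗ d) ↦ ± b ⊗ (a ⊗ d)`. -/
def kswap (γA : A →ₗ[ℚ] A) (γB : B →ₗ[ℚ] B) (D : Type*) [AddCommGroup D] [Module ℚ D] :
    A ⊗[ℚ] (B ⊗[ℚ] D) →ₗ[ℚ] B ⊗[ℚ] (A ⊗[ℚ] D) :=
  (TensorProduct.assoc ℚ B A D).toLinearMap ∘ₗ TensorProduct.map (kflip γA γB) LinearMap.id ∘ₗ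
    (TensorProduct.assoc ℚ A B D).symm.toLinearMap

/-- `a₁ ⊗ (a₂ ⊗ a₃) ↦ ± a₂ ⊗ (a₃ ⊗ a₁)`. -/
def kcyc (γ : A →ₗ[ℚ] A) : A ⊗[ℚ] (A ⊗[ℚ] A) →ₗ[ℚ] A ⊗[ℚ] (A ⊗[ℚ] A) :=
  (TensorProduct.assoc ℚ A A A).toLinearMap ∘ₗ kflip γ (TensorProduct.map γ γ)

/-- The degree `k` part of a tensor product of graded modules. -/
def tdeg (F : ℤ → Submodule ℚ A) (G : ℤ → Submodule ℚ B) (k : ℤ) : Submodule ℚ (A ⊗[ℚ] B) :=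
  ⨆ i : ℤ, LinearMap.range (TensorProduct.mapIncl (F i) (G (k - i)))

/-- The operator `x ↦ (-1)^|x| x` of an internally graded module. -/
def parity (F : ℤ → Submodule ℚ A) [DirectSum.Decomposition F] : A →ₗ[ℚ] A :=
  DirectSum.toModule ℚ ℤ A (fun i => (-1 : ℚ) ^ i • (F i).subtype) ∘ₗ
    (DirectSum.decomposeLinearEquiv F).toLinearMap

end Koszul

/-! ### Gerstenhaber coalgebras -/

section Gerstenhaber

variable {A : Type*} [AddCommGroup A] [Module ℚ A]

/-- Graded cocommutative coassociative coalgebra; `F` is the grading and `γ` its sign operator. -/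
structure IsCocommCoalgebra (F : ℤ → Submodule ℚ A) (γ : A →ₗ[ℚ] A)
    (v : A →ₗ[ℚ] A ⊗[ℚ] A) : Prop where
  deg : ∀ k, ∀ x ∈ F k, v x ∈ tdeg F F k
  coassoc : (TensorProduct.assoc ℚ A A A).toLinearMap ∘ₗ TensorProduct.map v LinearMap.id ∘ₗ v
    = TensorProduct.map LinearMap.id v ∘ₗ v
  cocomm : kflip γ γ ∘ₗ v = v

/-- Graded Lie coalgebra, with cobracket of degree `0`: the cobracket is skew-symmetric and
satisfies the co-Jacobi identity `(1 + σ + σ²) (S ⊗ id) S = 0`, `σ` the cyclic permutation. -/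
structure IsLieCoalgebra (F : ℤ → Submodule ℚ A) (γ : A →ₗ[ℚ] A)
    (S : A →ₗ[ℚ] A ⊗[ℚ] A) : Prop where
  deg : ∀ k, ∀ x ∈ F k, S x ∈ tdeg F F k
  skew : kflip γ γ ∘ₗ S = -S
  coJacobi : (LinearMap.id + kcyc γ + kcyc γ ∘ₗ kcyc γ) ∘ₗ
    (TensorProduct.assoc ℚ A A A).toLinearMap ∘ₗ TensorProduct.map S LinearMap.id ∘ₗ S = 0

variable (V : ℤ → Type*) [∀ k, AddCommGroup (V k)] [∀ k, Module ℚ (V k)]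

/-- The total space of a graded vector space. -/
abbrev Tot : Type _ := ⨁ k, V k

/-- The homogeneous elements of degree `k` in the total space. -/
def totDeg (k : ℤ) : Submodule ℚ (Tot V) := LinearMap.range (DirectSum.lof ℚ ℤ V k)

/-- `x ↦ (-1)^|x| x` on the total space. -/
def totPar : Tot V →ₗ[ℚ] Tot V :=
  DirectSum.toModule ℚ ℤ (Tot V) (fun k => (-1 : ℚ) ^ k • DirectSum.lof ℚ ℤ V k)

/-- A Gerstenhaber coalgebra `(V, v, S)`. The cobracket `S` has degree `1` on `V`, that is, it
makes `V[1]` (where `V[1]_k = V_(k+1)`) into a graded Lie coalgebra; the cobracket of `V[1]` is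
`(s ⊗ s) S s⁻¹`, which takes `x` to `∑ (-1)^|x₁| x₁ ⊗ x₂` if `S x = ∑ x₁ ⊗ x₂`. In the last field
`id ⊗ S` and `τ` follow the Koszul rule: `(id ⊗ S) (x ⊗ y) = (-1)^|x| x ⊗ S y`. -/
structure IsGerstenhaberCoalgebra (v S : Tot V →ₗ[ℚ] Tot V ⊗[ℚ] Tot V) : Prop where
  cocomm : IsCocommCoalgebra (totDeg V) (totPar V) v
  lie : IsLieCoalgebra (fun k => totDeg V (k + 1)) (-totPar V)
    (TensorProduct.map (totPar V) LinearMap.id ∘ₗ S)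
  coderivation :
    (TensorProduct.assoc ℚ _ _ _).toLinearMap ∘ₗ TensorProduct.map v LinearMap.id ∘ₗ S
      = (TensorProduct.map LinearMap.id (kflip (totPar V) (totPar V)) ∘ₗ
            (TensorProduct.assoc ℚ _ _ _).toLinearMap ∘ₗ TensorProduct.map S LinearMap.id
          + TensorProduct.map (totPar V) S) ∘ₗ v

end Gerstenhaber

/-! ### DG open Frobenius algebras -/

variable {C : Type*} [AddCommGroup C] [Module ℚ C] [Coalgebra ℚ C]

/-- A coaugmented DG open Frobenius algebra of degree `m` on the graded vector space `C = ⨁ 𝒞 i`.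
The coproduct (with counit) is a Mathlib coalgebra structure on `C`; the product `mul` is an
operator of degree `-m`, and all axioms follow the Koszul sign rule for an operator of this degree
(equivalently, `x • y := (-1)^(m|x|) x y` makes `C[m]` into a commutative DG algebra).
No unit is required. -/
structure OpenFrobenius (m : ℤ) (𝒞 : ℤ → Submodule ℚ C) [DirectSum.Decomposition 𝒞] where
  /-- the differential -/
  d : C →ₗ[ℚ] C
  /-- the product -/
  mul : C →ₗ[ℚ] C →ₗ[ℚ] C
  /-- the image of `1` under the coaugmentation `ℚ → C` -/
  e : C
  d_mem : ∀ i, ∀ x ∈ 𝒞 i, d x ∈ 𝒞 (i - 1)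
  d_d : ∀ x, d (d x) = 0
  mul_mem : ∀ i j, ∀ x ∈ 𝒞 i, ∀ y ∈ 𝒞 j, mul x y ∈ 𝒞 (i + j - m)
  mul_comm : ∀ i j, ∀ x ∈ 𝒞 i, ∀ y ∈ 𝒞 j, mul x y = (-1 : ℚ) ^ (i * j + m) • mul y x
  mul_assoc : ∀ i, ∀ x ∈ 𝒞 i, ∀ y z,
    mul (mul x y) z = (-1 : ℚ) ^ (m + m * i) • mul x (mul y z)
  d_mul : ∀ i, ∀ x ∈ 𝒞 i, ∀ y,
    d (mul x y) = (-1 : ℚ) ^ m • (mul (d x) y + (-1 : ℚ) ^ i • mul x (d y))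
  comul_mem : ∀ k, ∀ x ∈ 𝒞 k, Coalgebra.comul (R := ℚ) x ∈ tdeg 𝒞 𝒞 k
  counit_mem : ∀ i, i ≠ 0 → ∀ x ∈ 𝒞 i, Coalgebra.counit (R := ℚ) x = 0
  cocomm : kflip (parity 𝒞) (parity 𝒞) ∘ₗ Coalgebra.comul (R := ℚ) (A := C) = Coalgebra.comul
  d_comul : Coalgebra.comul (R := ℚ) (A := C) ∘ₗ d
    = (TensorProduct.map d LinearMap.id + TensorProduct.map (parity 𝒞) d) ∘ₗ Coalgebra.comul
  d_counit : ∀ x, Coalgebra.counit (R := ℚ) (d x) = 0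
  e_mem : e ∈ 𝒞 0
  d_e : d e = 0
  comul_e : Coalgebra.comul (R := ℚ) e = e ⊗ₜ[ℚ] e
  counit_e : Coalgebra.counit (R := ℚ) e = 1
  /-- `(x y)' ⊗ (x y)'' = x y' ⊗ y''` -/
  frob_left : ∀ x y, Coalgebra.comul (R := ℚ) (mul x y)
    = TensorProduct.map (mul x) LinearMap.id (Coalgebra.comul (R := ℚ) y)
  /-- `(x y)' ⊗ (x y)'' = (-1)^(m|x'|) x' ⊗ x'' y` -/
  frob_right : ∀ x y, Coalgebra.comul (R := ℚ) (mul x y)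
    = TensorProduct.map (gpow (parity 𝒞) m) (mul.flip y) (Coalgebra.comul (R := ℚ) x)

/-- `C̄`, realized as the kernel of the counit. -/
abbrev Cbar (C : Type*) [AddCommGroup C] [Module ℚ C] [Coalgebra ℚ C] : Type _ :=
  LinearMap.ker (Coalgebra.counit (R := ℚ) (A := C))

/-- Words `[a₁|⋯|aₙ]` in `C̄`, of all lengths: `[a₁|⋯|aₙ] = ι a₁ * ⋯ * ι aₙ`. The letters are
desuspended, so that `[a]` has degree `|a| - 1`. -/
abbrev Word (C : Type*) [AddCommGroup C] [Module ℚ C] [Coalgebra ℚ C] : Type _ :=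
  TensorAlgebra ℚ (Cbar C)

/-- The direct sum of the `C ⊗ (ΣC̄)^{⊗ n}`; `a₀[a₁|⋯|aₙ]` is `a₀ ⊗ₜ (ι a₁ * ⋯ * ι aₙ)`. -/
abbrev Cell (C : Type*) [AddCommGroup C] [Module ℚ C] [Coalgebra ℚ C] : Type _ :=
  C ⊗[ℚ] Word C

/-- The letter `[a]`. -/
abbrev letter : Cbar C →ₗ[ℚ] Word C := TensorAlgebra.ι ℚ

/-- The inclusion `C̄ → C`. -/
abbrev incl : Cbar C →ₗ[ℚ] C := (LinearMap.ker (Coalgebra.counit (R := ℚ) (A := C))).subtype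

/-- The action of the letter `w` used in the definition of `oddDer`. -/
def oddDerStep (γ : Word C →ₗ[ℚ] Word C) (φ : Cbar C →ₗ[ℚ] Word C) :
    Cbar C →ₗ[ℚ] Module.End ℚ (Word C × Word C) where
  toFun w := ((LinearMap.mulLeft ℚ (letter w)) ∘ₗ LinearMap.fst ℚ _ _).prod
    (LinearMap.mulLeft ℚ (φ w) ∘ₗ LinearMap.fst ℚ _ _
      + LinearMap.mulLeft ℚ (γ (letter w)) ∘ₗ LinearMap.snd ℚ _ _)
  map_add' w w' := by
    ext x <;> simp [add_mul]
  map_smul' c w := by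
    ext x <;> simp

theorem oddDerStep_apply (γ : Word C →ₗ[ℚ] Word C) (φ : Cbar C →ₗ[ℚ] Word C) (w : Cbar C)
    (y : Word C × Word C) :
    oddDerStep γ φ w y = (letter w * y.1, φ w * y.1 + γ (letter w) * y.2) := rfl

/-- The derivation `D` of the algebra of words with `D [w] = φ w` and
`D (u v) = D u * v + γ u * D v`, characterized by `oddDer_one` and `oddDer_letter_mul`. -/
def oddDer (γ : Word C →ₗ[ℚ] Word C) (φ : Cbar C →ₗ[ℚ] Word C) : Word C →ₗ[ℚ] Word C :=
  LinearMap.snd ℚ _ _ ∘ₗ LinearMap.applyₗ ((1, 0) : Word C × Word C) ∘ₗ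
    (TensorAlgebra.lift ℚ (oddDerStep γ φ)).toLinearMap

/-- The action of the letter `w` used in the definition of `cut`. -/
def cutStep : Cbar C →ₗ[ℚ]
    Module.End ℚ (Word C × (Word C ⊗[ℚ] (Cbar C ⊗[ℚ] Word C))) where
  toFun w := ((LinearMap.mulLeft ℚ (letter w)) ∘ₗ LinearMap.fst ℚ _ _).prod
    (TensorProduct.mk ℚ _ _ 1 ∘ₗ TensorProduct.mk ℚ _ _ w ∘ₗ LinearMap.fst ℚ _ _
      + TensorProduct.map (LinearMap.mulLeft ℚ (letter w)) LinearMap.id ∘ₗ LinearMap.snd ℚ _ _)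
  map_add' w w' := by
    refine LinearMap.ext fun x => Prod.ext ?_ ?_
    · simp [add_mul]
    · change (1 : Word C) ⊗ₜ[ℚ] ((w + w') ⊗ₜ x.1) + TensorProduct.map _ LinearMap.id x.2
        = ((1 : Word C) ⊗ₜ[ℚ] (w ⊗ₜ x.1) + TensorProduct.map _ LinearMap.id x.2)
          + ((1 : Word C) ⊗ₜ[ℚ] (w' ⊗ₜ x.1) + TensorProduct.map _ LinearMap.id x.2)
      have h : LinearMap.mulLeft ℚ (letter (w + w'))
          = LinearMap.mulLeft ℚ (letter w) + LinearMap.mulLeft ℚ (letter w') := by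
        ext; simp [add_mul]
      rw [h, TensorProduct.map_add_left, TensorProduct.add_tmul, TensorProduct.tmul_add,
        LinearMap.add_apply]
      abel
  map_smul' c w := by
    refine LinearMap.ext fun x => Prod.ext ?_ ?_
    · simp
    · change (1 : Word C) ⊗ₜ[ℚ] ((c • w) ⊗ₜ[ℚ] x.1) + TensorProduct.map _ LinearMap.id x.2
        = c • ((1 : Word C) ⊗ₜ[ℚ] (w ⊗ₜ x.1) + TensorProduct.map _ LinearMap.id x.2)
      have h : LinearMap.mulLeft ℚ (letter (c • w)) = c • LinearMap.mulLeft ℚ (letter w) := by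
        ext; simp
      rw [h, TensorProduct.map_smul_left, ← TensorProduct.smul_tmul', TensorProduct.tmul_smul,
        LinearMap.smul_apply, smul_add]

theorem cutStep_apply (w : Cbar C) (y : Word C × (Word C ⊗[ℚ] (Cbar C ⊗[ℚ] Word C))) :
    cutStep w y = (letter w * y.1, 1 ⊗ₜ (w ⊗ₜ y.1)
      + TensorProduct.map (LinearMap.mulLeft ℚ (letter w)) LinearMap.id y.2) := rfl

/-- `[a₁|⋯|aₙ] ↦ ∑ᵢ [a₁|⋯|aᵢ₋₁] ⊗ (aᵢ ⊗ [aᵢ₊₁|⋯|aₙ])`, characterized by `cut_one` and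
`cut_letter_mul`. -/
def cut : Word C →ₗ[ℚ] Word C ⊗[ℚ] (Cbar C ⊗[ℚ] Word C) :=
  LinearMap.snd ℚ _ _ ∘ₗ
    LinearMap.applyₗ ((1, 0) : Word C × (Word C ⊗[ℚ] (Cbar C ⊗[ℚ] Word C))) ∘ₗ
    (TensorAlgebra.lift ℚ (cutStep (C := C))).toLinearMap

theorem oddDer_one (γ : Word C →ₗ[ℚ] Word C) (φ : Cbar C →ₗ[ℚ] Word C) :
    oddDer γ φ 1 = 0 := by
  simp [oddDer]

theorem oddDer_letter_mul (γ : Word C →ₗ[ℚ] Word C) (φ : Cbar C →ₗ[ℚ] Word C)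
    (w : Cbar C) (u : Word C) :
    oddDer γ φ (letter w * u) = φ w * u + γ (letter w) * oddDer γ φ u := by
  have h : ∀ u : Word C,
      (TensorAlgebra.lift ℚ (oddDerStep γ φ) u ((1, 0) : Word C × Word C)).1 = u := by
    intro u
    have : ∀ y : Word C × Word C, (TensorAlgebra.lift ℚ (oddDerStep γ φ) u y).1 = u * y.1 := by
      induction u using TensorAlgebra.induction with
      | algebraMap r => intro y; simp [Algebra.smul_def]
      | ι x => intro y; simp [oddDerStep_apply]
      | mul a b ha hb => intro y; simp [ha, hb, mul_assoc]
      | add a b ha hb => intro y; simp [ha, hb, add_mul]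
    simpa using this (1, 0)
  simp only [oddDer, LinearMap.comp_apply, AlgHom.toLinearMap_apply, map_mul,
    TensorAlgebra.lift_ι_apply, LinearMap.applyₗ_apply_apply, Module.End.mul_apply]
  conv_rhs => rw [← h u]
  simp [h, oddDerStep_apply]

theorem cut_one : cut (1 : Word C) = 0 := by
  simp [cut]

theorem cut_letter_mul (w : Cbar C) (u : Word C) :
    cut (letter w * u) = 1 ⊗ₜ (w ⊗ₜ u)
      + TensorProduct.map (LinearMap.mulLeft ℚ (letter w)) LinearMap.id (cut u) := by
  have h : ∀ u : Word C, (TensorAlgebra.lift ℚ (cutStep (C := C)) u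
      ((1, 0) : Word C × (Word C ⊗[ℚ] (Cbar C ⊗[ℚ] Word C)))).1 = u := by
    intro u
    have : ∀ y : Word C × (Word C ⊗[ℚ] (Cbar C ⊗[ℚ] Word C)),
        (TensorAlgebra.lift ℚ (cutStep (C := C)) u y).1 = u * y.1 := by
      induction u using TensorAlgebra.induction with
      | algebraMap r => intro y; simp [Algebra.smul_def]
      | ι x => intro y; simp [cutStep_apply]
      | mul a b ha hb => intro y; simp [ha, hb, mul_assoc]
      | add a b ha hb => intro y; simp [ha, hb, add_mul]
    simpa using this (1, 0)
  simp only [cut, LinearMap.comp_apply, AlgHom.toLinearMap_apply, map_mul,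
    TensorAlgebra.lift_ι_apply, LinearMap.applyₗ_apply_apply, Module.End.mul_apply]
  conv_rhs => rw [← h u]
  simp [h, cutStep_apply]

/-- The projection of `⨁ₙ C ⊗ (ΣC̄)^{⊗ n}` to its component with words of length `n`. -/
def len (C : Type*) [AddCommGroup C] [Module ℚ C] [Coalgebra ℚ C] (n : ℕ) :
    Cell C →ₗ[ℚ] Cell C :=
  TensorProduct.map LinearMap.id
    (GradedAlgebra.proj (fun n : ℕ => LinearMap.range (TensorAlgebra.ι ℚ (M := Cbar C)) ^ n) n)

namespace OpenFrobenius

variable {m : ℤ} {𝒞 : ℤ → Submodule ℚ C} [DirectSum.Decomposition 𝒞] (Φ : OpenFrobenius m 𝒞)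

/-- The projection `C → C̄`, `x ↦ x - ε(x) e`. -/
def proj : C →ₗ[ℚ] Cbar C :=
  (LinearMap.id - (LinearMap.toSpanSingleton ℚ C Φ.e) ∘ₗ Coalgebra.counit).codRestrict _
    (fun x => by simp [Φ.counit_e])

/-- The sign `(-1)^|a|` on `C̄`. -/
def γbar : Cbar C →ₗ[ℚ] Cbar C := Φ.proj ∘ₗ parity 𝒞 ∘ₗ incl

/-- The sign operator of the algebra of words, `[a] ↦ (-1)^(|a|-1) [a]`. -/
def γword : Word C →ₗ[ℚ] Word C :=
  (TensorAlgebra.lift ℚ (letter ∘ₗ (-Φ.γbar))).toLinearMap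

/-- The sign operator of `⨁ₙ C ⊗ (ΣC̄)^{⊗ n}`. -/
def γcell : Cell C →ₗ[ℚ] Cell C := TensorProduct.map (parity 𝒞) Φ.γword

/-! #### The differential `b` -/

/-- The internal part of `b`:
`da₀[a₁|⋯|aₙ] + ∑ᵢ (-1)^(|a₀|+|[a₁|⋯|aᵢ₋₁]|) a₀[a₁|⋯|d[aᵢ]|⋯|aₙ]`, where `d[a] = -[da]` is the
differential of the desuspension `ΣC̄`. -/
def bInt : Cell C →ₗ[ℚ] Cell C :=
  TensorProduct.map Φ.d LinearMap.id
    + TensorProduct.map (parity 𝒞) (oddDer Φ.γword (-(letter ∘ₗ Φ.proj ∘ₗ Φ.d ∘ₗ incl)))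

/-- `a ↦ ∑ (-1)^|[a']| [a'|a'']`, with the reduced coproduct of `C̄`. -/
def splitLetter : Cbar C →ₗ[ℚ] Word C :=
  LinearMap.mul' ℚ (Word C) ∘ₗ
    TensorProduct.map (letter ∘ₗ (-Φ.γbar) ∘ₗ Φ.proj) (letter ∘ₗ Φ.proj) ∘ₗ
    Coalgebra.comul ∘ₗ incl

/-- `a₀ u ↦ ∑ (-1)^|a₀'| a₀' ⊗ ([a₀''] ⊗ u)`. -/
def pull : Cell C →ₗ[ℚ] C ⊗[ℚ] (Word C ⊗[ℚ] Word C) :=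
  (TensorProduct.assoc ℚ C (Word C) (Word C)).toLinearMap ∘ₗ
    TensorProduct.map
      (TensorProduct.map (parity 𝒞) (letter ∘ₗ Φ.proj) ∘ₗ Coalgebra.comul) LinearMap.id

/-- The part of `b` that makes words longer:
`∑ᵢ (-1)^(|a₀|+|[a₁|⋯|aᵢ₋₁|aᵢ']|) a₀[a₁|⋯|aᵢ'|aᵢ''|⋯|aₙ]
  + (-1)^|a₀'| a₀' ([a₀''|a₁|⋯|aₙ] - (-1)^((|a₀''|-1)|[a₁|⋯|aₙ]|) [a₁|⋯|aₙ|a₀''])`. -/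
def bExt : Cell C →ₗ[ℚ] Cell C :=
  TensorProduct.map (parity 𝒞) (oddDer Φ.γword Φ.splitLetter)
    + TensorProduct.map LinearMap.id (LinearMap.mul' ℚ (Word C)) ∘ₗ Φ.pull
    - TensorProduct.map LinearMap.id
        (LinearMap.mul' ℚ (Word C) ∘ₗ kflip Φ.γword Φ.γword) ∘ₗ Φ.pull

/-! #### The coproduct `∨`, the homotopy `h` and the cobracket `S` -/

/-- `a₀ ⊗ (L ⊗ (a ⊗ R)) ↦
(-1)^(|a₀| + (|a|-1)|L| + |(a₀a)''||L|) (a₀a)' L ⊗ (a₀a)'' R`. -/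
def veeTerm : C ⊗[ℚ] (Word C ⊗[ℚ] (Cbar C ⊗[ℚ] Word C)) →ₗ[ℚ] Cell C ⊗[ℚ] Cell C :=
  (TensorProduct.assoc ℚ C (Word C) (C ⊗[ℚ] Word C)).symm.toLinearMap ∘ₗ
    TensorProduct.map LinearMap.id (kswap (parity 𝒞) Φ.γword (Word C)) ∘ₗ
    (TensorProduct.assoc ℚ C C (Word C ⊗[ℚ] Word C)).toLinearMap ∘ₗ
    TensorProduct.map
      (Coalgebra.comul ∘ₗ TensorProduct.lift Φ.mul ∘ₗ TensorProduct.map (parity 𝒞) incl)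
      LinearMap.id ∘ₗ
    (TensorProduct.assoc ℚ C (Cbar C) (Word C ⊗[ℚ] Word C)).symm.toLinearMap ∘ₗ
    TensorProduct.map LinearMap.id (kswap Φ.γword (-Φ.γbar) (Word C))

/-- The explicit formula for `veeTerm` on homogeneous elements. -/
theorem veeTerm_tmul {a₀ c f : C} {L R : Word C} {a : Cbar C} {i j l t : ℤ}
    (h₀ : parity 𝒞 a₀ = (-1 : ℚ) ^ i • a₀) (ha : Φ.γbar a = (-1 : ℚ) ^ j • a)
    (hL : Φ.γword L = (-1 : ℚ) ^ l • L) (hf : parity 𝒞 f = (-1 : ℚ) ^ t • f)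
    (hcf : Coalgebra.comul (R := ℚ) (Φ.mul a₀ (a : C)) = c ⊗ₜ[ℚ] f) :
    Φ.veeTerm (a₀ ⊗ₜ (L ⊗ₜ (a ⊗ₜ R)))
      = (-1 : ℚ) ^ (i + (1 + j + t) * l) • ((c ⊗ₜ[ℚ] L) ⊗ₜ[ℚ] (f ⊗ₜ[ℚ] R)) := by
  have ha' : (-Φ.γbar) a = (-1 : ℚ) ^ (1 + j) • a := by
    rw [LinearMap.neg_apply, ha, zpow_add₀ (by norm_num)]; simp
  simp only [veeTerm, kswap, LinearMap.comp_apply, LinearEquiv.coe_coe, TensorProduct.map_tmul,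
    LinearMap.id_apply, TensorProduct.assoc_symm_tmul, kflip_tmul hL ha', map_smul,
    TensorProduct.tmul_smul, TensorProduct.assoc_tmul,
    ← TensorProduct.smul_tmul', TensorProduct.lift.tmul, h₀,
    Submodule.subtype_apply, hcf, kflip_tmul hf hL, smul_smul]
  congr 1
  rw [← zpow_add₀ (by norm_num), ← zpow_add₀ (by norm_num)]
  congr 1; ring

/-- The coproduct `∨`, with all its components (also those with an empty word):
`a₀[a₁|⋯|aₙ] ↦ ∑ᵢ (-1)^ε(i) (a₀aᵢ)'[a₁|⋯|aᵢ₋₁] ⊗ (a₀aᵢ)''[aᵢ₊₁|⋯|aₙ]`,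
`ε(i) = |a₀| + (1 + |aᵢ| + |(a₀aᵢ)''|) |[a₁|⋯|aᵢ₋₁]|`. -/
def vee : Cell C →ₗ[ℚ] Cell C ⊗[ℚ] Cell C :=
  Φ.veeTerm ∘ₗ TensorProduct.map LinearMap.id cut

/-- `a ⊗ (M ⊗ (a' ⊗ R)) ↦ (-1)^(|a| + (|a'|-1)|M| + (|aa'|+|M|)|R|) R ⊗ (aa') M`. -/
def hInner : Cbar C ⊗[ℚ] (Word C ⊗[ℚ] (Cbar C ⊗[ℚ] Word C)) →ₗ[ℚ] Word C ⊗[ℚ] Cell C :=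
  kflip Φ.γcell Φ.γword ∘ₗ
    (TensorProduct.assoc ℚ C (Word C) (Word C)).symm.toLinearMap ∘ₗ
    TensorProduct.map
      (TensorProduct.lift Φ.mul ∘ₗ TensorProduct.map (incl ∘ₗ Φ.γbar) incl) LinearMap.id ∘ₗ
    (TensorProduct.assoc ℚ (Cbar C) (Cbar C) (Word C ⊗[ℚ] Word C)).symm.toLinearMap ∘ₗ
    TensorProduct.map LinearMap.id (kswap Φ.γword (-Φ.γbar) (Word C))

/-- `a₀ ⊗ (L ⊗ (a ⊗ (M ⊗ (a' ⊗ R)))) ↦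
(-1)^(m(|a₀|+|L|) + |a| + (|a'|-1)|M| + (|aa'|+|M|)|R|) a₀ (L R) ⊗ (aa') M`. -/
def hTerm : C ⊗[ℚ] (Word C ⊗[ℚ] (Cbar C ⊗[ℚ] (Word C ⊗[ℚ] (Cbar C ⊗[ℚ] Word C)))) →ₗ[ℚ]
    Cell C ⊗[ℚ] Cell C :=
  (TensorProduct.assoc ℚ C (Word C) (Cell C)).symm.toLinearMap ∘ₗ
    TensorProduct.map (gpow (parity 𝒞) m)
      (TensorProduct.map (LinearMap.mul' ℚ (Word C)) LinearMap.id ∘ₗ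
        (TensorProduct.assoc ℚ (Word C) (Word C) (Cell C)).symm.toLinearMap ∘ₗ
        TensorProduct.map (gpow Φ.γword m) Φ.hInner)

/-- The explicit formula for `hTerm` on homogeneous elements. -/
theorem hTerm_tmul {a₀ : C} {L M R : Word C} {a a' : Cbar C} {i l j j' μ ρ t : ℤ}
    (h₀ : parity 𝒞 a₀ = (-1 : ℚ) ^ i • a₀) (hL : Φ.γword L = (-1 : ℚ) ^ l • L)
    (ha : Φ.γbar a = (-1 : ℚ) ^ j • a) (hM : Φ.γword M = (-1 : ℚ) ^ μ • M)
    (ha' : Φ.γbar a' = (-1 : ℚ) ^ j' • a') (hR : Φ.γword R = (-1 : ℚ) ^ ρ • R)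
    (hc : parity 𝒞 (Φ.mul (a : C) (a' : C)) = (-1 : ℚ) ^ t • Φ.mul (a : C) (a' : C)) :
    Φ.hTerm (a₀ ⊗ₜ (L ⊗ₜ (a ⊗ₜ (M ⊗ₜ (a' ⊗ₜ R)))))
      = (-1 : ℚ) ^ (m * (i + l) + j + (j' - 1) * μ + (t + μ) * ρ) •
        ((a₀ ⊗ₜ[ℚ] (L * R)) ⊗ₜ[ℚ] (Φ.mul (a : C) (a' : C) ⊗ₜ[ℚ] M)) := by
  have ha1 : (-Φ.γbar) a' = (-1 : ℚ) ^ (j' - 1) • a' := by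
    rw [LinearMap.neg_apply, ha', zpow_sub₀ (by norm_num), zpow_one, div_neg, div_one, neg_smul]
  have hcM : Φ.γcell (Φ.mul (a : C) (a' : C) ⊗ₜ[ℚ] M)
      = (-1 : ℚ) ^ (t + μ) • (Φ.mul (a : C) (a' : C) ⊗ₜ[ℚ] M) := by
    rw [γcell, TensorProduct.map_tmul, hc, hM, TensorProduct.tmul_smul,
      ← TensorProduct.smul_tmul', smul_smul, zpow_add₀ (by norm_num), _root_.mul_comm]
  simp only [hTerm, hInner, kswap, LinearMap.comp_apply, LinearEquiv.coe_coe,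
    TensorProduct.map_tmul, LinearMap.id_apply, TensorProduct.assoc_symm_tmul,
    kflip_tmul hM ha1, map_smul, TensorProduct.tmul_smul, TensorProduct.assoc_tmul,
    ← TensorProduct.smul_tmul', TensorProduct.lift.tmul,
    Submodule.subtype_apply, ha, kflip_tmul hcM hR, smul_smul, gpow_apply h₀, gpow_apply hL,
    LinearMap.mul'_apply]
  congr 1
  simp only [← zpow_add₀ (show (-1 : ℚ) ≠ 0 by norm_num)]
  congr 1; ring

/-- The homotopy `h`, with all its components (also those with an empty word):
`a₀[a₁|⋯|aₙ] ↦ ∑_{i<j} ± a₀[a₁|⋯|aᵢ₋₁|aⱼ₊₁|⋯|aₙ] ⊗ aᵢaⱼ[aᵢ₊₁|⋯|aⱼ₋₁]`,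
with the Koszul signs displayed at `hTerm`. -/
def h : Cell C →ₗ[ℚ] Cell C ⊗[ℚ] Cell C :=
  Φ.hTerm ∘ₗ TensorProduct.map LinearMap.id
    (TensorProduct.map LinearMap.id (TensorProduct.map LinearMap.id cut) ∘ₗ cut)

/-- The flip of the shifted complex `CC[w]`, as an operator on `CC ⊗ CC`: if `t` is the shift then
`(t ⊗ t)⁻¹ τ (t ⊗ t)` is `(-1)^w` times the flip of `CC ⊗ CC`. -/
def shiftFlip (w : ℤ) : Cell C ⊗[ℚ] Cell C →ₗ[ℚ] Cell C ⊗[ℚ] Cell C :=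
  (-1 : ℚ) ^ w • kflip Φ.γcell Φ.γcell

/-- The cobracket `S = h - τ h`, where `τ` is the flip of `CC[2-m]`, the complex on which `S` is a
Lie cobracket. -/
def S : Cell C →ₗ[ℚ] Cell C ⊗[ℚ] Cell C := Φ.h - Φ.shiftFlip (2 - m) ∘ₗ Φ.h

/-! #### The shift by `1 - m`

Let `s` be the shift to `CC[1-m]`, where `CC[1-m]_k = CC_(k+1-m)`; it has degree `m - 1`. -/

/-- The sign operator of `CC[1-m]`. -/
def γs : Cell C →ₗ[ℚ] Cell C := (-1 : ℚ) ^ (m - 1) • Φ.γcell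

/-- The operator `(s ⊗ s) φ s⁻¹` on `CC[1-m]`: if `φ α = ∑ x ⊗ y` then it takes `s α` to
`∑ (-1)^((m-1)|x|) s x ⊗ s y`. -/
def susp (φ : Cell C →ₗ[ℚ] Cell C ⊗[ℚ] Cell C) : Cell C →ₗ[ℚ] Cell C ⊗[ℚ] Cell C :=
  TensorProduct.map (gpow Φ.γcell (m - 1)) LinearMap.id ∘ₗ φ

/-- `∨` on `CC[1-m]`, of degree `0`. -/
def veeS : Cell C →ₗ[ℚ] Cell C ⊗[ℚ] Cell C := Φ.susp Φ.vee

/-- `S` on `CC[1-m]`, of degree `1`. -/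
def SS : Cell C →ₗ[ℚ] Cell C ⊗[ℚ] Cell C := Φ.susp Φ.S

/-- `S` on `CC[1-m][1]`, of degree `0`. -/
def SL : Cell C →ₗ[ℚ] Cell C ⊗[ℚ] Cell C :=
  TensorProduct.map Φ.γs LinearMap.id ∘ₗ Φ.SS

/-- The two parts of the differential of `CC[1-m]`. -/
def bIntS : Cell C →ₗ[ℚ] Cell C := (-1 : ℚ) ^ (m - 1) • Φ.bInt

/-- See `bIntS`. -/
def bExtS : Cell C →ₗ[ℚ] Cell C := (-1 : ℚ) ^ (m - 1) • Φ.bExt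

end OpenFrobenius

/-! ### The reduced complex and its completed tensor powers

The reduced complex is the product over `n ≥ 1` of the `C ⊗ (ΣC̄)^{⊗ n}`; its elements are
sequences `α : ℕ → Cell C` with `α 0 = 0` whose `n`-th term has words of length `n`. Its tensor
square and cube are completed accordingly: they are the products over `p, q ≥ 1` (and
`p, q, r ≥ 1`) of the tensor products of the factors. -/

/-- Underlying space of the reduced complex. -/
abbrev Ch1 (C : Type*) [AddCommGroup C] [Module ℚ C] [Coalgebra ℚ C] : Type _ := ℕ → Cell C

/-- Underlying space of the completed tensor square. -/
abbrev Ch2 (C : Type*) [AddCommGroup C] [Module ℚ C] [Coalgebra ℚ C] : Type _ :=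
  ℕ → ℕ → Cell C ⊗[ℚ] Cell C

/-- Underlying space of the completed tensor cube. -/
abbrev Ch3 (C : Type*) [AddCommGroup C] [Module ℚ C] [Coalgebra ℚ C] : Type _ :=
  ℕ → ℕ → ℕ → Cell C ⊗[ℚ] (Cell C ⊗[ℚ] Cell C)

section Chains

variable (𝒞 : ℤ → Submodule ℚ C)

/-- The degree `k` part of `C ⊗ (ΣC̄)^{⊗ n}` for `n ≥ 1`, and zero for `n = 0`. -/
def cellDeg (n : ℕ) (k : ℤ) : Submodule ℚ (Cell C) :=
  if n = 0 then ⊥ else Submodule.span ℚ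
    {x | ∃ (i : ℤ) (a : C) (δ : Fin n → ℤ) (w : Fin n → Cbar C),
      a ∈ 𝒞 i ∧ (∀ l, (w l : C) ∈ 𝒞 (δ l)) ∧ i + ∑ l, (δ l - 1) = k ∧
      x = a ⊗ₜ[ℚ] TensorAlgebra.tprod ℚ (Cbar C) n w}

/-- The degree `k` part of the reduced complex. -/
def cc1 (k : ℤ) : Submodule ℚ (Ch1 C) :=
  Submodule.pi Set.univ fun n => cellDeg 𝒞 n k

/-- The degree `k` part of the completed tensor square. -/
def cc2 (k : ℤ) : Submodule ℚ (Ch2 C) :=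
  Submodule.pi Set.univ fun p => Submodule.pi Set.univ fun q =>
    tdeg (cellDeg 𝒞 p) (cellDeg 𝒞 q) k

/-- The degree `k` part of the completed tensor cube. -/
def cc3 (k : ℤ) : Submodule ℚ (Ch3 C) :=
  Submodule.pi Set.univ fun p => Submodule.pi Set.univ fun q => Submodule.pi Set.univ fun r =>
    tdeg (cellDeg 𝒞 p) (tdeg (cellDeg 𝒞 q) (cellDeg 𝒞 r)) k

/-- The term of index `n - 1` of a sequence (zero if `n = 0`). -/
def prev (M : Type*) [AddCommGroup M] [Module ℚ M] (n : ℕ) : (ℕ → M) →ₗ[ℚ] M :=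
  if n = 0 then 0 else LinearMap.proj (n - 1)

/-- The term of index `n` of a sequence. -/
abbrev term (M : Type*) [AddCommGroup M] [Module ℚ M] (n : ℕ) : (ℕ → M) →ₗ[ℚ] M :=
  LinearMap.proj n

/-- The external product of two sequences. -/
def cross (x y : Ch1 C) : Ch2 C := fun p q => x p ⊗ₜ[ℚ] y q

/-- The flip of the completed tensor square, for a sign operator `γ`. -/
def flip2 (γ : Cell C →ₗ[ℚ] Cell C) (ξ : Ch2 C) : Ch2 C := fun p q => kflip γ γ (ξ q p)

/-- The cyclic permutation `x ⊗ y ⊗ z ↦ ± y ⊗ z ⊗ x` of the completed tensor cube. -/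
def cyc3 (γ : Cell C →ₗ[ℚ] Cell C) (ξ : Ch3 C) : Ch3 C := fun p q r => kcyc γ (ξ r p q)

/-- `id ⊗ τ` on the completed tensor cube. -/
def flip23 (γ : Cell C →ₗ[ℚ] Cell C) (ξ : Ch3 C) : Ch3 C := fun p q r =>
  TensorProduct.map LinearMap.id (kflip γ γ) (ξ p r q)

/-- The map to the completed tensor square induced by an operator `φ` that shortens words by `r`
letters in total; components with an empty word are dropped. -/
def op (r : ℕ) (φ : Cell C →ₗ[ℚ] Cell C ⊗[ℚ] Cell C) (α : Ch1 C) : Ch2 C := fun p q =>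
  if p = 0 ∨ q = 0 then 0 else TensorProduct.map (len C p) (len C q) (φ (α (p + q + r)))

/-- `φ ⊗ id`, for `φ` as in `op`. -/
def opLeft (r : ℕ) (φ : Cell C →ₗ[ℚ] Cell C ⊗[ℚ] Cell C) (ξ : Ch2 C) : Ch3 C := fun p q t =>
  if p = 0 ∨ q = 0 then 0 else
    TensorProduct.assoc ℚ _ _ _
      (TensorProduct.map (TensorProduct.map (len C p) (len C q) ∘ₗ φ) LinearMap.id
        (ξ (p + q + r) t))

/-- `id ⊗ φ`, for `φ` as in `op`; the Koszul sign of `φ` passing the first factor is given by `γ`,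
so `γ = id` for `φ` of even degree. -/
def opRight (r : ℕ) (γ : Cell C →ₗ[ℚ] Cell C) (φ : Cell C →ₗ[ℚ] Cell C ⊗[ℚ] Cell C)
    (ξ : Ch2 C) : Ch3 C := fun p q t =>
  if q = 0 ∨ t = 0 then 0 else
    TensorProduct.map γ (TensorProduct.map (len C q) (len C t) ∘ₗ φ) (ξ p (q + t + r))

end Chains

namespace OpenFrobenius

variable {m : ℤ} {𝒞 : ℤ → Submodule ℚ C} [DirectSum.Decomposition 𝒞] (Φ : OpenFrobenius m 𝒞)

/-- The differential `b` of the reduced complex. -/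
def b1 : Ch1 C →ₗ[ℚ] Ch1 C := LinearMap.pi fun n =>
  Φ.bInt ∘ₗ term _ n + Φ.bExt ∘ₗ prev _ n

/-- The differential of `CC[1-m]`, where `CC` is the reduced complex. -/
def b1S : Ch1 C →ₗ[ℚ] Ch1 C := (-1 : ℚ) ^ (m - 1) • Φ.b1

/-- The differential `b ⊗ id + id ⊗ b` of the completed tensor square of `CC[1-m]`. -/
def b2S : Ch2 C →ₗ[ℚ] Ch2 C := LinearMap.pi fun p => LinearMap.pi fun q =>
  (TensorProduct.map Φ.bIntS LinearMap.id + TensorProduct.map Φ.γs Φ.bIntS) ∘ₗ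
      term _ q ∘ₗ term _ p
    + TensorProduct.map Φ.bExtS LinearMap.id ∘ₗ term _ q ∘ₗ prev _ p
    + TensorProduct.map Φ.γs Φ.bExtS ∘ₗ prev _ q ∘ₗ term _ p

/-- The differential of the completed tensor cube of `CC[1-m]`. -/
def b3S : Ch3 C →ₗ[ℚ] Ch3 C :=
  LinearMap.pi fun p => LinearMap.pi fun q => LinearMap.pi fun r =>
    (TensorProduct.map Φ.bIntS LinearMap.id
        + TensorProduct.map Φ.γs (TensorProduct.map Φ.bIntS LinearMap.id)
        + TensorProduct.map Φ.γs (TensorProduct.map Φ.γs Φ.bIntS)) ∘ₗ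
        term _ r ∘ₗ term _ q ∘ₗ term _ p
      + TensorProduct.map Φ.bExtS LinearMap.id ∘ₗ term _ r ∘ₗ term _ q ∘ₗ prev _ p
      + TensorProduct.map Φ.γs (TensorProduct.map Φ.bExtS LinearMap.id) ∘ₗ
          term _ r ∘ₗ prev _ q ∘ₗ term _ p
      + TensorProduct.map Φ.γs (TensorProduct.map Φ.γs Φ.bExtS) ∘ₗ
          prev _ r ∘ₗ term _ q ∘ₗ term _ p

/-- The cycles of degree `k` of the reduced complex. -/
def cycles (k : ℤ) : Submodule ℚ (Ch1 C) := cc1 𝒞 k ⊓ LinearMap.ker Φ.b1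

/-- The reduced Hochschild homology in degree `k`. -/
abbrev HH (k : ℤ) : Type _ :=
  Φ.cycles k ⧸ ((cc1 𝒞 (k + 1)).map Φ.b1).submoduleOf (Φ.cycles k)

/-- The shifted reduced Hochschild homology `HH[1-m]`. -/
abbrev HHs (k : ℤ) : Type _ := Φ.HH (k + 1 - m)

/-- The class of a cycle in the total space of `HH[1-m]`. -/
def cls (k : ℤ) (α : Φ.cycles (k + 1 - m)) : Tot Φ.HHs :=
  DirectSum.lof ℚ ℤ Φ.HHs k (Submodule.Quotient.mk α)

/-- Two elements of degree `k` of the completed tensor square of `CC[1-m]` are homologous. -/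
def Homol2 (k : ℤ) (ξ η : Ch2 C) : Prop :=
  ∃ ζ ∈ cc2 𝒞 (k + 1 + 2 * (1 - m)), ξ - η = Φ.b2S ζ

/-- Two elements of degree `k` of the completed tensor cube of `CC[1-m]` are homologous. -/
def Homol3 (k : ℤ) (ξ η : Ch3 C) : Prop :=
  ∃ ζ ∈ cc3 𝒞 (k + 1 + 3 * (1 - m)), ξ - η = Φ.b3S ζ

/-- The Gerstenhaber coalgebra identities on `HH[1-m]`, with values in the homology of the
completed tensor powers of `CC[1-m]`. The first group of fields says that `∨` and `S`, and
`∨ ⊗ id`, `id ⊗ ∨`, `S ⊗ id`, `id ⊗ S`, are maps of degree `0` and `1` which commute, respectively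
anticommute, with the differentials, and so induce maps on homology; the second group states the
axioms of a Gerstenhaber coalgebra for the induced maps.

The completion is needed because `∨` and `S` take an element of the infinite product to an infinite
sum of tensors, which in general does not lie in the algebraic tensor product. -/
structure CompletedGerstenhaber : Prop where
  vee_deg : ∀ k, ∀ α ∈ cc1 𝒞 (k + 1 - m), op 1 Φ.veeS α ∈ cc2 𝒞 (k + 2 * (1 - m))
  S_deg : ∀ k, ∀ α ∈ cc1 𝒞 (k + 1 - m), op 2 Φ.SS α ∈ cc2 𝒞 (k + 1 + 2 * (1 - m))
  vee_chain : ∀ k, ∀ α ∈ cc1 𝒞 k, Φ.b2S (op 1 Φ.veeS α) = op 1 Φ.veeS (Φ.b1S α)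
  S_chain : ∀ k, ∀ α ∈ cc1 𝒞 k, Φ.b2S (op 2 Φ.SS α) = -op 2 Φ.SS (Φ.b1S α)
  veeLeft_deg : ∀ k, ∀ ξ ∈ cc2 𝒞 (k + 2 * (1 - m)),
    opLeft 1 Φ.veeS ξ ∈ cc3 𝒞 (k + 3 * (1 - m))
  veeRight_deg : ∀ k, ∀ ξ ∈ cc2 𝒞 (k + 2 * (1 - m)),
    opRight 1 LinearMap.id Φ.veeS ξ ∈ cc3 𝒞 (k + 3 * (1 - m))
  SLeft_deg : ∀ k, ∀ ξ ∈ cc2 𝒞 (k + 2 * (1 - m)),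
    opLeft 2 Φ.SS ξ ∈ cc3 𝒞 (k + 1 + 3 * (1 - m))
  SRight_deg : ∀ k, ∀ ξ ∈ cc2 𝒞 (k + 2 * (1 - m)),
    opRight 2 Φ.γs Φ.SS ξ ∈ cc3 𝒞 (k + 1 + 3 * (1 - m))
  veeLeft_chain : ∀ k, ∀ ξ ∈ cc2 𝒞 k,
    Φ.b3S (opLeft 1 Φ.veeS ξ) = opLeft 1 Φ.veeS (Φ.b2S ξ)
  veeRight_chain : ∀ k, ∀ ξ ∈ cc2 𝒞 k,
    Φ.b3S (opRight 1 LinearMap.id Φ.veeS ξ) = opRight 1 LinearMap.id Φ.veeS (Φ.b2S ξ)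
  SLeft_chain : ∀ k, ∀ ξ ∈ cc2 𝒞 k,
    Φ.b3S (opLeft 2 Φ.SS ξ) = -opLeft 2 Φ.SS (Φ.b2S ξ)
  SRight_chain : ∀ k, ∀ ξ ∈ cc2 𝒞 k,
    Φ.b3S (opRight 2 Φ.γs Φ.SS ξ) = -opRight 2 Φ.γs Φ.SS (Φ.b2S ξ)
  /-- `∨` is coassociative. -/
  coassoc : ∀ k, ∀ α ∈ Φ.cycles (k + 1 - m), Φ.Homol3 k
    (opLeft 1 Φ.veeS (op 1 Φ.veeS α)) (opRight 1 LinearMap.id Φ.veeS (op 1 Φ.veeS α))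
  /-- `∨` is graded cocommutative. -/
  cocomm : ∀ k, ∀ α ∈ Φ.cycles (k + 1 - m), Φ.Homol2 k
    (flip2 Φ.γs (op 1 Φ.veeS α)) (op 1 Φ.veeS α)
  /-- `S` is graded skew-symmetric on `CC[1-m][1]`, already before passing to homology. -/
  skew : ∀ k, ∀ α ∈ cc1 𝒞 k, flip2 (-Φ.γs) (op 2 Φ.SL α) = -op 2 Φ.SL α
  /-- `S` satisfies the graded co-Jacobi identity `(1 + σ + σ²) (S ⊗ id) S = 0` on `CC[1-m][1]`,
  already before passing to homology. -/
  coJacobi : ∀ k, ∀ α ∈ cc1 𝒞 k,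
    opLeft 2 Φ.SL (op 2 Φ.SL α) + cyc3 (-Φ.γs) (opLeft 2 Φ.SL (op 2 Φ.SL α))
      + cyc3 (-Φ.γs) (cyc3 (-Φ.γs) (opLeft 2 Φ.SL (op 2 Φ.SL α))) = 0
  /-- `(∨ ⊗ id) S = ((id ⊗ τ) (S ⊗ id) + id ⊗ S) ∨`. -/
  coderivation : ∀ k, ∀ α ∈ Φ.cycles (k + 1 - m), Φ.Homol3 (k + 1)
    (opLeft 1 Φ.veeS (op 2 Φ.SS α))
    (flip23 Φ.γs (opLeft 2 Φ.SS (op 1 Φ.veeS α)) + opRight 2 Φ.γs Φ.SS (op 1 Φ.veeS α))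

/-- The element `t` of `HH[1-m] ⊗ HH[1-m]` corresponds to the homology class of `ξ`, of degree `k`,
under the map `[x] ⊗ [y] ↦ [x ⊗ y]` to the homology of the completed tensor square. -/
def Represents (k : ℤ) (t : Tot Φ.HHs ⊗[ℚ] Tot Φ.HHs) (ξ : Ch2 C) : Prop :=
  ∃ (n : ℕ) (i j : Fin n → ℤ) (x : ∀ l, Φ.cycles (i l + 1 - m)) (y : ∀ l, Φ.cycles (j l + 1 - m)),
    t = ∑ l, Φ.cls (i l) (x l) ⊗ₜ[ℚ] Φ.cls (j l) (y l) ∧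
    Φ.Homol2 k (∑ l, cross (x l : Ch1 C) (y l : Ch1 C)) ξ

/-- `v` and `S` are the maps `HH[1-m] → HH[1-m] ⊗ HH[1-m]` induced by `∨` and by `S = h - τ h`. -/
def Induced (v S : Tot Φ.HHs →ₗ[ℚ] Tot Φ.HHs ⊗[ℚ] Tot Φ.HHs) : Prop :=
  ∀ (k : ℤ) (α : Φ.cycles (k + 1 - m)),
    Φ.Represents k (v (Φ.cls k α)) (op 1 Φ.veeS (α : Ch1 C)) ∧
    Φ.Represents (k + 1) (S (Φ.cls k α)) (op 2 Φ.SS (α : Ch1 C))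

end OpenFrobenius

end HochCog

end

open scoped TensorProduct DirectSum
open TensorProduct
open LinearMap (comp_apply id_apply)

noncomputable section

set_option linter.unusedSimpArgs false
set_option maxSynthPendingDepth 3

namespace HochCog

local notation "assoc" => TensorProduct.assoc ℚ

/-! ### Shortcut instances -/

section

variable {A B : Type*} [AddCommGroup A] [Module ℚ A] [AddCommGroup B] [Module ℚ B]

instance : AddMonoidHomClass (A →ₗ[ℚ] B) A B := inferInstance

instance : ZeroHomClass (A →ₗ[ℚ] B) A B := inferInstance

instance : AddHomClass (A →ₗ[ℚ] B) A B := inferInstance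

instance : MulActionHomClass (A →ₗ[ℚ] B) ℚ A B := inferInstance

instance : AddMonoidHomClass (A ≃ₗ[ℚ] B) A B := inferInstance

instance : ZeroHomClass (A ≃ₗ[ℚ] B) A B := inferInstance

instance : AddHomClass (A ≃ₗ[ℚ] B) A B := inferInstance

instance : MulActionHomClass (A ≃ₗ[ℚ] B) ℚ A B := inferInstance

end

/-! ### Parities -/

/-- The sign `(-1)^p` of a parity `p`. -/
def sgn (p : ZMod 2) : ℚ := if p = 0 then 1 else -1

@[simp] theorem sgn_zero : sgn 0 = 1 := rfl

@[simp] theorem sgn_one : sgn 1 = -1 := rfl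

theorem sgn_add (p q : ZMod 2) : sgn (p + q) = sgn p * sgn q := by
  have h : ∀ p : ZMod 2, p = 0 ∨ p = 1 := by decide
  rcases h p with rfl | rfl <;> rcases h q with rfl | rfl <;>
    simp [sgn, show (1 : ZMod 2) + 1 = 0 from rfl]

theorem sgn_mul_self (p : ZMod 2) : sgn p * sgn p = 1 := by
  rw [← sgn_add, show p + p = 0 by grind, sgn_zero]

theorem zmod_two_mul_self (p : ZMod 2) : p * p = p := by
  revert p; decide

theorem zmod_two_two : (2 : ZMod 2) = 0 := rfl

theorem neg_one_zpow_eq_sgn (i : ℤ) : (-1 : ℚ) ^ i = sgn (i : ZMod 2) := by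
  rcases Int.even_or_odd i with hi | hi
  · rw [hi.neg_one_zpow, (ZMod.intCast_eq_zero_iff_even).2 hi, sgn_zero]
  · rw [hi.neg_one_zpow, (ZMod.intCast_eq_one_iff_odd).2 hi, sgn_one]

section

variable {A B M : Type*} [AddCommGroup A] [Module ℚ A] [AddCommGroup B] [Module ℚ B]
  [AddCommGroup M] [Module ℚ M]

/-- `a` is homogeneous of parity `p` for the sign operator `γ`. -/
class HasPar (γ : A →ₗ[ℚ] A) (a : A) (p : outParam (ZMod 2)) : Prop where
  eq : γ a = sgn p • a

theorem exists_hasPar {γ : A →ₗ[ℚ] A} (hγ : ∀ a, γ (γ a) = a) (a : A) :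
    ∃ a₀ a₁ : A, HasPar γ a₀ 0 ∧ HasPar γ a₁ 1 ∧ a = a₀ + a₁ := by
  refine ⟨(1 / 2 : ℚ) • (a + γ a), (1 / 2 : ℚ) • (a - γ a), ⟨?_⟩, ⟨?_⟩, by module⟩
  · simp [hγ, add_comm]
  · rw [map_smul, map_sub, hγ, sgn_one]; module

/-- To prove an additive statement it is enough to consider homogeneous elements. -/
theorem hasPar_induction {γ : A →ₗ[ℚ] A} (hγ : ∀ a, γ (γ a) = a) {P : A → Prop}
    (add : ∀ a b, P a → P b → P (a + b)) (h : ∀ p a, HasPar γ a p → P a) (a : A) : P a := by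
  obtain ⟨a₀, a₁, h₀, h₁, rfl⟩ := exists_hasPar hγ a
  exact add _ _ (h _ _ h₀) (h _ _ h₁)

/-- To prove an additive statement about tensors it is enough to consider homogeneous ones. -/
theorem tensor_induction {γA : A →ₗ[ℚ] A} {γB : B →ₗ[ℚ] B} (hA : ∀ a, γA (γA a) = a)
    (hB : ∀ b, γB (γB b) = b) {P : A ⊗[ℚ] B → Prop} (zero : P 0)
    (add : ∀ s t, P s → P t → P (s + t))
    (h : ∀ p q a b, HasPar γA a p → HasPar γB b q → P (a ⊗ₜ b)) (t : A ⊗[ℚ] B) : P t := by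
  induction t with
  | zero => exact zero
  | tmul a b =>
    refine hasPar_induction hA (P := fun a => P (a ⊗ₜ b)) ?_ (fun p a ha => ?_) a
    · intro a a' h h'; rw [add_tmul]; exact add _ _ h h'
    · refine hasPar_induction hB (P := fun b => P (a ⊗ₜ b)) ?_ (fun q b hb => h p q a b ha hb) b
      intro b b' h h'; rw [tmul_add]; exact add _ _ h h'
  | add s t hs ht => exact add _ _ hs ht

/-- A homogeneous tensor is a sum of homogeneous tensors of the same parity. -/
@[elab_as_elim]
theorem tensor_induction_par {γA : A →ₗ[ℚ] A} {γB : B →ₗ[ℚ] B} (hA : ∀ a, γA (γA a) = a)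
    (hB : ∀ b, γB (γB b) = b) {r : ZMod 2} {P : A ⊗[ℚ] B → Prop} (zero : P 0)
    (add : ∀ s t, P s → P t → P (s + t))
    (h : ∀ p q a b, HasPar γA a p → HasPar γB b q → r = p + q → P (a ⊗ₜ b)) (t : A ⊗[ℚ] B)
    (ht : HasPar (map γA γB) t r) : P t := by
  have key : ∀ t : A ⊗[ℚ] B,
      P ((1 / 2 : ℚ) • (t + sgn r • map γA γB t)) := by
    intro t
    induction t using tensor_induction hA hB with
    | zero => simpa using zero
    | add s t hs ht =>
      convert add _ _ hs ht using 1
      simp only [map_add]; module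
    | h p q a b ha hb =>
      rw [map_tmul, ha.eq, hb.eq, smul_tmul_smul, ← sgn_add, smul_smul, ← sgn_add]
      by_cases e : r = p + q
      · convert h p q a b ha hb e using 1
        rw [e, show p + q + (p + q) = 0 by grind, sgn_zero]; module
      · have aux : ∀ y z : ZMod 2, ¬y = z → y + z = 1 := by decide
        rw [aux _ _ e, sgn_one]
        convert zero using 1; module
  convert key t using 1
  rw [ht.eq, smul_smul, sgn_mul_self]; module

theorem tensor_ext {γA : A →ₗ[ℚ] A} {γB : B →ₗ[ℚ] B} (hA : ∀ a, γA (γA a) = a)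
    (hB : ∀ b, γB (γB b) = b) {f g : A ⊗[ℚ] B →ₗ[ℚ] M}
    (h : ∀ p q a b, HasPar γA a p → HasPar γB b q → f (a ⊗ₜ b) = g (a ⊗ₜ b)) : f = g :=
  LinearMap.ext fun t => tensor_induction hA hB (P := fun t => f t = g t) (by simp)
    (fun s t hs ht => by rw [map_add, map_add, hs, ht]) h t

theorem HasPar.zpow {γ : A →ₗ[ℚ] A} {a : A} {p : ZMod 2} (h : HasPar γ a p) :
    γ a = (-1 : ℚ) ^ (p.val : ℤ) • a := by
  rw [neg_one_zpow_eq_sgn, h.eq]; simp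

theorem kflip_tmul_sgn {γA : A →ₗ[ℚ] A} {γB : B →ₗ[ℚ] B} (a : A) (b : B) {p q : ZMod 2}
    [ha : HasPar γA a p] [hb : HasPar γB b q] :
    kflip γA γB (a ⊗ₜ b) = sgn (p * q) • (b ⊗ₜ[ℚ] a) := by
  rw [kflip_tmul ha.zpow hb.zpow, neg_one_zpow_eq_sgn]; simp

theorem kswap_tmul_sgn {D : Type*} [AddCommGroup D] [Module ℚ D] {γA : A →ₗ[ℚ] A}
    {γB : B →ₗ[ℚ] B} (a : A) (b : B) (d : D) {p q : ZMod 2}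
    [ha : HasPar γA a p] [hb : HasPar γB b q] :
    kswap γA γB D (a ⊗ₜ (b ⊗ₜ d)) = sgn (p * q) • (b ⊗ₜ[ℚ] (a ⊗ₜ d)) := by
  simp [kswap, kflip_tmul_sgn a b, ← smul_tmul']

instance HasPar.tmul {γA : A →ₗ[ℚ] A} {γB : B →ₗ[ℚ] B} (a : A) (b : B) {p q : ZMod 2}
    [ha : HasPar γA a p] [hb : HasPar γB b q] :
    HasPar (map γA γB) (a ⊗ₜ b) (p + q) := ⟨by
  rw [map_tmul, ha.eq, hb.eq, sgn_add, smul_tmul_smul]⟩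

instance HasPar.smul {γ : A →ₗ[ℚ] A} (a : A) (c : ℚ) {p : ZMod 2} [ha : HasPar γ a p] :
    HasPar γ (c • a) p := ⟨by rw [map_smul, ha.eq, smul_comm]⟩

theorem map_map_self {γA : A →ₗ[ℚ] A} {γB : B →ₗ[ℚ] B} (hA : ∀ a, γA (γA a) = a)
    (hB : ∀ b, γB (γB b) = b) (t : A ⊗[ℚ] B) :
    map γA γB (map γA γB t) = t := by
  induction t with
  | zero => simp
  | tmul a b => simp [hA, hB]
  | add s t hs ht => simp only [map_add, hs, ht]

end

/-! ### Words -/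

section Words

variable {U V M : Type*} [AddCommGroup U] [Module ℚ U] [AddCommGroup V] [Module ℚ V]
  [AddCommGroup M] [Module ℚ M]

/-- The action of a letter used in the definition of `wordRec`. -/
def wordRecStep (s : U →ₗ[ℚ] (TensorAlgebra ℚ U × V) →ₗ[ℚ] V) :
    U →ₗ[ℚ] Module.End ℚ (TensorAlgebra ℚ U × V) :=
  LinearMap.mk₂ ℚ (fun a y => (TensorAlgebra.ι ℚ a * y.1, s a y))
    (by intros; simp [add_mul]) (by intros; simp) (by intros; simp [mul_add]) (by intros; simp)

theorem wordRecStep_apply (s : U →ₗ[ℚ] (TensorAlgebra ℚ U × V) →ₗ[ℚ] V) (a : U)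
    (y : TensorAlgebra ℚ U × V) :
    wordRecStep s a y = (TensorAlgebra.ι ℚ a * y.1, s a y) := rfl

/-- The linear map `f` on words with `f 1 = 0` and `f ([a] u) = s a (u, f u)`. -/
def wordRec (s : U →ₗ[ℚ] (TensorAlgebra ℚ U × V) →ₗ[ℚ] V) : TensorAlgebra ℚ U →ₗ[ℚ] V :=
  LinearMap.snd ℚ _ _ ∘ₗ LinearMap.applyₗ ((1, 0) : TensorAlgebra ℚ U × V) ∘ₗ
    (TensorAlgebra.lift ℚ (wordRecStep s)).toLinearMap

theorem wordRec_one (s : U →ₗ[ℚ] (TensorAlgebra ℚ U × V) →ₗ[ℚ] V) : wordRec s 1 = 0 := by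
  simp [wordRec]

theorem wordRec_ι_mul (s : U →ₗ[ℚ] (TensorAlgebra ℚ U × V) →ₗ[ℚ] V) (a : U)
    (u : TensorAlgebra ℚ U) :
    wordRec s (TensorAlgebra.ι ℚ a * u) = s a (u, wordRec s u) := by
  have h : ∀ (u : TensorAlgebra ℚ U) (y : TensorAlgebra ℚ U × V),
      (TensorAlgebra.lift ℚ (wordRecStep s) u y).1 = u * y.1 := by
    intro u
    induction u using TensorAlgebra.induction with
    | algebraMap r => intro y; simp [Algebra.smul_def]
    | ι x => intro y; simp [wordRecStep_apply]
    | mul a b ha hb => intro y; simp [ha, hb, mul_assoc]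
    | add a b ha hb => intro y; simp [ha, hb, add_mul]
  have h' : TensorAlgebra.lift ℚ (wordRecStep s) u ((1, 0) : TensorAlgebra ℚ U × V)
      = (u, wordRec s u) := Prod.ext (by simpa using h u (1, 0)) rfl
  change (TensorAlgebra.lift ℚ (wordRecStep s) (TensorAlgebra.ι ℚ a * u)
    ((1, 0) : TensorAlgebra ℚ U × V)).2 = _
  rw [map_mul, Module.End.mul_apply, h', TensorAlgebra.lift_ι_apply, wordRecStep_apply]

theorem word_submodule_eq_top (S : Submodule ℚ (TensorAlgebra ℚ U)) (one : 1 ∈ S)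
    (mul : ∀ a, ∀ u ∈ S, TensorAlgebra.ι ℚ a * u ∈ S) : S = ⊤ := by
  have h : ∀ u : TensorAlgebra ℚ U, ∀ v ∈ S, u * v ∈ S := by
    intro u
    induction u using TensorAlgebra.induction with
    | algebraMap r => intro v hv; rw [← Algebra.smul_def]; exact S.smul_mem r hv
    | ι x => exact mul x
    | mul a b ha hb => intro v hv; rw [mul_assoc]; exact ha _ (hb _ hv)
    | add a b ha hb => intro v hv; rw [add_mul]; exact S.add_mem (ha _ hv) (hb _ hv)
  exact (Submodule.eq_top_iff').2 fun u => by simpa using h u 1 one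

theorem word_ext {f g : TensorAlgebra ℚ U →ₗ[ℚ] M} (one : f 1 = g 1)
    (mul : ∀ a u, f u = g u → f (TensorAlgebra.ι ℚ a * u) = g (TensorAlgebra.ι ℚ a * u)) :
    f = g :=
  LinearMap.ext fun u => by
    have := word_submodule_eq_top (LinearMap.eqLocus f g) one mul
    have hu : u ∈ LinearMap.eqLocus f g := this ▸ Submodule.mem_top
    exact hu

/-- The sign operator on words. -/
def wordPar (γ : U →ₗ[ℚ] U) : TensorAlgebra ℚ U →ₗ[ℚ] TensorAlgebra ℚ U :=
  (TensorAlgebra.lift ℚ (TensorAlgebra.ι ℚ ∘ₗ γ)).toLinearMap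

theorem wordPar_one (γ : U →ₗ[ℚ] U) : wordPar γ 1 = 1 := by simp [wordPar]

theorem wordPar_mul (γ : U →ₗ[ℚ] U) (u v : TensorAlgebra ℚ U) :
    wordPar γ (u * v) = wordPar γ u * wordPar γ v := by simp [wordPar]

theorem wordPar_ι (γ : U →ₗ[ℚ] U) (a : U) :
    wordPar γ (TensorAlgebra.ι ℚ a) = TensorAlgebra.ι ℚ (γ a) := by simp [wordPar]

theorem wordPar_wordPar {γ : U →ₗ[ℚ] U} (hγ : ∀ a, γ (γ a) = a) (u : TensorAlgebra ℚ U) :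
    wordPar γ (wordPar γ u) = u := by
  have : wordPar γ ∘ₗ wordPar γ = LinearMap.id := word_ext (by simp [wordPar_one])
    (fun a u h => by
      simp only [comp_apply, id_apply] at h ⊢
      rw [wordPar_mul, wordPar_mul, h, wordPar_ι, wordPar_ι, hγ])
  exact LinearMap.congr_fun this u

instance HasPar.word_one (γ : U →ₗ[ℚ] U) : HasPar (wordPar γ) 1 0 :=
  ⟨by rw [wordPar_one, sgn_zero, one_smul]⟩

instance HasPar.word_mul (γ : U →ₗ[ℚ] U) (u v : TensorAlgebra ℚ U) {p q : ZMod 2}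
    [hu : HasPar (wordPar γ) u p] [hv : HasPar (wordPar γ) v q] :
    HasPar (wordPar γ) (u * v) (p + q) :=
  ⟨by rw [wordPar_mul, hu.eq, hv.eq, sgn_add, smul_mul_smul_comm]⟩

instance HasPar.word_ι (γ : U →ₗ[ℚ] U) (a : U) {p : ZMod 2} [ha : HasPar γ a p] :
    HasPar (wordPar γ) (TensorAlgebra.ι ℚ a) p :=
  ⟨by rw [wordPar_ι, ha.eq, map_smul]⟩

/-- Induction on words with homogeneous letters. -/
theorem word_hom_ext {γ : U →ₗ[ℚ] U} (hγ : ∀ a, γ (γ a) = a) {f g : TensorAlgebra ℚ U →ₗ[ℚ] M}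
    (one : f 1 = g 1)
    (mul : ∀ p q a u, HasPar γ a p → HasPar (wordPar γ) u q → f u = g u →
      f (TensorAlgebra.ι ℚ a * u) = g (TensorAlgebra.ι ℚ a * u)) : f = g := by
  have key : ∀ u, f u = g u ∧ f (wordPar γ u) = g (wordPar γ u) := by
    intro u
    have := word_submodule_eq_top
      (LinearMap.eqLocus f g ⊓ LinearMap.eqLocus (f ∘ₗ wordPar γ) (g ∘ₗ wordPar γ))
      ⟨one, by simpa [wordPar_one] using one⟩ ?_
    · have hu : u ∈ LinearMap.eqLocus f g ⊓
        LinearMap.eqLocus (f ∘ₗ wordPar γ) (g ∘ₗ wordPar γ) := this ▸ Submodule.mem_top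
      exact hu
    · intro a u hu
      obtain ⟨h1, h2⟩ := hu
      replace h1 : f u = g u := h1
      replace h2 : f (wordPar γ u) = g (wordPar γ u) := h2
      have hom : ∀ p a, HasPar γ a p → ∀ q v, HasPar (wordPar γ) v q →
          f v = g v → f (TensorAlgebra.ι ℚ a * v) = g (TensorAlgebra.ι ℚ a * v) ∧
            f (wordPar γ (TensorAlgebra.ι ℚ a * v)) = g (wordPar γ (TensorAlgebra.ι ℚ a * v)) := by
        intro p a ha q v hv h
        have e := mul p q a v ha hv h
        refine ⟨e, ?_⟩
        rw [(HasPar.word_mul γ (TensorAlgebra.ι ℚ a) v).eq, map_smul, map_smul, e]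
      have main : ∀ p a, HasPar γ a p →
          f (TensorAlgebra.ι ℚ a * u) = g (TensorAlgebra.ι ℚ a * u) ∧
            f (wordPar γ (TensorAlgebra.ι ℚ a * u)) = g (wordPar γ (TensorAlgebra.ι ℚ a * u)) := by
        intro p a ha
        have e : u = (1 / 2 : ℚ) • (u + wordPar γ u) + (1 / 2 : ℚ) • (u - wordPar γ u) := by
          module
        have p0 : HasPar (wordPar γ) ((1 / 2 : ℚ) • (u + wordPar γ u)) 0 :=
          ⟨by simp [wordPar_wordPar hγ, add_comm]⟩
        have p1 : HasPar (wordPar γ) ((1 / 2 : ℚ) • (u - wordPar γ u)) 1 :=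
          ⟨by rw [map_smul, map_sub, wordPar_wordPar hγ, sgn_one]; module⟩
        have a0 := hom p a ha _ _ p0 (by simp [h1, h2])
        have a1 := hom p a ha _ _ p1 (by simp [h1, h2])
        rw [e, mul_add, map_add, map_add, map_add, map_add, map_add, a0.1, a0.2, a1.1, a1.2]
        exact ⟨rfl, rfl⟩
      have := hasPar_induction hγ (P := fun a =>
        f (TensorAlgebra.ι ℚ a * u) = g (TensorAlgebra.ι ℚ a * u) ∧
            f (wordPar γ (TensorAlgebra.ι ℚ a * u)) = g (wordPar γ (TensorAlgebra.ι ℚ a * u)))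
        (fun a b ha hb => by
          simp only [map_add, add_mul, ha.1, ha.2, hb.1, hb.2, and_self]) main a
      exact this
  exact LinearMap.ext fun u => (key u).1

/-- The projection of words to words of positive length. -/
def wordPos (U : Type*) [AddCommGroup U] [Module ℚ U] :
    TensorAlgebra ℚ U →ₗ[ℚ] TensorAlgebra ℚ U :=
  LinearMap.id - Algebra.linearMap ℚ _ ∘ₗ (TensorAlgebra.algebraMapInv (M := U)).toLinearMap

theorem wordPos_one : wordPos U 1 = 0 := by simp [wordPos]

theorem wordPos_ι_mul (a : U) (u : TensorAlgebra ℚ U) :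
    wordPos U (TensorAlgebra.ι ℚ a * u) = TensorAlgebra.ι ℚ a * u := by
  simp [wordPos, TensorAlgebra.algebraMapInv]

theorem wordPos_mul_ι (a : U) (u : TensorAlgebra ℚ U) :
    wordPos U (u * TensorAlgebra.ι ℚ a) = u * TensorAlgebra.ι ℚ a := by
  simp [wordPos, TensorAlgebra.algebraMapInv]

theorem wordPos_apply (u : TensorAlgebra ℚ U) :
    ∃ c : ℚ, wordPos U u = u - c • 1 :=
  ⟨TensorAlgebra.algebraMapInv u, by simp [wordPos, Algebra.algebraMap_eq_smul_one]⟩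

theorem wordPos_wordPos (u : TensorAlgebra ℚ U) : wordPos U (wordPos U u) = wordPos U u := by
  obtain ⟨c, hc⟩ := wordPos_apply u
  rw [hc, map_sub, hc, map_smul, wordPos_one, smul_zero, sub_zero]

theorem wordPos_wordPar (γ : U →ₗ[ℚ] U) (u : TensorAlgebra ℚ U) :
    wordPos U (wordPar γ u) = wordPar γ (wordPos U u) := by
  have : wordPos U ∘ₗ wordPar γ = wordPar γ ∘ₗ wordPos U :=
    word_ext (by simp [wordPar_one, wordPos_one])
      (fun a u _ => by simp [wordPar_mul, wordPar_ι, wordPos_ι_mul])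
  exact LinearMap.congr_fun this u

instance HasPar.wordPos (γ : U →ₗ[ℚ] U) (u : TensorAlgebra ℚ U) {p : ZMod 2}
    [hu : HasPar (wordPar γ) u p] : HasPar (wordPar γ) (wordPos U u) p :=
  ⟨by rw [← wordPos_wordPar, hu.eq, map_smul]⟩

/-- The derivation `D` of the algebra of words with `D [a] = φ a` and
`D ([a] u) = φ a * u + [γ a] * D u`. -/
def wordDer (γ : U →ₗ[ℚ] U) (φ : U →ₗ[ℚ] TensorAlgebra ℚ U) :
    TensorAlgebra ℚ U →ₗ[ℚ] TensorAlgebra ℚ U :=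
  wordRec (LinearMap.mk₂ ℚ (fun a y => φ a * y.1 + TensorAlgebra.ι ℚ (γ a) * y.2)
    (by intros; simp only [map_add, add_mul]; abel) (by intros; simp)
    (by intros; simp only [Prod.fst_add, Prod.snd_add, mul_add]; abel) (by intros; simp))

theorem wordDer_one (γ : U →ₗ[ℚ] U) (φ : U →ₗ[ℚ] TensorAlgebra ℚ U) : wordDer γ φ 1 = 0 :=
  wordRec_one _

theorem wordDer_ι_mul (γ : U →ₗ[ℚ] U) (φ : U →ₗ[ℚ] TensorAlgebra ℚ U) (a : U)
    (u : TensorAlgebra ℚ U) :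
    wordDer γ φ (TensorAlgebra.ι ℚ a * u) = φ a * u + TensorAlgebra.ι ℚ (γ a) * wordDer γ φ u :=
  wordRec_ι_mul _ a u

theorem wordDer_ι (γ : U →ₗ[ℚ] U) (φ : U →ₗ[ℚ] TensorAlgebra ℚ U) (a : U) :
    wordDer γ φ (TensorAlgebra.ι ℚ a) = φ a := by
  simpa [wordDer_one] using wordDer_ι_mul γ φ a 1

theorem wordDer_mul (γ : U →ₗ[ℚ] U) (φ : U →ₗ[ℚ] TensorAlgebra ℚ U)
    (u v : TensorAlgebra ℚ U) :
    wordDer γ φ (u * v) = wordDer γ φ u * v + wordPar γ u * wordDer γ φ v := by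
  have : wordDer γ φ ∘ₗ LinearMap.mulRight ℚ v = LinearMap.mulRight ℚ v ∘ₗ wordDer γ φ
      + LinearMap.mulRight ℚ (wordDer γ φ v) ∘ₗ wordPar γ :=
    word_ext (by simp [wordDer_one, wordPar_one]) (fun a u h => by
      simp only [comp_apply, LinearMap.add_apply, LinearMap.mulRight_apply] at h ⊢
      rw [mul_assoc, wordDer_ι_mul, h, wordDer_ι_mul, wordPar_mul, wordPar_ι]
      noncomm_ring)
  exact LinearMap.congr_fun this u

/-- `[a₁|⋯|aₙ] ↦ ∑ᵢ [a₁|⋯|aᵢ₋₁] ⊗ (aᵢ ⊗ [aᵢ₊₁|⋯|aₙ])`. -/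
def wordCut (U : Type*) [AddCommGroup U] [Module ℚ U] :
    TensorAlgebra ℚ U →ₗ[ℚ] TensorAlgebra ℚ U ⊗[ℚ] (U ⊗[ℚ] TensorAlgebra ℚ U) :=
  wordRec (LinearMap.mk₂ ℚ (fun a y => 1 ⊗ₜ (a ⊗ₜ y.1) + TensorAlgebra.ι ℚ a • y.2)
    (by intros; simp only [map_add, tmul_add, add_tmul, add_smul]
        abel)
    (by intros; simp only [map_smul, ← smul_tmul', tmul_smul, smul_assoc, smul_add])
    (by intros; simp only [Prod.fst_add, Prod.snd_add, tmul_add, smul_add]; abel)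
    (by intro c a y
        simp only [Prod.smul_fst, Prod.smul_snd, tmul_smul, smul_add]
        rw [smul_comm (TensorAlgebra.ι ℚ a) c]))

theorem wordCut_one : wordCut U 1 = 0 := wordRec_one _

theorem wordCut_ι_mul (a : U) (u : TensorAlgebra ℚ U) :
    wordCut U (TensorAlgebra.ι ℚ a * u) = 1 ⊗ₜ (a ⊗ₜ u) + TensorAlgebra.ι ℚ a • wordCut U u :=
  wordRec_ι_mul _ a u

/-- Right multiplication of the last factor. -/
def ract (V : Type*) [AddCommGroup V] [Module ℚ V] (w : TensorAlgebra ℚ U) :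
    TensorAlgebra ℚ U ⊗[ℚ] (V ⊗[ℚ] TensorAlgebra ℚ U) →ₗ[ℚ]
      TensorAlgebra ℚ U ⊗[ℚ] (V ⊗[ℚ] TensorAlgebra ℚ U) :=
  map .id (map .id (LinearMap.mulRight ℚ w))

theorem ract_tmul (w L R : TensorAlgebra ℚ U) (v : V) :
    ract V w (L ⊗ₜ (v ⊗ₜ R)) = L ⊗ₜ (v ⊗ₜ (R * w)) := by simp [ract]

theorem map_id_smul {N : Type*} [AddCommGroup N] [Module ℚ N] (f : V →ₗ[ℚ] N)
    (w : TensorAlgebra ℚ U) (t : TensorAlgebra ℚ U ⊗[ℚ] V) :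
    map .id f (w • t) = w • map .id f t := by
  induction t with
  | zero => simp
  | tmul a b => simp [smul_tmul']
  | add s t hs ht => simp only [smul_add, map_add, hs, ht]

theorem ract_smul (w w' : TensorAlgebra ℚ U)
    (t : TensorAlgebra ℚ U ⊗[ℚ] (V ⊗[ℚ] TensorAlgebra ℚ U)) :
    ract V w (w' • t) = w' • ract V w t := map_id_smul _ _ _

theorem wordCut_mul (u v : TensorAlgebra ℚ U) :
    wordCut U (u * v) = ract U v (wordCut U u) + u • wordCut U v := by
  have : wordCut U ∘ₗ LinearMap.mulRight ℚ v = ract U v ∘ₗ wordCut U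
      + LinearMap.toSpanSingleton (TensorAlgebra ℚ U) _ (wordCut U v) :=
    word_ext (by simp [wordCut_one]) (fun a u h => by
      simp only [comp_apply, LinearMap.add_apply, LinearMap.mulRight_apply,
        LinearMap.coe_restrictScalars, LinearMap.toSpanSingleton_apply] at h ⊢
      rw [mul_assoc, wordCut_ι_mul, h, wordCut_ι_mul, map_add, ract_smul, ract_tmul, smul_add,
        mul_smul, add_assoc])
  exact LinearMap.congr_fun this u

end Words

/-! ### Koszul models

A `KModel` is the structure on the spaces `X = C[1-m]` and `U = C[1]` out of which the operations on
`X ⊗ T(U)` are built. All operators of a model are odd, and all axioms follow the Koszul rule,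
so that the degree `m` does not appear any more. -/

/-- Two spaces `X`, `U` with a differential, coproducts `δ : X → X ⊗ U`, `ς : U → U ⊗ U` and a
product `κ : U ⊗ U → X`, all of them odd, which satisfy the Frobenius relations. -/
structure KModel (X U : Type*) [AddCommGroup X] [Module ℚ X] [AddCommGroup U] [Module ℚ U] where
  /-- the sign operator of `X` -/
  γX : X →ₗ[ℚ] X
  /-- the sign operator of `U` -/
  γU : U →ₗ[ℚ] U
  /-- the differential of `X` -/
  dX : X →ₗ[ℚ] X
  /-- the differential of `U` -/
  dU : U →ₗ[ℚ] U
  /-- the coaction -/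
  δ : X →ₗ[ℚ] X ⊗[ℚ] U
  /-- the coproduct -/
  ς : U →ₗ[ℚ] U ⊗[ℚ] U
  /-- the product -/
  κ : U →ₗ[ℚ] U →ₗ[ℚ] X
  γX_γX : ∀ x, γX (γX x) = x
  γU_γU : ∀ a, γU (γU a) = a
  γX_dX : ∀ x, γX (dX x) = -dX (γX x)
  γU_dU : ∀ a, γU (dU a) = -dU (γU a)
  γ_δ : ∀ x, map γX γU (δ x) = -δ (γX x)
  γ_ς : ∀ a, map γU γU (ς a) = -ς (γU a)
  γ_κ : ∀ a b, γX (κ a b) = -κ (γU a) (γU b)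
  dX_dX : ∀ x, dX (dX x) = 0
  dU_dU : ∀ a, dU (dU a) = 0
  d_δ : ∀ x, map dX .id (δ x) + map γX dU (δ x) + δ (dX x) = 0
  d_ς : ∀ a, map dU .id (ς a) + map γU dU (ς a) + ς (dU a) = 0
  d_κ : ∀ a b, dX (κ a b) + κ (dU a) b + κ (γU a) (dU b) = 0
  coassoc_δ : ∀ x, assoc X U U (map δ .id (δ x))
    = -map γX ς (δ x)
  coassoc_ς : ∀ a, assoc U U U (map ς .id (ς a))
    = -map γU ς (ς a)
  anti_ς : ∀ a, kflip γU γU (ς a) = -ς a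
  frob_right : ∀ a b, δ (κ a b) = -map (κ (γU a)) LinearMap.id (ς b)
  frob_left : ∀ a b, kflip γX γU (δ (κ a b)) = map γU (κ.flip b) (ς a)
  symm : ∀ x a, kflip γX γX (map γX (κ.flip a) (δ x))
    = map γX (TensorProduct.lift κ ∘ₗ kflip γU γU ∘ₗ (TensorProduct.mk ℚ U U).flip a)
        (δ x)

namespace KModel

variable {X U : Type*} [AddCommGroup X] [Module ℚ X] [AddCommGroup U] [Module ℚ U]
  (Ψ : KModel X U)

/-- Words in `U`. -/
abbrev Wd (U : Type*) [AddCommGroup U] [Module ℚ U] : Type _ := TensorAlgebra ℚ U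

/-- `X ⊗ T(U)`. -/
abbrev Ce (X U : Type*) [AddCommGroup X] [Module ℚ X] [AddCommGroup U] [Module ℚ U] : Type _ :=
  X ⊗[ℚ] TensorAlgebra ℚ U

/-- Words with a marked letter. -/
abbrev Om (U : Type*) [AddCommGroup U] [Module ℚ U] : Type _ :=
  TensorAlgebra ℚ U ⊗[ℚ] (U ⊗[ℚ] TensorAlgebra ℚ U)

/-- Words with an extracted block. -/
abbrev Bl (X U : Type*) [AddCommGroup X] [Module ℚ X] [AddCommGroup U] [Module ℚ U] : Type _ :=
  TensorAlgebra ℚ U ⊗[ℚ] ((X ⊗[ℚ] TensorAlgebra ℚ U) ⊗[ℚ] TensorAlgebra ℚ U)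

/-- A letter as a word. -/
abbrev lt : U →ₗ[ℚ] Wd U := TensorAlgebra.ι ℚ

/-- The sign operator on words. -/
abbrev γW : Wd U →ₗ[ℚ] Wd U := wordPar Ψ.γU

/-- The sign operator on `X ⊗ T(U)`. -/
abbrev γc : Ce X U →ₗ[ℚ] Ce X U := map Ψ.γX Ψ.γW

/-- The sign operator on words with a block. -/
abbrev γB : Bl X U →ₗ[ℚ] Bl X U :=
  map Ψ.γW (map Ψ.γc Ψ.γW)

theorem γW_γW (u : Wd U) : Ψ.γW (Ψ.γW u) = u := wordPar_wordPar Ψ.γU_γU u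

theorem γc_γc (t : Ce X U) : Ψ.γc (Ψ.γc t) = t := map_map_self Ψ.γX_γX Ψ.γW_γW t

instance (x : X) {p : ZMod 2} [h : HasPar Ψ.γX x p] : HasPar Ψ.γX (Ψ.dX x) (p + 1) :=
  ⟨by rw [Ψ.γX_dX, h.eq, map_smul, sgn_add, sgn_one]; module⟩

instance (a : U) {p : ZMod 2} [h : HasPar Ψ.γU a p] : HasPar Ψ.γU (Ψ.dU a) (p + 1) :=
  ⟨by rw [Ψ.γU_dU, h.eq, map_smul, sgn_add, sgn_one]; module⟩

instance (a b : U) {p q : ZMod 2} [ha : HasPar Ψ.γU a p] [hb : HasPar Ψ.γU b q] :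
    HasPar Ψ.γX (Ψ.κ a b) (p + q + 1) :=
  ⟨by rw [Ψ.γ_κ, ha.eq, hb.eq, map_smul, map_smul, LinearMap.smul_apply, sgn_add, sgn_add,
    sgn_one]; module⟩

instance (x : X) {p : ZMod 2} [h : HasPar Ψ.γX x p] :
    HasPar (map Ψ.γX Ψ.γU) (Ψ.δ x) (p + 1) :=
  ⟨by rw [Ψ.γ_δ, h.eq, map_smul, sgn_add, sgn_one]; module⟩

instance (a : U) {p : ZMod 2} [h : HasPar Ψ.γU a p] :
    HasPar (map Ψ.γU Ψ.γU) (Ψ.ς a) (p + 1) :=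
  ⟨by rw [Ψ.γ_ς, h.eq, map_smul, sgn_add, sgn_one]; module⟩

theorem γX_apply (x : X) {p : ZMod 2} [h : HasPar Ψ.γX x p] : Ψ.γX x = sgn p • x := h.eq

theorem γU_apply (a : U) {p : ZMod 2} [h : HasPar Ψ.γU a p] : Ψ.γU a = sgn p • a := h.eq

theorem γW_apply (u : Wd U) {p : ZMod 2} [h : HasPar Ψ.γW u p] : Ψ.γW u = sgn p • u := h.eq

/-- `a ⊗ b ↦ [a|b]`. -/
def sp : U ⊗[ℚ] U →ₗ[ℚ] Wd U := LinearMap.mul' ℚ (Wd U) ∘ₗ map lt lt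

theorem sp_tmul (a b : U) : sp (a ⊗ₜ b) = lt a * lt b := by simp [sp]

theorem sp_mem_pos (t : U ⊗[ℚ] U) (u : Wd U) : wordPos U (sp t * u) = sp t * u := by
  induction t with
  | zero => simp
  | tmul a b => rw [sp_tmul, mul_assoc, wordPos_ι_mul]
  | add s t hs ht => simp only [map_add, add_mul, hs, ht]

/-- The differential of a letter. -/
def dl : U →ₗ[ℚ] Wd U := lt ∘ₗ Ψ.dU + sp ∘ₗ Ψ.ς

theorem dl_apply (a : U) : Ψ.dl a = lt (Ψ.dU a) + sp (Ψ.ς a) := rfl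

/-- The differential of words. -/
def D : Wd U →ₗ[ℚ] Wd U := wordDer Ψ.γU Ψ.dl

theorem D_one : Ψ.D 1 = 0 := wordDer_one _ _

theorem D_lt (a : U) : Ψ.D (lt a) = Ψ.dl a := wordDer_ι _ _ a

theorem D_mul (u v : Wd U) : Ψ.D (u * v) = Ψ.D u * v + Ψ.γW u * Ψ.D v := wordDer_mul _ _ u v

theorem γW_sp (t : U ⊗[ℚ] U) : Ψ.γW (sp t) = sp (map Ψ.γU Ψ.γU t) := by
  induction t with
  | zero => simp
  | tmul a b => simp [sp_tmul, wordPar_mul, wordPar_ι]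
  | add s t hs ht => simp only [map_add, hs, ht]

theorem γW_dl (a : U) : Ψ.γW (Ψ.dl a) = -Ψ.dl (Ψ.γU a) := by
  rw [dl_apply, map_add, wordPar_ι, Ψ.γU_dU, γW_sp, Ψ.γ_ς, dl_apply]; simp; abel

theorem γW_D (u : Wd U) : Ψ.γW (Ψ.D u) = -Ψ.D (Ψ.γW u) := by
  have : Ψ.γW ∘ₗ Ψ.D = -(Ψ.D ∘ₗ Ψ.γW) := word_ext (by simp [D_one, wordPar_one])
    (fun a u h => by
      simp only [comp_apply, LinearMap.neg_apply] at h ⊢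
      rw [D_mul, D_lt, map_add, wordPar_mul, wordPar_mul, wordPar_mul, D_mul, γW_dl, h, wordPar_ι,
        wordPar_ι, D_lt]
      noncomm_ring)
  exact LinearMap.congr_fun this u

theorem wordPos_D (u : Wd U) : wordPos U (Ψ.D u) = Ψ.D u := by
  have : wordPos U ∘ₗ Ψ.D = Ψ.D := word_ext (by simp [D_one])
    (fun a u h => by
      rw [comp_apply, D_mul, D_lt, map_add, wordPar_ι, wordPos_ι_mul, dl_apply, add_mul, map_add,
        wordPos_ι_mul, sp_mem_pos])
  exact LinearMap.congr_fun this u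

theorem D_wordPos (u : Wd U) : Ψ.D (wordPos U u) = Ψ.D u := by
  obtain ⟨c, hc⟩ := wordPos_apply u
  rw [hc, map_sub, map_smul, D_one, smul_zero, sub_zero]

instance (u : Wd U) {p : ZMod 2} [h : HasPar Ψ.γW u p] : HasPar Ψ.γW (Ψ.D u) (p + 1) :=
  ⟨by rw [γW_D, h.eq, map_smul, sgn_add, sgn_one]; module⟩

/-- `(x ⊗ a) ⊗ u ↦ x [a] u`. -/
def insL : (X ⊗[ℚ] U) ⊗[ℚ] Wd U →ₗ[ℚ] Ce X U :=
  map .id (LinearMap.mul' ℚ (Wd U) ∘ₗ map lt .id) ∘ₗ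
    (assoc X U (Wd U)).toLinearMap

/-- `(x ⊗ a) ⊗ u ↦ ± x u [a]`. -/
def insR : (X ⊗[ℚ] U) ⊗[ℚ] Wd U →ₗ[ℚ] Ce X U :=
  map .id (LinearMap.mul' ℚ (Wd U) ∘ₗ map .id lt ∘ₗ
    kflip Ψ.γU Ψ.γW) ∘ₗ (assoc X U (Wd U)).toLinearMap

theorem insL_tmul (x : X) (a : U) (u : Wd U) :
    insL ((x ⊗ₜ a) ⊗ₜ u) = x ⊗ₜ[ℚ] (lt a * u) := by simp [insL]

theorem insR_tmul (x : X) (a : U) (u : Wd U) {p q : ZMod 2} [HasPar Ψ.γU a p]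
    [HasPar Ψ.γW u q] :
    Ψ.insR ((x ⊗ₜ a) ⊗ₜ u) = sgn (p * q) • (x ⊗ₜ[ℚ] (u * lt a)) := by
  simp [insR, kflip_tmul_sgn a u]

theorem insR_one (t : X ⊗[ℚ] U) : Ψ.insR (t ⊗ₜ 1) = insL (t ⊗ₜ 1) := by
  induction t using tensor_induction Ψ.γX_γX Ψ.γU_γU with
  | zero => simp
  | add s t hs ht => simp only [add_tmul, map_add, hs, ht]
  | h p q x a hx ha => rw [insR_tmul, insL_tmul]; simp

/-- The differential of `X ⊗ T(U)`. -/
def b : Ce X U →ₗ[ℚ] Ce X U :=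
  map Ψ.dX .id + map Ψ.γX Ψ.D
    + insL ∘ₗ map Ψ.δ .id - Ψ.insR ∘ₗ map Ψ.δ .id

theorem b_tmul (x : X) (u : Wd U) :
    Ψ.b (x ⊗ₜ u) = Ψ.dX x ⊗ₜ u + Ψ.γX x ⊗ₜ Ψ.D u + insL (Ψ.δ x ⊗ₜ u)
      - Ψ.insR (Ψ.δ x ⊗ₜ u) := by simp [b]

theorem γc_insL (t : X ⊗[ℚ] U) (u : Wd U) :
    Ψ.γc (insL (t ⊗ₜ u)) = insL (map Ψ.γX Ψ.γU t ⊗ₜ Ψ.γW u) := by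
  induction t with
  | zero => simp
  | tmul a b => simp [insL_tmul, wordPar_mul, wordPar_ι]
  | add s t hs ht => simp only [map_add, add_tmul, hs, ht]

theorem γc_insR (t : X ⊗[ℚ] U) (u : Wd U) :
    Ψ.γc (Ψ.insR (t ⊗ₜ u)) = Ψ.insR (map Ψ.γX Ψ.γU t ⊗ₜ Ψ.γW u) := by
  induction t using tensor_induction Ψ.γX_γX Ψ.γU_γU with
  | zero => simp
  | add s t hs ht => simp only [map_add, add_tmul, hs, ht]
  | h p q x a hx ha =>
    induction u using hasPar_induction Ψ.γW_γW with
    | add u v hu hv => simp only [map_add, tmul_add, hu, hv]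
    | h r u hu =>
      simp only [map_tmul, γX_apply, γU_apply, γW_apply, tmul_smul, ← smul_tmul', insR_tmul,
        map_smul, wordPar_mul, wordPar_ι, mul_smul_comm, smul_mul_assoc]
      module

theorem γc_b (t : Ce X U) : Ψ.γc (Ψ.b t) = -Ψ.b (Ψ.γc t) := by
  induction t using TensorProduct.induction_on with
  | zero => simp
  | tmul x u =>
    rw [b_tmul, map_sub, map_add, map_add, map_tmul, map_tmul, map_tmul, γc_insL, γc_insR, b_tmul,
      Ψ.γ_δ, Ψ.γX_dX, γW_D]
    simp only [neg_tmul, tmul_neg, map_neg]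
    abel
  | add s t hs ht => rw [map_add, map_add, hs, ht, map_add, map_add]; abel

instance (t : Ce X U) {p : ZMod 2} [h : HasPar Ψ.γc t p] : HasPar Ψ.γc (Ψ.b t) (p + 1) :=
  ⟨by rw [γc_b, h.eq, map_smul, sgn_add, sgn_one]; module⟩

/-- The projection of `X ⊗ T(U)` to words of positive length. -/
def pos (X U : Type*) [AddCommGroup X] [Module ℚ X] [AddCommGroup U] [Module ℚ U] :
    Ce X U →ₗ[ℚ] Ce X U := map .id (wordPos U)

theorem pos_tmul (x : X) (u : Wd U) : pos X U (x ⊗ₜ u) = x ⊗ₜ wordPos U u := rfl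

theorem insL_pos (s : X ⊗[ℚ] U) (u : Wd U) : pos X U (insL (s ⊗ₜ u)) = insL (s ⊗ₜ u) := by
  induction s with
  | zero => simp
  | tmul a b => rw [insL_tmul, pos_tmul, wordPos_ι_mul]
  | add s t hs ht => simp only [map_add, add_tmul, hs, ht]

theorem insR_pos (s : X ⊗[ℚ] U) (u : Wd U) : pos X U (Ψ.insR (s ⊗ₜ u)) = Ψ.insR (s ⊗ₜ u) := by
  induction s using tensor_induction Ψ.γX_γX Ψ.γU_γU with
  | zero => simp
  | add s t hs ht => simp only [map_add, add_tmul, hs, ht]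
  | h p q x a hx ha =>
    induction u using hasPar_induction Ψ.γW_γW with
    | add u v hu hv => simp only [map_add, tmul_add, hu, hv]
    | h r u hu =>
      rw [insR_tmul, map_smul, pos_tmul, wordPos_mul_ι]

theorem b_wordPos (x : X) (u : Wd U) :
    Ψ.b (x ⊗ₜ wordPos U u) = Ψ.dX x ⊗ₜ wordPos U u + Ψ.γX x ⊗ₜ Ψ.D u + insL (Ψ.δ x ⊗ₜ u)
      - Ψ.insR (Ψ.δ x ⊗ₜ u) := by
  rw [b_tmul, D_wordPos]
  obtain ⟨c, hc⟩ := wordPos_apply u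
  rw [hc]
  simp only [tmul_sub, tmul_smul, map_sub, map_smul, insR_one]
  abel

/-! #### Blocks -/

/-- `a ⊗ (M ⊗ (c ⊗ R)) ↦ ± κ(a, c) M ⊗ R`; the empty word `M` is sent to zero. -/
def Q : U ⊗[ℚ] Om U →ₗ[ℚ] Ce X U ⊗[ℚ] Wd U :=
  (assoc X (Wd U) (Wd U)).symm.toLinearMap ∘ₗ
    map (TensorProduct.lift Ψ.κ) (map (wordPos U) .id) ∘ₗ
    (assoc U U (Wd U ⊗[ℚ] Wd U)).symm.toLinearMap ∘ₗ
    map .id (kswap Ψ.γW Ψ.γU (Wd U))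

theorem Q_tmul (a c : U) (M R : Wd U) {p q : ZMod 2} [HasPar Ψ.γU c p] [HasPar Ψ.γW M q] :
    Ψ.Q (a ⊗ₜ (M ⊗ₜ (c ⊗ₜ R)))
      = sgn (p * q) • ((Ψ.κ a c ⊗ₜ[ℚ] wordPos U M) ⊗ₜ[ℚ] R) := by
  simp [Q, kswap_tmul_sgn M c R, mul_comm]

/-- `[a₁|⋯|aₙ] ↦ ∑ ± [a₁|⋯|aᵢ₋₁] ⊗ (κ(aᵢ, aⱼ)[aᵢ₊₁|⋯|aⱼ₋₁] ⊗ [aⱼ₊₁|⋯|aₙ])`. -/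
def E : Wd U →ₗ[ℚ] Bl X U :=
  map Ψ.γW (Ψ.Q ∘ₗ map .id (wordCut U)) ∘ₗ wordCut U

theorem E_one : Ψ.E 1 = 0 := by simp [E, wordCut_one]

theorem map_γW_smul {V N : Type*} [AddCommGroup V] [Module ℚ V] [AddCommGroup N] [Module ℚ N]
    (f : V →ₗ[ℚ] N) (w : Wd U) (t : Wd U ⊗[ℚ] V) :
    map Ψ.γW f (w • t) = Ψ.γW w • map Ψ.γW f t := by
  induction t with
  | zero => simp
  | tmul a b => simp [smul_tmul', wordPar_mul]
  | add s t hs ht => simp only [smul_add, map_add, hs, ht]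

theorem E_lt_mul (a : U) (u : Wd U) :
    Ψ.E (lt a * u) = lt (Ψ.γU a) • Ψ.E u + 1 ⊗ₜ Ψ.Q (a ⊗ₜ wordCut U u) := by
  rw [E, comp_apply, wordCut_ι_mul, map_add, map_γW_smul, wordPar_ι, add_comm]
  simp [wordPar_one]

end KModel

namespace KModel

variable {X U : Type*} [AddCommGroup X] [Module ℚ X] [AddCommGroup U] [Module ℚ U]
  (Ψ : KModel X U)

/-! #### The differential of marked words -/

/-- The differential of words with a marked letter. -/
def Θ : Om U →ₗ[ℚ] Om U :=
  map Ψ.D .id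
    + map Ψ.γW (map Ψ.dU .id)
    + map Ψ.γW (map .id
        (LinearMap.mul' ℚ (Wd U) ∘ₗ map lt .id) ∘ₗ
        (assoc U U (Wd U)).toLinearMap ∘ₗ map Ψ.ς .id)
    + map (LinearMap.mul' ℚ (Wd U)) LinearMap.id ∘ₗ
        (assoc (Wd U) (Wd U) (U ⊗[ℚ] Wd U)).symm.toLinearMap ∘ₗ
        map Ψ.γW (map lt .id ∘ₗ
          (assoc U U (Wd U)).toLinearMap ∘ₗ map Ψ.ς .id)
    + map Ψ.γW (map Ψ.γU Ψ.D)

/-- `(a ⊗ c) ⊗ R ↦ a ⊗ [c] R`. -/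
def spR : (U ⊗[ℚ] U) ⊗[ℚ] Wd U →ₗ[ℚ] U ⊗[ℚ] Wd U :=
  map .id (LinearMap.mul' ℚ (Wd U) ∘ₗ map lt .id) ∘ₗ
        (assoc U U (Wd U)).toLinearMap

theorem spR_tmul (a c : U) (R : Wd U) : spR ((a ⊗ₜ c) ⊗ₜ R) = a ⊗ₜ[ℚ] (lt c * R) := by simp [spR]

/-- `M ⊗ ((a ⊗ c) ⊗ R) ↦ M [a] ⊗ (c ⊗ R)`. -/
def spL : Wd U ⊗[ℚ] ((U ⊗[ℚ] U) ⊗[ℚ] Wd U) →ₗ[ℚ] Om U :=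
  map (LinearMap.mul' ℚ (Wd U)) LinearMap.id ∘ₗ
        (assoc (Wd U) (Wd U) (U ⊗[ℚ] Wd U)).symm.toLinearMap ∘ₗ
        map .id (map lt .id ∘ₗ
          (assoc U U (Wd U)).toLinearMap)

theorem spL_tmul (M : Wd U) (a c : U) (R : Wd U) :
    spL (M ⊗ₜ ((a ⊗ₜ c) ⊗ₜ R)) = (M * lt a) ⊗ₜ[ℚ] (c ⊗ₜ[ℚ] R) := by simp [spL]

theorem Θ_tmul (M R : Wd U) (c : U) :
    Ψ.Θ (M ⊗ₜ (c ⊗ₜ R)) = Ψ.D M ⊗ₜ (c ⊗ₜ R) + Ψ.γW M ⊗ₜ (Ψ.dU c ⊗ₜ R)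
      + Ψ.γW M ⊗ₜ spR (Ψ.ς c ⊗ₜ R) + spL (Ψ.γW M ⊗ₜ (Ψ.ς c ⊗ₜ R))
      + Ψ.γW M ⊗ₜ (Ψ.γU c ⊗ₜ Ψ.D R) := by
  simp [Θ, spR, spL]

theorem spL_smul (w M : Wd U) (s : U ⊗[ℚ] U) (R : Wd U) :
    spL ((w * M) ⊗ₜ (s ⊗ₜ R)) = w • spL (M ⊗ₜ (s ⊗ₜ R)) := by
  induction s with
  | zero => simp
  | tmul a c => simp [spL_tmul, smul_tmul', mul_assoc]
  | add s t hs ht => simp only [add_tmul, tmul_add, map_add, smul_add, hs, ht]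

theorem Θ_smul (w : Wd U) (t : Om U) :
    Ψ.Θ (w • t) = Ψ.D w • t + Ψ.γW w • Ψ.Θ t := by
  induction t using TensorProduct.induction_on with
  | zero => simp
  | tmul M s =>
    induction s with
    | zero => simp
    | tmul c R =>
      rw [smul_tmul', smul_eq_mul, Θ_tmul, Θ_tmul, wordPar_mul, D_mul, spL_smul]
      simp only [smul_add, smul_tmul', smul_eq_mul, add_tmul]
      abel
    | add s t hs ht =>
      simp only [tmul_add, map_add, smul_add] at hs ht ⊢
      rw [hs, ht]; abel
  | add s t hs ht => simp only [smul_add, map_add, hs, ht]; abel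

theorem cut_sp_mul (s : U ⊗[ℚ] U) (u : Wd U) :
    wordCut U (sp s * u) = sp s • wordCut U u + 1 ⊗ₜ spR (s ⊗ₜ u) + spL (1 ⊗ₜ (s ⊗ₜ u)) := by
  induction s with
  | zero => simp
  | tmul a c =>
    rw [sp_tmul, mul_assoc, wordCut_ι_mul, wordCut_ι_mul, spR_tmul, spL_tmul, smul_add, mul_smul,
      smul_tmul', smul_eq_mul, mul_one, one_mul]
    abel
  | add s t hs ht =>
    simp only [map_add, add_mul, add_smul, add_tmul, tmul_add, hs, ht]
    abel

theorem cut_D (u : Wd U) : wordCut U (Ψ.D u) = Ψ.Θ (wordCut U u) := by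
  have : wordCut U ∘ₗ Ψ.D = Ψ.Θ ∘ₗ wordCut U := word_ext (by simp [D_one, wordCut_one])
    (fun a u h => by
      simp only [comp_apply] at h ⊢
      rw [D_mul, D_lt, dl_apply, add_mul, map_add, map_add, wordCut_ι_mul, cut_sp_mul, wordPar_ι,
        wordCut_ι_mul, h, wordCut_ι_mul, map_add, Θ_smul, Θ_tmul, D_one, wordPar_one, wordPar_ι,
        D_lt, dl_apply, add_smul, zero_tmul]
      abel)
  exact LinearMap.congr_fun this u

/-! #### The differential of words with a block -/

/-- `(x ⊗ a) ⊗ M ↦ ± x M ⊗ [a]`. -/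
def emi : (X ⊗[ℚ] U) ⊗[ℚ] Wd U →ₗ[ℚ] Ce X U ⊗[ℚ] Wd U :=
  map .id lt ∘ₗ (assoc X (Wd U) U).symm.toLinearMap ∘ₗ
    map .id (kflip Ψ.γU Ψ.γW) ∘ₗ
    (assoc X U (Wd U)).toLinearMap

theorem emi_tmul (x : X) (a : U) (M : Wd U) {p q : ZMod 2} [HasPar Ψ.γU a p]
    [HasPar Ψ.γW M q] :
    Ψ.emi ((x ⊗ₜ a) ⊗ₜ M) = sgn (p * q) • ((x ⊗ₜ[ℚ] M) ⊗ₜ[ℚ] lt a) := by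
  simp [emi, kflip_tmul_sgn a M]

/-- Emission of a letter from a block to the word on its right. -/
def emR : Bl X U →ₗ[ℚ] Bl X U :=
  sgn 1 • map Ψ.γW (map .id (LinearMap.mul' ℚ (Wd U)) ∘ₗ
    (assoc (Ce X U) (Wd U) (Wd U)).toLinearMap ∘ₗ
    map (Ψ.emi ∘ₗ map Ψ.δ LinearMap.id) .id)

/-- Emission of a letter from a block to the word on its left. -/
def emL : Bl X U →ₗ[ℚ] Bl X U :=
  map (LinearMap.mul' ℚ (Wd U)) LinearMap.id ∘ₗ
    (assoc (Wd U) (Wd U) (Ce X U ⊗[ℚ] Wd U)).symm.toLinearMap ∘ₗ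
    map Ψ.γW ((assoc (Wd U) (Ce X U) (Wd U)).toLinearMap ∘ₗ
      map (kflip Ψ.γc Ψ.γW ∘ₗ Ψ.emi ∘ₗ map Ψ.δ .id)
        LinearMap.id)

/-- `L ⊗ ((B ⊗ u) ⊗ R) ↦ L ⊗ (B ⊗ u R)`. -/
def attR : Wd U ⊗[ℚ] ((Ce X U ⊗[ℚ] Wd U) ⊗[ℚ] Wd U) →ₗ[ℚ] Bl X U :=
  map .id (map .id (LinearMap.mul' ℚ (Wd U)) ∘ₗ
    (assoc (Ce X U) (Wd U) (Wd U)).toLinearMap)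

/-- `L ⊗ ((u ⊗ B) ⊗ R) ↦ L u ⊗ (B ⊗ R)`. -/
def attL : Wd U ⊗[ℚ] ((Wd U ⊗[ℚ] Ce X U) ⊗[ℚ] Wd U) →ₗ[ℚ] Bl X U :=
  map (LinearMap.mul' ℚ (Wd U)) LinearMap.id ∘ₗ
    (assoc (Wd U) (Wd U) (Ce X U ⊗[ℚ] Wd U)).symm.toLinearMap ∘ₗ
    map .id (assoc (Wd U) (Ce X U) (Wd U)).toLinearMap

theorem attR_tmul (L u R : Wd U) (B : Ce X U) :
    attR (L ⊗ₜ ((B ⊗ₜ u) ⊗ₜ R)) = L ⊗ₜ[ℚ] (B ⊗ₜ[ℚ] (u * R)) := by simp [attR]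

theorem attL_tmul (L u R : Wd U) (B : Ce X U) :
    attL (L ⊗ₜ ((u ⊗ₜ B) ⊗ₜ R)) = (L * u) ⊗ₜ[ℚ] (B ⊗ₜ[ℚ] R) := by simp [attL]

theorem emR_tmul (L M R : Wd U) (x : X) :
    Ψ.emR (L ⊗ₜ ((x ⊗ₜ M) ⊗ₜ R))
      = sgn 1 • attR (Ψ.γW L ⊗ₜ (Ψ.emi (Ψ.δ x ⊗ₜ M) ⊗ₜ R)) := by
  simp [emR, attR, -sgn_one]

theorem emL_tmul (L M R : Wd U) (x : X) :
    Ψ.emL (L ⊗ₜ ((x ⊗ₜ M) ⊗ₜ R))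
      = attL (Ψ.γW L ⊗ₜ (kflip Ψ.γc Ψ.γW (Ψ.emi (Ψ.δ x ⊗ₜ M)) ⊗ₜ R)) := by
  simp [emL, attL]

/-- The differential of words with a block. -/
def 𝔇 : Bl X U →ₗ[ℚ] Bl X U :=
  map Ψ.D .id + map Ψ.γW (map Ψ.b .id)
    + map Ψ.γW (map Ψ.γc Ψ.D)

theorem 𝔇_tmul (L R : Wd U) (B : Ce X U) :
    Ψ.𝔇 (L ⊗ₜ (B ⊗ₜ R)) = Ψ.D L ⊗ₜ (B ⊗ₜ R) + Ψ.γW L ⊗ₜ (Ψ.b B ⊗ₜ R)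
      + Ψ.γW L ⊗ₜ (Ψ.γc B ⊗ₜ Ψ.D R) := by
  simp [𝔇]

theorem δκ_right (a c : U) :
    Ψ.δ (Ψ.κ a c) = sgn 1 • map (Ψ.κ (Ψ.γU a)) LinearMap.id (Ψ.ς c) := by
  rw [Ψ.frob_right, sgn_one, neg_smul, one_smul]

/-- The second Frobenius relation, with the coproduct flipped. -/
theorem δκ_flip (a c : U) :
    Ψ.δ (Ψ.κ a c) = map (Ψ.κ (Ψ.γU a)) LinearMap.id (kflip Ψ.γU Ψ.γU (Ψ.ς c)) := by
  rw [Ψ.frob_right, Ψ.anti_ς, map_neg]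

/-- `(a ⊗ c) ⊗ t ↦ [γ a] Q(c ⊗ t)` -/
def qL : (U ⊗[ℚ] U) ⊗[ℚ] Om U →ₗ[ℚ] Bl X U :=
  map (lt ∘ₗ Ψ.γU) Ψ.Q ∘ₗ (assoc U U (Om U)).toLinearMap

/-- `a ⊗ t ↦ [a] t` -/
def actL : U ⊗[ℚ] Om U →ₗ[ℚ] Om U :=
  map (LinearMap.mul' ℚ (Wd U) ∘ₗ map lt .id) LinearMap.id ∘ₗ
    (assoc U (Wd U) (U ⊗[ℚ] Wd U)).symm.toLinearMap

theorem actL_tmul (a : U) (t : Om U) : actL (a ⊗ₜ t) = lt a • t := by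
  induction t using TensorProduct.induction_on with
  | zero => simp
  | tmul M s => simp [actL, smul_tmul']
  | add s t hs ht => simp only [tmul_add, map_add, smul_add, hs, ht]

/-- `(a ⊗ c) ⊗ t ↦ Q(a ⊗ [c] t)` -/
def qR : (U ⊗[ℚ] U) ⊗[ℚ] Om U →ₗ[ℚ] Ce X U ⊗[ℚ] Wd U :=
  Ψ.Q ∘ₗ map .id actL ∘ₗ (assoc U U (Om U)).toLinearMap

theorem qL_tmul (a c : U) (t : Om U) : Ψ.qL ((a ⊗ₜ c) ⊗ₜ t) = lt (Ψ.γU a) ⊗ₜ Ψ.Q (c ⊗ₜ t) := by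
  simp [qL]

theorem qR_tmul (a c : U) (t : Om U) : Ψ.qR ((a ⊗ₜ c) ⊗ₜ t) = Ψ.Q (a ⊗ₜ (lt c • t)) := by
  simp [qR, actL_tmul]

theorem Q_one (a c : U) (R : Wd U) : Ψ.Q (a ⊗ₜ (1 ⊗ₜ (c ⊗ₜ R))) = 0 := by
  induction c using hasPar_induction Ψ.γU_γU with
  | add c c' h h' =>
    simp only [add_tmul, tmul_add, map_add, h, h', add_zero]
  | h p c hc => rw [Q_tmul]; simp [wordPos_one]

theorem E_sp_mul (s : U ⊗[ℚ] U) (u : Wd U) :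
    Ψ.E (sp s * u) = Ψ.γW (sp s) • Ψ.E u + Ψ.qL (s ⊗ₜ wordCut U u)
      + 1 ⊗ₜ Ψ.qR (s ⊗ₜ wordCut U u) := by
  induction s with
  | zero => simp
  | tmul a c =>
    rw [sp_tmul, mul_assoc, E_lt_mul, E_lt_mul, smul_add, wordCut_ι_mul, tmul_add, map_add, Q_one,
      zero_add, qL_tmul, qR_tmul, wordPar_mul, wordPar_ι, wordPar_ι, mul_smul, smul_tmul',
      smul_eq_mul, mul_one]
  | add s t hs ht =>
    simp only [map_add, add_mul, add_smul, add_tmul, tmul_add, hs, ht]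
    abel

end KModel

namespace KModel

variable {X U : Type*} [AddCommGroup X] [Module ℚ X] [AddCommGroup U] [Module ℚ U]
  (Ψ : KModel X U)

theorem kflip_kflip {A B : Type*} [AddCommGroup A] [Module ℚ A] [AddCommGroup B] [Module ℚ B]
    {γA : A →ₗ[ℚ] A} {γB : B →ₗ[ℚ] B} (hA : ∀ a, γA (γA a) = a) (hB : ∀ b, γB (γB b) = b)
    (t : A ⊗[ℚ] B) : kflip γB γA (kflip γA γB t) = t := by
  induction t using tensor_induction hA hB with
  | zero => simp
  | add s t hs ht => simp only [map_add, hs, ht]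
  | h p q a b ha hb =>
    rw [kflip_tmul_sgn, map_smul, kflip_tmul_sgn, smul_smul, mul_comm q p, sgn_mul_self, one_smul]

/-- The first Frobenius relation, with the coproduct flipped. -/
theorem δκ_left (a c : U) :
    Ψ.δ (Ψ.κ a c) = sgn 1 • kflip Ψ.γU Ψ.γX (map Ψ.γU (Ψ.κ.flip c)
      (kflip Ψ.γU Ψ.γU (Ψ.ς a))) := by
  rw [sgn_one, neg_smul, one_smul, Ψ.anti_ς, map_neg, map_neg, neg_neg, ← Ψ.frob_left, kflip_kflip Ψ.γX_γX Ψ.γU_γU]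

theorem kflip_emi (y : X ⊗[ℚ] U) (N : Wd U) {n : ZMod 2} [HasPar Ψ.γW N n] :
    kflip Ψ.γc Ψ.γW (Ψ.emi (y ⊗ₜ N))
      = map lt ((TensorProduct.mk ℚ X (Wd U)).flip N) (kflip Ψ.γX Ψ.γU y) := by
  induction y using tensor_induction Ψ.γX_γX Ψ.γU_γU with
  | zero => simp
  | add s t hs ht => simp only [add_tmul, map_add, hs, ht]
  | h p q x a hx ha =>
    rw [emi_tmul, map_smul, kflip_tmul_sgn (x ⊗ₜ N) (lt a), kflip_tmul_sgn, map_smul, map_tmul,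
      smul_smul, ← sgn_add]
    congr 2; grind

theorem qL_ς (a c : U) (M R : Wd U) {q r : ZMod 2} [HasPar Ψ.γU c q] [HasPar Ψ.γW M r] :
    Ψ.qL (Ψ.ς a ⊗ₜ (M ⊗ₜ (c ⊗ₜ R))) = Ψ.emL (1 ⊗ₜ Ψ.Q (a ⊗ₜ (M ⊗ₜ (c ⊗ₜ R)))) := by
  rw [Q_tmul, tmul_smul, map_smul, emL_tmul, kflip_emi, Ψ.frob_left, wordPar_one]
  generalize Ψ.ς a = s
  induction s with
  | zero => simp
  | add s t hs ht =>
    simp only [add_tmul, tmul_add, map_add, smul_add, hs, ht]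
  | tmul a' a'' =>
    rw [qL_tmul, Q_tmul, map_tmul, map_tmul, attL_tmul, one_mul, tmul_smul]
    rfl

theorem qR_ς (a c : U) (M R : Wd U) {q r : ZMod 2} [HasPar Ψ.γU c q] [HasPar Ψ.γW M r] :
    Ψ.qR (Ψ.ς a ⊗ₜ (M ⊗ₜ (c ⊗ₜ R)))
      = sgn (1 + q * r) • (insL (Ψ.δ (Ψ.κ a c) ⊗ₜ M) ⊗ₜ[ℚ] R) := by
  rw [δκ_left]
  generalize Ψ.ς a = s
  induction s using tensor_induction Ψ.γU_γU Ψ.γU_γU with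
  | zero => simp
  | add s t hs ht =>
    simp only [add_tmul, map_add, smul_add, hs, ht]
  | h p₁ p₂ a₁ a₂ h₁ h₂ =>
    rw [qR_tmul, smul_tmul', smul_eq_mul, Q_tmul, wordPos_ι_mul]
    simp only [kflip_tmul_sgn, map_smul, map_tmul, LinearMap.flip_apply, γU_apply, ← smul_tmul',
      insL_tmul, smul_smul, ← sgn_add]
    congr 2
    have := zmod_two_mul_self p₁; have := zmod_two_mul_self p₂; grind

theorem Q_spR_ς (a c : U) (M R : Wd U) {p q r : ZMod 2} [HasPar Ψ.γU a p] [HasPar Ψ.γU c q]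
    [HasPar Ψ.γW M r] :
    1 ⊗ₜ Ψ.Q (Ψ.γU a ⊗ₜ (Ψ.γW M ⊗ₜ spR (Ψ.ς c ⊗ₜ R)))
      = Ψ.emR (1 ⊗ₜ Ψ.Q (a ⊗ₜ (M ⊗ₜ (c ⊗ₜ R)))) := by
  have hs : HasPar (map Ψ.γU Ψ.γU) (Ψ.ς c) (q + 1) := inferInstance
  rw [Q_tmul, tmul_smul, map_smul, emR_tmul, δκ_right, wordPar_one]
  generalize Ψ.ς c = s at hs
  refine tensor_induction_par Ψ.γU_γU Ψ.γU_γU ?_ ?_ ?_ s hs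
  · simp
  · intro s t hs ht
    simp only [add_tmul, tmul_add, map_add, smul_add, hs, ht]
  · intro p₁ p₂ a₁ a₂ h₁ h₂ e
    simp only [spR_tmul, Q_tmul, kflip_tmul_sgn, map_smul, map_tmul, γU_apply, γW_apply,
      LinearMap.smul_apply, id_apply, ← smul_tmul', tmul_smul, emi_tmul, attR_tmul, smul_smul,
      ← sgn_add]
    congr 2
    grind

theorem Q_spL_ς (a c : U) (M R : Wd U) {p q r : ZMod 2} [HasPar Ψ.γU a p] [HasPar Ψ.γU c q]
    [HasPar Ψ.γW M r] :
    Ψ.Q (Ψ.γU a ⊗ₜ spL (Ψ.γW M ⊗ₜ (Ψ.ς c ⊗ₜ R)))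
      = sgn (q * r) • (Ψ.insR (Ψ.δ (Ψ.κ a c) ⊗ₜ M) ⊗ₜ[ℚ] R) := by
  have hs : HasPar (map Ψ.γU Ψ.γU) (Ψ.ς c) (q + 1) := inferInstance
  rw [δκ_flip]
  generalize Ψ.ς c = s at hs
  refine tensor_induction_par Ψ.γU_γU Ψ.γU_γU ?_ ?_ ?_ s hs
  · simp
  · intro s t hs ht
    simp only [add_tmul, tmul_add, map_add, smul_add, hs, ht]
  · intro p₁ p₂ a₁ a₂ h₁ h₂ e
    simp only [spL_tmul, Q_tmul, kflip_tmul_sgn, map_smul, map_tmul, γU_apply, γW_apply,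
      LinearMap.smul_apply, id_apply, smul_mul_assoc, wordPos_mul_ι, ← smul_tmul', tmul_smul,
      insR_tmul, smul_smul, ← sgn_add]
    congr 2
    grind

end KModel

namespace KModel

variable {X U : Type*} [AddCommGroup X] [Module ℚ X] [AddCommGroup U] [Module ℚ U]
  (Ψ : KModel X U)

theorem 𝔇_smul (w : Wd U) (t : Bl X U) :
    Ψ.𝔇 (w • t) = Ψ.D w • t + Ψ.γW w • Ψ.𝔇 t := by
  induction t using TensorProduct.induction_on with
  | zero => simp
  | tmul M s =>
    induction s with
    | zero => simp
    | tmul c R =>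
      rw [smul_tmul', smul_eq_mul, 𝔇_tmul, 𝔇_tmul, wordPar_mul, D_mul]
      simp only [smul_add, smul_tmul', smul_eq_mul, add_tmul]
      abel
    | add s t hs ht =>
      simp only [tmul_add, map_add, smul_add] at hs ht ⊢
      rw [hs, ht]; abel
  | add s t hs ht => simp only [smul_add, map_add, hs, ht]; abel

theorem emR_smul (w : Wd U) (t : Bl X U) : Ψ.emR (w • t) = Ψ.γW w • Ψ.emR t := by
  rw [emR, LinearMap.smul_apply, map_γW_smul, LinearMap.smul_apply, smul_comm]

theorem emL_smul (w : Wd U) (t : Bl X U) : Ψ.emL (w • t) = Ψ.γW w • Ψ.emL t := by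
  simp only [emL, comp_apply, map_γW_smul]
  generalize map Ψ.γW
    ((assoc (Wd U) (Ce X U) (Wd U)).toLinearMap ∘ₗ map
      (kflip Ψ.γc Ψ.γW ∘ₗ Ψ.emi ∘ₗ map Ψ.δ .id) LinearMap.id) t = s
  induction s with
  | zero => simp only [smul_zero, map_zero]
  | tmul M s =>
    induction s with
    | zero => simp only [tmul_zero, smul_zero, map_zero]
    | tmul c R => simp [smul_tmul', mul_assoc]
    | add s t hs ht => simp only [tmul_add, map_add, smul_add, hs, ht]
  | add s t hs ht => simp only [smul_add, map_add, hs, ht]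

/-- The change of a word with a block under the differential. -/
def em : Bl X U →ₗ[ℚ] Bl X U := Ψ.emL + Ψ.emR - Ψ.𝔇

theorem em_apply (t : Bl X U) : Ψ.em t = Ψ.emL t + Ψ.emR t - Ψ.𝔇 t := rfl

theorem em_smul (w : Wd U) (t : Bl X U) :
    Ψ.em (w • t) = Ψ.γW w • Ψ.em t - Ψ.D w • t := by
  rw [em_apply, emL_smul, emR_smul, 𝔇_smul, em_apply, smul_sub, smul_add]; abel

theorem dX_κ (a c : U) : Ψ.dX (Ψ.κ a c) = -Ψ.κ (Ψ.dU a) c - Ψ.κ (Ψ.γU a) (Ψ.dU c) := by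
  rw [eq_sub_iff_add_eq, eq_neg_iff_add_eq_zero, ← Ψ.d_κ a c]; abel

theorem em_Q_tmul (a c : U) (M R : Wd U) {p q r : ZMod 2} [HasPar Ψ.γU a p] [HasPar Ψ.γU c q]
    [HasPar Ψ.γW M r] :
    Ψ.em (1 ⊗ₜ Ψ.Q (a ⊗ₜ (M ⊗ₜ (c ⊗ₜ R)))) = 1 ⊗ₜ Ψ.Q (Ψ.dU a ⊗ₜ (M ⊗ₜ (c ⊗ₜ R)))
      + Ψ.qL (Ψ.ς a ⊗ₜ (M ⊗ₜ (c ⊗ₜ R))) + 1 ⊗ₜ Ψ.qR (Ψ.ς a ⊗ₜ (M ⊗ₜ (c ⊗ₜ R)))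
      + 1 ⊗ₜ Ψ.Q (Ψ.γU a ⊗ₜ Ψ.Θ (M ⊗ₜ (c ⊗ₜ R))) := by
  rw [em_apply, ← qL_ς, ← Q_spR_ς, qR_ς, Θ_tmul]
  simp only [tmul_add, map_add, Q_spL_ς]
  have e : Ψ.𝔇 (1 ⊗ₜ Ψ.Q (a ⊗ₜ (M ⊗ₜ (c ⊗ₜ R)))) =
      sgn (q * r) • (1 ⊗ₜ[ℚ] ((Ψ.dX (Ψ.κ a c) ⊗ₜ[ℚ] wordPos U M) ⊗ₜ[ℚ] R)
        + 1 ⊗ₜ[ℚ] ((Ψ.γX (Ψ.κ a c) ⊗ₜ[ℚ] Ψ.D M) ⊗ₜ[ℚ] R)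
        + 1 ⊗ₜ[ℚ] (insL (Ψ.δ (Ψ.κ a c) ⊗ₜ M) ⊗ₜ[ℚ] R)
        - 1 ⊗ₜ[ℚ] (Ψ.insR (Ψ.δ (Ψ.κ a c) ⊗ₜ M) ⊗ₜ[ℚ] R)
        + 1 ⊗ₜ[ℚ] (Ψ.γc (Ψ.κ a c ⊗ₜ[ℚ] wordPos U M) ⊗ₜ[ℚ] Ψ.D R)) := by
    rw [Q_tmul, tmul_smul, map_smul, 𝔇_tmul, D_one, wordPar_one, b_wordPos, zero_tmul, zero_add]
    simp only [add_tmul, sub_tmul, tmul_add, tmul_sub]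
  rw [e, dX_κ]
  simp only [Q_tmul, γU_apply, γX_apply, γW_apply, map_tmul, LinearMap.smul_apply, map_smul,
    ← smul_tmul', tmul_smul, sub_tmul, neg_tmul, tmul_sub, tmul_neg, wordPos_D, smul_smul, smul_add,
    smul_sub, smul_neg, ← sgn_add]
  ring_nf
  simp only [zmod_two_two, mul_zero, add_zero, zero_add]
  simp only [sgn_add, sgn_one, sgn_zero]
  module

theorem em_Q (a : U) (t : Om U) {p : ZMod 2} [HasPar Ψ.γU a p] :
    Ψ.em (1 ⊗ₜ Ψ.Q (a ⊗ₜ t)) = 1 ⊗ₜ Ψ.Q (Ψ.dU a ⊗ₜ t)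
      + Ψ.qL (Ψ.ς a ⊗ₜ t) + 1 ⊗ₜ Ψ.qR (Ψ.ς a ⊗ₜ t) + 1 ⊗ₜ Ψ.Q (Ψ.γU a ⊗ₜ Ψ.Θ t) := by
  induction t using TensorProduct.induction_on with
  | zero => simp
  | tmul M s =>
    induction s with
    | zero => simp
    | tmul c R =>
      induction M using hasPar_induction Ψ.γW_γW with
      | add M M' h h' =>
        simp only [add_tmul, tmul_add, map_add, h, h']; abel
      | h r M hM =>
        induction c using hasPar_induction Ψ.γU_γU with
        | add c c' h h' =>
          simp only [add_tmul, tmul_add, map_add, h, h']; abel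
        | h q c hc => exact Ψ.em_Q_tmul a c M R
    | add s t hs ht => simp only [tmul_add, map_add, hs, ht]; abel
  | add s t hs ht => simp only [tmul_add, map_add, hs, ht]; abel

/-- The change of the block decomposition under the differential. -/
theorem E_D (u : Wd U) : Ψ.E (Ψ.D u) = Ψ.em (Ψ.E u) := by
  have : Ψ.E ∘ₗ Ψ.D = Ψ.em ∘ₗ Ψ.E := word_hom_ext Ψ.γU_γU (by simp [D_one, E_one])
    (fun p q a u ha hu h => by
      simp only [comp_apply] at h ⊢
      rw [D_mul, D_lt, wordPar_ι, map_add, E_lt_mul, Ψ.γU_γU, h, dl_apply, add_mul, map_add,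
        E_lt_mul, E_sp_mul, E_lt_mul, map_add, em_smul, em_Q, cut_D, wordPar_ι, Ψ.γU_γU, D_lt]
      have e : Ψ.dl (Ψ.γU a) • Ψ.E u
          = -(lt (Ψ.γU (Ψ.dU a)) • Ψ.E u) - Ψ.γW (sp (Ψ.ς a)) • Ψ.E u := by
        rw [dl_apply, Ψ.γU_dU, γW_sp, Ψ.γ_ς, map_neg, map_neg, neg_smul, neg_smul, add_smul]; abel
      rw [e]
      abel)
  exact LinearMap.congr_fun this u

end KModel

namespace KModel

variable {X U : Type*} [AddCommGroup X] [Module ℚ X] [AddCommGroup U] [Module ℚ U]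
  (Ψ : KModel X U)

/-! #### Contraction of blocks -/

/-- `L ⊗ (B ⊗ R) ↦ ± (L R) ⊗ B`. -/
def Kw : Bl X U →ₗ[ℚ] Wd U ⊗[ℚ] Ce X U :=
  map (LinearMap.mul' ℚ (Wd U)) LinearMap.id ∘ₗ
    (assoc (Wd U) (Wd U) (Ce X U)).symm.toLinearMap ∘ₗ
    map .id (kflip Ψ.γc Ψ.γW)

theorem Kw_tmul (L R : Wd U) (B : Ce X U) {q r : ZMod 2} [HasPar Ψ.γc B q] [HasPar Ψ.γW R r] :
    Ψ.Kw (L ⊗ₜ (B ⊗ₜ R)) = sgn (q * r) • ((L * R) ⊗ₜ[ℚ] B) := by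
  simp only [Kw, comp_apply, LinearEquiv.coe_coe, map_tmul, id_apply, kflip_tmul_sgn, map_smul,
    tmul_smul, assoc_symm_tmul, LinearMap.mul'_apply]

/-- `x ⊗ (L ⊗ (B ⊗ R)) ↦ ± x (L R) ⊗ B`. -/
def K : X ⊗[ℚ] Bl X U →ₗ[ℚ] Ce X U ⊗[ℚ] Ce X U :=
  (assoc X (Wd U) (Ce X U)).symm.toLinearMap ∘ₗ map Ψ.γX Ψ.Kw

theorem K_eq (x : X) (t : Bl X U) :
    Ψ.K (x ⊗ₜ t) = (assoc X (Wd U) (Ce X U)).symm (Ψ.γX x ⊗ₜ Ψ.Kw t) := rfl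

theorem K_tmul (x : X) (L R : Wd U) (B : Ce X U) {p q r : ZMod 2} [HasPar Ψ.γX x p]
    [HasPar Ψ.γc B q] [HasPar Ψ.γW R r] :
    Ψ.K (x ⊗ₜ (L ⊗ₜ (B ⊗ₜ R))) = sgn (p + q * r) • ((x ⊗ₜ[ℚ] (L * R)) ⊗ₜ[ℚ] B) := by
  simp only [K_eq, Kw_tmul, map_smul, tmul_smul, γX_apply, assoc_symm_tmul, ← smul_tmul', smul_smul,
    sgn_add]
  congr 1; ring

/-- Homogeneous induction for words with a block. -/
theorem bl_induction {P : Bl X U → Prop} (zero : P 0) (add : ∀ s t, P s → P t → P (s + t))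
    (h : ∀ p q r L B R, HasPar Ψ.γW L p → HasPar Ψ.γc B q → HasPar Ψ.γW R r →
      P (L ⊗ₜ (B ⊗ₜ R))) (t : Bl X U) : P t := by
  induction t using TensorProduct.induction_on with
  | zero => exact zero
  | add s t hs ht => exact add s t hs ht
  | tmul L s =>
    induction s using tensor_induction Ψ.γc_γc Ψ.γW_γW with
    | zero => rw [tmul_zero]; exact zero
    | add s t hs ht => rw [tmul_add]; exact add _ _ hs ht
    | h q r B R hB hR =>
      induction L using hasPar_induction Ψ.γW_γW with
      | add L L' h h' => rw [add_tmul]; exact add _ _ h h'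
      | h p L hL => exact h p q r L B R hL hB hR

theorem Kw_attL (L R : Wd U) (z : Ce X U ⊗[ℚ] Wd U) {r : ZMod 2} [HasPar Ψ.γW R r] :
    Ψ.Kw (attL (L ⊗ₜ (kflip Ψ.γc Ψ.γW z ⊗ₜ R))) = Ψ.Kw (attR (L ⊗ₜ (z ⊗ₜ R))) := by
  induction z using tensor_induction Ψ.γc_γc Ψ.γW_γW with
  | zero => simp
  | add s t hs ht => simp only [add_tmul, tmul_add, map_add, hs, ht]
  | h q v B w hB hw =>
    rw [kflip_tmul_sgn, ← smul_tmul', tmul_smul, map_smul, attL_tmul, attR_tmul, map_smul, Kw_tmul,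
      Kw_tmul, smul_smul, ← sgn_add, mul_assoc]
    congr 2; grind

theorem Kw_emLR (t : Bl X U) : Ψ.Kw (Ψ.emL t) + Ψ.Kw (Ψ.emR t) = 0 := by
  induction t using Ψ.bl_induction with
  | zero => simp
  | add s t hs ht =>
    simp only [map_add]
    rw [add_add_add_comm, hs, ht, add_zero]
  | h p q r L B R hL hB hR =>
    clear hB
    induction B using TensorProduct.induction_on with
    | zero => simp
    | add s t hs ht =>
      simp only [tmul_add, add_tmul, map_add]
      rw [add_add_add_comm, hs, ht, add_zero]
    | tmul y N =>
      rw [emL_tmul, emR_tmul, Kw_attL, map_smul, sgn_one]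
      module

theorem K_emLR (x : X) (t : Bl X U) : Ψ.K (x ⊗ₜ Ψ.emL t) + Ψ.K (x ⊗ₜ Ψ.emR t) = 0 := by
  rw [K_eq, K_eq, ← map_add, ← tmul_add, Kw_emLR, tmul_zero, map_zero]

/-- The differential of the tensor square. -/
def b₂ : Ce X U ⊗[ℚ] Ce X U →ₗ[ℚ] Ce X U ⊗[ℚ] Ce X U :=
  map Ψ.b .id + map Ψ.γc Ψ.b

theorem b₂_tmul (s t : Ce X U) : Ψ.b₂ (s ⊗ₜ t) = Ψ.b s ⊗ₜ t + Ψ.γc s ⊗ₜ Ψ.b t := rfl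

theorem ract_add {V : Type*} [AddCommGroup V] [Module ℚ V] (w w' : Wd U)
    (t : Wd U ⊗[ℚ] (V ⊗[ℚ] Wd U)) : ract V (w + w') t = ract V w t + ract V w' t := by
  induction t with
  | zero => simp
  | add s t hs ht => simp only [map_add, hs, ht]; abel
  | tmul L s =>
    induction s with
    | zero => simp
    | add s t hs ht => simp only [tmul_add, map_add, hs, ht]; abel
    | tmul v R => simp only [ract_tmul, mul_add, tmul_add]

theorem ract_smul_left {V : Type*} [AddCommGroup V] [Module ℚ V] (c : ℚ) (w : Wd U)
    (t : Wd U ⊗[ℚ] (V ⊗[ℚ] Wd U)) : ract V (c • w) t = c • ract V w t := by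
  induction t with
  | zero => simp
  | add s t hs ht => simp only [map_add, hs, ht, smul_add]
  | tmul L s =>
    induction s with
    | zero => simp
    | add s t hs ht => simp only [tmul_add, map_add, hs, ht, smul_add]
    | tmul v R => simp only [ract_tmul, mul_smul_comm, tmul_smul]

/-- `t ⊗ a ↦ t [a]` -/
def actR (V U : Type*) [AddCommGroup V] [Module ℚ V] [AddCommGroup U] [Module ℚ U] :
    (Wd U ⊗[ℚ] (V ⊗[ℚ] Wd U)) ⊗[ℚ] U →ₗ[ℚ] Wd U ⊗[ℚ] (V ⊗[ℚ] Wd U) :=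
  TensorProduct.lift (LinearMap.mk₂ ℚ (fun t a => ract V (lt a) t)
    (by intros; rw [map_add]) (by intros; rw [map_smul])
    (by intros; rw [map_add, ract_add]) (by intros; rw [map_smul, ract_smul_left]))

theorem actR_tmul {V : Type*} [AddCommGroup V] [Module ℚ V] (t : Wd U ⊗[ℚ] (V ⊗[ℚ] Wd U)) (a : U) :
    actR V U (t ⊗ₜ a) = ract V (lt a) t := by simp [actR]

/-- `a ⊗ t ↦ [a] t` -/
def actB : U ⊗[ℚ] Bl X U →ₗ[ℚ] Bl X U :=
  map (LinearMap.mul' ℚ (Wd U) ∘ₗ map lt .id) LinearMap.id ∘ₗ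
    (assoc U (Wd U) (Ce X U ⊗[ℚ] Wd U)).symm.toLinearMap

theorem actB_tmul (a : U) (t : Bl X U) : actB (a ⊗ₜ t) = lt a • t := by
  induction t using TensorProduct.induction_on with
  | zero => simp
  | tmul M s => simp [actB, smul_tmul']
  | add s t hs ht => simp only [tmul_add, map_add, smul_add, hs, ht]

instance HasPar.neg {A : Type*} [AddCommGroup A] [Module ℚ A] {γ : A →ₗ[ℚ] A} (a : A)
    {p : ZMod 2} [h : HasPar γ a p] : HasPar (-γ) a (p + 1) :=
  ⟨by rw [LinearMap.neg_apply, h.eq, sgn_add, sgn_one]; module⟩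

/-- `(x ⊗ a) ⊗ t ↦ x ([γ a] t)`, contracted -/
def KL : (X ⊗[ℚ] U) ⊗[ℚ] Bl X U →ₗ[ℚ] Ce X U ⊗[ℚ] Ce X U :=
  Ψ.K ∘ₗ map .id (actB ∘ₗ map Ψ.γU .id) ∘ₗ
    (assoc X U (Bl X U)).toLinearMap

/-- `(x ⊗ a) ⊗ t ↦ ± x (t [a])`, contracted -/
def KR : (X ⊗[ℚ] U) ⊗[ℚ] Bl X U →ₗ[ℚ] Ce X U ⊗[ℚ] Ce X U :=
  Ψ.K ∘ₗ map .id (actR (Ce X U) U ∘ₗ kflip Ψ.γU (-Ψ.γB)) ∘ₗ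
    (assoc X U (Bl X U)).toLinearMap

theorem KL_tmul (x : X) (a : U) (t : Bl X U) :
    Ψ.KL ((x ⊗ₜ a) ⊗ₜ t) = Ψ.K (x ⊗ₜ (lt (Ψ.γU a) • t)) := by simp [KL, actB_tmul]

theorem KR_tmul (x : X) (a : U) (t : Bl X U) {p q : ZMod 2} [HasPar Ψ.γU a p]
    [HasPar Ψ.γB t q] :
    Ψ.KR ((x ⊗ₜ a) ⊗ₜ t) = sgn (p * (q + 1)) • Ψ.K (x ⊗ₜ ract _ (lt a) t) := by
  simp only [KR, comp_apply, LinearEquiv.coe_coe, assoc_tmul, map_tmul, id_apply, kflip_tmul_sgn,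
    map_smul, actR_tmul, tmul_smul]

theorem KL_hom (y : X ⊗[ℚ] U) (L R : Wd U) (B : Ce X U) {v p q r : ZMod 2}
    [hy : HasPar (map Ψ.γX Ψ.γU) y v] [HasPar Ψ.γW L p]
    [HasPar Ψ.γc B q] [HasPar Ψ.γW R r] :
    Ψ.KL (y ⊗ₜ (L ⊗ₜ (B ⊗ₜ R))) = sgn (v + q * r) • (insL (y ⊗ₜ (L * R)) ⊗ₜ[ℚ] B) := by
  refine tensor_induction_par Ψ.γX_γX Ψ.γU_γU ?_ ?_ ?_ y hy
  · simp
  · intro s t hs ht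
    simp only [add_tmul, map_add, hs, ht, smul_add]
  · intro p₁ p₂ x a hx ha e
    rw [KL_tmul, smul_tmul', smul_eq_mul, K_tmul, insL_tmul, mul_assoc, γU_apply, map_smul,
      smul_mul_assoc, tmul_smul, ← smul_tmul', smul_smul, ← sgn_add, e]
    congr 2; grind

theorem KR_hom (y : X ⊗[ℚ] U) (L R : Wd U) (B : Ce X U) {v p q r : ZMod 2}
    [hy : HasPar (map Ψ.γX Ψ.γU) y v] [HasPar Ψ.γW L p]
    [HasPar Ψ.γc B q] [HasPar Ψ.γW R r] :
    Ψ.KR (y ⊗ₜ (L ⊗ₜ (B ⊗ₜ R))) = sgn (v + q * r) • (Ψ.insR (y ⊗ₜ (L * R)) ⊗ₜ[ℚ] B) := by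
  refine tensor_induction_par Ψ.γX_γX Ψ.γU_γU ?_ ?_ ?_ y hy
  · simp
  · intro s t hs ht
    simp only [add_tmul, map_add, hs, ht, smul_add]
  · intro p₁ p₂ x a hx ha e
    rw [KR_tmul, ract_tmul, K_tmul, insR_tmul, ← mul_assoc, ← smul_tmul', smul_smul, smul_smul,
      ← sgn_add, ← sgn_add, e]
    congr 2; grind

/-- The differential of a contraction. -/
theorem b₂_K (x : X) (t : Bl X U) :
    Ψ.b₂ (Ψ.K (x ⊗ₜ t)) + Ψ.K (Ψ.dX x ⊗ₜ t) + Ψ.K (Ψ.γX x ⊗ₜ Ψ.em t)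
      + Ψ.KL (Ψ.δ x ⊗ₜ t) - Ψ.KR (Ψ.δ x ⊗ₜ t) = 0 := by
  have e : Ψ.K (Ψ.γX x ⊗ₜ Ψ.em t) = -Ψ.K (Ψ.γX x ⊗ₜ Ψ.𝔇 t) := by
    rw [em_apply, tmul_sub, map_sub, tmul_add, map_add, K_emLR, zero_sub]
  rw [e]
  clear e
  induction x using hasPar_induction Ψ.γX_γX with
  | add x x' h h' =>
    simp only [add_tmul, map_add]
    linear_combination (norm := module) h + h'
  | h v x hx =>
    induction t using Ψ.bl_induction with
    | zero => simp
    | add s t hs ht =>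
      simp only [tmul_add, map_add]
      linear_combination (norm := module) hs + ht
    | h p q r L B R hL hB hR =>
      rw [KL_hom, KR_hom, K_tmul, K_tmul, map_smul, b₂_tmul, b_tmul, 𝔇_tmul, D_mul]
      simp only [add_tmul, sub_tmul, tmul_add, map_add, K_tmul, γX_apply, γW_apply, map_tmul,
        ← smul_tmul', tmul_smul, map_smul, smul_add, smul_sub, smul_smul, hB.eq, smul_mul_assoc,
        ← sgn_add]
      ring_nf
      simp only [zmod_two_two, mul_zero, add_zero, zero_add]
      simp only [sgn_add, sgn_one, sgn_zero]
      module

/-! #### The operations `h` and `∨` -/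

theorem γ_cut (u : Wd U) :
    map Ψ.γW (map Ψ.γU Ψ.γW) (wordCut U u) = wordCut U (Ψ.γW u) := by
  have : map Ψ.γW (map Ψ.γU Ψ.γW) ∘ₗ wordCut U
      = wordCut U ∘ₗ Ψ.γW := word_ext (by simp [wordCut_one, wordPar_one]) (fun a u h => by
    simp only [comp_apply] at h ⊢
    rw [wordCut_ι_mul, map_add, map_γW_smul, h, wordPar_mul, wordPar_ι, wordCut_ι_mul, map_tmul,
      map_tmul, wordPar_one])
  exact LinearMap.congr_fun this u

instance (u : Wd U) {p : ZMod 2} [h : HasPar Ψ.γW u p] :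
    HasPar (map Ψ.γW (map Ψ.γU Ψ.γW)) (wordCut U u) p :=
  ⟨by rw [γ_cut, h.eq, map_smul]⟩

theorem γ_Q (a : U) (t : Om U) :
    map Ψ.γc Ψ.γW (Ψ.Q (a ⊗ₜ t))
      = -Ψ.Q (Ψ.γU a ⊗ₜ map Ψ.γW (map Ψ.γU Ψ.γW) t) := by
  induction t using TensorProduct.induction_on with
  | zero => simp
  | add s t hs ht => simp only [tmul_add, map_add, hs, ht]; abel
  | tmul M s =>
    induction s with
    | zero => simp
    | add s t hs ht => simp only [tmul_add, map_add, hs, ht]; abel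
    | tmul c R =>
      induction M using hasPar_induction Ψ.γW_γW with
      | add M M' h h' =>
        simp only [tmul_add, add_tmul, map_add, h, h']; abel
      | h r M hM =>
        induction c using hasPar_induction Ψ.γU_γU with
        | add c c' h h' =>
          simp only [tmul_add, add_tmul, map_add, h, h']; abel
        | h q c hc =>
          rw [Q_tmul, map_smul, map_tmul, map_tmul, Ψ.γ_κ, map_tmul, map_tmul]
          simp only [γW_apply, γU_apply, tmul_smul, ← smul_tmul', map_smul, Q_tmul, neg_tmul]
          module

theorem γ_E (u : Wd U) : Ψ.γB (Ψ.E u) = -Ψ.E (Ψ.γW u) := by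
  have : Ψ.γB ∘ₗ Ψ.E = -(Ψ.E ∘ₗ Ψ.γW) := word_ext (by simp [E_one, wordPar_one])
    (fun a u h => by
      simp only [comp_apply, LinearMap.neg_apply] at h ⊢
      rw [E_lt_mul, map_add, map_γW_smul, h, wordPar_mul, wordPar_ι, wordPar_ι, E_lt_mul, map_tmul,
        γ_Q, wordPar_one, γ_cut, tmul_neg, smul_neg, neg_add])
  exact LinearMap.congr_fun this u

instance (u : Wd U) {p : ZMod 2} [h : HasPar Ψ.γW u p] : HasPar Ψ.γB (Ψ.E u) (p + 1) :=
  ⟨by rw [γ_E, h.eq, map_smul, sgn_add, sgn_one]; module⟩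

/-- `u ⊗ a ↦ E(u[a]) - E(u)[a]`, the blocks which contain the last letter. -/
def last : Wd U ⊗[ℚ] U →ₗ[ℚ] Bl X U :=
  Ψ.E ∘ₗ LinearMap.mul' ℚ (Wd U) ∘ₗ map .id lt
    - actR (Ce X U) U ∘ₗ map Ψ.E .id

theorem last_tmul (u : Wd U) (a : U) :
    Ψ.last (u ⊗ₜ a) = Ψ.E (u * lt a) - ract _ (lt a) (Ψ.E u) := by
  simp [last, actR_tmul]

theorem E_mul_lt (u : Wd U) (a : U) :
    Ψ.E (u * lt a) = ract _ (lt a) (Ψ.E u) + Ψ.last (u ⊗ₜ a) := by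
  rw [last_tmul, add_sub_cancel]

/-- `h`. -/
def h : Ce X U →ₗ[ℚ] Ce X U ⊗[ℚ] Ce X U := Ψ.K ∘ₗ map .id Ψ.E

theorem h_tmul (x : X) (u : Wd U) : Ψ.h (x ⊗ₜ u) = Ψ.K (x ⊗ₜ Ψ.E u) := rfl

/-- `∨`. -/
def vee : Ce X U →ₗ[ℚ] Ce X U ⊗[ℚ] Ce X U :=
  Ψ.K ∘ₗ map .id (Ψ.last ∘ₗ kflip Ψ.γU Ψ.γW) ∘ₗ
    (assoc X U (Wd U)).toLinearMap ∘ₗ map Ψ.δ .id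

/-- The flip of `∨`. -/
def veeFlip : Ce X U →ₗ[ℚ] Ce X U ⊗[ℚ] Ce X U :=
  Ψ.K ∘ₗ map .id (TensorProduct.mk ℚ _ _ 1 ∘ₗ Ψ.Q ∘ₗ
    map .id (wordCut U)) ∘ₗ
    (assoc X U (Wd U)).toLinearMap ∘ₗ map Ψ.δ .id

/-- `h` is a homotopy between `∨` and its flip. -/
theorem b₂_h (t : Ce X U) : Ψ.b₂ (Ψ.h t) + Ψ.h (Ψ.b t) = Ψ.veeFlip t - Ψ.vee t := by
  induction t using tensor_induction Ψ.γX_γX Ψ.γW_γW with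
  | zero => simp
  | add s t hs ht => simp only [map_add]; linear_combination (norm := module) hs + ht
  | h p q x u hx hu =>
    have key : ∀ y : X ⊗[ℚ] U, Ψ.h (insL (y ⊗ₜ u)) - Ψ.h (Ψ.insR (y ⊗ₜ u))
        = Ψ.KL (y ⊗ₜ Ψ.E u) - Ψ.KR (y ⊗ₜ Ψ.E u)
          + (Ψ.K (map .id (TensorProduct.mk ℚ _ _ 1 ∘ₗ Ψ.Q ∘ₗ
              map .id (wordCut U)) (assoc X U (Wd U)
                (y ⊗ₜ u)))
            - Ψ.K (map .id (Ψ.last ∘ₗ kflip Ψ.γU Ψ.γW)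
              (assoc X U (Wd U) (y ⊗ₜ u)))) := by
      intro y
      induction y using tensor_induction Ψ.γX_γX Ψ.γU_γU with
      | zero => simp
      | add s t hs ht =>
        simp only [add_tmul, map_add]; linear_combination (norm := module) hs + ht
      | h r s x a hx ha =>
        rw [insL_tmul, insR_tmul, map_smul, h_tmul, h_tmul, E_lt_mul, E_mul_lt, KL_tmul, KR_tmul]
        simp only [assoc_tmul, map_tmul, comp_apply, id_apply, kflip_tmul_sgn, map_smul, tmul_smul,
          tmul_add, map_add, mk_apply]
        rw [show s * (q + 1 + 1) = s * q by grind]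
        module
    have e := Ψ.b₂_K x (Ψ.E u)
    rw [h_tmul, b_tmul, map_sub, map_add, map_add, h_tmul, h_tmul, E_D]
    have k := key (Ψ.δ x)
    simp only [veeFlip, vee, comp_apply, map_tmul, id_apply, LinearEquiv.coe_coe]
    linear_combination (norm := module) e + k

end KModel

namespace KModel

variable {X U : Type*} [AddCommGroup X] [Module ℚ X] [AddCommGroup U] [Module ℚ U]
  (Ψ : KModel X U)

/-! #### The square of the differential -/

theorem D_sp (s : U ⊗[ℚ] U) :
    Ψ.D (sp s) = sp (map Ψ.dU .id s + map Ψ.γU Ψ.dU s)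
      + (LinearMap.mul' ℚ (Wd U) ∘ₗ map lt sp)
        (assoc U U U (map Ψ.ς .id s)
          + map Ψ.γU Ψ.ς s) := by
  have key : ∀ (s : U ⊗[ℚ] U) (a : U), (LinearMap.mul' ℚ (Wd U) ∘ₗ map lt sp)
      (assoc U U U (s ⊗ₜ a)) = sp s * lt a := by
    intro s a
    induction s with
    | zero => simp
    | tmul c d => simp [sp_tmul, mul_assoc]
    | add s t hs ht => simp only [add_tmul, map_add, add_mul, hs, ht]
  induction s with
  | zero => simp
  | add s t hs ht => simp only [map_add, hs, ht]; abel
  | tmul a c =>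
    rw [sp_tmul, D_mul, D_lt, D_lt, wordPar_ι, dl_apply, dl_apply]
    simp only [map_add, map_tmul, id_apply, key, sp_tmul]
    simp only [add_mul, mul_add, comp_apply, map_tmul, LinearMap.mul'_apply]
    abel

theorem D_dl (a : U) : Ψ.D (Ψ.dl a) = 0 := by
  rw [dl_apply, map_add, D_lt, D_sp, Ψ.coassoc_ς, dl_apply, Ψ.dU_dU, neg_add_cancel, map_zero,
    map_zero, add_zero, zero_add, ← map_add, add_comm, Ψ.d_ς, map_zero]

theorem D_D (u : Wd U) : Ψ.D (Ψ.D u) = 0 := by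
  have : Ψ.D ∘ₗ Ψ.D = 0 := word_ext (by simp [D_one])
    (fun a u h => by
      simp only [comp_apply, LinearMap.zero_apply] at h ⊢
      rw [D_mul, map_add, D_mul, D_mul, h, D_lt, D_dl, wordPar_ι, D_lt, γW_dl]
      simp)
  exact LinearMap.congr_fun this u

/-- The part of the differential of `X ⊗ T(U)` without the coaction. -/
def bO : Ce X U →ₗ[ℚ] Ce X U :=
  map Ψ.dX .id + map Ψ.γX Ψ.D

/-- The part of the differential that emits a letter to the left end of the word. -/
def iL : Ce X U →ₗ[ℚ] Ce X U := insL ∘ₗ map Ψ.δ .id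

/-- The part of the differential that emits a letter to the right end of the word. -/
def iR : Ce X U →ₗ[ℚ] Ce X U := Ψ.insR ∘ₗ map Ψ.δ .id

theorem bO_tmul (x : X) (u : Wd U) : Ψ.bO (x ⊗ₜ u) = Ψ.dX x ⊗ₜ u + Ψ.γX x ⊗ₜ Ψ.D u := rfl

theorem iL_tmul (x : X) (u : Wd U) : Ψ.iL (x ⊗ₜ u) = insL (Ψ.δ x ⊗ₜ u) := rfl

theorem iR_tmul (x : X) (u : Wd U) : Ψ.iR (x ⊗ₜ u) = Ψ.insR (Ψ.δ x ⊗ₜ u) := rfl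

theorem b_apply (t : Ce X U) : Ψ.b t = Ψ.bO t + Ψ.iL t - Ψ.iR t := rfl

/-- The iterated coaction. -/
def δδ : X →ₗ[ℚ] X ⊗[ℚ] (U ⊗[ℚ] U) :=
  (assoc X U U).toLinearMap ∘ₗ map Ψ.δ .id ∘ₗ Ψ.δ

theorem δδ_eq (x : X) : Ψ.δδ x = -map Ψ.γX Ψ.ς (Ψ.δ x) := Ψ.coassoc_δ x

theorem δδ_anti (x : X) :
    map .id (kflip Ψ.γU Ψ.γU) (Ψ.δδ x) = -Ψ.δδ x := by
  rw [δδ_eq, map_neg, neg_inj]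
  generalize Ψ.δ x = s
  induction s with
  | zero => simp
  | add s t hs ht => simp only [map_add, hs, ht]; abel
  | tmul y a => simp [Ψ.anti_ς, tmul_neg]

/-- `(x ⊗ s) ⊗ u ↦ x s u`. -/
def insLL : (X ⊗[ℚ] (U ⊗[ℚ] U)) ⊗[ℚ] Wd U →ₗ[ℚ] Ce X U :=
  map .id (LinearMap.mul' ℚ (Wd U) ∘ₗ map sp .id) ∘ₗ
    (assoc X (U ⊗[ℚ] U) (Wd U)).toLinearMap

theorem insLL_tmul (x : X) (s : U ⊗[ℚ] U) (u : Wd U) :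
    insLL ((x ⊗ₜ s) ⊗ₜ u) = x ⊗ₜ[ℚ] (sp s * u) := by simp [insLL]

/-- `(x ⊗ s) ⊗ u ↦ ± x u s`. -/
def insRR : (X ⊗[ℚ] (U ⊗[ℚ] U)) ⊗[ℚ] Wd U →ₗ[ℚ] Ce X U :=
  map .id (LinearMap.mul' ℚ (Wd U) ∘ₗ map .id sp ∘ₗ
    kflip (map Ψ.γU Ψ.γU) Ψ.γW) ∘ₗ
    (assoc X (U ⊗[ℚ] U) (Wd U)).toLinearMap

theorem insRR_tmul (x : X) (s : U ⊗[ℚ] U) (u : Wd U) {p q : ZMod 2}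
    [HasPar (map Ψ.γU Ψ.γU) s p] [HasPar Ψ.γW u q] :
    Ψ.insRR ((x ⊗ₜ s) ⊗ₜ u) = sgn (p * q) • (x ⊗ₜ[ℚ] (u * sp s)) := by
  simp [insRR, kflip_tmul_sgn s u]

/-- `(x ⊗ (a ⊗ c)) ⊗ u ↦ ± x [a] u [c]`. -/
def insLR : (X ⊗[ℚ] (U ⊗[ℚ] U)) ⊗[ℚ] Wd U →ₗ[ℚ] Ce X U :=
  map .id (LinearMap.mul' ℚ (Wd U) ∘ₗ map lt
    (LinearMap.mul' ℚ (Wd U) ∘ₗ map .id lt ∘ₗ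
    kflip Ψ.γU Ψ.γW) ∘ₗ (assoc U U (Wd U)).toLinearMap) ∘ₗ
    (assoc X (U ⊗[ℚ] U) (Wd U)).toLinearMap

theorem insLR_tmul (x : X) (a c : U) (u : Wd U) {p q : ZMod 2}
    [HasPar Ψ.γU c p] [HasPar Ψ.γW u q] :
    Ψ.insLR ((x ⊗ₜ (a ⊗ₜ c)) ⊗ₜ u) = sgn (p * q) • (x ⊗ₜ[ℚ] (lt a * (u * lt c))) := by
  simp [insLR, kflip_tmul_sgn c u]

theorem iL_insL (y : X ⊗[ℚ] U) (u : Wd U) :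
    Ψ.iL (insL (y ⊗ₜ u))
      = insLL (assoc X U U (map Ψ.δ .id y) ⊗ₜ u) := by
  induction y with
  | zero => simp
  | add s t hs ht => simp only [add_tmul, map_add, hs, ht]
  | tmul x a =>
    rw [insL_tmul, iL_tmul, map_tmul]
    generalize Ψ.δ x = s
    induction s with
    | zero => simp
    | add s t hs ht => simp only [add_tmul, map_add, hs, ht]
    | tmul x c => simp [insL_tmul, insLL_tmul, sp_tmul, mul_assoc]

theorem iR_insR (y : X ⊗[ℚ] U) (u : Wd U) {p : ZMod 2} [HasPar Ψ.γW u p] :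
    Ψ.iR (Ψ.insR (y ⊗ₜ u))
      = Ψ.insRR (map .id (kflip Ψ.γU Ψ.γU)
          (assoc X U U (map Ψ.δ .id y)) ⊗ₜ u) := by
  induction y using tensor_induction Ψ.γX_γX Ψ.γU_γU with
  | zero => simp
  | add s t hs ht => simp only [add_tmul, map_add, hs, ht]
  | h q r x a hx ha =>
    rw [insR_tmul, map_smul, iR_tmul, map_tmul]
    generalize Ψ.δ x = s
    induction s using tensor_induction Ψ.γX_γX Ψ.γU_γU with
    | zero => simp
    | add s t hs ht => simp only [add_tmul, map_add, smul_add, hs, ht]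
    | h q' r' x c hx hc =>
      simp only [insR_tmul, id_apply, assoc_tmul, map_tmul, kflip_tmul_sgn, tmul_smul, ← smul_tmul',
        map_smul, insRR_tmul, sp_tmul, smul_smul, mul_assoc, ← sgn_add]
      congr 2; grind

theorem iL_insR (y : X ⊗[ℚ] U) (u : Wd U) {p : ZMod 2} [HasPar Ψ.γW u p] :
    Ψ.iL (Ψ.insR (y ⊗ₜ u))
      = Ψ.insLR (assoc X U U (map Ψ.δ .id y) ⊗ₜ u) := by
  induction y using tensor_induction Ψ.γX_γX Ψ.γU_γU with
  | zero => simp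
  | add s t hs ht => simp only [add_tmul, map_add, hs, ht]
  | h q r x a hx ha =>
    rw [insR_tmul, map_smul, iL_tmul, map_tmul]
    generalize Ψ.δ x = s
    induction s with
    | zero => simp
    | add s t hs ht => simp only [add_tmul, map_add, smul_add, hs, ht]
    | tmul x c => simp [insL_tmul, insLR_tmul]

theorem iR_insL (y : X ⊗[ℚ] U) (u : Wd U) {p : ZMod 2} [HasPar Ψ.γW u p] :
    Ψ.iR (insL (y ⊗ₜ u))
      = Ψ.insLR (map .id (kflip Ψ.γU Ψ.γU)
          (assoc X U U (map Ψ.δ .id y)) ⊗ₜ u) := by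
  induction y using tensor_induction Ψ.γX_γX Ψ.γU_γU with
  | zero => simp
  | add s t hs ht => simp only [add_tmul, map_add, hs, ht]
  | h q r x a hx ha =>
    rw [insL_tmul, iR_tmul, map_tmul]
    generalize Ψ.δ x = s
    induction s using tensor_induction Ψ.γX_γX Ψ.γU_γU with
    | zero => simp
    | add s t hs ht => simp only [add_tmul, map_add, smul_add, hs, ht]
    | h q' r' x c hx hc =>
      simp only [insR_tmul, id_apply, assoc_tmul, map_tmul, kflip_tmul_sgn, tmul_smul, ← smul_tmul',
        map_smul, insLR_tmul, sp_tmul, smul_smul, mul_assoc, ← sgn_add]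
      congr 2; grind

theorem bO_bO (t : Ce X U) : Ψ.bO (Ψ.bO t) = 0 := by
  induction t using TensorProduct.induction_on with
  | zero => simp
  | add s t hs ht => simp only [map_add, hs, ht, add_zero]
  | tmul x u =>
    rw [bO_tmul, map_add, bO_tmul, bO_tmul, Ψ.dX_dX, D_D, Ψ.γX_dX]
    simp [neg_tmul]

theorem iL_iR (t : Ce X U) : Ψ.iL (Ψ.iR t) + Ψ.iR (Ψ.iL t) = 0 := by
  induction t using tensor_induction Ψ.γX_γX Ψ.γW_γW with
  | zero => simp
  | add s t hs ht => simp only [map_add]; linear_combination (norm := module) hs + ht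
  | h p q x u hx hu =>
    rw [iL_tmul, iR_tmul, iL_insR, iR_insL]
    have := Ψ.δδ_anti x
    simp only [δδ, comp_apply, LinearEquiv.coe_coe] at this
    rw [this, neg_tmul, map_neg, add_neg_cancel]

theorem bO_insL (y : X ⊗[ℚ] U) (u : Wd U) :
    Ψ.bO (insL (y ⊗ₜ u)) = insL (map Ψ.dX .id y ⊗ₜ u)
      + insL (map Ψ.γX Ψ.dU y ⊗ₜ u) + insLL (map Ψ.γX Ψ.ς y ⊗ₜ u)
      + insL (map Ψ.γX Ψ.γU y ⊗ₜ Ψ.D u) := by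
  induction y with
  | zero => simp
  | add s t hs ht => simp only [add_tmul, map_add, hs, ht]; abel
  | tmul x a =>
    simp only [insL_tmul, bO_tmul, map_tmul, id_apply, D_mul, D_lt, dl_apply, add_mul, tmul_add,
      insLL_tmul, wordPar_ι]
    abel

theorem bO_insR (y : X ⊗[ℚ] U) (u : Wd U) {p : ZMod 2} [HasPar Ψ.γW u p] :
    Ψ.bO (Ψ.insR (y ⊗ₜ u)) = Ψ.insR (map Ψ.dX .id y ⊗ₜ u)
      + Ψ.insR (map Ψ.γX Ψ.dU y ⊗ₜ u)
      + Ψ.insRR (map Ψ.γX Ψ.ς y ⊗ₜ u)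
      + Ψ.insR (map Ψ.γX Ψ.γU y ⊗ₜ Ψ.D u) := by
  induction y using tensor_induction Ψ.γX_γX Ψ.γU_γU with
  | zero => simp
  | add s t hs ht => simp only [add_tmul, map_add, hs, ht]; abel
  | h q r x a hx ha =>
    simp only [insR_tmul, bO_tmul, map_tmul, id_apply, D_mul, D_lt, dl_apply, add_mul, tmul_add,
      insRR_tmul, wordPar_ι, γX_apply, γU_apply, γW_apply, mul_add, tmul_smul, ← smul_tmul',
      map_smul, map_add, smul_add, smul_smul, smul_mul_assoc, mul_smul_comm, ← sgn_add]
    ring_nf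
    simp only [zmod_two_two, mul_zero, add_zero, zero_add]
    simp only [sgn_add, sgn_one, sgn_zero]
    module

theorem bO_iL (t : Ce X U) :
    Ψ.bO (Ψ.iL t) + Ψ.iL (Ψ.bO t) + Ψ.iL (Ψ.iL t) = 0 := by
  induction t using TensorProduct.induction_on with
  | zero => simp
  | add s t hs ht => simp only [map_add]; linear_combination (norm := module) hs + ht
  | tmul x u =>
    have h := Ψ.d_δ x
    have c := Ψ.coassoc_δ x
    rw [iL_tmul, iL_insL, c, bO_insL, bO_tmul, map_add, iL_tmul, iL_tmul, Ψ.γ_δ, neg_tmul, neg_tmul,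
      map_neg, map_neg]
    have e := congrArg (fun s => insL (s ⊗ₜ[ℚ] u)) h
    simp only [add_tmul, map_add, zero_tmul, map_zero] at e
    linear_combination (norm := module) e

theorem bO_iR (t : Ce X U) :
    Ψ.bO (Ψ.iR t) + Ψ.iR (Ψ.bO t) - Ψ.iR (Ψ.iR t) = 0 := by
  induction t using tensor_induction Ψ.γX_γX Ψ.γW_γW with
  | zero => simp
  | add s t hs ht => simp only [map_add]; linear_combination (norm := module) hs + ht
  | h p q x u hx hu =>
    have h := Ψ.d_δ x
    have a := Ψ.δδ_anti x
    rw [δδ_eq, neg_neg] at a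
    have c := Ψ.coassoc_δ x
    rw [iR_tmul, iR_insR, c, a, bO_insR, bO_tmul, map_add, iR_tmul, iR_tmul, Ψ.γ_δ, neg_tmul,
      map_neg]
    have e := congrArg (fun s => Ψ.insR (s ⊗ₜ[ℚ] u)) h
    simp only [add_tmul, map_add, zero_tmul, map_zero] at e
    linear_combination (norm := module) e

/-- The differential without the emission to the left. -/
def bR : Ce X U →ₗ[ℚ] Ce X U := Ψ.bO - Ψ.iR

theorem bR_apply (t : Ce X U) : Ψ.bR t = Ψ.bO t - Ψ.iR t := rfl

theorem bR_bR (t : Ce X U) : Ψ.bR (Ψ.bR t) = 0 := by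
  simp only [bR_apply, map_sub]
  linear_combination (norm := module) Ψ.bO_bO t - Ψ.bO_iR t

theorem b_b (t : Ce X U) : Ψ.b (Ψ.b t) = 0 := by
  simp only [b_apply, map_sub, map_add]
  linear_combination (norm := module) Ψ.bO_bO t - Ψ.bO_iR t + Ψ.bO_iL t - Ψ.iL_iR t

end KModel

namespace KModel

variable {X U : Type*} [AddCommGroup X] [Module ℚ X] [AddCommGroup U] [Module ℚ U]
  (Ψ : KModel X U)

/-! #### `∨` commutes with the differentials -/

theorem γc_iL (t : Ce X U) : Ψ.γc (Ψ.iL t) = -Ψ.iL (Ψ.γc t) := by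
  induction t using TensorProduct.induction_on with
  | zero => simp
  | add s t hs ht => simp only [map_add, hs, ht, neg_add]
  | tmul x u =>
    rw [iL_tmul, γc_insL, Ψ.γ_δ, neg_tmul, map_neg, map_tmul, iL_tmul]

theorem γc_bR (t : Ce X U) : Ψ.γc (Ψ.bR t) = -Ψ.bR (Ψ.γc t) := by
  have e : ∀ t, Ψ.bR t = Ψ.b t - Ψ.iL t := fun t => by rw [b_apply, bR_apply]; abel
  rw [e, e, map_sub, γc_b, γc_iL]; abel

/-- The differential of the tensor square without the emission to the left in the first factor. -/
def bR₂ : Ce X U ⊗[ℚ] Ce X U →ₗ[ℚ] Ce X U ⊗[ℚ] Ce X U :=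
  map Ψ.bR .id + map Ψ.γc Ψ.b

theorem bR₂_tmul (s t : Ce X U) : Ψ.bR₂ (s ⊗ₜ t) = Ψ.bR s ⊗ₜ t + Ψ.γc s ⊗ₜ Ψ.b t := rfl

theorem bR₂_bR₂ (t : Ce X U ⊗[ℚ] Ce X U) : Ψ.bR₂ (Ψ.bR₂ t) = 0 := by
  induction t with
  | zero => simp
  | add s t hs ht => simp only [map_add, hs, ht, add_zero]
  | tmul s t =>
    rw [bR₂_tmul, map_add, bR₂_tmul, bR₂_tmul, bR_bR, b_b, γc_bR]
    simp [neg_tmul]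

theorem b₂_eq (t : Ce X U ⊗[ℚ] Ce X U) :
    Ψ.b₂ t = Ψ.bR₂ t + map Ψ.iL .id t := by
  induction t with
  | zero => simp
  | add s t hs ht => simp only [map_add, hs, ht]; abel
  | tmul s t =>
    rw [b₂_tmul, bR₂_tmul, b_apply, bR_apply, map_tmul, id_apply]
    simp only [add_tmul, sub_tmul]; abel

theorem iL_K (x : X) (t : Bl X U) :
    map Ψ.iL .id (Ψ.K (x ⊗ₜ t)) = -Ψ.KL (Ψ.δ x ⊗ₜ t) := by
  induction x using hasPar_induction Ψ.γX_γX with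
  | add x x' h h' => simp only [add_tmul, map_add, h, h', neg_add]
  | h v x hx =>
    induction t using Ψ.bl_induction with
    | zero => simp
    | add s t hs ht => simp only [tmul_add, map_add, hs, ht, neg_add]
    | h p q r L B R hL hB hR =>
      rw [KL_hom, K_tmul, map_smul, map_tmul, iL_tmul, id_apply]
      rw [sgn_add, sgn_add, sgn_add, sgn_one]; module

theorem h_insL (y : X ⊗[ℚ] U) (u : Wd U) :
    Ψ.h (insL (y ⊗ₜ u)) = Ψ.KL (y ⊗ₜ Ψ.E u) + Ψ.K (map .id
      (TensorProduct.mk ℚ _ _ 1 ∘ₗ Ψ.Q ∘ₗ map .id (wordCut U))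
      (assoc X U (Wd U) (y ⊗ₜ u))) := by
  induction y with
  | zero => simp
  | add s t hs ht => simp only [add_tmul, map_add, hs, ht]; abel
  | tmul x a =>
    rw [insL_tmul, h_tmul, E_lt_mul, KL_tmul, tmul_add, map_add]
    simp

theorem h_iL (t : Ce X U) :
    map Ψ.iL .id (Ψ.h t) + Ψ.h (Ψ.iL t) = Ψ.veeFlip t := by
  induction t using TensorProduct.induction_on with
  | zero => simp
  | add s t hs ht => simp only [map_add]; linear_combination (norm := module) hs + ht
  | tmul x u =>
    rw [h_tmul, iL_K, iL_tmul, h_insL, neg_add_cancel_left]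
    rfl

theorem bR₂_h (t : Ce X U) : Ψ.bR₂ (Ψ.h t) + Ψ.h (Ψ.bR t) = -Ψ.vee t := by
  have e : Ψ.bR t = Ψ.b t - Ψ.iL t := by rw [b_apply, bR_apply]; abel
  have h₁ := Ψ.b₂_h t
  have h₂ := Ψ.h_iL t
  rw [b₂_eq] at h₁
  rw [e, map_sub]
  linear_combination (norm := module) h₁ - h₂

theorem bR₂_vee (t : Ce X U) : Ψ.bR₂ (Ψ.vee t) = Ψ.vee (Ψ.bR t) := by
  have h₁ := congrArg Ψ.bR₂ (Ψ.bR₂_h t)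
  have h₂ := Ψ.bR₂_h (Ψ.bR t)
  rw [map_add, bR₂_bR₂, map_neg] at h₁
  rw [bR_bR, map_zero] at h₂
  linear_combination (norm := module) h₁ - h₂

/-! #### An explicit formula for `∨` -/

theorem smul_tmul_word {V : Type*} [AddCommGroup V] [Module ℚ V] (w L : Wd U) (v : V) :
    w • (L ⊗ₜ[ℚ] v) = (w * L) ⊗ₜ[ℚ] v := rfl

/-- Homogeneous induction for words with a marked letter. -/
@[elab_as_elim]
theorem om_induction_par {r : ZMod 2} {P : Om U → Prop} (zero : P 0)
    (add : ∀ s t, P s → P t → P (s + t))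
    (h : ∀ p q v L a R, HasPar Ψ.γW L p → HasPar Ψ.γU a q → HasPar Ψ.γW R v →
      r = p + (q + v) → P (L ⊗ₜ (a ⊗ₜ R))) (t : Om U)
    (ht : HasPar (map Ψ.γW (map Ψ.γU Ψ.γW)) t r) : P t := by
  refine tensor_induction_par Ψ.γW_γW (map_map_self Ψ.γU_γU Ψ.γW_γW) zero add ?_ t ht
  intro p q L s hL hs e
  refine tensor_induction_par (P := fun s => P (L ⊗ₜ s)) Ψ.γU_γU Ψ.γW_γW ?_ ?_ ?_ s hs
  · simpa using zero
  · intro s t hs ht; simpa only [tmul_add] using add _ _ hs ht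
  · intro q' v a R ha hR e'
    exact h p q' v L a R hL ha hR (by rw [e, e'])

theorem om_induction {P : Om U → Prop} (zero : P 0)
    (add : ∀ s t, P s → P t → P (s + t))
    (h : ∀ p q v L a R, HasPar Ψ.γW L p → HasPar Ψ.γU a q → HasPar Ψ.γW R v →
      P (L ⊗ₜ (a ⊗ₜ R))) (t : Om U) : P t := by
  refine hasPar_induction (map_map_self Ψ.γW_γW (map_map_self Ψ.γU_γU Ψ.γW_γW)) add ?_ t
  intro p t ht
  exact Ψ.om_induction_par zero add (fun p q v L a R hL ha hR _ => h p q v L a R hL ha hR) t ht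

/-- `a ⊗ M ↦ Q(a ⊗ (M ⊗ (q ⊗ 1)))` -/
def Qend (q : U) : U ⊗[ℚ] Wd U →ₗ[ℚ] Ce X U ⊗[ℚ] Wd U :=
  Ψ.Q ∘ₗ map .id ((TensorProduct.mk ℚ _ _).flip (q ⊗ₜ[ℚ] (1 : Wd U)))

theorem Qend_tmul (q a : U) (M : Wd U) :
    Ψ.Qend q (a ⊗ₜ M) = Ψ.Q (a ⊗ₜ (M ⊗ₜ (q ⊗ₜ 1))) := by simp [Qend]

theorem Q_ract (a : U) (w : Wd U) (t : Om U) :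
    Ψ.Q (a ⊗ₜ ract U w t) = map .id (LinearMap.mulRight ℚ w)
      (Ψ.Q (a ⊗ₜ t)) := by
  induction t using Ψ.om_induction with
  | zero => simp
  | add s t hs ht => simp only [tmul_add, map_add, hs, ht]
  | h p q v L c R hL hc hR => rw [ract_tmul, Q_tmul, Q_tmul]; simp

theorem last_eq (u : Wd U) (q : U) :
    Ψ.last (u ⊗ₜ q) = map Ψ.γW (Ψ.Qend q) (wordCut U u) := by
  have : Ψ.last ∘ₗ (TensorProduct.mk ℚ _ _).flip q
      = map Ψ.γW (Ψ.Qend q) ∘ₗ wordCut U :=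
    word_ext (by
      simp [last_tmul, E_one, wordCut_one]
      rw [← mul_one (TensorAlgebra.ι ℚ q), E_lt_mul, E_one, wordCut_one]; simp)
    (fun a u h => by
      simp only [comp_apply, LinearMap.flip_apply, mk_apply] at h ⊢
      rw [last_tmul, mul_assoc, E_lt_mul, E_lt_mul, E_mul_lt, map_add, ract_smul, wordCut_mul,
        tmul_add, map_add, Q_ract, wordCut_ι_mul, map_add, map_γW_smul, ← h, wordPar_ι, smul_add,
        map_tmul, Qend_tmul, wordPar_one, ← mul_one (TensorAlgebra.ι ℚ q), wordCut_ι_mul,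
        wordCut_one, smul_zero, add_zero, smul_tmul', smul_eq_mul, mul_one, tmul_add]
      simp only [ract, map_tmul, id_apply, mul_one]
      abel)
  exact LinearMap.congr_fun this u

/-- `a ⊗ (c ⊗ M) ↦ ± κ(c, a) M`; the empty word `M` is sent to zero. -/
def κM : U ⊗[ℚ] (U ⊗[ℚ] Wd U) →ₗ[ℚ] Ce X U :=
  map (TensorProduct.lift Ψ.κ ∘ₗ kflip Ψ.γU Ψ.γU) (wordPos U) ∘ₗ
    (assoc U U (Wd U)).symm.toLinearMap

theorem κM_tmul (a c : U) (M : Wd U) {p q : ZMod 2} [HasPar Ψ.γU a p] [HasPar Ψ.γU c q] :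
    Ψ.κM (a ⊗ₜ (c ⊗ₜ M)) = sgn (p * q) • (Ψ.κ c a ⊗ₜ[ℚ] wordPos U M) := by
  simp [κM, kflip_tmul_sgn, ← smul_tmul']

/-- `(x ⊗ q) ⊗ (L ⊗ (a ⊗ M)) ↦ ± x L ⊗ κ(a, q) M`; the empty word `M` is sent to zero. -/
def vT : (X ⊗[ℚ] U) ⊗[ℚ] Om U →ₗ[ℚ] Ce X U ⊗[ℚ] Ce X U :=
  (assoc X (Wd U) (Ce X U)).symm.toLinearMap ∘ₗ
    map Ψ.γX (map Ψ.γW Ψ.κM ∘ₗ kswap Ψ.γU Ψ.γW (U ⊗[ℚ] Wd U)) ∘ₗ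
    (assoc X U (Om U)).toLinearMap

theorem vT_tmul (x : X) (q a : U) (L M : Wd U) {p₁ p₂ p₃ p₄ : ZMod 2} [HasPar Ψ.γX x p₁]
    [HasPar Ψ.γU q p₂] [HasPar Ψ.γW L p₃] [HasPar Ψ.γU a p₄] :
    Ψ.vT ((x ⊗ₜ q) ⊗ₜ (L ⊗ₜ (a ⊗ₜ M))) = sgn (p₁ + p₂ * p₃ + p₂ * p₄ + p₃) •
      ((x ⊗ₜ[ℚ] L) ⊗ₜ[ℚ] (Ψ.κ a q ⊗ₜ[ℚ] wordPos U M)) := by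
  simp only [vT, comp_apply, LinearEquiv.coe_coe, map_tmul, assoc_tmul, kswap_tmul_sgn, κM_tmul,
    map_smul, tmul_smul, γX_apply, γW_apply, ← smul_tmul', assoc_symm_tmul, smul_smul, ← sgn_add]
  congr 2; grind

theorem vT_eq (y : X ⊗[ℚ] U) (u : Wd U) :
    Ψ.K (map .id (Ψ.last ∘ₗ kflip Ψ.γU Ψ.γW)
      (assoc X U (Wd U) (y ⊗ₜ u))) = Ψ.vT (y ⊗ₜ wordCut U u) := by
  induction u using hasPar_induction Ψ.γW_γW with
  | add u u' h h' => simp only [tmul_add, map_add, h, h']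
  | h r u hu =>
    induction y using tensor_induction Ψ.γX_γX Ψ.γU_γU with
    | zero => simp
    | add s t hs ht => simp only [add_tmul, map_add, hs, ht]
    | h p q x a hx ha =>
      simp only [assoc_tmul, map_tmul, comp_apply, kflip_tmul_sgn, map_smul, last_eq, id_apply,
        tmul_smul]
      have hc : HasPar (map Ψ.γW (map Ψ.γU Ψ.γW))
        (wordCut U u) r := inferInstance
      refine Ψ.om_induction_par ?_ ?_ ?_ (wordCut U u) hc
      · simp
      · intro s t hs ht
        simp only [tmul_add, map_add, smul_add, hs, ht]
      · intro p₁ p₂ p₃ L c M hL hc hM e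
        simp only [map_tmul, Qend_tmul, Q_tmul, tmul_smul, map_smul, γW_apply, ← smul_tmul', K_tmul,
          vT_tmul, mul_one, smul_smul, ← sgn_add, e]
        congr 2; grind

theorem vee_tmul (x : X) (u : Wd U) : Ψ.vee (x ⊗ₜ u) = Ψ.vT (Ψ.δ x ⊗ₜ wordCut U u) :=
  Ψ.vT_eq (Ψ.δ x) u

/-- `((x ⊗ (a ⊗ c)) ⊗ s ↦ vT((x ⊗ a) ⊗ [c] s)`. -/
def vLL : (X ⊗[ℚ] (U ⊗[ℚ] U)) ⊗[ℚ] Om U →ₗ[ℚ] Ce X U ⊗[ℚ] Ce X U :=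
  Ψ.vT ∘ₗ map .id actL ∘ₗ
    (assoc (X ⊗[ℚ] U) U (Om U)).toLinearMap ∘ₗ
    map (assoc X U U).symm.toLinearMap LinearMap.id

theorem vLL_tmul (x : X) (a c : U) (s : Om U) :
    Ψ.vLL ((x ⊗ₜ (a ⊗ₜ c)) ⊗ₜ s) = Ψ.vT ((x ⊗ₜ a) ⊗ₜ (lt c • s)) := by
  simp [vLL, actL_tmul]

theorem vLL_assoc (y : X ⊗[ℚ] U) (c : U) (s : Om U) :
    Ψ.vLL (assoc X U U (y ⊗ₜ c) ⊗ₜ s) = Ψ.vT (y ⊗ₜ (lt c • s)) := by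
  simp [vLL, actL_tmul]

theorem vT_pos_one (y : X ⊗[ℚ] U) (t : U ⊗[ℚ] Wd U) :
    map (pos X U) .id (Ψ.vT (y ⊗ₜ (1 ⊗ₜ t))) = 0 := by
  induction y using tensor_induction Ψ.γX_γX Ψ.γU_γU with
  | zero => simp
  | add s t hs ht => simp only [add_tmul, map_add, hs, ht, add_zero]
  | h p q x a hx ha =>
    induction t using tensor_induction Ψ.γU_γU Ψ.γW_γW with
    | zero => simp
    | add s t hs ht => simp only [tmul_add, map_add, hs, ht, add_zero]
    | h p q c M hc hM => rw [vT_tmul]; simp [pos_tmul, wordPos_one]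

theorem vee_insL (y : X ⊗[ℚ] U) (u : Wd U) :
    map (pos X U) .id (Ψ.vee (insL (y ⊗ₜ u)))
      = map (pos X U) .id (Ψ.vLL (assoc X U U
          (map Ψ.δ .id y) ⊗ₜ wordCut U u)) := by
  induction y with
  | zero => simp
  | add s t hs ht => simp only [add_tmul, map_add, hs, ht]
  | tmul x a =>
    rw [insL_tmul, vee_tmul, wordCut_ι_mul, tmul_add, map_add, map_add, vT_pos_one, zero_add,
      map_tmul, id_apply, vLL_assoc]

theorem iL_vT (y : X ⊗[ℚ] U) (s : Om U) :
    map Ψ.iL .id (Ψ.vT (y ⊗ₜ s))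
      = -Ψ.vLL (map .id (kflip Ψ.γU Ψ.γU) (assoc X U U
          (map Ψ.δ .id y)) ⊗ₜ s) := by
  induction s using Ψ.om_induction with
  | zero => simp
  | add s t hs ht => simp only [tmul_add, map_add, hs, ht, neg_add]
  | h p₁ p₂ p₃ L c M hL hc hM =>
    induction y using tensor_induction Ψ.γX_γX Ψ.γU_γU with
    | zero => simp
    | add s t hs ht => simp only [add_tmul, map_add, hs, ht, neg_add]
    | h p q x a hx ha =>
      rw [vT_tmul, map_smul, map_tmul, iL_tmul, map_tmul]
      have hy : HasPar (map Ψ.γX Ψ.γU) (Ψ.δ x) (p + 1) := inferInstance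
      refine tensor_induction_par Ψ.γX_γX Ψ.γU_γU ?_ ?_ ?_ (Ψ.δ x) hy
      · simp
      · intro s t hs ht
        simp only [add_tmul, map_add, smul_add, hs, ht, neg_add]
      · intro q₁ q₂ z a' hz ha' e
        obtain rfl : p = q₁ + q₂ + 1 := by grind
        simp only [assoc_tmul, map_tmul, id_apply, kflip_tmul_sgn, tmul_smul, ← smul_tmul',
          map_smul, vLL_tmul, smul_tmul_word, vT_tmul, insL_tmul, smul_smul]
        rw [← neg_one_smul ℚ, smul_smul, ← sgn_one, ← sgn_add, ← sgn_add]
        congr 2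
        grind

theorem iL_vee (t : Ce X U) :
    map (pos X U) .id (map Ψ.iL .id (Ψ.vee t))
      = map (pos X U) .id (Ψ.vee (Ψ.iL t)) := by
  induction t using TensorProduct.induction_on with
  | zero => simp
  | add s t hs ht => simp only [map_add, hs, ht]
  | tmul x u =>
    have := Ψ.δδ_anti x
    simp only [δδ, comp_apply, LinearEquiv.coe_coe] at this
    rw [vee_tmul, iL_vT, iL_tmul, vee_insL, this, neg_tmul, map_neg, map_neg, map_neg, neg_neg]

theorem b₂_vee (t : Ce X U) :
    map (pos X U) .id (Ψ.b₂ (Ψ.vee t))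
      = map (pos X U) .id (Ψ.vee (Ψ.b t)) := by
  have e : Ψ.b t = Ψ.bR t + Ψ.iL t := by rw [b_apply, bR_apply]; abel
  rw [b₂_eq, e, map_add, map_add, map_add, bR₂_vee, iL_vee]

end KModel

/-- The power `γ ^ p` of a sign operator. -/
def parPow {A : Type*} [AddCommGroup A] [Module ℚ A] (γ : A →ₗ[ℚ] A) (p : ZMod 2) : A →ₗ[ℚ] A :=
  if p = 0 then LinearMap.id else γ

theorem parPow_apply {A : Type*} [AddCommGroup A] [Module ℚ A] {γ : A →ₗ[ℚ] A} (p : ZMod 2)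
    (a : A) {q : ZMod 2} [h : HasPar γ a q] : parPow γ p a = sgn (p * q) • a := by
  have : ∀ p : ZMod 2, p = 0 ∨ p = 1 := by decide
  rcases this p with rfl | rfl
  · simp [parPow]
  · simp [parPow, h.eq]

namespace KModel

variable {X U : Type*} [AddCommGroup X] [Module ℚ X] [AddCommGroup U] [Module ℚ U]
  (Ψ : KModel X U)

/-! #### The flip of `∨` -/

/-- `x ⊗ y ↦ ± x L ⊗ y M`. -/
def attach (p : ZMod 2) (L M : Wd U) : X ⊗[ℚ] X →ₗ[ℚ] Ce X U ⊗[ℚ] Ce X U :=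
  map ((TensorProduct.mk ℚ X (Wd U)).flip L)
    ((TensorProduct.mk ℚ X (Wd U)).flip M ∘ₗ parPow Ψ.γX p)

theorem attach_tmul (p : ZMod 2) (L M : Wd U) (x y : X) {q : ZMod 2} [HasPar Ψ.γX y q] :
    Ψ.attach p L M (x ⊗ₜ y) = sgn (p * q) • ((x ⊗ₜ[ℚ] L) ⊗ₜ[ℚ] (y ⊗ₜ[ℚ] M)) := by
  simp [attach, parPow_apply p y, ← smul_tmul']

theorem kflip_attach (L M : Wd U) (t : X ⊗[ℚ] X) {l μ : ZMod 2} [HasPar Ψ.γW L l]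
    [HasPar Ψ.γW M μ] :
    kflip Ψ.γc Ψ.γc (Ψ.attach l L M t) = sgn (l * μ) • Ψ.attach μ M L (kflip Ψ.γX Ψ.γX t) := by
  induction t using tensor_induction Ψ.γX_γX Ψ.γX_γX with
  | zero => simp
  | add s t hs ht => simp only [map_add, hs, ht, smul_add]
  | h p q x y hx hy =>
    simp only [attach_tmul, map_smul, kflip_tmul_sgn, smul_smul, ← sgn_add]
    congr 2; grind

theorem vT_attach (y : X ⊗[ℚ] U) (L M : Wd U) (a : U) {p l : ZMod 2} [HasPar Ψ.γW L l]
    [HasPar Ψ.γU a p] :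
    map (pos X U) .id (Ψ.vT (y ⊗ₜ (L ⊗ₜ (a ⊗ₜ M))))
      = sgn (p * l) • Ψ.attach l (wordPos U L) (wordPos U M) (map Ψ.γX
          (TensorProduct.lift Ψ.κ ∘ₗ kflip Ψ.γU Ψ.γU ∘ₗ (TensorProduct.mk ℚ U U).flip a) y) := by
  induction y using tensor_induction Ψ.γX_γX Ψ.γU_γU with
  | zero => simp
  | add s t hs ht => simp only [add_tmul, map_add, smul_add, hs, ht]
  | h r s x q hx hq =>
    simp only [vT_tmul, map_tmul, map_smul, id_apply, pos_tmul, comp_apply, LinearMap.flip_apply,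
      mk_apply, kflip_tmul_sgn, TensorProduct.lift.tmul, tmul_smul, γX_apply, ← smul_tmul',
      attach_tmul, smul_smul, ← sgn_add]
    congr 2; grind

theorem veeFlip_tmul (x : X) (u : Wd U) :
    Ψ.veeFlip (x ⊗ₜ u) = Ψ.K (map .id (TensorProduct.mk ℚ _ _ 1 ∘ₗ Ψ.Q)
      (assoc X U (Om U) (Ψ.δ x ⊗ₜ wordCut U u))) := by
  simp only [veeFlip, comp_apply, map_tmul, LinearEquiv.coe_coe]
  generalize Ψ.δ x = y
  induction y with
  | zero => simp
  | add s t hs ht => simp only [add_tmul, map_add, hs, ht]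
  | tmul x a => simp

theorem fT_attach (y : X ⊗[ℚ] U) (L M : Wd U) (a : U) {p l μ : ZMod 2} [HasPar Ψ.γW L l]
    [HasPar Ψ.γU a p] [HasPar Ψ.γW M μ] :
    map (pos X U) .id
      (Ψ.K (map .id (TensorProduct.mk ℚ _ _ 1 ∘ₗ Ψ.Q)
        (assoc X U (Om U) (y ⊗ₜ (L ⊗ₜ (a ⊗ₜ M))))))
      = sgn (p * l + l * μ) • Ψ.attach μ (wordPos U M) (wordPos U L)
          (map Ψ.γX (Ψ.κ.flip a) y) := by
  induction y using tensor_induction Ψ.γX_γX Ψ.γU_γU with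
  | zero => simp
  | add s t hs ht => simp only [add_tmul, map_add, smul_add, hs, ht]
  | h r s x q hx hq =>
    simp only [map_tmul, map_smul, id_apply, pos_tmul, Q_tmul, comp_apply, LinearMap.flip_apply,
      mk_apply, K_tmul, one_mul, assoc_tmul, tmul_smul, γX_apply, ← smul_tmul', attach_tmul,
      smul_smul, ← sgn_add]
    congr 2; grind

theorem map_pos_pos (t : Ce X U ⊗[ℚ] Ce X U) :
    map (pos X U) (pos X U) t
      = map .id (pos X U) (map (pos X U) .id t) := by
  rw [← comp_apply, ← map_comp]; simp

theorem pos_attach (p : ZMod 2) (L M : Wd U) (t : X ⊗[ℚ] X) :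
    map .id (pos X U) (Ψ.attach p L (wordPos U M) t)
      = Ψ.attach p L (wordPos U M) t := by
  induction t with
  | zero => simp
  | add s t hs ht => simp only [map_add, hs, ht]
  | tmul x y => simp [attach, pos_tmul, wordPos_wordPos]

theorem veeFlip_eq (t : Ce X U) :
    map (pos X U) (pos X U) (Ψ.veeFlip t)
      = kflip Ψ.γc Ψ.γc (map (pos X U) (pos X U) (Ψ.vee t)) := by
  induction t using TensorProduct.induction_on with
  | zero => simp
  | add s t hs ht => simp only [map_add, hs, ht]
  | tmul x u =>
    rw [veeFlip_tmul, vee_tmul]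
    generalize wordCut U u = s
    induction s using Ψ.om_induction with
    | zero => simp
    | add s t hs ht => simp only [tmul_add, map_add, hs, ht]
    | h p q r L a M hL ha hM =>
      rw [map_pos_pos, map_pos_pos, vT_attach, fT_attach, map_smul, map_smul, map_smul, pos_attach,
        pos_attach, kflip_attach, ← Ψ.symm, kflip_kflip Ψ.γX_γX Ψ.γX_γX, smul_smul, ← sgn_add]

end KModel

/-- `(a ⊗ (b ⊗ c)) ⊗ d ↦ a ⊗ (b ⊗ (c ⊗ d))`. -/
def reass (A B C D : Type*) [AddCommGroup A] [Module ℚ A] [AddCommGroup B] [Module ℚ B]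
    [AddCommGroup C] [Module ℚ C] [AddCommGroup D] [Module ℚ D] :
    (A ⊗[ℚ] (B ⊗[ℚ] C)) ⊗[ℚ] D →ₗ[ℚ] A ⊗[ℚ] (B ⊗[ℚ] (C ⊗[ℚ] D)) :=
  map .id (assoc B C D).toLinearMap ∘ₗ
    (assoc A (B ⊗[ℚ] C) D).toLinearMap

theorem reass_tmul {A B C D : Type*} [AddCommGroup A] [Module ℚ A] [AddCommGroup B] [Module ℚ B]
    [AddCommGroup C] [Module ℚ C] [AddCommGroup D] [Module ℚ D] (a : A) (b : B) (c : C) (d : D) :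
    reass A B C D ((a ⊗ₜ (b ⊗ₜ c)) ⊗ₜ d) = a ⊗ₜ[ℚ] (b ⊗ₜ[ℚ] (c ⊗ₜ[ℚ] d)) := rfl

theorem reass_smul {U B C D : Type*} [AddCommGroup U] [Module ℚ U] [AddCommGroup B] [Module ℚ B]
    [AddCommGroup C] [Module ℚ C] [AddCommGroup D] [Module ℚ D] (w : TensorAlgebra ℚ U)
    (t : TensorAlgebra ℚ U ⊗[ℚ] (B ⊗[ℚ] C)) (d : D) :
    reass (TensorAlgebra ℚ U) B C D ((w • t) ⊗ₜ d)
      = w • reass (TensorAlgebra ℚ U) B C D (t ⊗ₜ d) := by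
  induction t with
  | zero => simp only [smul_zero, zero_tmul, map_zero]
  | add s t hs ht => simp only [smul_add, add_tmul, map_add, hs, ht]
  | tmul a t => rfl

/-- Cutting a word at two letters does not depend on the order of the cuts. -/
theorem wordCut_wordCut {U : Type*} [AddCommGroup U] [Module ℚ U] (u : TensorAlgebra ℚ U) :
    map .id (map .id (wordCut U)) (wordCut U u)
      = reass _ _ _ _ (map (wordCut U) .id (wordCut U u)) := by
  have key : ∀ (a : U) (t : TensorAlgebra ℚ U ⊗[ℚ] (U ⊗[ℚ] TensorAlgebra ℚ U)),
      reass _ _ _ _ (map (wordCut U) .id (TensorAlgebra.ι ℚ a • t))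
        = 1 ⊗ₜ (a ⊗ₜ t) + TensorAlgebra.ι ℚ a •
          reass _ _ _ _ (map (wordCut U) .id t) := by
    intro a t
    induction t with
    | zero => simp only [smul_zero, map_zero, tmul_zero, add_zero]
    | add s t hs ht => simp only [smul_add, map_add, hs, ht, tmul_add]; abel
    | tmul L s =>
      rw [KModel.smul_tmul_word, map_tmul, wordCut_ι_mul, add_tmul, map_add, map_tmul, reass_smul]
      rfl
  have : map .id (map .id (wordCut U)) ∘ₗ wordCut U
      = reass _ _ _ _ ∘ₗ map (wordCut U) .id ∘ₗ wordCut U :=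
    word_ext (by simp only [comp_apply, wordCut_one, map_zero]) (fun a u h => by
      simp only [comp_apply] at h ⊢
      rw [wordCut_ι_mul, map_add, map_id_smul, h, map_add, map_add, key]
      simp only [map_tmul, wordCut_one, zero_tmul, map_zero, zero_add, id_apply])
  exact LinearMap.congr_fun this u

namespace KModel

variable {X U : Type*} [AddCommGroup X] [Module ℚ X] [AddCommGroup U] [Module ℚ U]
  (Ψ : KModel X U)

/-! #### Cutting a word with a block -/

/-- The map `Q` for an arbitrary last factor. -/
def QV (V : Type*) [AddCommGroup V] [Module ℚ V] :
    U ⊗[ℚ] (Wd U ⊗[ℚ] (U ⊗[ℚ] V)) →ₗ[ℚ] Ce X U ⊗[ℚ] V :=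
  (assoc X (Wd U) V).symm.toLinearMap ∘ₗ
    map (TensorProduct.lift Ψ.κ) (map (wordPos U) .id) ∘ₗ
    (assoc U U (Wd U ⊗[ℚ] V)).symm.toLinearMap ∘ₗ
    map .id (kswap Ψ.γW Ψ.γU V)

theorem QV_tmul {V : Type*} [AddCommGroup V] [Module ℚ V] (a c : U) (M : Wd U) (v : V)
    {p q : ZMod 2} [HasPar Ψ.γU c p] [HasPar Ψ.γW M q] :
    Ψ.QV V (a ⊗ₜ (M ⊗ₜ (c ⊗ₜ v)))
      = sgn (p * q) • ((Ψ.κ a c ⊗ₜ[ℚ] wordPos U M) ⊗ₜ[ℚ] v) := by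
  simp [QV, kswap_tmul_sgn M c v, mul_comm]

/-- Homogeneous induction for words with a marked letter and an arbitrary last factor. -/
theorem omV_induction {V : Type*} [AddCommGroup V] [Module ℚ V]
    {P : Wd U ⊗[ℚ] (U ⊗[ℚ] V) → Prop} (zero : P 0)
    (add : ∀ s t, P s → P t → P (s + t))
    (h : ∀ p q L a v, HasPar Ψ.γW L p → HasPar Ψ.γU a q → P (L ⊗ₜ (a ⊗ₜ v)))
    (t : Wd U ⊗[ℚ] (U ⊗[ℚ] V)) : P t := by
  induction t with
  | zero => exact zero
  | add s t hs ht => exact add _ _ hs ht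
  | tmul L s =>
    induction s with
    | zero => simpa using zero
    | add s t hs ht => simpa only [tmul_add] using add _ _ hs ht
    | tmul a v =>
      induction L using hasPar_induction Ψ.γW_γW with
      | add L L' h h' => simpa only [add_tmul] using add _ _ h h'
      | h p L hL =>
        induction a using hasPar_induction Ψ.γU_γU with
        | add a a' h h' =>
          simpa only [add_tmul, tmul_add] using add _ _ h h'
        | h q a ha => exact h p q L a v hL ha

theorem QV_map {V N : Type*} [AddCommGroup V] [Module ℚ V] [AddCommGroup N] [Module ℚ N]
    (f : V →ₗ[ℚ] N) (a : U) (s : Wd U ⊗[ℚ] (U ⊗[ℚ] V)) :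
    Ψ.QV N (a ⊗ₜ map .id (map .id f) s)
      = map .id f (Ψ.QV V (a ⊗ₜ s)) := by
  induction s using Ψ.omV_induction with
  | zero => simp
  | add s t hs ht => simp only [tmul_add, map_add, hs, ht]
  | h p q L c v hL hc => simp [QV_tmul]

theorem QV_assoc {V N : Type*} [AddCommGroup V] [Module ℚ V] [AddCommGroup N] [Module ℚ N]
    (a : U) (s : Wd U ⊗[ℚ] (U ⊗[ℚ] V)) (n : N) :
    Ψ.QV (V ⊗[ℚ] N) (a ⊗ₜ reass _ _ _ _ (s ⊗ₜ n))
      = assoc _ _ _ (Ψ.QV V (a ⊗ₜ s) ⊗ₜ n) := by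
  induction s using Ψ.omV_induction with
  | zero => simp only [zero_tmul, tmul_zero, map_zero]
  | add s t hs ht => simp only [add_tmul, tmul_add, map_add, hs, ht]
  | h p q L c v hL hc =>
    rw [reass_tmul, QV_tmul, QV_tmul, ← smul_tmul', map_smul, assoc_tmul]

/-- `E` followed by a cut of the word on the right. -/
theorem E_cut_right (u : Wd U) :
    map .id (map .id (wordCut U)) (Ψ.E u)
      = reass _ _ _ _ (map Ψ.E .id (wordCut U u)) := by
  have key : ∀ (a : U) (t : Om U),
      reass _ _ _ _ (map Ψ.E .id (lt a • t))
        = lt (Ψ.γU a) • reass _ _ _ _ (map Ψ.E .id t)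
          + 1 ⊗ₜ Ψ.QV _ (a ⊗ₜ reass _ _ _ _ (map (wordCut U) .id t)) := by
    intro a t
    induction t using TensorProduct.induction_on with
    | zero => simp only [smul_zero, map_zero, tmul_zero, add_zero]
    | add s t hs ht => simp only [smul_add, map_add, hs, ht, tmul_add]; abel
    | tmul L s =>
      rw [smul_tmul_word, map_tmul, E_lt_mul, add_tmul, map_add, map_tmul, map_tmul, id_apply,
        QV_assoc, reass_smul]
      rfl
  have : map .id (map .id (wordCut U)) ∘ₗ Ψ.E
      = reass _ _ _ _ ∘ₗ map Ψ.E .id ∘ₗ wordCut U :=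
    word_ext (by simp only [comp_apply, E_one, wordCut_one, map_zero]) (fun a u h => by
      simp only [comp_apply] at h ⊢
      rw [E_lt_mul, map_add, map_id_smul, h, wordCut_ι_mul, map_add, map_add, key,
        ← wordCut_wordCut, QV_map]
      simp only [map_tmul, id_apply, E_one, zero_tmul, map_zero, zero_add]
      rfl)
  exact LinearMap.congr_fun this u

/-- `E` followed by a cut of the word on the left. -/
theorem E_cut_left (u : Wd U) :
    map (wordCut U) .id (Ψ.E u)
      = (assoc (Wd U) (U ⊗[ℚ] Wd U) (Ce X U ⊗[ℚ] Wd U)).symm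
          (map Ψ.γW ((assoc U (Wd U) (Ce X U ⊗[ℚ] Wd U)).symm.toLinearMap
            ∘ₗ map Ψ.γU Ψ.E) (wordCut U u)) := by
  have key : ∀ (a : U) (t : Bl X U), map (wordCut U) .id (lt a • t)
      = (assoc (Wd U) (U ⊗[ℚ] Wd U) (Ce X U ⊗[ℚ] Wd U)).symm (1 ⊗ₜ
        (assoc U (Wd U) (Ce X U ⊗[ℚ] Wd U)).symm (a ⊗ₜ t))
        + map (Algebra.lsmul ℚ ℚ (Om U) (lt a)) LinearMap.id
          (map (wordCut U) .id t) := by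
    intro a t
    induction t using TensorProduct.induction_on with
    | zero => simp
    | add s t hs ht => simp only [smul_add, map_add, hs, ht, tmul_add]; abel
    | tmul L s =>
      rw [smul_tmul_word, map_tmul, wordCut_ι_mul, add_tmul]
      simp
  have key' : ∀ (a : U) (t : Wd U ⊗[ℚ] ((U ⊗[ℚ] Wd U) ⊗[ℚ] (Ce X U ⊗[ℚ] Wd U))),
      (assoc (Wd U) (U ⊗[ℚ] Wd U) (Ce X U ⊗[ℚ] Wd U)).symm (lt a • t)
        = map (Algebra.lsmul ℚ ℚ (Om U) (lt a)) LinearMap.id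
          ((assoc (Wd U) (U ⊗[ℚ] Wd U) (Ce X U ⊗[ℚ] Wd U)).symm t) := by
    intro a t
    induction t with
    | zero => simp
    | add s t hs ht => simp only [smul_add, map_add, hs, ht]
    | tmul L s =>
      induction s with
      | zero => simp
      | add s t hs ht => simp only [smul_add, map_add, hs, ht, tmul_add]
      | tmul c s => simp [smul_tmul_word]
  have : map (wordCut U) .id ∘ₗ Ψ.E
      = (assoc (Wd U) (U ⊗[ℚ] Wd U) (Ce X U ⊗[ℚ] Wd U)).symm.toLinearMap ∘ₗ
          map Ψ.γW ((assoc U (Wd U) (Ce X U ⊗[ℚ] Wd U)).symm.toLinearMap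
            ∘ₗ map Ψ.γU Ψ.E) ∘ₗ wordCut U :=
    word_ext (by simp [E_one, wordCut_one]) (fun a u h => by
      simp only [comp_apply, LinearEquiv.coe_coe] at h ⊢
      rw [E_lt_mul, map_add, key, h, wordCut_ι_mul, map_add, map_add, map_γW_smul, wordPar_ι, key',
        map_tmul, map_tmul, wordCut_one, wordPar_one]
      simp)
  exact LinearMap.congr_fun this u

/-! #### Contracted blocks -/

/-- `[a₁|⋯|aₙ] ↦ ∑ ± [a₁|⋯|aᵢ₋₁|aⱼ₊₁|⋯|aₙ] ⊗ κ(aᵢ, aⱼ)[aᵢ₊₁|⋯|aⱼ₋₁]`. -/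
def N : Wd U →ₗ[ℚ] Wd U ⊗[ℚ] Ce X U := Ψ.Kw ∘ₗ Ψ.E

theorem N_apply (u : Wd U) : Ψ.N u = Ψ.Kw (Ψ.E u) := rfl

theorem h_eq (x : X) (u : Wd U) :
    Ψ.h (x ⊗ₜ u) = (assoc X (Wd U) (Ce X U)).symm (Ψ.γX x ⊗ₜ Ψ.N u) := rfl

theorem N_one : Ψ.N 1 = 0 := by rw [N_apply, E_one, map_zero]

theorem N_wordPos (u : Wd U) : Ψ.N (wordPos U u) = Ψ.N u := by
  obtain ⟨c, hc⟩ := wordPos_apply u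
  rw [hc, map_sub, map_smul, N_one, smul_zero, sub_zero]

theorem γ_Kw (t : Bl X U) :
    map Ψ.γW Ψ.γc (Ψ.Kw t) = Ψ.Kw (Ψ.γB t) := by
  induction t using Ψ.bl_induction with
  | zero => simp
  | add s t hs ht => simp only [map_add, hs, ht]
  | h p q r L B R hL hB hR =>
    rw [Kw_tmul, map_tmul, map_tmul]
    simp only [map_smul, map_tmul, hB.eq, hL.eq, hR.eq, wordPar_mul, ← smul_tmul', tmul_smul,
      Kw_tmul, smul_mul_assoc, mul_smul_comm]
    module

theorem γ_N (u : Wd U) : map Ψ.γW Ψ.γc (Ψ.N u) = -Ψ.N (Ψ.γW u) := by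
  rw [N_apply, γ_Kw, γ_E, map_neg, N_apply]

instance (u : Wd U) {p : ZMod 2} [h : HasPar Ψ.γW u p] :
    HasPar (map Ψ.γW Ψ.γc) (Ψ.N u) (p + 1) :=
  ⟨by rw [γ_N, h.eq, map_smul, sgn_add, sgn_one]; module⟩

theorem Kw_smul (w : Wd U) (t : Bl X U) : Ψ.Kw (w • t) = w • Ψ.Kw t := by
  induction t using Ψ.bl_induction with
  | zero => simp
  | add s t hs ht => simp only [smul_add, map_add, hs, ht]
  | h p q r L B R hL hB hR =>
    rw [smul_tmul_word, Kw_tmul, Kw_tmul, mul_assoc, smul_comm, smul_tmul_word]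

theorem Kw_one (t : Ce X U ⊗[ℚ] Wd U) : Ψ.Kw (1 ⊗ₜ t) = kflip Ψ.γc Ψ.γW t := by
  induction t using tensor_induction Ψ.γc_γc Ψ.γW_γW with
  | zero => simp
  | add s t hs ht => simp only [tmul_add, map_add, hs, ht]
  | h p q B R hB hR => rw [Kw_tmul, kflip_tmul_sgn, one_mul]

theorem N_lt_mul (a : U) (u : Wd U) :
    Ψ.N (lt a * u) = lt (Ψ.γU a) • Ψ.N u + kflip Ψ.γc Ψ.γW (Ψ.Q (a ⊗ₜ wordCut U u)) := by
  rw [N_apply, E_lt_mul, map_add, Kw_smul, Kw_one, N_apply]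

end KModel

namespace KModel

variable {X U : Type*} [AddCommGroup X] [Module ℚ X] [AddCommGroup U] [Module ℚ U]
  (Ψ : KModel X U)

/-! #### `∨` is coassociative -/

/-- `(q ⊗ r) ⊗ (a ⊗ t) ↦ ± vT((κ(a, q) ⊗ r) ⊗ t)`. -/
def κvT : (U ⊗[ℚ] U) ⊗[ℚ] (U ⊗[ℚ] Om U) →ₗ[ℚ] Ce X U ⊗[ℚ] Ce X U :=
  Ψ.vT ∘ₗ map (map (TensorProduct.lift Ψ.κ) .id ∘ₗ
    (assoc U U U).symm.toLinearMap) LinearMap.id ∘ₗ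
    (assoc U (U ⊗[ℚ] U) (Om U)).symm.toLinearMap ∘ₗ
    kswap (map Ψ.γU Ψ.γU) Ψ.γU (Om U)

theorem κvT_tmul (q r a : U) (t : Om U) {p₁ p₂ p₃ : ZMod 2} [HasPar Ψ.γU q p₁]
    [HasPar Ψ.γU r p₂] [HasPar Ψ.γU a p₃] :
    Ψ.κvT ((q ⊗ₜ r) ⊗ₜ (a ⊗ₜ t))
      = sgn ((p₁ + p₂) * p₃) • Ψ.vT ((Ψ.κ a q ⊗ₜ r) ⊗ₜ t) := by
  simp [κvT, kswap_tmul_sgn]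

/-- The iterated `∨` in terms of the iterated coaction and two cuts. -/
def vvT : (X ⊗[ℚ] (U ⊗[ℚ] U)) ⊗[ℚ] (Wd U ⊗[ℚ] (U ⊗[ℚ] Om U)) →ₗ[ℚ]
    Ce X U ⊗[ℚ] (Ce X U ⊗[ℚ] Ce X U) :=
  (assoc X (Wd U) (Ce X U ⊗[ℚ] Ce X U)).symm.toLinearMap ∘ₗ
    map .id (map .id Ψ.κvT ∘ₗ
      kswap (map Ψ.γU Ψ.γU) Ψ.γW (U ⊗[ℚ] Om U)) ∘ₗ
    (assoc X (U ⊗[ℚ] U) (Wd U ⊗[ℚ] (U ⊗[ℚ] Om U))).toLinearMap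

theorem vvT_tmul (x : X) (q r a : U) (L : Wd U) (t : Om U) {p₁ p₂ p₃ p₄ : ZMod 2}
    [HasPar Ψ.γU q p₁] [HasPar Ψ.γU r p₂] [HasPar Ψ.γU a p₃] [HasPar Ψ.γW L p₄] :
    Ψ.vvT ((x ⊗ₜ (q ⊗ₜ r)) ⊗ₜ (L ⊗ₜ (a ⊗ₜ t)))
      = sgn ((p₁ + p₂) * (p₃ + p₄)) • ((x ⊗ₜ L) ⊗ₜ Ψ.vT ((Ψ.κ a q ⊗ₜ r) ⊗ₜ t)) := by
  simp only [vvT, comp_apply, LinearEquiv.coe_coe, assoc_tmul, map_tmul, id_apply, kswap_tmul_sgn,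
    map_smul, κvT_tmul, tmul_smul, assoc_symm_tmul, smul_smul, ← sgn_add]
  congr 2; ring

/-- The projection of the middle factor of a cube to words of positive length. -/
def posM (X U : Type*) [AddCommGroup X] [Module ℚ X] [AddCommGroup U] [Module ℚ U] :
    Ce X U ⊗[ℚ] (Ce X U ⊗[ℚ] Ce X U) →ₗ[ℚ] Ce X U ⊗[ℚ] (Ce X U ⊗[ℚ] Ce X U) :=
  map .id (map (pos X U) .id)

theorem posM_tmul (s t v : Ce X U) :
    posM X U (s ⊗ₜ (t ⊗ₜ v)) = s ⊗ₜ (pos X U t ⊗ₜ v) := rfl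

theorem posM_vvT_tmul (x : X) (q r a c : U) (L M N : Wd U) {p₁ p₂ p₃ p₄ p₅ p₆ : ZMod 2}
    [HasPar Ψ.γU q p₁] [HasPar Ψ.γU r p₂] [HasPar Ψ.γU a p₃] [HasPar Ψ.γW L p₄]
    [HasPar Ψ.γU c p₅] [HasPar Ψ.γW M p₆] :
    posM X U (Ψ.vvT ((x ⊗ₜ (q ⊗ₜ r)) ⊗ₜ (L ⊗ₜ (a ⊗ₜ (M ⊗ₜ (c ⊗ₜ N))))))
      = sgn ((p₁ + p₂) * (p₃ + p₄) + (p₃ + p₁ + 1 + p₂ * p₆ + p₂ * p₅ + p₆)) •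
        ((x ⊗ₜ L) ⊗ₜ ((Ψ.κ a q ⊗ₜ wordPos U M) ⊗ₜ (Ψ.κ c r ⊗ₜ wordPos U N))) := by
  rw [vvT_tmul, vT_tmul, map_smul, tmul_smul, map_smul, posM_tmul, smul_smul, ← sgn_add, pos_tmul]

theorem vvT_split (y : X ⊗[ℚ] U) (s : Om U) (a c : U) (M : Wd U) {p q p₁ p₂ : ZMod 2}
    [hy : HasPar (map Ψ.γX Ψ.γU) y (p + 1)]
    [hs : HasPar (map Ψ.γW (map Ψ.γU Ψ.γW)) s p₁]
    [HasPar Ψ.γU a q] [HasPar Ψ.γU c p₂] :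
    posM X U (Ψ.vvT (assoc X U U (y ⊗ₜ a) ⊗ₜ reass _ _ _ _ (s ⊗ₜ (c ⊗ₜ M))))
      = sgn (p + q * p₁ + q * p₂ + p₁) • posM X U (assoc _ _ _
          (Ψ.vT (y ⊗ₜ s) ⊗ₜ (Ψ.κ c a ⊗ₜ wordPos U M))) := by
  refine tensor_induction_par Ψ.γX_γX Ψ.γU_γU ?_ ?_ ?_ y hy
  · simp only [zero_tmul, map_zero, smul_zero]
  · intro s t hs ht
    simp only [add_tmul, map_add, smul_add, hs, ht]
  · intro q₁ q₂ z a' hz ha' e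
    rw [assoc_tmul]
    refine Ψ.om_induction_par ?_ ?_ ?_ s hs
    · simp only [zero_tmul, tmul_zero, map_zero, smul_zero]
    · intro s t hs ht
      rw [add_tmul, map_add, tmul_add, map_add, map_add, hs, ht, tmul_add, map_add, add_tmul,
        map_add, map_add, smul_add]
    · intro r₁ r₂ r₃ L c' M hL hc' hM e'
      rw [reass_tmul, posM_vvT_tmul, vT_tmul, ← smul_tmul', map_smul, map_smul, assoc_tmul,
        posM_tmul, smul_smul, ← sgn_add, pos_tmul, wordPos_wordPos]
      obtain rfl : p = q₁ + q₂ + 1 := by grind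
      congr 2
      grind

theorem vee_vT_left (y : X ⊗[ℚ] U) (s : Om U) :
    posM X U (assoc _ _ _ (map Ψ.vee .id (Ψ.vT (y ⊗ₜ s))))
      = posM X U (Ψ.vvT (assoc _ _ _ (map Ψ.δ .id y) ⊗ₜ
          reass _ _ _ _ (map (wordCut U) .id s))) := by
  induction s using Ψ.om_induction with
  | zero => simp only [tmul_zero, map_zero]
  | add s t hs ht => simp only [tmul_add, map_add, hs, ht]
  | h p₁ p₂ p₃ L c M hL hc hM =>
    induction y using tensor_induction Ψ.γX_γX Ψ.γU_γU with
    | zero => simp only [zero_tmul, map_zero]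
    | add s t hs ht => simp only [add_tmul, map_add, hs, ht]
    | h p q x a hx ha =>
      rw [vT_tmul, map_smul, map_tmul, vee_tmul, map_tmul, map_tmul, map_smul, map_smul]
      simp only [id_apply]
      rw [vvT_split]

theorem vee_wordPos (x : X) (u : Wd U) : Ψ.vee (x ⊗ₜ wordPos U u) = Ψ.vee (x ⊗ₜ u) := by
  obtain ⟨c, hc⟩ := wordPos_apply u
  rw [vee_tmul, vee_tmul, hc, map_sub, map_smul, wordCut_one, smul_zero, sub_zero]

theorem vee_vT_right (y : X ⊗[ℚ] U) (s : Om U) :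
    map .id Ψ.vee (Ψ.vT (y ⊗ₜ s))
      = -Ψ.vvT (map Ψ.γX Ψ.ς y ⊗ₜ
          map .id (map .id (wordCut U)) s) := by
  induction s using Ψ.om_induction with
  | zero => simp only [tmul_zero, map_zero, neg_zero]
  | add s t hs ht => simp only [tmul_add, map_add, hs, ht, neg_add]
  | h p₁ p₂ p₃ L c M hL hc hM =>
    induction y using tensor_induction Ψ.γX_γX Ψ.γU_γU with
    | zero => simp only [zero_tmul, map_zero, neg_zero]
    | add s t hs ht => simp only [add_tmul, map_add, hs, ht, neg_add]
    | h p q x a hx ha =>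
      rw [vT_tmul, map_smul, map_tmul, vee_wordPos, vee_tmul, map_tmul, map_tmul, map_tmul,
        δκ_right]
      have hy : HasPar (map Ψ.γU Ψ.γU) (Ψ.ς a) (q + 1) := inferInstance
      generalize Ψ.ς a = y at hy
      refine tensor_induction_par Ψ.γU_γU Ψ.γU_γU ?_ ?_ ?_ y hy
      · simp only [zero_tmul, tmul_zero, map_zero, smul_zero, neg_zero]
      · intro s t hs ht
        simp only [add_tmul, tmul_add, map_add, smul_add, hs, ht, neg_add]
      · intro q₁ q₂ a₁ a₂ h₁ h₂ e
        obtain rfl : q = q₁ + q₂ + 1 := by grind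
        rw [← neg_one_smul ℚ, ← sgn_one]
        simp only [map_tmul, id_apply, γU_apply, γX_apply, map_smul, LinearMap.smul_apply,
          ← smul_tmul', tmul_smul, vvT_tmul, smul_smul, ← sgn_add]
        congr 2
        have := zmod_two_mul_self p₁; have := zmod_two_mul_self p₂
        grind

/-- `∨` is coassociative. -/
theorem vee_coassoc (t : Ce X U) :
    posM X U (assoc _ _ _ (map Ψ.vee .id (Ψ.vee t)))
      = posM X U (map .id Ψ.vee (Ψ.vee t)) := by
  induction t using TensorProduct.induction_on with
  | zero => simp only [map_zero]
  | add s t hs ht => simp only [map_add, hs, ht]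
  | tmul x u =>
    rw [vee_tmul, vee_vT_left, vee_vT_right, Ψ.coassoc_δ, wordCut_wordCut, neg_tmul, map_neg]

/-! #### Cutting a word with a contracted block -/

/-- `s ⊗ (B ⊗ R) ↦ ± (s R) ⊗ B`. -/
def KwL : Om U ⊗[ℚ] (Ce X U ⊗[ℚ] Wd U) →ₗ[ℚ] Om U ⊗[ℚ] Ce X U :=
  map (TensorProduct.lift (LinearMap.mk₂ ℚ (fun (t : Om U) (w : Wd U) => ract U w t)
    (by intros; rw [map_add]) (by intros; rw [map_smul])
    (by intros; rw [ract_add]) (by intros; rw [ract_smul_left]))) LinearMap.id ∘ₗ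
    (assoc (Om U) (Wd U) (Ce X U)).symm.toLinearMap ∘ₗ
    map .id (kflip Ψ.γc Ψ.γW)

theorem KwL_tmul (s : Om U) (R : Wd U) (B : Ce X U) {q r : ZMod 2} [HasPar Ψ.γc B q]
    [HasPar Ψ.γW R r] :
    Ψ.KwL (s ⊗ₜ (B ⊗ₜ R)) = sgn (q * r) • (ract U R s ⊗ₜ[ℚ] B) := by
  simp only [KwL, comp_apply, LinearEquiv.coe_coe, map_tmul, id_apply, kflip_tmul_sgn, map_smul,
    tmul_smul, assoc_symm_tmul, TensorProduct.lift.tmul, LinearMap.mk₂_apply]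

/-- The sign operator on words with a marked letter. -/
abbrev γO : Om U →ₗ[ℚ] Om U := map Ψ.γW (map Ψ.γU Ψ.γW)

/-- `L ⊗ (B ⊗ s) ↦ ± (L s) ⊗ B`. -/
def KwR : Wd U ⊗[ℚ] (Ce X U ⊗[ℚ] Om U) →ₗ[ℚ] Om U ⊗[ℚ] Ce X U :=
  map (map (LinearMap.mul' ℚ (Wd U)) LinearMap.id ∘ₗ
    (assoc (Wd U) (Wd U) (U ⊗[ℚ] Wd U)).symm.toLinearMap) LinearMap.id ∘ₗ
    (assoc (Wd U) (Om U) (Ce X U)).symm.toLinearMap ∘ₗ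
    map .id (kflip Ψ.γc Ψ.γO)

theorem mul_tmul_word (L : Wd U) (s : Om U) :
    map (LinearMap.mul' ℚ (Wd U)) LinearMap.id
      ((assoc (Wd U) (Wd U) (U ⊗[ℚ] Wd U)).symm (L ⊗ₜ s)) = L • s := by
  induction s using TensorProduct.induction_on with
  | zero => simp only [tmul_zero, map_zero, smul_zero]
  | add s t hs ht => simp only [tmul_add, map_add, smul_add, hs, ht]
  | tmul M t => simp [smul_tmul_word]

theorem KwR_tmul (L : Wd U) (s : Om U) (B : Ce X U) {q r : ZMod 2} [HasPar Ψ.γc B q]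
    [HasPar Ψ.γO s r] :
    Ψ.KwR (L ⊗ₜ (B ⊗ₜ s)) = sgn (q * r) • ((L • s) ⊗ₜ[ℚ] B) := by
  simp only [KwR, comp_apply, LinearEquiv.coe_coe, map_tmul, id_apply, kflip_tmul_sgn, map_smul,
    tmul_smul, assoc_symm_tmul, mul_tmul_word]

theorem cut_Kw (t : Bl X U) :
    map (wordCut U) .id (Ψ.Kw t)
      = Ψ.KwL (map (wordCut U) .id t)
        + Ψ.KwR (map .id (map .id (wordCut U)) t) := by
  induction t using Ψ.bl_induction with
  | zero => simp only [map_zero, add_zero]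
  | add s t hs ht => simp only [map_add, hs, ht]; abel
  | h p q r L B R hL hB hR =>
    rw [Kw_tmul, map_smul, map_tmul, map_tmul, map_tmul, map_tmul, wordCut_mul]
    simp only [id_apply]
    rw [KwL_tmul, KwR_tmul, add_tmul, smul_add]

/-- Insertion of a block to the right of the marked letter. -/
def insN (L : Wd U) (a : U) : Wd U ⊗[ℚ] Ce X U →ₗ[ℚ] Om U ⊗[ℚ] Ce X U :=
  map (TensorProduct.mk ℚ _ _ L ∘ₗ TensorProduct.mk ℚ _ _ a) .id

theorem insN_tmul (L : Wd U) (a : U) (R : Wd U) (B : Ce X U) :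
    insN L a (R ⊗ₜ B) = (L ⊗ₜ[ℚ] (a ⊗ₜ[ℚ] R)) ⊗ₜ[ℚ] B := rfl

/-- Insertion of a block to the left of the marked letter. -/
def Nins (p : ZMod 2) (s : U ⊗[ℚ] Wd U) : Wd U ⊗[ℚ] Ce X U →ₗ[ℚ] Om U ⊗[ℚ] Ce X U :=
  map ((TensorProduct.mk ℚ _ _).flip s) (parPow Ψ.γc p)

theorem Nins_tmul (p : ZMod 2) (s : U ⊗[ℚ] Wd U) (R : Wd U) (B : Ce X U) {q : ZMod 2}
    [HasPar Ψ.γc B q] :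
    Ψ.Nins p s (R ⊗ₜ B) = sgn (p * q) • ((R ⊗ₜ[ℚ] s) ⊗ₜ[ℚ] B) := by
  rw [Nins, map_tmul, parPow_apply, tmul_smul]
  rfl

/-- The cuts to the left of a contracted block. -/
def NcutL : Om U →ₗ[ℚ] Om U ⊗[ℚ] Ce X U :=
  Ψ.KwL ∘ₗ (assoc (Wd U) (U ⊗[ℚ] Wd U) (Ce X U ⊗[ℚ] Wd U)).symm.toLinearMap ∘ₗ
    map Ψ.γW ((assoc U (Wd U) (Ce X U ⊗[ℚ] Wd U)).symm.toLinearMap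
      ∘ₗ map Ψ.γU Ψ.E)

/-- The cuts to the right of a contracted block. -/
def NcutR : Om U →ₗ[ℚ] Om U ⊗[ℚ] Ce X U :=
  Ψ.KwR ∘ₗ reass _ _ _ _ ∘ₗ map Ψ.E .id

theorem NcutL_tmul (L R : Wd U) (a : U) {p q : ZMod 2} [HasPar Ψ.γW L p] [HasPar Ψ.γU a q] :
    Ψ.NcutL (L ⊗ₜ (a ⊗ₜ R)) = sgn (p + q) • insN L a (Ψ.N R) := by
  rw [NcutL, N_apply]
  simp only [comp_apply, LinearEquiv.coe_coe, map_tmul, γW_apply, γU_apply]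
  induction Ψ.E R using Ψ.bl_induction with
  | zero => simp only [tmul_zero, map_zero, smul_zero]
  | add s t hs ht => simp only [tmul_add, map_add, smul_add, hs, ht]
  | h p q r L B R hL hB hR =>
    simp only [← smul_tmul', tmul_smul, map_smul, assoc_symm_tmul, KwL_tmul, Kw_tmul, insN_tmul,
      ract_tmul, smul_smul, sgn_add]
    congr 2; ring

theorem NcutR_tmul (L R : Wd U) (a : U) {q r : ZMod 2} [HasPar Ψ.γU a q] [HasPar Ψ.γW R r] :
    Ψ.NcutR (L ⊗ₜ (a ⊗ₜ R)) = Ψ.Nins (q + r) (a ⊗ₜ R) (Ψ.N L) := by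
  rw [NcutR, N_apply]
  simp only [comp_apply, map_tmul, id_apply]
  induction Ψ.E L using Ψ.bl_induction with
  | zero => simp only [zero_tmul, map_zero]
  | add s t hs ht => simp only [add_tmul, map_add, hs, ht]
  | h p₁ p₂ p₃ L B M hL hB hR =>
    simp only [reass_tmul, KwR_tmul, Kw_tmul, map_smul, Nins_tmul, smul_tmul_word, smul_smul,
      ← sgn_add]
    congr 2; grind

theorem cut_N (u : Wd U) :
    map (wordCut U) .id (Ψ.N u)
      = Ψ.NcutL (wordCut U u) + Ψ.NcutR (wordCut U u) := by
  rw [N_apply, cut_Kw, E_cut_left, E_cut_right]; rfl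

end KModel

namespace KModel

variable {X U : Type*} [AddCommGroup X] [Module ℚ X] [AddCommGroup U] [Module ℚ U]
  (Ψ : KModel X U)

/-! #### `h` is a coderivation of `∨` -/

theorem vee_attach (x : X) (t : Wd U ⊗[ℚ] Ce X U) :
    map Ψ.vee .id ((assoc X (Wd U) (Ce X U)).symm (x ⊗ₜ t))
      = map Ψ.vT .id ((assoc (X ⊗[ℚ] U) (Om U)
          (Ce X U)).symm (Ψ.δ x ⊗ₜ map (wordCut U) .id t)) := by
  induction t with
  | zero => simp only [tmul_zero, map_zero]
  | add s t hs ht => simp only [tmul_add, map_add, hs, ht]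
  | tmul w B =>
    rw [map_tmul, assoc_symm_tmul, map_tmul, assoc_symm_tmul, map_tmul, vee_tmul]
    rfl

/-- The flip of the last two factors of a cube. -/
def flipM : Ce X U ⊗[ℚ] (Ce X U ⊗[ℚ] Ce X U) →ₗ[ℚ] Ce X U ⊗[ℚ] (Ce X U ⊗[ℚ] Ce X U) :=
  map .id (kflip Ψ.γc Ψ.γc)

theorem flipM_tmul (s t v : Ce X U) {p q : ZMod 2} [HasPar Ψ.γc t p] [HasPar Ψ.γc v q] :
    Ψ.flipM (s ⊗ₜ (t ⊗ₜ v)) = sgn (p * q) • (s ⊗ₜ (v ⊗ₜ t)) := by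
  rw [flipM, map_tmul, kflip_tmul_sgn, tmul_smul, id_apply]

theorem vT_Nins (x : X) (q a : U) (M : Wd U) (n : Wd U ⊗[ℚ] Ce X U) {p₁ p₂ p₃ p₄ l : ZMod 2}
    [HasPar Ψ.γX x p₁] [HasPar Ψ.γU q p₂] [HasPar Ψ.γU a p₃] [HasPar Ψ.γW M p₄]
    [hn : HasPar (map Ψ.γW Ψ.γc) n l] :
    assoc _ _ _ (map Ψ.vT .id
      ((assoc (X ⊗[ℚ] U) (Om U) (Ce X U)).symm
        ((x ⊗ₜ q) ⊗ₜ Ψ.Nins (p₃ + p₄) (a ⊗ₜ M) n)))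
      = sgn (p₁ + p₂ * l + p₂ * p₃ + l) • Ψ.flipM (assoc _ _ _
          ((assoc X (Wd U) (Ce X U)).symm (x ⊗ₜ n) ⊗ₜ
            (Ψ.κ a q ⊗ₜ wordPos U M))) := by
  refine tensor_induction_par Ψ.γW_γW Ψ.γc_γc ?_ ?_ ?_ n hn
  · simp only [zero_tmul, tmul_zero, map_zero, smul_zero]
  · intro s t hs ht
    simp only [add_tmul, tmul_add, map_add, smul_add, hs, ht]
  · intro q₁ q₂ L B hL hB e
    rw [Nins_tmul, tmul_smul, map_smul, map_smul, map_smul, assoc_symm_tmul, map_tmul, vT_tmul,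
      ← smul_tmul', map_smul, assoc_tmul, assoc_symm_tmul, assoc_tmul, flipM_tmul, smul_smul,
      smul_smul, ← sgn_add, ← sgn_add, e, id_apply]
    congr 2; grind

theorem vT_insN (x : X) (q a : U) (L : Wd U) (n : Wd U ⊗[ℚ] Ce X U) {p₁ p₂ p₃ p₄ : ZMod 2}
    [HasPar Ψ.γX x p₁] [HasPar Ψ.γU q p₂] [HasPar Ψ.γU a p₃] [HasPar Ψ.γW L p₄] :
    posM X U (assoc _ _ _ (map Ψ.vT .id
      ((assoc (X ⊗[ℚ] U) (Om U) (Ce X U)).symm ((x ⊗ₜ q) ⊗ₜ insN L a n))))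
      = sgn (p₁ + p₂ * p₄ + p₂ * p₃ + p₄) • posM X U ((x ⊗ₜ L) ⊗ₜ
          (assoc X (Wd U) (Ce X U)).symm (Ψ.κ a q ⊗ₜ n)) := by
  induction n with
  | zero => simp only [tmul_zero, map_zero, smul_zero]
  | add s t hs ht => simp only [tmul_add, map_add, smul_add, hs, ht]
  | tmul M B =>
    rw [insN_tmul, assoc_symm_tmul, map_tmul, vT_tmul, ← smul_tmul', map_smul, map_smul, assoc_tmul,
      assoc_symm_tmul, posM_tmul, posM_tmul, pos_tmul, pos_tmul, wordPos_wordPos, id_apply]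

theorem vT_NcutR (y : X ⊗[ℚ] U) (s : Om U) :
    assoc _ _ _ (map Ψ.vT .id
      ((assoc (X ⊗[ℚ] U) (Om U) (Ce X U)).symm
        (map Ψ.γX Ψ.γU y ⊗ₜ Ψ.NcutR s)))
      = -Ψ.flipM (assoc _ _ _
          (map Ψ.h .id (Ψ.vT (y ⊗ₜ s)))) := by
  induction s using Ψ.om_induction with
  | zero => simp only [tmul_zero, map_zero, neg_zero]
  | add s t hs ht => simp only [tmul_add, map_add, hs, ht, neg_add]
  | h p₁ p₂ p₃ L c M hL hc hM =>
    induction y using tensor_induction Ψ.γX_γX Ψ.γU_γU with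
    | zero => simp only [zero_tmul, map_zero, neg_zero]
    | add s t hs ht => simp only [add_tmul, map_add, hs, ht, neg_add]
    | h p q x a hx ha =>
      rw [vT_tmul, map_smul, map_tmul, map_tmul, h_eq, NcutR_tmul]
      simp only [γX_apply, γU_apply, tmul_smul, ← smul_tmul', map_smul, id_apply]
      rw [vT_Nins, smul_smul, smul_smul, smul_smul, ← sgn_add, ← sgn_add, ← sgn_add,
        ← neg_one_smul ℚ, smul_smul, ← sgn_one, ← sgn_add]
      congr 2; grind

theorem vT_NcutL (y : X ⊗[ℚ] U) (s : Om U) :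
    posM X U (assoc _ _ _ (map Ψ.vT .id
      ((assoc (X ⊗[ℚ] U) (Om U) (Ce X U)).symm
        (map Ψ.γX Ψ.γU y ⊗ₜ Ψ.NcutL s))))
      = -posM X U (map Ψ.γc Ψ.h (Ψ.vT (y ⊗ₜ s))) := by
  induction s using Ψ.om_induction with
  | zero => simp only [tmul_zero, map_zero, neg_zero]
  | add s t hs ht => simp only [tmul_add, map_add, hs, ht, neg_add]
  | h p₁ p₂ p₃ L c M hL hc hM =>
    induction y using tensor_induction Ψ.γX_γX Ψ.γU_γU with
    | zero => simp only [zero_tmul, map_zero, neg_zero]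
    | add s t hs ht => simp only [add_tmul, map_add, hs, ht, neg_add]
    | h p q x a hx ha =>
      rw [vT_tmul, map_smul, map_tmul, map_tmul, h_eq, N_wordPos, NcutL_tmul, map_tmul]
      simp only [γX_apply, γU_apply, γW_apply, tmul_smul, ← smul_tmul', map_smul]
      rw [vT_insN]
      simp only [smul_smul, ← sgn_add]
      rw [← neg_one_smul ℚ, smul_smul, ← sgn_one, ← sgn_add]
      congr 2; grind

/-- `h` is a coderivation of `∨`. -/
theorem vee_h (t : Ce X U) :
    posM X U (assoc _ _ _ (map Ψ.vee .id (Ψ.h t)))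
      = posM X U (Ψ.flipM (assoc _ _ _
          (map Ψ.h .id (Ψ.vee t))))
        + posM X U (map Ψ.γc Ψ.h (Ψ.vee t)) := by
  induction t using TensorProduct.induction_on with
  | zero => simp only [map_zero, add_zero]
  | add s t hs ht => simp only [map_add, hs, ht]; abel
  | tmul x u =>
    have e : Ψ.δ (Ψ.γX x) = -map Ψ.γX Ψ.γU (Ψ.δ x) := by rw [Ψ.γ_δ, neg_neg]
    rw [h_eq, vee_attach, cut_N, e, neg_tmul, map_neg, map_neg, map_neg, map_neg, tmul_add, map_add,
      map_add, map_add, map_add, vT_NcutR, vT_NcutL, vee_tmul, map_neg]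
    abel

end KModel

namespace KModel

variable {X U : Type*} [AddCommGroup X] [Module ℚ X] [AddCommGroup U] [Module ℚ U]
  (Ψ : KModel X U)

/-! #### `h` is pre-Lie -/

/-- `s ↦ ± Q(a ⊗ s)`, with the block in the last position. -/
def Qf (a : U) : Om U →ₗ[ℚ] Wd U ⊗[ℚ] Ce X U :=
  kflip Ψ.γc Ψ.γW ∘ₗ Ψ.Q ∘ₗ TensorProduct.mk ℚ _ _ a

theorem Qf_apply (a : U) (s : Om U) : Ψ.Qf a s = kflip Ψ.γc Ψ.γW (Ψ.Q (a ⊗ₜ s)) := rfl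

theorem Qf_tmul (a c : U) (M R : Wd U) {p₁ p₂ p₃ p₄ : ZMod 2} [HasPar Ψ.γU a p₁]
    [HasPar Ψ.γU c p₂] [HasPar Ψ.γW M p₃] [HasPar Ψ.γW R p₄] :
    Ψ.Qf a (M ⊗ₜ (c ⊗ₜ R)) = sgn (p₂ * p₃ + (p₁ + p₂ + 1 + p₃) * p₄) •
      (R ⊗ₜ[ℚ] (Ψ.κ a c ⊗ₜ[ℚ] wordPos U M)) := by
  rw [Qf_apply, Q_tmul, map_smul, kflip_tmul_sgn, smul_smul, ← sgn_add]

theorem N_lt_mul' (a : U) (u : Wd U) :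
    Ψ.N (lt a * u) = lt (Ψ.γU a) • Ψ.N u + Ψ.Qf a (wordCut U u) := Ψ.N_lt_mul a u

theorem assoc_smul {V N : Type*} [AddCommGroup V] [Module ℚ V] [AddCommGroup N] [Module ℚ N]
    (w : Wd U) (s : Wd U ⊗[ℚ] V) (n : N) :
    assoc (Wd U) V N ((w • s) ⊗ₜ n)
      = w • assoc (Wd U) V N (s ⊗ₜ n) := by
  induction s with
  | zero => simp only [zero_tmul, map_zero, smul_zero]
  | add s t hs ht => simp only [add_tmul, map_add, smul_add, hs, ht]
  | tmul L v => rfl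

/-- `(N ⊗ id)`. -/
def NL : Wd U ⊗[ℚ] Ce X U →ₗ[ℚ] Wd U ⊗[ℚ] (Ce X U ⊗[ℚ] Ce X U) :=
  (assoc (Wd U) (Ce X U) (Ce X U)).toLinearMap ∘ₗ
    map Ψ.N .id

theorem NL_tmul (u : Wd U) (B : Ce X U) :
    Ψ.NL (u ⊗ₜ B) = assoc (Wd U) (Ce X U) (Ce X U) (Ψ.N u ⊗ₜ B) := rfl

/-- `(Qf a ⊗ id)`. -/
def QfL (a : U) : Om U ⊗[ℚ] Ce X U →ₗ[ℚ] Wd U ⊗[ℚ] (Ce X U ⊗[ℚ] Ce X U) :=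
  (assoc (Wd U) (Ce X U) (Ce X U)).toLinearMap ∘ₗ
    map (Ψ.Qf a) .id

theorem QfL_tmul (a : U) (s : Om U) (B : Ce X U) :
    Ψ.QfL a (s ⊗ₜ B) = assoc (Wd U) (Ce X U) (Ce X U) (Ψ.Qf a s ⊗ₜ B) := rfl

theorem NL_smul (a : U) (t : Wd U ⊗[ℚ] Ce X U) :
    Ψ.NL (lt a • t) = lt (Ψ.γU a) • Ψ.NL t
      + Ψ.QfL a (map (wordCut U) .id t) := by
  induction t with
  | zero => simp only [smul_zero, map_zero, add_zero]
  | add s t hs ht => simp only [smul_add, map_add, hs, ht]; abel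
  | tmul u B =>
    rw [smul_tmul_word, NL_tmul, N_lt_mul', add_tmul, map_add, assoc_smul, map_tmul, QfL_tmul,
      NL_tmul, id_apply]

/-- `h`, with the empty word in the first factor sent to zero. -/
def hpos : Ce X U →ₗ[ℚ] Ce X U ⊗[ℚ] Ce X U := map (pos X U) .id ∘ₗ Ψ.h

theorem hpos_tmul (x : X) (u : Wd U) : Ψ.hpos (x ⊗ₜ u) = map (pos X U) .id
    ((assoc X (Wd U) (Ce X U)).symm (Ψ.γX x ⊗ₜ Ψ.N u)) := rfl

theorem QfL_Nins (a c : U) (R : Wd U) (n : Wd U ⊗[ℚ] Ce X U) {p₁ p₂ p₃ l : ZMod 2}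
    [HasPar Ψ.γU a p₁] [HasPar Ψ.γU c p₂] [HasPar Ψ.γW R p₃]
    [hn : HasPar (map Ψ.γW Ψ.γc) n l] :
    Ψ.QfL a (Ψ.Nins (p₂ + p₃) (c ⊗ₜ R) n)
      = sgn (p₂ * l + (p₁ + p₂ + 1 + l) * p₃) • (R ⊗ₜ map (pos X U) .id
          ((assoc X (Wd U) (Ce X U)).symm (Ψ.κ a c ⊗ₜ n))) := by
  refine tensor_induction_par Ψ.γW_γW Ψ.γc_γc ?_ ?_ ?_ n hn
  · simp only [zero_tmul, tmul_zero, map_zero, smul_zero]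
  · intro s t hs ht
    simp only [add_tmul, tmul_add, map_add, smul_add, hs, ht]
  · intro q₁ q₂ L B hL hB e
    rw [Nins_tmul, map_smul, QfL_tmul, Qf_tmul, ← smul_tmul', map_smul, assoc_tmul, assoc_symm_tmul,
      map_tmul, pos_tmul, smul_smul, ← sgn_add, id_apply, e]
    congr 2; grind

theorem QfL_NcutR (a : U) (s : Om U) {p : ZMod 2} [HasPar Ψ.γU a p] :
    Ψ.QfL (Ψ.γU a) (Ψ.NcutR s) + map Ψ.γW Ψ.hpos (Ψ.Qf a s) = 0 := by
  induction s using Ψ.om_induction with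
  | zero => simp only [map_zero, add_zero]
  | add s t hs ht => simp only [map_add]; linear_combination (norm := module) hs + ht
  | h p₁ p₂ p₃ M c R hM hc hR =>
    have : HasPar Ψ.γU (Ψ.γU a) p := ⟨by rw [Ψ.γU_apply a, map_smul, Ψ.γU_apply a]⟩
    rw [NcutR_tmul, Qf_tmul, map_smul, map_tmul, hpos_tmul, N_wordPos, QfL_Nins, γU_apply, map_smul,
      LinearMap.smul_apply]
    simp only [γW_apply, γX_apply, ← smul_tmul', tmul_smul, map_smul, smul_smul, ← sgn_add]
    rw [add_eq_zero_iff_eq_neg, ← neg_one_smul ℚ, smul_smul, ← sgn_one, ← sgn_add]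
    congr 2; grind

theorem QfL_insN (a c : U) (M : Wd U) (n : Wd U ⊗[ℚ] Ce X U) {p₁ p₂ p₃ l : ZMod 2}
    [HasPar Ψ.γU a p₁] [HasPar Ψ.γU c p₂] [HasPar Ψ.γW M p₃]
    [hn : HasPar (map Ψ.γW Ψ.γc) n l] :
    map .id (kflip Ψ.γc Ψ.γc) (Ψ.QfL a (insN M c n))
      = sgn (p₂ * p₃ + (p₁ + p₂ + 1 + p₃) * l) • assoc (Wd U) (Ce X U) (Ce X U)
          (n ⊗ₜ (Ψ.κ a c ⊗ₜ wordPos U M)) := by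
  refine tensor_induction_par Ψ.γW_γW Ψ.γc_γc ?_ ?_ ?_ n hn
  · simp only [zero_tmul, tmul_zero, map_zero, smul_zero]
  · intro s t hs ht
    simp only [add_tmul, tmul_add, map_add, smul_add, hs, ht]
  · intro q₁ q₂ L B hL hB e
    rw [insN_tmul, QfL_tmul, Qf_tmul, ← smul_tmul', map_smul, map_smul, assoc_tmul, assoc_tmul,
      map_tmul, kflip_tmul_sgn, tmul_smul, smul_smul, ← sgn_add, id_apply, e]
    congr 2; grind

theorem NL_Qf (a : U) (s : Om U) {p : ZMod 2} [HasPar Ψ.γU a p] :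
    Ψ.NL (Ψ.Qf a s)
      = -map .id (kflip Ψ.γc Ψ.γc) (Ψ.QfL (Ψ.γU a) (Ψ.NcutL s)) := by
  induction s using Ψ.om_induction with
  | zero => simp only [map_zero, neg_zero]
  | add s t hs ht => simp only [map_add, hs, ht, neg_add]
  | h p₁ p₂ p₃ M c R hM hc hR =>
    have : HasPar Ψ.γU (Ψ.γU a) p := ⟨by rw [Ψ.γU_apply a, map_smul, Ψ.γU_apply a]⟩
    rw [NcutL_tmul, Qf_tmul, map_smul, map_smul, map_smul, NL_tmul, QfL_insN, γU_apply, map_smul,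
      LinearMap.smul_apply, ← smul_tmul', tmul_smul, map_smul]
    rw [smul_smul, smul_smul, ← sgn_add, ← sgn_add, ← neg_one_smul ℚ, smul_smul, ← sgn_one,
      ← sgn_add]
    congr 2; grind

/-- `(N ⊗ id) N + (id ⊗ h) N`. -/
def NN : Wd U →ₗ[ℚ] Wd U ⊗[ℚ] (Ce X U ⊗[ℚ] Ce X U) :=
  Ψ.NL ∘ₗ Ψ.N + map Ψ.γW Ψ.hpos ∘ₗ Ψ.N

theorem NN_apply (u : Wd U) :
    Ψ.NN u = Ψ.NL (Ψ.N u) + map Ψ.γW Ψ.hpos (Ψ.N u) := rfl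

theorem NN_lt_mul (a : U) (u : Wd U) {p : ZMod 2} [HasPar Ψ.γU a p] :
    Ψ.NN (lt a * u) = lt a • Ψ.NN u + (Ψ.QfL (Ψ.γU a) (Ψ.NcutL (wordCut U u))
      - map .id (kflip Ψ.γc Ψ.γc)
        (Ψ.QfL (Ψ.γU a) (Ψ.NcutL (wordCut U u)))) := by
  rw [NN_apply, N_lt_mul', map_add, map_add, NL_smul, cut_N, map_add, NL_Qf, map_γW_smul, wordPar_ι,
    Ψ.γU_γU, NN_apply, smul_add, eq_neg_of_add_eq_zero_left (Ψ.QfL_NcutR a (wordCut U u))]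
  abel

theorem map_kflip_kflip (t : Wd U ⊗[ℚ] (Ce X U ⊗[ℚ] Ce X U)) :
    map .id (kflip Ψ.γc Ψ.γc)
      (map .id (kflip Ψ.γc Ψ.γc) t) = t := by
  induction t with
  | zero => simp only [map_zero]
  | add s t hs ht => rw [map_add, map_add, hs, ht]
  | tmul u t => rw [map_tmul, map_tmul, kflip_kflip Ψ.γc_γc Ψ.γc_γc, id_apply, id_apply]

theorem NN_anti (u : Wd U) :
    map .id (kflip Ψ.γc Ψ.γc) (Ψ.NN u) = -Ψ.NN u := by
  have : map .id (kflip Ψ.γc Ψ.γc) ∘ₗ Ψ.NN = -Ψ.NN :=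
    word_hom_ext Ψ.γU_γU
    (by rw [comp_apply, LinearMap.neg_apply, NN_apply, N_one, map_zero, map_zero, add_zero,
          map_zero, neg_zero])
    (fun p q a u ha hu h => by
      rw [comp_apply, LinearMap.neg_apply] at h ⊢
      rw [NN_lt_mul, map_add, map_id_smul, h, map_sub, map_kflip_kflip, smul_neg, neg_add, neg_sub])
  exact LinearMap.congr_fun this u

theorem h_attach (x : X) (s : Wd U ⊗[ℚ] Ce X U) :
    assoc _ _ _ (map Ψ.h .id
        ((assoc X (Wd U) (Ce X U)).symm (x ⊗ₜ s)))
      = (assoc X (Wd U) (Ce X U ⊗[ℚ] Ce X U)).symm (Ψ.γX x ⊗ₜ Ψ.NL s) := by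
  induction s with
  | zero => simp only [tmul_zero, map_zero]
  | add s t hs ht => simp only [tmul_add, map_add, hs, ht]
  | tmul u B =>
    rw [assoc_symm_tmul, map_tmul, h_eq, NL_tmul, id_apply]
    generalize Ψ.N u = n
    induction n with
    | zero => simp only [tmul_zero, zero_tmul, map_zero]
    | add s t hs ht =>
      simp only [tmul_add, add_tmul, map_add, hs, ht]
    | tmul v B' => rfl

theorem γh_attach (x : X) (s : Wd U ⊗[ℚ] Ce X U) :
    posM X U (map Ψ.γc Ψ.h
        ((assoc X (Wd U) (Ce X U)).symm (x ⊗ₜ s)))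
      = (assoc X (Wd U) (Ce X U ⊗[ℚ] Ce X U)).symm (Ψ.γX x ⊗ₜ
          map Ψ.γW Ψ.hpos s) := by
  induction s with
  | zero => simp only [tmul_zero, map_zero]
  | add s t hs ht => simp only [tmul_add, map_add, hs, ht]
  | tmul u B => rfl

theorem flipM_attach (x : X) (s : Wd U ⊗[ℚ] (Ce X U ⊗[ℚ] Ce X U)) :
    Ψ.flipM ((assoc X (Wd U) (Ce X U ⊗[ℚ] Ce X U)).symm (x ⊗ₜ s))
      = (assoc X (Wd U) (Ce X U ⊗[ℚ] Ce X U)).symm (x ⊗ₜ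
          map .id (kflip Ψ.γc Ψ.γc) s) := by
  induction s with
  | zero => simp only [tmul_zero, map_zero]
  | add s t hs ht => simp only [tmul_add, map_add, hs, ht]
  | tmul u B => rfl

/-- `h` is a pre-Lie coproduct. -/
theorem h_preLie (t : Ce X U) :
    Ψ.flipM (assoc _ _ _ (map Ψ.h .id (Ψ.h t))
        + posM X U (map Ψ.γc Ψ.h (Ψ.h t)))
      = -(assoc _ _ _ (map Ψ.h .id (Ψ.h t))
        + posM X U (map Ψ.γc Ψ.h (Ψ.h t))) := by
  induction t using TensorProduct.induction_on with
  | zero => simp only [map_zero, add_zero, neg_zero]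
  | add s t hs ht => simp only [map_add] at hs ht ⊢; linear_combination (norm := module) hs + ht
  | tmul x u =>
    rw [h_eq, h_attach, γh_attach, ← map_add, ← tmul_add, ← NN_apply, flipM_attach, NN_anti,
      tmul_neg, map_neg]

end KModel

namespace KModel

variable {X U : Type*} [AddCommGroup X] [Module ℚ X] [AddCommGroup U] [Module ℚ U]
  (Ψ : KModel X U)

/-! #### Two consecutive blocks -/

/-- `u ⊗ (w ⊗ v) ↦ u w ⊗ v`. -/
def mact (U V : Type*) [AddCommGroup U] [Module ℚ U] [AddCommGroup V] [Module ℚ V] :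
    Wd U ⊗[ℚ] (Wd U ⊗[ℚ] V) →ₗ[ℚ] Wd U ⊗[ℚ] V :=
  map (LinearMap.mul' ℚ (Wd U)) LinearMap.id ∘ₗ
    (assoc (Wd U) (Wd U) V).symm.toLinearMap

theorem mact_tmul {V : Type*} [AddCommGroup V] [Module ℚ V] (L : Wd U) (s : Wd U ⊗[ℚ] V) :
    mact U V (L ⊗ₜ s) = L • s := by
  induction s with
  | zero => rw [tmul_zero, map_zero, smul_zero]
  | add s t hs ht => rw [tmul_add, map_add, smul_add, hs, ht]
  | tmul w v => rfl

/-- The differential of `T(U) ⊗ (X ⊗ T(U))`. -/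
def D₂ : Wd U ⊗[ℚ] Ce X U →ₗ[ℚ] Wd U ⊗[ℚ] Ce X U :=
  map Ψ.D .id + map Ψ.γW Ψ.b

theorem D₂_tmul (w : Wd U) (B : Ce X U) : Ψ.D₂ (w ⊗ₜ B) = Ψ.D w ⊗ₜ B + Ψ.γW w ⊗ₜ Ψ.b B := rfl

theorem Kw_𝔇 (t : Bl X U) : Ψ.Kw (Ψ.𝔇 t) = Ψ.D₂ (Ψ.Kw t) := by
  induction t using Ψ.bl_induction with
  | zero => simp only [map_zero]
  | add s t hs ht => rw [map_add, map_add, map_add, map_add, hs, ht]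
  | h p q r L B R hL hB hR =>
    rw [𝔇_tmul, map_add, map_add, hB.eq, ← smul_tmul', tmul_smul, map_smul, Kw_tmul, Kw_tmul,
      Kw_tmul, Kw_tmul, map_smul, D₂_tmul, D_mul, wordPar_mul, Ψ.γW_apply L, Ψ.γW_apply R]
    simp only [add_tmul, smul_mul_assoc, mul_smul_comm, ← smul_tmul', tmul_smul, smul_add,
      smul_smul, ← sgn_add]
    ring_nf
    simp only [zmod_two_two, mul_zero, add_zero, zero_add]
    abel

theorem N_D (u : Wd U) : Ψ.N (Ψ.D u) = -Ψ.D₂ (Ψ.N u) := by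
  rw [N_apply, E_D, em_apply, map_sub, map_add, Kw_emLR, Kw_𝔇, zero_sub, N_apply]

/-- The differential of `T(U) ⊗ (X ⊗ T(U)) ⊗ (X ⊗ T(U))`. -/
def D₃ : Wd U ⊗[ℚ] (Ce X U ⊗[ℚ] Ce X U) →ₗ[ℚ] Wd U ⊗[ℚ] (Ce X U ⊗[ℚ] Ce X U) :=
  map Ψ.D .id + map Ψ.γW Ψ.b₂

theorem D₃_tmul (w : Wd U) (t : Ce X U ⊗[ℚ] Ce X U) :
    Ψ.D₃ (w ⊗ₜ t) = Ψ.D w ⊗ₜ t + Ψ.γW w ⊗ₜ Ψ.b₂ t := rfl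

theorem D₃_smul (w : Wd U) (t : Wd U ⊗[ℚ] (Ce X U ⊗[ℚ] Ce X U)) :
    Ψ.D₃ (w • t) = Ψ.D w • t + Ψ.γW w • Ψ.D₃ t := by
  induction t with
  | zero => simp only [smul_zero, map_zero, add_zero]
  | add s t hs ht => rw [smul_add, map_add, hs, ht, smul_add, map_add, smul_add]; abel
  | tmul v t =>
    rw [smul_tmul_word, D₃_tmul, D₃_tmul, D_mul, wordPar_mul, add_tmul, smul_add, smul_tmul_word,
      smul_tmul_word, smul_tmul_word]
    abel

/-- The Koszul swap of a block and a word. -/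
def sw : Ce X U ⊗[ℚ] (Wd U ⊗[ℚ] Ce X U) →ₗ[ℚ] Wd U ⊗[ℚ] (Ce X U ⊗[ℚ] Ce X U) :=
  kswap Ψ.γc Ψ.γW (Ce X U)

theorem sw_tmul (B B' : Ce X U) (w : Wd U) {p q : ZMod 2} [HasPar Ψ.γc B p] [HasPar Ψ.γW w q] :
    Ψ.sw (B ⊗ₜ (w ⊗ₜ B')) = sgn (p * q) • (w ⊗ₜ[ℚ] (B ⊗ₜ[ℚ] B')) := kswap_tmul_sgn B w B'

theorem D₃_sw (B : Ce X U) (n : Wd U ⊗[ℚ] Ce X U) :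
    Ψ.D₃ (Ψ.sw (B ⊗ₜ n)) = Ψ.sw (Ψ.b B ⊗ₜ n) + Ψ.sw (Ψ.γc B ⊗ₜ Ψ.D₂ n) := by
  induction B using hasPar_induction Ψ.γc_γc with
  | add s t hs ht =>
    rw [add_tmul, map_add, map_add, hs, ht, map_add, map_add, add_tmul, add_tmul, map_add, map_add]
    abel
  | h p B hB =>
    induction n using tensor_induction Ψ.γW_γW Ψ.γc_γc with
    | zero => simp only [tmul_zero, map_zero, add_zero]
    | add s t hs ht =>
      rw [tmul_add, map_add, map_add, hs, ht, map_add, tmul_add, tmul_add, map_add, map_add]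
      abel
    | h q r w B' hw hB' =>
      rw [sw_tmul, map_smul, D₃_tmul, b₂_tmul, sw_tmul, D₂_tmul, tmul_add, tmul_add, map_add,
        γW_apply, hB.eq]
      simp only [← smul_tmul', tmul_smul, map_smul]
      rw [sw_tmul, sw_tmul]
      simp only [smul_add, tmul_add, tmul_smul, smul_smul, ← sgn_add]
      ring_nf
      simp only [zmod_two_two, mul_zero, add_zero, zero_add]
      abel

theorem sw_smul (w : Wd U) (B : Ce X U) (n : Wd U ⊗[ℚ] Ce X U) {p q : ZMod 2} [HasPar Ψ.γc B p]
    [HasPar Ψ.γW w q] : Ψ.sw (B ⊗ₜ (w • n)) = sgn (p * q) • (w • Ψ.sw (B ⊗ₜ n)) := by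
  induction n using tensor_induction Ψ.γW_γW Ψ.γc_γc with
  | zero => simp only [smul_zero, tmul_zero, map_zero]
  | add s t hs ht =>
    rw [smul_add, tmul_add, map_add, hs, ht, tmul_add, map_add, smul_add, smul_add]
  | h r s v B' hv hB' =>
    rw [smul_tmul_word, sw_tmul, sw_tmul, smul_comm w, smul_smul, ← sgn_add, smul_tmul_word,
      mul_add]

/-- `L ⊗ (B ⊗ R) ↦ ± L R' ⊗ (B ⊗ B')`, where `N R = ∑ R' ⊗ B'`. -/
def KwN : Bl X U →ₗ[ℚ] Wd U ⊗[ℚ] (Ce X U ⊗[ℚ] Ce X U) :=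
  mact U _ ∘ₗ map Ψ.γW (Ψ.sw ∘ₗ map Ψ.γc Ψ.N)

theorem KwN_tmul (L R : Wd U) (B : Ce X U) :
    Ψ.KwN (L ⊗ₜ (B ⊗ₜ R)) = Ψ.γW L • Ψ.sw (Ψ.γc B ⊗ₜ Ψ.N R) := mact_tmul _ _

theorem KwN_one (t : Ce X U ⊗[ℚ] Wd U) :
    Ψ.KwN (1 ⊗ₜ t) = Ψ.sw (map Ψ.γc Ψ.N t) := by
  rw [KwN, comp_apply, map_tmul, mact_tmul, wordPar_one, one_smul]; rfl

theorem KwN_smul (w : Wd U) (t : Bl X U) : Ψ.KwN (w • t) = Ψ.γW w • Ψ.KwN t := by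
  induction t using Ψ.bl_induction with
  | zero => simp only [smul_zero, map_zero]
  | add s t hs ht => rw [smul_add, map_add, map_add, hs, ht, smul_add]
  | h p q r L B R hL hB hR =>
    rw [smul_tmul_word, KwN_tmul, KwN_tmul, wordPar_mul, mul_smul]

theorem KwN_𝔇 (t : Bl X U) : Ψ.KwN (Ψ.𝔇 t) = -Ψ.D₃ (Ψ.KwN t) := by
  induction t using Ψ.bl_induction with
  | zero => simp only [map_zero, neg_zero]
  | add s t hs ht => rw [map_add, map_add, map_add, map_add, hs, ht, neg_add]
  | h p q r L B R hL hB hR =>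
    rw [𝔇_tmul, map_add, map_add, KwN_tmul, KwN_tmul, KwN_tmul, KwN_tmul, D₃_smul, D₃_sw, N_D,
      γW_γW, γc_γc, γW_D, γc_b, tmul_neg, neg_tmul, map_neg, map_neg, neg_smul, smul_neg, smul_neg,
      smul_add]
    abel

/-- `(x ⊗ a) ⊗ M ↦ ± x M ⊗ a`. -/
def emU : (X ⊗[ℚ] U) ⊗[ℚ] Wd U →ₗ[ℚ] Ce X U ⊗[ℚ] U :=
  (assoc X (Wd U) U).symm.toLinearMap ∘ₗ
    map .id (kflip Ψ.γU Ψ.γW) ∘ₗ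
    (assoc X U (Wd U)).toLinearMap

theorem emU_tmul (x : X) (a : U) (M : Wd U) {p q : ZMod 2} [HasPar Ψ.γU a p]
    [HasPar Ψ.γW M q] : Ψ.emU ((x ⊗ₜ a) ⊗ₜ M) = sgn (p * q) • ((x ⊗ₜ[ℚ] M) ⊗ₜ[ℚ] a) := by
  rw [emU, comp_apply, comp_apply, LinearEquiv.coe_coe, LinearEquiv.coe_coe, assoc_tmul, map_tmul,
    kflip_tmul_sgn, tmul_smul, map_smul, assoc_symm_tmul, id_apply]

theorem emi_eq (t : (X ⊗[ℚ] U) ⊗[ℚ] Wd U) :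
    Ψ.emi t = map .id lt (Ψ.emU t) := rfl

/-- `(B ⊗ a) ⊗ s ↦ ± R ⊗ (B ⊗ κ(a, c) M)`, for `s = M ⊗ (c ⊗ R)`. -/
def ψ : (Ce X U ⊗[ℚ] U) ⊗[ℚ] Om U →ₗ[ℚ] Wd U ⊗[ℚ] (Ce X U ⊗[ℚ] Ce X U) :=
  Ψ.sw ∘ₗ map Ψ.γc (kflip Ψ.γc Ψ.γW ∘ₗ Ψ.Q) ∘ₗ
    (assoc (Ce X U) U (Om U)).toLinearMap

theorem ψ_tmul (B : Ce X U) (a : U) (s : Om U) :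
    Ψ.ψ ((B ⊗ₜ a) ⊗ₜ s) = Ψ.sw (Ψ.γc B ⊗ₜ Ψ.Qf a s) := rfl

/-- The term of `KwN ∘ em` in which the emitted letter starts the second block. -/
def Ξ : Bl X U →ₗ[ℚ] Wd U ⊗[ℚ] (Ce X U ⊗[ℚ] Ce X U) :=
  mact U _ ∘ₗ map .id (Ψ.ψ ∘ₗ
    map (Ψ.emU ∘ₗ map Ψ.δ .id) (wordCut U))

theorem Ξ_tmul (L M R : Wd U) (x : X) : Ψ.Ξ (L ⊗ₜ ((x ⊗ₜ M) ⊗ₜ R))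
    = L • Ψ.ψ (Ψ.emU (Ψ.δ x ⊗ₜ M) ⊗ₜ wordCut U R) := mact_tmul _ _

theorem Ξ_one (t : Ce X U ⊗[ℚ] Wd U) : Ψ.Ξ (1 ⊗ₜ t) = Ψ.ψ (map
    (Ψ.emU ∘ₗ map Ψ.δ .id) (wordCut U) t) := by
  rw [Ξ, comp_apply, map_tmul, mact_tmul, id_apply, one_smul]; rfl

theorem Ξ_smul (w : Wd U) (t : Bl X U) : Ψ.Ξ (w • t) = w • Ψ.Ξ t := by
  have key : ∀ (w : Wd U) (t : Wd U ⊗[ℚ] (Wd U ⊗[ℚ] (Ce X U ⊗[ℚ] Ce X U))),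
      mact U _ (w • t) = w • mact U _ t := by
    intro w t
    induction t with
    | zero => simp only [smul_zero, map_zero]
    | add s t hs ht => rw [smul_add, map_add, map_add, hs, ht, smul_add]
    | tmul v t => rw [smul_tmul_word, mact_tmul, mact_tmul, mul_smul]
  rw [Ξ, comp_apply, map_id_smul, key]; rfl

theorem KwN_attLR (L R : Wd U) (z : Ce X U ⊗[ℚ] U) :
    Ψ.KwN (attL (Ψ.γW L ⊗ₜ (kflip Ψ.γc Ψ.γW (map .id lt z) ⊗ₜ R)))
      - Ψ.KwN (attR (Ψ.γW L ⊗ₜ (map .id lt z ⊗ₜ R)))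
      = -(L • Ψ.ψ (z ⊗ₜ wordCut U R)) := by
  induction z using tensor_induction Ψ.γc_γc Ψ.γU_γU with
  | zero => simp only [map_zero, zero_tmul, tmul_zero, smul_zero, neg_zero, sub_zero]
  | add s t hs ht =>
    simp only [map_add, add_tmul, tmul_add, smul_add, neg_add, ← hs, ← ht]
    abel
  | h p q B a hB ha =>
    rw [map_tmul, id_apply, attR_tmul, KwN_tmul, N_lt_mul', γW_γW, ψ_tmul, tmul_add, map_add,
      smul_add, kflip_tmul_sgn, ← smul_tmul', tmul_smul, map_smul, attL_tmul, map_smul, KwN_tmul,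
      wordPar_mul, γW_γW, wordPar_ι, Ψ.γU_apply a, map_smul, smul_assoc (sgn q) (lt a), tmul_smul,
      map_smul, hB.eq, sw_smul, mul_smul, smul_assoc (sgn q) (lt a), smul_comm L (sgn q),
      smul_comm L (sgn q), smul_comm L (sgn (p * q)), smul_comm (sgn (p * q)) (sgn q)]
    abel

theorem KwN_emLR (t : Bl X U) : Ψ.KwN (Ψ.emL t) + Ψ.KwN (Ψ.emR t) = -Ψ.Ξ t := by
  induction t using TensorProduct.induction_on with
  | zero => simp only [map_zero, add_zero, neg_zero]
  | add s t hs ht => simp only [map_add, neg_add, ← hs, ← ht]; abel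
  | tmul L t =>
    induction t with
    | zero => simp only [tmul_zero, map_zero, add_zero, neg_zero]
    | add s t hs ht => simp only [tmul_add, map_add, neg_add, ← hs, ← ht]; abel
    | tmul B R =>
      induction B with
      | zero => simp only [zero_tmul, tmul_zero, map_zero, add_zero, neg_zero]
      | add s t hs ht =>
        simp only [add_tmul, tmul_add, map_add, neg_add, ← hs, ← ht]
        abel
      | tmul x M =>
        rw [emL_tmul, emR_tmul, emi_eq, Ξ_tmul, ← KwN_attLR, map_smul, sgn_one, neg_one_smul,
          sub_eq_add_neg]

/-- `[a₁|⋯|aₙ] ↦ ∑ ± [⋯] ⊗ κ(aᵢ, aⱼ)[⋯] ⊗ κ(aₖ, aₗ)[⋯]` over `i < j < k < l`. -/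
def N₂ : Wd U →ₗ[ℚ] Wd U ⊗[ℚ] (Ce X U ⊗[ℚ] Ce X U) := Ψ.KwN ∘ₗ Ψ.E

theorem N₂_apply (u : Wd U) : Ψ.N₂ u = Ψ.KwN (Ψ.E u) := rfl

theorem N₂_D (u : Wd U) : Ψ.N₂ (Ψ.D u) = Ψ.D₃ (Ψ.N₂ u) - Ψ.Ξ (Ψ.E u) := by
  rw [N₂_apply, E_D, em_apply, map_sub, map_add, KwN_emLR, KwN_𝔇, N₂_apply]
  abel

end KModel

namespace KModel

variable {X U : Type*} [AddCommGroup X] [Module ℚ X] [AddCommGroup U] [Module ℚ U]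
  (Ψ : KModel X U)

/-! #### The boundary of two consecutive blocks -/

/-- `b ⊗ y ↦ ± κ(a, b) M ⊗ y M'`. -/
def κatt (a : U) (p : ZMod 2) (M M' : Wd U) : U ⊗[ℚ] X →ₗ[ℚ] Ce X U ⊗[ℚ] Ce X U :=
  map ((TensorProduct.mk ℚ X (Wd U)).flip M ∘ₗ Ψ.κ a ∘ₗ parPow Ψ.γU p)
    ((TensorProduct.mk ℚ X (Wd U)).flip M')

theorem κatt_tmul (a b : U) (y : X) (p : ZMod 2) (M M' : Wd U) {q : ZMod 2} [HasPar Ψ.γU b q] :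
    Ψ.κatt a p M M' (b ⊗ₜ y) = sgn (p * q) • ((Ψ.κ a b ⊗ₜ[ℚ] M) ⊗ₜ[ℚ] (y ⊗ₜ[ℚ] M')) := by
  rw [κatt, map_tmul, comp_apply, comp_apply, parPow_apply, map_smul, map_smul,
    LinearMap.flip_apply, LinearMap.flip_apply, mk_apply, mk_apply, ← smul_tmul']

theorem ψ_κatt (z : U ⊗[ℚ] U) (a c : U) (M M₂ R : Wd U) {l p₁ p₂ p₃ p₄ p₅ : ZMod 2}
    [hz : HasPar (map Ψ.γU Ψ.γU) z l] [HasPar Ψ.γU a p₁] [HasPar Ψ.γU c p₂]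
    [HasPar Ψ.γW M p₃] [HasPar Ψ.γW M₂ p₄] [HasPar Ψ.γW R p₅] :
    Ψ.ψ (Ψ.emU (map (Ψ.κ a) .id z ⊗ₜ M) ⊗ₜ (M₂ ⊗ₜ (c ⊗ₜ R)))
      = sgn (l * p₃ + p₁ + 1 + p₃ + p₂ * p₄ + p₅ * (l + p₂ + p₄ + p₁ + p₃)) •
        (R ⊗ₜ[ℚ] Ψ.κatt a p₃ M (wordPos U M₂) (map Ψ.γU (Ψ.κ.flip c) z)) := by
  refine tensor_induction_par Ψ.γU_γU Ψ.γU_γU ?_ ?_ ?_ z hz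
  · simp only [map_zero, zero_tmul, tmul_zero, smul_zero]
  · intro s t hs ht
    simp only [map_add, add_tmul, tmul_add, smul_add, hs, ht]
  · intro q₁ q₂ e e' he he' h
    rw [map_tmul, emU_tmul, ← smul_tmul', map_smul, ψ_tmul,
      (HasPar.tmul (γA := Ψ.γX) (γB := Ψ.γW) (Ψ.κ a e) M).eq, Qf_tmul, id_apply, ← smul_tmul',
      tmul_smul, map_smul, map_smul, sw_tmul, map_tmul, LinearMap.flip_apply, Ψ.γU_apply e,
      ← smul_tmul', map_smul, κatt_tmul, tmul_smul, tmul_smul]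
    simp only [smul_smul, ← sgn_add]
    congr 2
    have := zmod_two_mul_self q₁
    grind

theorem vT_κatt (z : U ⊗[ℚ] U) (a e : U) (M M₂ : Wd U) {l p₁ p₂ p₃ : ZMod 2}
    [hz : HasPar (map Ψ.γU Ψ.γU) z l] [HasPar Ψ.γU a p₁] [HasPar Ψ.γU e p₂]
    [HasPar Ψ.γW M p₃] :
    map (pos X U) .id
        (Ψ.vT (map (Ψ.κ a) .id z ⊗ₜ (M ⊗ₜ (e ⊗ₜ M₂))))
      = sgn (p₁ + 1 + p₃ + l * p₃ + l * p₂) • Ψ.κatt a p₃ (wordPos U M) (wordPos U M₂)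
          (kflip Ψ.γX Ψ.γU (map (Ψ.κ e) .id (kflip Ψ.γU Ψ.γU z))) := by
  refine tensor_induction_par Ψ.γU_γU Ψ.γU_γU ?_ ?_ ?_ z hz
  · simp only [map_zero, zero_tmul, tmul_zero, smul_zero]
  · intro s t hs ht
    simp only [map_add, add_tmul, tmul_add, smul_add, hs, ht]
  · intro q₁ q₂ c c' hc hc' h
    rw [map_tmul, id_apply, vT_tmul, map_smul, map_tmul, pos_tmul, id_apply, kflip_tmul_sgn,
      map_smul, map_tmul, map_smul, id_apply, kflip_tmul_sgn, map_smul, map_smul, κatt_tmul]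
    simp only [smul_smul, ← sgn_add]
    congr 2
    have := zmod_two_mul_self q₁
    grind

theorem κ_ς_exchange (e c : U) {p : ZMod 2} [HasPar Ψ.γU e p] :
    map Ψ.γU (Ψ.κ.flip c) (Ψ.ς e) = sgn p • kflip Ψ.γX Ψ.γU
      (map (Ψ.κ e) .id (kflip Ψ.γU Ψ.γU (Ψ.ς c))) := by
  rw [← Ψ.frob_left, δκ_flip, γU_apply, map_smul, map_smul_left, LinearMap.smul_apply, map_smul]

/-- The projection of the first block to words of positive length. -/
def posT (X U : Type*) [AddCommGroup X] [Module ℚ X] [AddCommGroup U] [Module ℚ U] :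
    Wd U ⊗[ℚ] (Ce X U ⊗[ℚ] Ce X U) →ₗ[ℚ] Wd U ⊗[ℚ] (Ce X U ⊗[ℚ] Ce X U) :=
  map .id (map (pos X U) .id)

theorem posT_tmul (w : Wd U) (t : Ce X U ⊗[ℚ] Ce X U) :
    posT X U (w ⊗ₜ t) = w ⊗ₜ map (pos X U) .id t := rfl

theorem posT_smul (w : Wd U) (t : Wd U ⊗[ℚ] (Ce X U ⊗[ℚ] Ce X U)) :
    posT X U (w • t) = w • posT X U t := map_id_smul _ _ _

/-- The coaction of a block, as a map to `(X ⊗ T(U)) ⊗ U`. -/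
def emδ : Ce X U →ₗ[ℚ] Ce X U ⊗[ℚ] U := Ψ.emU ∘ₗ map Ψ.δ .id

theorem emδ_tmul (x : X) (M : Wd U) : Ψ.emδ (x ⊗ₜ M) = Ψ.emU (Ψ.δ x ⊗ₜ M) := rfl

theorem pos_κatt (a : U) (p : ZMod 2) (M M' : Wd U) (t : U ⊗[ℚ] X) :
    map (pos X U) .id (Ψ.κatt a p (wordPos U M) M' t)
      = Ψ.κatt a p (wordPos U M) M' t := by
  induction t with
  | zero => simp only [map_zero]
  | add s t hs ht => rw [map_add, map_add, hs, ht]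
  | tmul b y =>
    rw [κatt, map_tmul, map_tmul, comp_apply, LinearMap.flip_apply, mk_apply, pos_tmul,
      wordPos_wordPos, id_apply]

theorem ψ_reass (a c : U) (s : Om U) (R : Wd U) {p q r v : ZMod 2}
    [HasPar Ψ.γU a p] [HasPar Ψ.γU c q] [hs : HasPar Ψ.γO s r] [HasPar Ψ.γW R v] :
    posT X U (Ψ.ψ (map Ψ.emδ .id
        (Ψ.QV (Om U) (a ⊗ₜ reass _ _ _ _ (s ⊗ₜ (c ⊗ₜ R))))))
      = sgn (q * r + (p + q + 1 + r) * v) • posT X U (R ⊗ₜ Ψ.vT (Ψ.δ (Ψ.κ a c) ⊗ₜ s)) := by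
  refine Ψ.om_induction_par ?_ ?_ ?_ s hs
  · simp only [map_zero, zero_tmul, tmul_zero, smul_zero]
  · intro s t hs ht
    simp only [map_add, add_tmul, tmul_add, smul_add, hs, ht]
  · intro p₁ p₂ p₃ M e M₂ hM he hM₂ h
    have h1 : Ψ.δ (Ψ.κ a e) = sgn (1 + p) • map (Ψ.κ a) .id (Ψ.ς e) := by
      rw [δκ_right, γU_apply, map_smul, map_smul_left, LinearMap.smul_apply, smul_smul, ← sgn_add]
    have h2 : Ψ.δ (Ψ.κ a c) = sgn (1 + p) • map (Ψ.κ a) .id (Ψ.ς c) := by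
      rw [δκ_right, γU_apply, map_smul, map_smul_left, LinearMap.smul_apply, smul_smul, ← sgn_add]
    rw [reass_tmul, QV_tmul, map_smul, map_tmul, id_apply, emδ_tmul, h1, h2]
    simp only [← smul_tmul', map_smul, tmul_smul]
    rw [ψ_κatt, map_smul, posT_tmul, posT_tmul, vT_κatt, κ_ς_exchange, map_smul, map_smul, pos_κatt,
      tmul_smul, tmul_smul]
    simp only [smul_smul, ← sgn_add]
    congr 2
    grind

theorem vee_Qf (a : U) (s : Om U) {p : ZMod 2} [HasPar Ψ.γU a p] :
    posT X U (Ψ.ψ (map Ψ.emδ .id (Ψ.QV (Om U)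
        (a ⊗ₜ reass _ _ _ _ (map (wordCut U) .id s)))))
      = posT X U (map .id Ψ.vee (Ψ.Qf a s)) := by
  induction s using Ψ.om_induction with
  | zero => simp only [map_zero, tmul_zero]
  | add s t hs ht => simp only [map_add, tmul_add, hs, ht]
  | h p₁ p₂ p₃ M c R hM hc hR =>
    rw [map_tmul, id_apply, ψ_reass, Qf_tmul, map_smul, map_smul, map_tmul, vee_wordPos, vee_tmul,
      id_apply]

theorem Ξ_Q (a : U) (u : Wd U) {p : ZMod 2} [HasPar Ψ.γU a p] :
    posT X U (Ψ.Ξ (1 ⊗ₜ Ψ.Q (a ⊗ₜ wordCut U u)))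
      = posT X U (map .id Ψ.vee (Ψ.Qf a (wordCut U u))) := by
  rw [← vee_Qf, ← wordCut_wordCut, QV_map, Ξ_one]
  congr 2
  rw [map_map]
  rfl

theorem Ξ_E (u : Wd U) :
    posT X U (Ψ.Ξ (Ψ.E u)) = posT X U (map .id Ψ.vee (Ψ.N u)) := by
  have : posT X U ∘ₗ Ψ.Ξ ∘ₗ Ψ.E = posT X U ∘ₗ map .id Ψ.vee ∘ₗ Ψ.N :=
    word_hom_ext Ψ.γU_γU
    (by simp only [comp_apply, N_apply, E_one, map_zero])
    (fun p q a u ha hu h => by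
      simp only [comp_apply] at h ⊢
      rw [E_lt_mul, N_lt_mul', map_add, map_add, map_add, map_add, Ξ_Q, Ξ_smul, map_id_smul,
        posT_smul, posT_smul, h])
  exact LinearMap.congr_fun this u

end KModel

namespace KModel

variable {X U : Type*} [AddCommGroup X] [Module ℚ X] [AddCommGroup U] [Module ℚ U]
  (Ψ : KModel X U)

/-! #### Right multiplication -/

/-- Right multiplication by a letter of parity `p`, with its Koszul sign. -/
def rmul {V : Type*} [AddCommGroup V] [Module ℚ V] (γ : V →ₗ[ℚ] V) (p : ZMod 2) (q : U) :
    Wd U ⊗[ℚ] V →ₗ[ℚ] Wd U ⊗[ℚ] V :=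
  map (LinearMap.mulRight ℚ (lt q)) (parPow γ p)

theorem rmul_tmul {V : Type*} [AddCommGroup V] [Module ℚ V] (γ : V →ₗ[ℚ] V) (p : ZMod 2) (q : U)
    (w : Wd U) (v : V) {r : ZMod 2} [HasPar γ v r] :
    rmul γ p q (w ⊗ₜ v) = sgn (p * r) • ((w * lt q) ⊗ₜ[ℚ] v) := by
  rw [rmul, map_tmul, parPow_apply, tmul_smul, LinearMap.mulRight_apply]

theorem rmul_smul {V : Type*} [AddCommGroup V] [Module ℚ V] (γ : V →ₗ[ℚ] V) (p : ZMod 2) (q : U)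
    (w : Wd U) (t : Wd U ⊗[ℚ] V) : rmul γ p q (w • t) = w • rmul γ p q t := by
  induction t with
  | zero => simp only [smul_zero, map_zero]
  | add s t hs ht => rw [smul_add, map_add, map_add, hs, ht, smul_add]
  | tmul v t =>
    rw [smul_tmul_word, rmul, map_tmul, map_tmul, smul_tmul_word, LinearMap.mulRight_apply,
      LinearMap.mulRight_apply, mul_assoc]

/-- Right multiplication of a marked word by a letter of parity `p`, with its Koszul sign. -/
def rmulO (p : ZMod 2) (q : U) : Om U ⊗[ℚ] Ce X U →ₗ[ℚ] Om U ⊗[ℚ] Ce X U :=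
  map (ract U (lt q)) (parPow Ψ.γc p)

theorem rmulO_tmul (p : ZMod 2) (q : U) (s : Om U) (B : Ce X U) {r : ZMod 2} [HasPar Ψ.γc B r] :
    Ψ.rmulO p q (s ⊗ₜ B) = sgn (p * r) • (ract U (lt q) s ⊗ₜ[ℚ] B) := by
  rw [rmulO, map_tmul, parPow_apply, tmul_smul]

theorem Kw_ract (q : U) (t : Bl X U) {p : ZMod 2} [HasPar Ψ.γU q p] :
    Ψ.Kw (ract _ (lt q) t) = rmul Ψ.γc p q (Ψ.Kw t) := by
  induction t using Ψ.bl_induction with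
  | zero => simp only [map_zero]
  | add s t hs ht => rw [map_add, map_add, map_add, map_add, hs, ht]
  | h p₁ p₂ p₃ L B R hL hB hR =>
    rw [ract_tmul, Kw_tmul, Kw_tmul, map_smul, rmul_tmul, smul_smul, ← sgn_add, mul_assoc]
    congr 2; grind

theorem Qf_ract (a q : U) (s : Om U) {p r : ZMod 2} [HasPar Ψ.γU q p] [HasPar Ψ.γU a r] :
    Ψ.Qf a (ract U (lt q) s) = rmul Ψ.γc p q (Ψ.Qf a s) := by
  induction s using Ψ.om_induction with
  | zero => simp only [map_zero]
  | add s t hs ht => rw [map_add, map_add, map_add, map_add, hs, ht]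
  | h p₁ p₂ p₃ M c R hM hc hR =>
    rw [ract_tmul, Qf_tmul, Qf_tmul, map_smul, rmul_tmul, smul_smul, ← sgn_add]
    congr 2; grind

theorem QfL_rmulO (a q : U) (t : Om U ⊗[ℚ] Ce X U) {p r : ZMod 2} [HasPar Ψ.γU q p]
    [HasPar Ψ.γU a r] :
    Ψ.QfL a (Ψ.rmulO p q t) = rmul (map Ψ.γc Ψ.γc) p q (Ψ.QfL a t) := by
  induction t with
  | zero => simp only [map_zero]
  | add s t hs ht => rw [map_add, map_add, map_add, map_add, hs, ht]
  | tmul s B =>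
    induction B using hasPar_induction Ψ.γc_γc with
    | add s t hs ht =>
      rw [tmul_add, map_add, map_add, map_add, map_add, hs, ht]
    | h l B hB =>
      rw [rmulO_tmul, map_smul, QfL_tmul, QfL_tmul, Qf_ract]
      generalize Ψ.Qf a s = n
      induction n using tensor_induction Ψ.γW_γW Ψ.γc_γc with
      | zero => simp only [map_zero, zero_tmul, smul_zero]
      | add s t hs ht =>
        simp only [map_add, add_tmul, smul_add, hs, ht]
      | h p₁ p₂ w B' hw hB' =>
        rw [rmul_tmul, assoc_tmul, rmul_tmul, ← smul_tmul', map_smul, assoc_tmul, smul_smul,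
          ← sgn_add]
        congr 2; grind

theorem NcutR_ract (q : U) (s : Om U) {p : ZMod 2} [HasPar Ψ.γU q p] :
    Ψ.NcutR (ract U (lt q) s) = Ψ.rmulO p q (Ψ.NcutR s) := by
  induction s using Ψ.om_induction with
  | zero => simp only [map_zero]
  | add s t hs ht => rw [map_add, map_add, map_add, map_add, hs, ht]
  | h p₁ p₂ p₃ M c R hM hc hR =>
    rw [ract_tmul, NcutR_tmul, NcutR_tmul]
    generalize Ψ.N M = n
    induction n using tensor_induction Ψ.γW_γW Ψ.γc_γc with
    | zero => simp only [map_zero]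
    | add s t hs ht => rw [map_add, map_add, map_add, hs, ht]
    | h r₁ r₂ w B hw hB =>
      rw [Nins_tmul, Nins_tmul, map_smul, rmulO_tmul, ract_tmul, smul_smul, ← sgn_add]
      congr 2; grind

/-- `N(u[q]) - N(u)[q]`. -/
def Nlast (p : ZMod 2) (q : U) : Wd U →ₗ[ℚ] Wd U ⊗[ℚ] Ce X U :=
  Ψ.N ∘ₗ LinearMap.mulRight ℚ (lt q) - rmul Ψ.γc p q ∘ₗ Ψ.N

theorem Nlast_apply (p : ZMod 2) (q : U) (u : Wd U) :
    Ψ.Nlast p q u = Ψ.N (u * lt q) - rmul Ψ.γc p q (Ψ.N u) := rfl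

theorem Kw_last (q : U) (u : Wd U) {p : ZMod 2} [HasPar Ψ.γU q p] :
    Ψ.Kw (Ψ.last (u ⊗ₜ q)) = Ψ.Nlast p q u := by
  rw [last_tmul, map_sub, Kw_ract, Nlast_apply]; rfl

theorem cut_mul_lt (u : Wd U) (q : U) :
    wordCut U (u * lt q) = ract U (lt q) (wordCut U u) + u ⊗ₜ (q ⊗ₜ 1) := by
  have e : wordCut U (lt q) = 1 ⊗ₜ (q ⊗ₜ 1) := by
    have := wordCut_ι_mul q 1
    rwa [wordCut_one, smul_zero, add_zero, mul_one] at this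
  rw [wordCut_mul, e, smul_tmul_word, mul_one]

theorem NcutL_last (u : Wd U) (q : U) : Ψ.NcutL (u ⊗ₜ (q ⊗ₜ 1)) = 0 := by
  induction u using hasPar_induction Ψ.γW_γW with
  | add s t hs ht => rw [add_tmul, map_add, hs, ht, add_zero]
  | h r u hu =>
    induction q using hasPar_induction Ψ.γU_γU with
    | add s t hs ht => rw [add_tmul, tmul_add, map_add, hs, ht, add_zero]
    | h p q hq => rw [NcutL_tmul, N_one, map_zero, smul_zero]

theorem cut_rmul (q : U) (n : Wd U ⊗[ℚ] Ce X U) (p : ZMod 2) :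
    map (wordCut U) .id (rmul Ψ.γc p q n)
      = Ψ.rmulO p q (map (wordCut U) .id n) + Ψ.Nins p (q ⊗ₜ 1) n := by
  induction n with
  | zero => simp only [map_zero, add_zero]
  | add s t hs ht => simp only [map_add, hs, ht]; abel
  | tmul w B =>
    rw [rmul, rmulO, Nins, map_tmul, map_tmul, map_tmul, map_tmul, map_tmul,
      LinearMap.mulRight_apply, cut_mul_lt, add_tmul]
    rfl

theorem cut_Nlast (q : U) (u : Wd U) {p : ZMod 2} [HasPar Ψ.γU q p] :
    map (wordCut U) .id (Ψ.Nlast p q u)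
      = Ψ.NcutL (ract U (lt q) (wordCut U u)) - Ψ.rmulO p q (Ψ.NcutL (wordCut U u)) := by
  have e : Ψ.NcutR (u ⊗ₜ (q ⊗ₜ 1)) = Ψ.Nins p (q ⊗ₜ 1) (Ψ.N u) := by
    rw [NcutR_tmul, add_zero]
  rw [Nlast_apply, map_sub, cut_N, cut_rmul, cut_N, cut_mul_lt, map_add, map_add, NcutL_last,
    NcutR_ract, map_add, e]
  abel

theorem Nlast_lt_mul (a q : U) (u : Wd U) {p r : ZMod 2} [HasPar Ψ.γU q p] [HasPar Ψ.γU a r] :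
    Ψ.Nlast p q (lt a * u) = lt (Ψ.γU a) • Ψ.Nlast p q u + Ψ.Qf a (u ⊗ₜ (q ⊗ₜ 1)) := by
  rw [Nlast_apply, Nlast_apply, mul_assoc, N_lt_mul', N_lt_mul', map_add, rmul_smul, cut_mul_lt,
    map_add, Qf_ract, smul_sub]
  abel

theorem N₂_lt_mul (a : U) (u : Wd U) {p : ZMod 2} [HasPar Ψ.γU a p] :
    Ψ.N₂ (lt a * u) = lt a • Ψ.N₂ u + map .id (kflip Ψ.γc Ψ.γc)
      (Ψ.NL (Ψ.Qf a (wordCut U u))) := by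
  rw [N₂_apply, E_lt_mul, map_add, KwN_smul, KwN_one, wordPar_ι, Ψ.γU_γU, N₂_apply, Qf_apply]
  congr 1
  generalize Ψ.Q (a ⊗ₜ wordCut U u) = t
  induction t using tensor_induction Ψ.γc_γc Ψ.γW_γW with
  | zero => simp only [map_zero]
  | add s t hs ht => simp only [map_add, hs, ht]
  | h p q B R hB hR =>
    rw [map_tmul, kflip_tmul_sgn, hB.eq, ← smul_tmul', map_smul, map_smul, map_smul, NL_tmul]
    have hn : HasPar (map Ψ.γW Ψ.γc) (Ψ.N R) (q + 1) := inferInstance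
    refine tensor_induction_par Ψ.γW_γW Ψ.γc_γc ?_ ?_ ?_ (Ψ.N R) hn
    · simp only [zero_tmul, tmul_zero, map_zero, smul_zero]
    · intro s t hs ht
      simp only [add_tmul, tmul_add, map_add, smul_add, hs, ht]
    · intro q₁ q₂ w B' hw hB' e
      rw [sw_tmul, assoc_tmul, map_tmul, kflip_tmul_sgn, tmul_smul, smul_smul, smul_smul, ← sgn_add,
        ← sgn_add, id_apply]
      congr 2; grind

theorem N₂_lt_mul' (a : U) (u : Wd U) {p : ZMod 2} [HasPar Ψ.γU a p] :
    Ψ.N₂ (lt a * u) = lt a • Ψ.N₂ u - Ψ.QfL (Ψ.γU a) (Ψ.NcutL (wordCut U u)) := by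
  rw [N₂_lt_mul, NL_Qf, map_neg, map_kflip_kflip, sub_eq_add_neg]

theorem N₂_mul_lt (u : Wd U) (q : U) {p : ZMod 2} [HasPar Ψ.γU q p] :
    Ψ.N₂ (u * lt q) = rmul (map Ψ.γc Ψ.γc) p q (Ψ.N₂ u) - Ψ.NL (Ψ.Nlast p q u) := by
  have : Ψ.N₂ ∘ₗ LinearMap.mulRight ℚ (lt q)
      = rmul (map Ψ.γc Ψ.γc) p q ∘ₗ Ψ.N₂ - Ψ.NL ∘ₗ Ψ.Nlast p q :=
    word_hom_ext Ψ.γU_γU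
    (by
      have e : Ψ.N₂ (lt q) = 0 := by
        have := Ψ.N₂_lt_mul' q 1
        rwa [mul_one, wordCut_one, map_zero, map_zero, N₂_apply, N₂_apply, E_one, map_zero,
          smul_zero, sub_zero] at this
      have e' : Ψ.N (lt q) = 0 := by
        have := Ψ.N_lt_mul' q 1
        rwa [mul_one, wordCut_one, map_zero, N_one, smul_zero, add_zero] at this
      simp only [comp_apply, LinearMap.sub_apply, LinearMap.mulRight_apply, one_mul, Nlast_apply,
        N₂_apply Ψ 1, E_one, N_one, map_zero, e, e', sub_zero])
    (fun r l a u ha hu h => by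
      have : HasPar Ψ.γU (Ψ.γU a) r := ⟨by rw [Ψ.γU_apply a, map_smul, Ψ.γU_apply a]⟩
      simp only [comp_apply, LinearMap.sub_apply, LinearMap.mulRight_apply] at h ⊢
      rw [mul_assoc, N₂_lt_mul', h, N₂_lt_mul', map_sub, rmul_smul, Nlast_lt_mul, map_add, NL_smul,
        NL_Qf, NcutL_last, map_zero, map_zero, cut_Nlast, map_sub, QfL_rmulO, Ψ.γU_γU, cut_mul_lt,
        map_add, NcutL_last, add_zero, smul_sub]
      abel)
  exact LinearMap.congr_fun this u

end KModel

namespace KModel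

variable {X U : Type*} [AddCommGroup X] [Module ℚ X] [AddCommGroup U] [Module ℚ U]
  (Ψ : KModel X U)

/-! #### The homotopy for `(id ⊗ ∨) h` -/

/-- The sign operator on `T(U) ⊗ (X ⊗ T(U)) ⊗ (X ⊗ T(U))`. -/
abbrev γT : Wd U ⊗[ℚ] (Ce X U ⊗[ℚ] Ce X U) →ₗ[ℚ] Wd U ⊗[ℚ] (Ce X U ⊗[ℚ] Ce X U) :=
  map Ψ.γW (map Ψ.γc Ψ.γc)

theorem γT_sw (B : Ce X U) (n : Wd U ⊗[ℚ] Ce X U) :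
    Ψ.γT (Ψ.sw (B ⊗ₜ n)) = Ψ.sw (Ψ.γc B ⊗ₜ map Ψ.γW Ψ.γc n) := by
  induction B using hasPar_induction Ψ.γc_γc with
  | add s t hs ht =>
    rw [add_tmul, map_add, map_add, hs, ht, map_add, add_tmul, map_add]
  | h p B hB =>
    induction n using tensor_induction Ψ.γW_γW Ψ.γc_γc with
    | zero => simp only [tmul_zero, map_zero]
    | add s t hs ht =>
      rw [tmul_add, map_add, map_add, hs, ht, map_add, tmul_add, map_add]
    | h q r w B' hw hB' =>
      rw [sw_tmul, map_smul, map_tmul, map_tmul, map_tmul, hB.eq, hB'.eq, hw.eq]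
      simp only [← smul_tmul', tmul_smul, map_smul]
      rw [sw_tmul]
      simp only [smul_smul, ← sgn_add]
      congr 2; grind

theorem γT_KwN (t : Bl X U) : Ψ.γT (Ψ.KwN t) = -Ψ.KwN (Ψ.γB t) := by
  induction t using Ψ.bl_induction with
  | zero => simp only [map_zero, neg_zero]
  | add s t hs ht => rw [map_add, map_add, map_add, map_add, hs, ht, neg_add]
  | h p q r L B R hL hB hR =>
    rw [map_tmul, map_tmul, KwN_tmul, KwN_tmul, map_γW_smul, γT_sw, γ_N, tmul_neg, map_neg,
      smul_neg]

instance (u : Wd U) {p : ZMod 2} [h : HasPar Ψ.γW u p] : HasPar Ψ.γT (Ψ.N₂ u) p :=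
  ⟨by rw [N₂_apply, γT_KwN, γ_E, h.eq, map_neg, map_smul, map_smul, neg_neg]⟩

/-- `x ⊗ u ↦ x N₂(u)`. -/
def H₀ : Ce X U →ₗ[ℚ] Ce X U ⊗[ℚ] (Ce X U ⊗[ℚ] Ce X U) :=
  (assoc X (Wd U) (Ce X U ⊗[ℚ] Ce X U)).symm.toLinearMap ∘ₗ
    map .id Ψ.N₂

theorem H₀_tmul (x : X) (u : Wd U) : Ψ.H₀ (x ⊗ₜ u)
    = (assoc X (Wd U) (Ce X U ⊗[ℚ] Ce X U)).symm (x ⊗ₜ Ψ.N₂ u) := rfl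

/-- The differential of the tensor cube. -/
def b₃ : Ce X U ⊗[ℚ] (Ce X U ⊗[ℚ] Ce X U) →ₗ[ℚ] Ce X U ⊗[ℚ] (Ce X U ⊗[ℚ] Ce X U) :=
  map Ψ.b .id + map Ψ.γc Ψ.b₂

theorem b₃_tmul (s : Ce X U) (t : Ce X U ⊗[ℚ] Ce X U) :
    Ψ.b₃ (s ⊗ₜ t) = Ψ.b s ⊗ₜ t + Ψ.γc s ⊗ₜ Ψ.b₂ t := rfl

theorem b₃_attach (x : X) (n : Wd U ⊗[ℚ] (Ce X U ⊗[ℚ] Ce X U)) :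
    Ψ.b₃ ((assoc X (Wd U) (Ce X U ⊗[ℚ] Ce X U)).symm (x ⊗ₜ n))
      = (assoc X (Wd U) (Ce X U ⊗[ℚ] Ce X U)).symm (Ψ.dX x ⊗ₜ n)
        + (assoc X (Wd U) (Ce X U ⊗[ℚ] Ce X U)).symm (Ψ.γX x ⊗ₜ Ψ.D₃ n)
        + map (insL ∘ₗ TensorProduct.mk ℚ _ _ (Ψ.δ x)) LinearMap.id n
        - map (Ψ.insR ∘ₗ TensorProduct.mk ℚ _ _ (Ψ.δ x)) LinearMap.id n := by
  induction n with
  | zero => simp only [tmul_zero, map_zero, add_zero, sub_zero]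
  | add s t hs ht => simp only [tmul_add, map_add, hs, ht]; abel
  | tmul w t =>
    rw [assoc_symm_tmul, b₃_tmul, b_tmul, map_tmul, map_tmul, map_tmul, D₃_tmul, tmul_add, map_add,
      assoc_symm_tmul, assoc_symm_tmul, assoc_symm_tmul, sub_tmul, add_tmul, add_tmul, comp_apply,
      comp_apply, mk_apply, id_apply]
    abel

/-- `(x ⊗ a) ⊗ s ↦ ± x R ⊗ κ(a, c) M`, for `s = M ⊗ (c ⊗ R)`. -/
def fT : (X ⊗[ℚ] U) ⊗[ℚ] Om U →ₗ[ℚ] Ce X U ⊗[ℚ] Ce X U :=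
  Ψ.K ∘ₗ map .id (TensorProduct.mk ℚ _ _ 1 ∘ₗ Ψ.Q) ∘ₗ
    (assoc X U (Om U)).toLinearMap

theorem fT_tmul (x : X) (a : U) (s : Om U) : Ψ.fT ((x ⊗ₜ a) ⊗ₜ s)
    = (assoc X (Wd U) (Ce X U)).symm (Ψ.γX x ⊗ₜ Ψ.Qf a s) := by
  rw [fT, comp_apply, comp_apply, LinearEquiv.coe_coe, assoc_tmul, map_tmul, K_eq, comp_apply,
    mk_apply, Kw_one, Qf_apply, id_apply]

theorem veeFlip_eq_fT (x : X) (u : Wd U) : Ψ.veeFlip (x ⊗ₜ u) = Ψ.fT (Ψ.δ x ⊗ₜ wordCut U u) :=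
  Ψ.veeFlip_tmul x u

theorem H₀_insL (y : X ⊗[ℚ] U) (u : Wd U) :
    Ψ.H₀ (insL (y ⊗ₜ u))
      = map (insL ∘ₗ TensorProduct.mk ℚ _ _ y) .id (Ψ.N₂ u)
        + Ψ.flipM (assoc _ _ _ (map Ψ.h .id
          (Ψ.fT (y ⊗ₜ wordCut U u)))) := by
  induction y using tensor_induction Ψ.γX_γX Ψ.γU_γU with
  | zero => simp only [zero_tmul, map_zero, LinearMap.comp_zero, TensorProduct.map_zero_left,
      LinearMap.zero_apply, add_zero]
  | add s t hs ht =>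
    simp only [add_tmul, map_add, LinearMap.comp_add, map_add_left, LinearMap.add_apply, hs, ht]
    abel
  | h p q x a hx ha =>
    rw [insL_tmul, H₀_tmul, N₂_lt_mul, tmul_add, map_add, fT_tmul, h_attach, Ψ.γX_γX, flipM_attach]
    congr 1
    generalize Ψ.N₂ u = n
    induction n with
    | zero => simp only [smul_zero, tmul_zero, map_zero]
    | add s t hs ht => simp only [smul_add, tmul_add, map_add, hs, ht]
    | tmul w t =>
      rw [smul_tmul_word, assoc_symm_tmul, map_tmul, comp_apply, mk_apply, insL_tmul, id_apply]

theorem H₀_insR (y : X ⊗[ℚ] U) (u : Wd U) :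
    Ψ.H₀ (Ψ.insR (y ⊗ₜ u))
      = map (Ψ.insR ∘ₗ TensorProduct.mk ℚ _ _ y) .id (Ψ.N₂ u)
        - assoc _ _ _ (map Ψ.h .id
          (Ψ.vT (y ⊗ₜ wordCut U u))) := by
  induction u using hasPar_induction Ψ.γW_γW with
  | add s t hs ht => simp only [tmul_add, map_add, hs, ht]; abel
  | h r u hu =>
    induction y using tensor_induction Ψ.γX_γX Ψ.γU_γU with
    | zero => simp only [zero_tmul, map_zero, LinearMap.comp_zero, TensorProduct.map_zero_left,
        LinearMap.zero_apply, sub_zero]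
    | add s t hs ht =>
      simp only [add_tmul, map_add, LinearMap.comp_add, map_add_left, LinearMap.add_apply, hs, ht]
      abel
    | h p q x a hx ha =>
      rw [insR_tmul, map_smul, H₀_tmul, N₂_mul_lt, ← vT_eq, assoc_tmul, map_tmul, comp_apply,
        kflip_tmul_sgn, map_smul, tmul_smul, map_smul, map_smul, map_smul, K_eq, Kw_last, id_apply,
        h_attach, Ψ.γX_γX, tmul_sub, map_sub, smul_sub]
      congr 1
      have hn : HasPar Ψ.γT (Ψ.N₂ u) r := inferInstance
      refine tensor_induction_par Ψ.γW_γW (map_map_self Ψ.γc_γc Ψ.γc_γc) ?_ ?_ ?_ (Ψ.N₂ u) hn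
      · simp only [map_zero, tmul_zero, smul_zero]
      · intro s t hs ht
        simp only [map_add, tmul_add, smul_add, hs, ht]
      · intro q₁ q₂ w t hw ht e
        rw [rmul_tmul, tmul_smul, map_smul, assoc_symm_tmul, map_tmul, comp_apply, mk_apply,
          insR_tmul, ← smul_tmul', smul_smul, ← sgn_add, id_apply]
        congr 2; grind

theorem posM_attach (x : X) (s : Wd U ⊗[ℚ] (Ce X U ⊗[ℚ] Ce X U)) :
    posM X U ((assoc X (Wd U) (Ce X U ⊗[ℚ] Ce X U)).symm (x ⊗ₜ s))
      = (assoc X (Wd U) (Ce X U ⊗[ℚ] Ce X U)).symm (x ⊗ₜ posT X U s) := by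
  induction s with
  | zero => simp only [tmul_zero, map_zero]
  | add s t hs ht => simp only [tmul_add, map_add, hs, ht]
  | tmul u B => rfl

theorem idvee_attach (x : X) (s : Wd U ⊗[ℚ] Ce X U) :
    map .id Ψ.vee
        ((assoc X (Wd U) (Ce X U)).symm (x ⊗ₜ s))
      = (assoc X (Wd U) (Ce X U ⊗[ℚ] Ce X U)).symm (x ⊗ₜ
          map .id Ψ.vee s) := by
  induction s with
  | zero => simp only [tmul_zero, map_zero]
  | add s t hs ht => simp only [tmul_add, map_add, hs, ht]
  | tmul u B => rfl

/-- `H₀` is a homotopy between `(id ⊗ ∨) h` and the sum of two compositions `(h ⊗ id) ∨`. -/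
theorem b₃_H₀ (t : Ce X U) :
    posM X U (Ψ.b₃ (Ψ.H₀ t)) - posM X U (Ψ.H₀ (Ψ.b t))
      = posM X U (map .id Ψ.vee (Ψ.h t))
        - posM X U (Ψ.flipM (assoc _ _ _
          (map Ψ.h .id (Ψ.veeFlip t))))
        - posM X U (assoc _ _ _
          (map Ψ.h .id (Ψ.vee t))) := by
  induction t using TensorProduct.induction_on with
  | zero => simp only [map_zero, sub_zero]
  | add s t hs ht => simp only [map_add] at hs ht ⊢; linear_combination (norm := module) hs + ht
  | tmul x u =>
    rw [veeFlip_eq_fT, vee_tmul, h_eq, idvee_attach, posM_attach, ← Ξ_E, ← posM_attach, H₀_tmul,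
      b₃_attach, b_tmul, Ψ.H₀.map_sub, Ψ.H₀.map_add, Ψ.H₀.map_add, H₀_tmul, H₀_tmul, N₂_D, H₀_insL,
      H₀_insR, tmul_sub]
    simp only [map_add, map_sub]
    abel

end KModel

/-! ### Gerstenhaber coalgebras up to homotopy -/

section

variable {V : Type*} [AddCommGroup V] [Module ℚ V]

/-- The differential of the tensor square. -/
def tb₂ (γ b : V →ₗ[ℚ] V) : V ⊗[ℚ] V →ₗ[ℚ] V ⊗[ℚ] V :=
  map b .id + map γ b

/-- The differential of the tensor cube. -/
def tb₃ (γ b : V →ₗ[ℚ] V) : V ⊗[ℚ] (V ⊗[ℚ] V) →ₗ[ℚ] V ⊗[ℚ] (V ⊗[ℚ] V) :=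
  map b .id + map γ (tb₂ γ b)

theorem tb₂_tmul (γ b : V →ₗ[ℚ] V) (x y : V) : tb₂ γ b (x ⊗ₜ y) = b x ⊗ₜ y + γ x ⊗ₜ b y := rfl

theorem tb₃_tmul (γ b : V →ₗ[ℚ] V) (x : V) (t : V ⊗[ℚ] V) :
    tb₃ γ b (x ⊗ₜ t) = b x ⊗ₜ t + γ x ⊗ₜ tb₂ γ b t := rfl

/-- `φ ⊗ id`, with values in `V ⊗ (V ⊗ V)`. -/
def lft (φ : V →ₗ[ℚ] V ⊗[ℚ] V) : V ⊗[ℚ] V →ₗ[ℚ] V ⊗[ℚ] (V ⊗[ℚ] V) :=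
  (assoc V V V).toLinearMap ∘ₗ map φ .id

theorem lft_tmul (φ : V →ₗ[ℚ] V ⊗[ℚ] V) (x y : V) :
    lft φ (x ⊗ₜ y) = assoc V V V (φ x ⊗ₜ y) := rfl

/-- `id ⊗ τ` on the cube. -/
def flipR (γ : V →ₗ[ℚ] V) : V ⊗[ℚ] (V ⊗[ℚ] V) →ₗ[ℚ] V ⊗[ℚ] (V ⊗[ℚ] V) :=
  map .id (kflip γ γ)

theorem flipR_tmul (γ : V →ₗ[ℚ] V) (x : V) (t : V ⊗[ℚ] V) :
    flipR γ (x ⊗ₜ t) = x ⊗ₜ kflip γ γ t := rfl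

/-- A complex with a coproduct `v` and an odd operator `h` such that `h` is a homotopy between `v`
and its flip, `h` is pre-Lie and a coderivation of `v`, and `H` is a homotopy for the second
coderivation property. -/
structure HomotopyGerstenhaber (γ b : V →ₗ[ℚ] V) (v h : V →ₗ[ℚ] V ⊗[ℚ] V)
    (H : V →ₗ[ℚ] V ⊗[ℚ] (V ⊗[ℚ] V)) : Prop where
  γ_γ : ∀ x, γ (γ x) = x
  γ_b : ∀ x, γ (b x) = -b (γ x)
  γ_v : ∀ x, map γ γ (v x) = v (γ x)
  γ_h : ∀ x, map γ γ (h x) = -h (γ x)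
  b_b : ∀ x, b (b x) = 0
  b_v : ∀ x, tb₂ γ b (v x) = v (b x)
  b_h : ∀ x, tb₂ γ b (h x) + h (b x) = kflip γ γ (v x) - v x
  coassoc : ∀ x, lft v (v x) = map .id v (v x)
  coder : ∀ x, lft v (h x) = flipR γ (lft h (v x)) + map γ h (v x)
  b_H : ∀ x, tb₃ γ b (H x) - H (b x) = map .id v (h x)
    - flipR γ (lft h (kflip γ γ (v x))) - lft h (v x)
  preLie : ∀ x, flipR γ (lft h (h x) + map γ h (h x))
    = -(lft h (h x) + map γ h (h x))

end

namespace KModel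

variable {X U : Type*} [AddCommGroup X] [Module ℚ X] [AddCommGroup U] [Module ℚ U]
  (Ψ : KModel X U)

/-! #### Truncation to words of positive length -/

theorem pos_pos (t : Ce X U) : pos X U (pos X U t) = pos X U t := by
  induction t using TensorProduct.induction_on with
  | zero => simp only [map_zero]
  | add s t hs ht => rw [map_add, map_add, hs, ht]
  | tmul x u => rw [pos_tmul, pos_tmul, wordPos_wordPos]

theorem pos_γc (t : Ce X U) : pos X U (Ψ.γc t) = Ψ.γc (pos X U t) := by
  induction t using TensorProduct.induction_on with
  | zero => simp only [map_zero]
  | add s t hs ht => rw [map_add, map_add, map_add, map_add, hs, ht]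
  | tmul x u =>
    rw [map_tmul, pos_tmul, pos_tmul, map_tmul, wordPos_wordPar]

theorem pos_b (t : Ce X U) : pos X U (Ψ.b t) = Ψ.b (pos X U t) := by
  have h1 : ∀ x : X, Ψ.b (x ⊗ₜ 1) = Ψ.dX x ⊗ₜ 1 := fun x => by
    rw [b_tmul, D_one, tmul_zero, insR_one, add_zero, add_sub_cancel_right]
  induction t using TensorProduct.induction_on with
  | zero => simp only [map_zero]
  | add s t hs ht => rw [map_add, map_add, map_add, map_add, hs, ht]
  | tmul x u =>
    obtain ⟨c, hc⟩ := wordPos_apply u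
    have key : ∀ u : Wd U, wordPos U u = u → pos X U (Ψ.b (x ⊗ₜ u)) = Ψ.b (x ⊗ₜ u) := by
      intro u hu
      rw [b_tmul, map_sub, map_add, map_add, pos_tmul, pos_tmul, wordPos_D, insL_pos, hu]
      congr 1
      exact Ψ.insR_pos _ _
    have e : u = wordPos U u + c • 1 := by rw [hc, sub_add_cancel]
    have e1 : pos X U ((Ψ.dX x) ⊗ₜ[ℚ] (1 : Wd U)) = 0 := by
      rw [pos_tmul, wordPos_one, tmul_zero]
    rw [pos_tmul]
    conv_lhs => rw [e]
    rw [tmul_add, map_add, map_add, key _ (wordPos_wordPos u), tmul_smul, map_smul, map_smul, h1,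
      e1, smul_zero, add_zero]

theorem h_pos (t : Ce X U) : Ψ.h (pos X U t) = Ψ.h t := by
  induction t using TensorProduct.induction_on with
  | zero => simp only [map_zero]
  | add s t hs ht => rw [map_add, map_add, map_add, hs, ht]
  | tmul x u => rw [pos_tmul, h_eq, h_eq, N_wordPos]

theorem vee_pos (t : Ce X U) : Ψ.vee (pos X U t) = Ψ.vee t := by
  induction t using TensorProduct.induction_on with
  | zero => simp only [map_zero]
  | add s t hs ht => rw [map_add, map_add, map_add, hs, ht]
  | tmul x u => rw [pos_tmul, vee_wordPos]

/-- The truncation of the square to words of positive length. -/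
def pos₂ (X U : Type*) [AddCommGroup X] [Module ℚ X] [AddCommGroup U] [Module ℚ U] :
    Ce X U ⊗[ℚ] Ce X U →ₗ[ℚ] Ce X U ⊗[ℚ] Ce X U := map (pos X U) (pos X U)

/-- The truncation of the cube to words of positive length. -/
def pos₃ (X U : Type*) [AddCommGroup X] [Module ℚ X] [AddCommGroup U] [Module ℚ U] :
    Ce X U ⊗[ℚ] (Ce X U ⊗[ℚ] Ce X U) →ₗ[ℚ] Ce X U ⊗[ℚ] (Ce X U ⊗[ℚ] Ce X U) :=
  map (pos X U) (pos₂ X U)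

/-- `∨`, truncated. -/
def veeP : Ce X U →ₗ[ℚ] Ce X U ⊗[ℚ] Ce X U := pos₂ X U ∘ₗ Ψ.vee

/-- `h`, truncated. -/
def hP : Ce X U →ₗ[ℚ] Ce X U ⊗[ℚ] Ce X U := pos₂ X U ∘ₗ Ψ.h

/-- `H₀`, truncated. -/
def HP : Ce X U →ₗ[ℚ] Ce X U ⊗[ℚ] (Ce X U ⊗[ℚ] Ce X U) := pos₃ X U ∘ₗ Ψ.H₀

theorem pos₂_kflip (t : Ce X U ⊗[ℚ] Ce X U) :
    pos₂ X U (kflip Ψ.γc Ψ.γc t) = kflip Ψ.γc Ψ.γc (pos₂ X U t) := by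
  induction t using tensor_induction Ψ.γc_γc Ψ.γc_γc with
  | zero => simp only [map_zero]
  | add s t hs ht => rw [map_add, map_add, map_add, map_add, hs, ht]
  | h p q s t hs ht =>
    have hs' : HasPar Ψ.γc (pos X U s) p := ⟨by rw [← pos_γc, hs.eq, map_smul]⟩
    have ht' : HasPar Ψ.γc (pos X U t) q := ⟨by rw [← pos_γc, ht.eq, map_smul]⟩
    rw [kflip_tmul_sgn, map_smul, pos₂, map_tmul, map_tmul, kflip_tmul_sgn]

theorem pos₂_γ (t : Ce X U ⊗[ℚ] Ce X U) :
    pos₂ X U (map Ψ.γc Ψ.γc t) = map Ψ.γc Ψ.γc (pos₂ X U t) := by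
  induction t with
  | zero => simp only [map_zero]
  | add s t hs ht => rw [map_add, map_add, map_add, map_add, hs, ht]
  | tmul s t =>
    rw [map_tmul, pos₂, map_tmul, map_tmul, map_tmul, pos_γc, pos_γc]

theorem pos₂_b₂ (t : Ce X U ⊗[ℚ] Ce X U) : pos₂ X U (Ψ.b₂ t) = Ψ.b₂ (pos₂ X U t) := by
  induction t with
  | zero => simp only [map_zero]
  | add s t hs ht => rw [map_add, map_add, map_add, map_add, hs, ht]
  | tmul s t =>
    rw [b₂_tmul, pos₂, map_tmul, b₂_tmul, map_add, map_tmul, map_tmul, pos_γc, pos_b, pos_b]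

theorem pos₃_b₃ (t : Ce X U ⊗[ℚ] (Ce X U ⊗[ℚ] Ce X U)) :
    pos₃ X U (Ψ.b₃ t) = Ψ.b₃ (pos₃ X U t) := by
  induction t with
  | zero => simp only [map_zero]
  | add s t hs ht => rw [map_add, map_add, map_add, map_add, hs, ht]
  | tmul s t =>
    rw [b₃_tmul, pos₃, map_tmul, b₃_tmul, map_add, map_tmul, map_tmul, pos_γc, pos_b, pos₂_b₂]

theorem pos₃_flipM (t : Ce X U ⊗[ℚ] (Ce X U ⊗[ℚ] Ce X U)) :
    pos₃ X U (Ψ.flipM t) = Ψ.flipM (pos₃ X U t) := by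
  induction t with
  | zero => simp only [map_zero]
  | add s t hs ht => rw [map_add, map_add, map_add, map_add, hs, ht]
  | tmul s t =>
    rw [flipM, pos₃, map_tmul, map_tmul, map_tmul, map_tmul, pos₂_kflip, id_apply, id_apply]

theorem pos₃_posM (t : Ce X U ⊗[ℚ] (Ce X U ⊗[ℚ] Ce X U)) :
    pos₃ X U (posM X U t) = pos₃ X U t := by
  induction t with
  | zero => simp only [map_zero]
  | add s t hs ht => rw [map_add, map_add, map_add, hs, ht]
  | tmul s t =>
    induction t with
    | zero => simp only [tmul_zero, map_zero]
    | add t v ht hv => rw [tmul_add, map_add, map_add, map_add, ht, hv]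
    | tmul t v =>
      rw [posM_tmul, pos₃, pos₂, map_tmul, map_tmul, map_tmul, map_tmul, pos_pos]

/-- The truncation of a composition `(φ ⊗ id) t`. -/
theorem pos₃_lft {φ : Ce X U →ₗ[ℚ] Ce X U ⊗[ℚ] Ce X U} (hφ : ∀ t, φ (pos X U t) = φ t)
    (t : Ce X U ⊗[ℚ] Ce X U) :
    lft (pos₂ X U ∘ₗ φ) (pos₂ X U t) = pos₃ X U (lft φ t) := by
  induction t with
  | zero => simp only [map_zero]
  | add s t hs ht => rw [map_add, map_add, map_add, map_add, hs, ht]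
  | tmul s t =>
    rw [pos₂, map_tmul, lft_tmul, lft_tmul, comp_apply, hφ]
    generalize φ s = n
    induction n with
    | zero => simp only [map_zero, zero_tmul]
    | add a b ha hb => simp only [map_add, add_tmul, ha, hb]
    | tmul a b => rfl

/-- The truncation of a composition `(f ⊗ φ) t`. -/
theorem pos₃_rgt {φ : Ce X U →ₗ[ℚ] Ce X U ⊗[ℚ] Ce X U} (hφ : ∀ t, φ (pos X U t) = φ t)
    {f : Ce X U →ₗ[ℚ] Ce X U} (hf : ∀ t, pos X U (f t) = f (pos X U t))
    (t : Ce X U ⊗[ℚ] Ce X U) :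
    map f (pos₂ X U ∘ₗ φ) (pos₂ X U t) = pos₃ X U (map f φ t) := by
  induction t with
  | zero => simp only [map_zero]
  | add s t hs ht => rw [map_add, map_add, map_add, map_add, hs, ht]
  | tmul s t =>
    rw [pos₂, map_tmul, map_tmul, comp_apply, hφ, pos₃, map_tmul, map_tmul, hf]
    rfl

theorem γ_h (t : Ce X U) : map Ψ.γc Ψ.γc (Ψ.h t) = -Ψ.h (Ψ.γc t) := by
  induction t using TensorProduct.induction_on with
  | zero => simp only [map_zero, neg_zero]
  | add s t hs ht => rw [map_add, map_add, map_add, map_add, hs, ht, neg_add]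
  | tmul x u =>
    have key : ∀ (x : X) (n : Wd U ⊗[ℚ] Ce X U), map Ψ.γc Ψ.γc
        ((assoc X (Wd U) (Ce X U)).symm (x ⊗ₜ n))
        = (assoc X (Wd U) (Ce X U)).symm
          (Ψ.γX x ⊗ₜ map Ψ.γW Ψ.γc n) := by
      intro x n
      induction n with
      | zero => simp only [tmul_zero, map_zero]
      | add s t hs ht => simp only [tmul_add, map_add, hs, ht]
      | tmul w B => rfl
    rw [h_eq, key, γ_N, map_tmul, h_eq, tmul_neg, map_neg]

theorem γ_vee (t : Ce X U) : map Ψ.γc Ψ.γc (Ψ.vee t) = Ψ.vee (Ψ.γc t) := by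
  have key : ∀ (y : X ⊗[ℚ] U) (s : Om U), map Ψ.γc Ψ.γc (Ψ.vT (y ⊗ₜ s))
      = -Ψ.vT (map Ψ.γX Ψ.γU y ⊗ₜ Ψ.γO s) := by
    intro y s
    induction s using Ψ.om_induction with
    | zero => simp only [tmul_zero, map_zero, neg_zero]
    | add s t hs ht => simp only [tmul_add, map_add, hs, ht, neg_add]
    | h p₁ p₂ p₃ L c M hL hc hM =>
      induction y using tensor_induction Ψ.γX_γX Ψ.γU_γU with
      | zero => simp only [zero_tmul, map_zero, neg_zero]
      | add s t hs ht => simp only [add_tmul, map_add, hs, ht, neg_add]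
      | h p q x a hx ha =>
        rw [(HasPar.tmul (γA := Ψ.γX) (γB := Ψ.γU) x a).eq,
          (HasPar.tmul (γA := Ψ.γW) (γB := map Ψ.γU Ψ.γW) L (c ⊗ₜ[ℚ] M)).eq, smul_tmul_smul,
          map_smul, vT_tmul, map_smul,
          (HasPar.tmul (γA := Ψ.γc) (γB := Ψ.γc) (x ⊗ₜ[ℚ] L) (Ψ.κ c a ⊗ₜ[ℚ] wordPos U M)).eq,
          smul_smul, ← sgn_add, smul_smul, ← sgn_add, ← sgn_add, ← neg_one_smul ℚ, smul_smul,
          ← sgn_one, ← sgn_add]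
        congr 2; grind
  induction t using TensorProduct.induction_on with
  | zero => simp only [map_zero]
  | add s t hs ht => rw [map_add, map_add, map_add, map_add, hs, ht]
  | tmul x u =>
    rw [vee_tmul, key, γ_cut, Ψ.γ_δ, neg_tmul, map_neg, neg_neg, map_tmul, vee_tmul]

/-- The truncated operators of a model. -/
theorem homotopyGerstenhaber :
    HomotopyGerstenhaber Ψ.γc Ψ.b Ψ.veeP Ψ.hP Ψ.HP where
  γ_γ := Ψ.γc_γc
  γ_b := Ψ.γc_b
  γ_v x := by
    rw [veeP, comp_apply, comp_apply, ← pos₂_γ, γ_vee]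
  γ_h x := by
    rw [hP, comp_apply, comp_apply, ← pos₂_γ, γ_h, map_neg]
  b_b := Ψ.b_b
  b_v x := by
    have e := congrArg (map .id (pos X U)) (Ψ.b₂_vee x)
    rw [← map_pos_pos, ← map_pos_pos] at e
    exact (Ψ.pos₂_b₂ _).symm.trans e
  b_h x := by
    have e := congrArg (pos₂ X U) (Ψ.b₂_h x)
    rw [map_add, map_sub, pos₂_b₂] at e
    exact e.trans (congrArg (· - Ψ.veeP x) (Ψ.veeFlip_eq x))
  coassoc x := by
    have e := congrArg (pos₃ X U) (Ψ.vee_coassoc x)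
    rw [pos₃_posM, pos₃_posM] at e
    rw [veeP, comp_apply, pos₃_lft Ψ.vee_pos, pos₃_rgt (f := LinearMap.id) Ψ.vee_pos (fun _ => rfl)]
    exact e
  coder x := by
    have e := congrArg (pos₃ X U) (Ψ.vee_h x)
    rw [map_add, pos₃_posM, pos₃_posM, pos₃_posM, pos₃_flipM] at e
    rw [veeP, hP, comp_apply, comp_apply, pos₃_lft Ψ.vee_pos, pos₃_lft Ψ.h_pos,
      pos₃_rgt Ψ.h_pos Ψ.pos_γc]
    exact e
  b_H x := by
    have e := congrArg (pos₃ X U) (Ψ.b₃_H₀ x)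
    simp only [map_sub, pos₃_posM, pos₃_b₃, pos₃_flipM] at e
    rw [veeP, hP, HP, comp_apply, comp_apply, comp_apply, comp_apply,
      pos₃_rgt (f := LinearMap.id) Ψ.vee_pos (fun _ => rfl), pos₃_lft Ψ.h_pos,
      show pos₂ X U (Ψ.vee x) = map (pos X U) (pos X U) (Ψ.vee x) from rfl, ← veeFlip_eq]
    exact e.trans (by
      congr 2
      exact congrArg Ψ.flipM (pos₃_lft Ψ.h_pos (Ψ.veeFlip x)).symm)
  preLie x := by
    have e := congrArg (pos₃ X U) (Ψ.h_preLie x)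
    rw [pos₃_flipM, map_neg, map_add, pos₃_posM] at e
    rw [hP, comp_apply, pos₃_lft Ψ.h_pos, pos₃_rgt Ψ.h_pos Ψ.pos_γc]
    exact e

end KModel

section

variable {V : Type*} [AddCommGroup V] [Module ℚ V] {γ b : V →ₗ[ℚ] V}

/-- An identity of linear maps on the tensor cube can be checked on homogeneous tensors. -/
theorem cube_ext {M : Type*} [AddCommGroup M] [Module ℚ M] (hγ : ∀ x, γ (γ x) = x)
    {f g : V ⊗[ℚ] (V ⊗[ℚ] V) →ₗ[ℚ] M}
    (h : ∀ p q r x y z, HasPar γ x p → HasPar γ y q → HasPar γ z r →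
      f (x ⊗ₜ (y ⊗ₜ z)) = g (x ⊗ₜ (y ⊗ₜ z))) (t : V ⊗[ℚ] (V ⊗[ℚ] V)) : f t = g t := by
  refine tensor_induction hγ (map_map_self hγ hγ) (P := fun t => f t = g t) (by simp)
    (fun s t hs ht => by rw [map_add, map_add, hs, ht]) (fun p _ x s hx _ => ?_) t
  refine tensor_induction hγ hγ (P := fun s => f (x ⊗ₜ s) = g (x ⊗ₜ s)) (by simp)
    (fun s t hs ht => by rw [tmul_add, map_add, map_add, hs, ht])
    (fun q r y z hy hz => h p q r x y z hx hy hz) s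

theorem kcyc_tmul_sgn (x y z : V) {p q r : ZMod 2} [HasPar γ x p] [HasPar γ y q] [HasPar γ z r] :
    kcyc γ (x ⊗ₜ (y ⊗ₜ z)) = sgn (p * (q + r)) • (y ⊗ₜ[ℚ] (z ⊗ₜ[ℚ] x)) := by
  rw [kcyc, comp_apply, kflip_tmul_sgn, map_smul]; rfl

theorem kcyc_tmul (x : V) (t : V ⊗[ℚ] V) {p r : ZMod 2} [HasPar γ x p]
    [HasPar (map γ γ) t r] :
    kcyc γ (x ⊗ₜ t) = sgn (p * r) • assoc V V V (t ⊗ₜ x) := by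
  rw [kcyc, comp_apply, kflip_tmul_sgn, map_smul]; rfl

theorem kflip_kflip (hγ : ∀ x, γ (γ x) = x) (t : V ⊗[ℚ] V) : kflip γ γ (kflip γ γ t) = t := by
  refine LinearMap.congr_fun (f := kflip γ γ ∘ₗ kflip γ γ) (g := LinearMap.id)
    (tensor_ext hγ hγ fun p q x y _ _ => ?_) t
  rw [comp_apply, kflip_tmul_sgn, map_smul, kflip_tmul_sgn, smul_smul, ← sgn_add,
    id_apply, show p * q + q * p = 0 by grind, sgn_zero, one_smul]

theorem kcyc_kcyc_kcyc (hγ : ∀ x, γ (γ x) = x) (t : V ⊗[ℚ] (V ⊗[ℚ] V)) :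
    kcyc γ (kcyc γ (kcyc γ t)) = t := by
  refine cube_ext hγ (f := kcyc γ ∘ₗ kcyc γ ∘ₗ kcyc γ) (g := LinearMap.id)
    (fun p q r x y z _ _ _ => ?_) t
  rw [comp_apply, comp_apply, kcyc_tmul_sgn, map_smul, kcyc_tmul_sgn, map_smul, map_smul,
    kcyc_tmul_sgn, smul_smul, smul_smul, ← sgn_add, ← sgn_add, id_apply]
  rw [show p * (q + r) + q * (r + p) + r * (p + q) = 0 by grind, sgn_zero, one_smul]

theorem kswap_eq_kcyc (hγ : ∀ x, γ (γ x) = x) (t : V ⊗[ℚ] (V ⊗[ℚ] V)) :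
    kswap γ γ V t = kcyc γ (kcyc γ (flipR γ t)) := by
  refine cube_ext hγ (f := kswap γ γ V) (g := kcyc γ ∘ₗ kcyc γ ∘ₗ flipR γ)
    (fun p q r x y z _ _ _ => ?_) t
  rw [comp_apply, comp_apply, flipR_tmul, kflip_tmul_sgn, kswap_tmul_sgn, tmul_smul, map_smul,
    map_smul, kcyc_tmul_sgn, map_smul, kcyc_tmul_sgn, smul_smul, smul_smul, ← sgn_add, ← sgn_add]
  congr 2; grind

theorem kcyc_flipR_kcyc (hγ : ∀ x, γ (γ x) = x) (t : V ⊗[ℚ] (V ⊗[ℚ] V)) :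
    kcyc γ (flipR γ (kcyc γ t)) = flipR γ t := by
  refine cube_ext hγ (f := kcyc γ ∘ₗ flipR γ ∘ₗ kcyc γ) (g := flipR γ)
    (fun p q r x y z _ _ _ => ?_) t
  rw [comp_apply, comp_apply, kcyc_tmul_sgn, map_smul, flipR_tmul, flipR_tmul, kflip_tmul_sgn,
    kflip_tmul_sgn, map_smul, tmul_smul, tmul_smul, map_smul, kcyc_tmul_sgn, smul_smul, smul_smul,
    ← sgn_add, ← sgn_add]
  congr 2; grind

theorem flipR_kcyc (hγ : ∀ x, γ (γ x) = x) (t : V ⊗[ℚ] (V ⊗[ℚ] V)) :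
    flipR γ (kcyc γ t) = kcyc γ (kcyc γ (flipR γ t)) := by
  rw [← kcyc_flipR_kcyc hγ t, kcyc_kcyc_kcyc hγ]

theorem kcyc_eq_flipR_kswap (hγ : ∀ x, γ (γ x) = x) (t : V ⊗[ℚ] (V ⊗[ℚ] V)) :
    kcyc γ t = flipR γ (kswap γ γ V t) := by
  refine cube_ext hγ (f := kcyc γ) (g := flipR γ ∘ₗ kswap γ γ V) (fun p q r x y z _ _ _ => ?_) t
  rw [comp_apply, kcyc_tmul_sgn, kswap_tmul_sgn, map_smul, flipR_tmul, kflip_tmul_sgn, tmul_smul,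
    smul_smul, ← sgn_add]
  congr 2; grind

theorem tb₂_kflip (hγ : ∀ x, γ (γ x) = x) (hb : ∀ x, γ (b x) = -b (γ x)) (t : V ⊗[ℚ] V) :
    tb₂ γ b (kflip γ γ t) = kflip γ γ (tb₂ γ b t) := by
  refine LinearMap.congr_fun (f := tb₂ γ b ∘ₗ kflip γ γ) (g := kflip γ γ ∘ₗ tb₂ γ b)
    (tensor_ext hγ hγ fun p q x y hx hy => ?_) t
  have hbx : HasPar γ (b x) (p + 1) :=
    ⟨by rw [hb, hx.eq, map_smul, sgn_add, sgn_one, ← smul_neg, mul_neg_one, neg_smul, smul_neg]⟩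
  have hby : HasPar γ (b y) (q + 1) :=
    ⟨by rw [hb, hy.eq, map_smul, sgn_add, sgn_one, ← smul_neg, mul_neg_one, neg_smul, smul_neg]⟩
  rw [comp_apply, comp_apply, kflip_tmul_sgn, map_smul, tb₂_tmul, tb₂_tmul, map_add, kflip_tmul_sgn,
    hx.eq, hy.eq, ← smul_tmul', ← smul_tmul', map_smul, kflip_tmul_sgn, smul_add, smul_smul,
    smul_smul, ← sgn_add, ← sgn_add]
  rw [add_comm]
  congr 3 <;> grind

theorem γ_γ_tb₂ (hb : ∀ x, γ (b x) = -b (γ x)) (t : V ⊗[ℚ] V) :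
    map γ γ (tb₂ γ b t) = -tb₂ γ b (map γ γ t) := by
  induction t with
  | zero => simp only [map_zero, neg_zero]
  | add s t hs ht => rw [map_add, map_add, map_add, map_add, hs, ht, neg_add]
  | tmul x y =>
    rw [tb₂_tmul, map_add, map_tmul, map_tmul, map_tmul, tb₂_tmul, hb, hb, neg_tmul, tmul_neg,
      neg_add]

theorem tb₃_assoc (s : V ⊗[ℚ] V) (z : V) :
    tb₃ γ b (assoc V V V (s ⊗ₜ z)) = assoc V V V (tb₂ γ b s ⊗ₜ z)
      + assoc V V V (map γ γ s ⊗ₜ b z) := by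
  induction s with
  | zero => simp only [zero_tmul, map_zero, add_zero]
  | add s t hs ht => simp only [add_tmul, map_add, hs, ht]; abel
  | tmul x y =>
    rw [assoc_tmul, tb₃_tmul, tb₂_tmul, tb₂_tmul, map_tmul, add_tmul, map_add, tmul_add, assoc_tmul,
      assoc_tmul, assoc_tmul, add_assoc]

theorem tb₃_kcyc (hγ : ∀ x, γ (γ x) = x) (hb : ∀ x, γ (b x) = -b (γ x))
    (t : V ⊗[ℚ] (V ⊗[ℚ] V)) : tb₃ γ b (kcyc γ t) = kcyc γ (tb₃ γ b t) := by
  refine LinearMap.congr_fun (f := tb₃ γ b ∘ₗ kcyc γ) (g := kcyc γ ∘ₗ tb₃ γ b)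
    (tensor_ext hγ (map_map_self hγ hγ) fun p q x s hx hs => ?_) t
  have hbx : HasPar γ (b x) (p + 1) :=
    ⟨by rw [hb, hx.eq, map_smul, sgn_add, sgn_one, ← smul_neg, mul_neg_one, neg_smul, smul_neg]⟩
  have hbs : HasPar (map γ γ) (tb₂ γ b s) (q + 1) :=
    ⟨by rw [γ_γ_tb₂ hb, hs.eq, map_smul, sgn_add, sgn_one, ← smul_neg, mul_neg_one, neg_smul,
      smul_neg]⟩
  rw [comp_apply, comp_apply, kcyc_tmul, map_smul, tb₃_assoc, tb₃_tmul, map_add, kcyc_tmul, hx.eq,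
    hs.eq, ← smul_tmul', ← smul_tmul', map_smul, map_smul, kcyc_tmul, smul_add, smul_smul,
    smul_smul, ← sgn_add, ← sgn_add]
  rw [add_comm]
  congr 3 <;> grind

theorem tb₃_lft_even {φ : V →ₗ[ℚ] V ⊗[ℚ] V} (hφ : ∀ x, map γ γ (φ x) = φ (γ x))
    (h : ∀ x, tb₂ γ b (φ x) = φ (b x)) (t : V ⊗[ℚ] V) :
    tb₃ γ b (lft φ t) = lft φ (tb₂ γ b t) := by
  induction t with
  | zero => simp only [map_zero]
  | add s t hs ht => rw [map_add, map_add, map_add, map_add, hs, ht]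
  | tmul x y => rw [lft_tmul, tb₃_assoc, h, hφ, tb₂_tmul, map_add, lft_tmul, lft_tmul]

theorem tb₃_lft_odd {φ : V →ₗ[ℚ] V ⊗[ℚ] V} (hφ : ∀ x, map γ γ (φ x) = -φ (γ x))
    (h : ∀ x, tb₂ γ b (φ x) = -φ (b x)) (t : V ⊗[ℚ] V) :
    tb₃ γ b (lft φ t) = -lft φ (tb₂ γ b t) := by
  induction t with
  | zero => simp only [map_zero, neg_zero]
  | add s t hs ht => rw [map_add, map_add, map_add, map_add, hs, ht, neg_add]
  | tmul x y =>
    rw [lft_tmul, tb₃_assoc, h, hφ, tb₂_tmul, map_add, lft_tmul, lft_tmul, neg_tmul, neg_tmul,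
      map_neg, map_neg, neg_add]

theorem tb₃_rgt_even {φ : V →ₗ[ℚ] V ⊗[ℚ] V} (h : ∀ x, tb₂ γ b (φ x) = φ (b x))
    (t : V ⊗[ℚ] V) : tb₃ γ b (map .id φ t)
      = map .id φ (tb₂ γ b t) := by
  induction t with
  | zero => simp only [map_zero]
  | add s t hs ht => rw [map_add, map_add, map_add, map_add, hs, ht]
  | tmul x y =>
    rw [map_tmul, tb₃_tmul, h, tb₂_tmul, map_add, map_tmul, map_tmul]
    rfl

theorem tb₃_rgt_odd {φ : V →ₗ[ℚ] V ⊗[ℚ] V} (hb : ∀ x, γ (b x) = -b (γ x))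
    (h : ∀ x, tb₂ γ b (φ x) = -φ (b x)) (t : V ⊗[ℚ] V) :
    tb₃ γ b (map γ φ t) = -map γ φ (tb₂ γ b t) := by
  induction t with
  | zero => simp only [map_zero, neg_zero]
  | add s t hs ht => rw [map_add, map_add, map_add, map_add, hs, ht, neg_add]
  | tmul x y =>
    rw [map_tmul, tb₃_tmul, h, tb₂_tmul, map_add, map_tmul, map_tmul, hb, neg_tmul, tmul_neg,
      neg_add, neg_neg]

theorem lft_kflip_even (hγ : ∀ x, γ (γ x) = x) {φ : V →ₗ[ℚ] V ⊗[ℚ] V}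
    (hφ : ∀ x, map γ γ (φ x) = φ (γ x)) (t : V ⊗[ℚ] V) :
    lft φ (kflip γ γ t) = kcyc γ (map .id φ t) := by
  refine LinearMap.congr_fun (f := lft φ ∘ₗ kflip γ γ)
    (g := kcyc γ ∘ₗ map .id φ) (tensor_ext hγ hγ fun p q x y hx hy => ?_) t
  have : HasPar (map γ γ) (φ y) q := ⟨by rw [hφ, hy.eq, map_smul]⟩
  rw [comp_apply, comp_apply, kflip_tmul_sgn, map_smul, lft_tmul, map_tmul, id_apply, kcyc_tmul]

theorem lft_kflip_odd (hγ : ∀ x, γ (γ x) = x) {φ : V →ₗ[ℚ] V ⊗[ℚ] V}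
    (hφ : ∀ x, map γ γ (φ x) = -φ (γ x)) (t : V ⊗[ℚ] V) :
    lft φ (kflip γ γ t) = kcyc γ (map γ φ t) := by
  refine LinearMap.congr_fun (f := lft φ ∘ₗ kflip γ γ)
    (g := kcyc γ ∘ₗ map γ φ) (tensor_ext hγ hγ fun p q x y hx hy => ?_) t
  have : HasPar (map γ γ) (φ y) (q + 1) :=
    ⟨by rw [hφ, hy.eq, map_smul, sgn_add, sgn_one, mul_neg_one, neg_smul]⟩
  rw [comp_apply, comp_apply, kflip_tmul_sgn, map_smul, lft_tmul, map_tmul, hx.eq, ← smul_tmul',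
    map_smul, kcyc_tmul, smul_smul, ← sgn_add]
  congr 2; grind

theorem lft_kflip_comp (φ : V →ₗ[ℚ] V ⊗[ℚ] V) (t : V ⊗[ℚ] V) :
    lft (kflip γ γ ∘ₗ φ) t = kswap γ γ V (lft φ t) := by
  simp only [kswap, lft, comp_apply, LinearEquiv.coe_coe, LinearEquiv.symm_apply_apply, map_map,
    LinearMap.comp_id]

theorem lft_add (φ ψ : V →ₗ[ℚ] V ⊗[ℚ] V) (t : V ⊗[ℚ] V) :
    lft (φ + ψ) t = lft φ t + lft ψ t := by
  rw [lft, map_add_left, comp_apply, LinearMap.add_apply, map_add]; rfl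

theorem flipR_map (f : V →ₗ[ℚ] V) (φ : V →ₗ[ℚ] V ⊗[ℚ] V) (t : V ⊗[ℚ] V) :
    flipR γ (map f φ t) = map f (kflip γ γ ∘ₗ φ) t := by
  rw [flipR, map_map]; rfl

theorem lft_γ_comp {φ : V →ₗ[ℚ] V ⊗[ℚ] V}
    (hφ : ∀ x, map γ γ (φ x) = -φ (γ x)) (hγ : ∀ x, γ (γ x) = x) (t : V ⊗[ℚ] V) :
    lft (map γ .id ∘ₗ φ) (map γ .id t)
      = -map .id (map γ .id) (lft φ t) := by
  have key : ∀ (s : V ⊗[ℚ] V) (z : V),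
      assoc V V V (map γ .id (map γ γ s) ⊗ₜ z)
      = map .id (map γ .id)
        (assoc V V V (s ⊗ₜ z)) := by
    intro s z
    induction s with
    | zero => simp only [zero_tmul, map_zero]
    | add s t hs ht => simp only [add_tmul, map_add, hs, ht]
    | tmul x y => simp [hγ]
  induction t with
  | zero => simp only [map_zero, neg_zero]
  | add s t hs ht => rw [map_add, map_add, map_add, map_add, hs, ht, neg_add]
  | tmul x z =>
    rw [map_tmul, lft_tmul, lft_tmul, comp_apply, ← neg_neg (φ (γ x)), ← hφ, map_neg, neg_tmul,
      map_neg, key]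
    rfl

theorem kcyc_neg_γ (hγ : ∀ x, γ (γ x) = x) (t : V ⊗[ℚ] (V ⊗[ℚ] V)) :
    kcyc (-γ) (map .id (map γ .id) t)
      = map .id (map γ .id) (kcyc γ t) := by
  refine cube_ext hγ
    (f := kcyc (-γ) ∘ₗ map .id (map γ .id))
    (g := map .id (map γ .id) ∘ₗ kcyc γ)
    (fun p q r x y z hx hy hz => ?_) t
  have neg : ∀ (p : ZMod 2) (x : V), HasPar γ x p → HasPar (-γ) x (p + 1) := fun p x h =>
    ⟨by rw [LinearMap.neg_apply, h.eq, sgn_add, sgn_one, mul_neg_one, neg_smul]⟩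
  have := neg p x hx
  have := neg q y hy
  have := neg r z hz
  rw [comp_apply, comp_apply, kcyc_tmul_sgn, map_smul, map_tmul, map_tmul, map_tmul, map_tmul,
    hy.eq, hz.eq, ← smul_tmul', ← smul_tmul', tmul_smul, tmul_smul, id_apply, id_apply, id_apply,
    map_smul, kcyc_tmul_sgn, smul_smul, smul_smul, ← sgn_add, ← sgn_add]
  congr 2; grind

theorem kflip_neg_γ (hγ : ∀ x, γ (γ x) = x) (t : V ⊗[ℚ] V) :
    kflip (-γ) (-γ) (map γ .id t)
      = -map γ .id (kflip γ γ t) := by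
  refine LinearMap.congr_fun (f := kflip (-γ) (-γ) ∘ₗ map γ .id)
    (g := -(map γ .id ∘ₗ kflip γ γ))
    (tensor_ext hγ hγ fun p q x y hx hy => ?_) t
  have neg : ∀ (p : ZMod 2) (x : V), HasPar γ x p → HasPar (-γ) x (p + 1) := fun p x h =>
    ⟨by rw [LinearMap.neg_apply, h.eq, sgn_add, sgn_one, mul_neg_one, neg_smul]⟩
  have := neg p x hx
  have := neg q y hy
  rw [comp_apply, LinearMap.neg_apply, comp_apply, map_tmul, hx.eq, ← smul_tmul', map_smul,
    id_apply, kflip_tmul_sgn, kflip_tmul_sgn, map_smul, map_tmul, hy.eq, ← smul_tmul', id_apply,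
    smul_smul, smul_smul, ← neg_one_smul ℚ, smul_smul, ← sgn_one, ← sgn_add, ← sgn_add, ← sgn_add]
  congr 2; grind

namespace HomotopyGerstenhaber

variable {v h : V →ₗ[ℚ] V ⊗[ℚ] V} {H : V →ₗ[ℚ] V ⊗[ℚ] (V ⊗[ℚ] V)}
  (𝔥 : HomotopyGerstenhaber γ b v h H)

include 𝔥

theorem γ_bracket (x : V) : map γ γ ((h + kflip γ γ ∘ₗ h) x)
    = -(h + kflip γ γ ∘ₗ h) (γ x) := by
  have e : ∀ t, map γ γ (kflip γ γ t) = kflip γ γ (map γ γ t) := by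
    refine fun t => LinearMap.congr_fun (f := map γ γ ∘ₗ kflip γ γ)
      (g := kflip γ γ ∘ₗ map γ γ) (tensor_ext 𝔥.γ_γ 𝔥.γ_γ fun p q x y hx hy => ?_) t
    rw [comp_apply, comp_apply, kflip_tmul_sgn, map_smul, (HasPar.tmul (γA := γ) (γB := γ) x y).eq,
      (HasPar.tmul (γA := γ) (γB := γ) y x).eq, map_smul, kflip_tmul_sgn, smul_comm, add_comm]
  rw [LinearMap.add_apply, LinearMap.add_apply, map_add, comp_apply, e, 𝔥.γ_h, map_neg, neg_add]
  rfl

theorem b_bracket (x : V) : tb₂ γ b ((h + kflip γ γ ∘ₗ h) x) = -(h + kflip γ γ ∘ₗ h) (b x) := by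
  have e := 𝔥.b_h x
  have e' := congrArg (kflip γ γ) e
  rw [map_sub, kflip_kflip 𝔥.γ_γ, map_add, ← tb₂_kflip 𝔥.γ_γ 𝔥.γ_b] at e'
  rw [LinearMap.add_apply, LinearMap.add_apply, map_add, comp_apply, comp_apply, eq_sub_of_add_eq e,
    eq_sub_of_add_eq e']
  abel

theorem kflip_bracket (x : V) :
    kflip γ γ ((h + kflip γ γ ∘ₗ h) x) = (h + kflip γ γ ∘ₗ h) x := by
  rw [LinearMap.add_apply, map_add, comp_apply, kflip_kflip 𝔥.γ_γ, add_comm]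

/-- The cobracket on the shifted complex is skew-symmetric. -/
theorem skew (x : V) : kflip (-γ) (-γ)
      (map γ .id ((h + kflip γ γ ∘ₗ h) x))
    = -map γ .id ((h + kflip γ γ ∘ₗ h) x) := by
  rw [kflip_neg_γ 𝔥.γ_γ, 𝔥.kflip_bracket]

theorem coJacobi_even (x : V) :
    lft (h + kflip γ γ ∘ₗ h) ((h + kflip γ γ ∘ₗ h) x)
      + kcyc γ (lft (h + kflip γ γ ∘ₗ h) ((h + kflip γ γ ∘ₗ h) x))
      + kcyc γ (kcyc γ (lft (h + kflip γ γ ∘ₗ h) ((h + kflip γ γ ∘ₗ h) x))) = 0 := by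
  set P := lft h (h x) with hP
  set R := map γ h (h x) with hR
  have e : lft (h + kflip γ γ ∘ₗ h) ((h + kflip γ γ ∘ₗ h) x)
      = (P + kcyc γ R) + kswap γ γ V (P + kcyc γ R) := by
    rw [lft_add, lft_kflip_comp, LinearMap.add_apply, comp_apply, map_add (lft h),
      lft_kflip_odd 𝔥.γ_γ 𝔥.γ_h]
  have c3 := kcyc_kcyc_kcyc 𝔥.γ_γ
  have hPR : flipR γ P + flipR γ R = -P - R := by
    rw [← map_add, 𝔥.preLie x, neg_add, sub_eq_add_neg]
  have hPR' : flipR γ R = -P - R - flipR γ P := by rw [← hPR]; abel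
  rw [e]
  simp only [map_add, kswap_eq_kcyc 𝔥.γ_γ, flipR_kcyc 𝔥.γ_γ, c3, hPR', map_sub, map_neg]
  abel

/-- The cobracket on the shifted complex satisfies the co-Jacobi identity. -/
theorem coJacobi (x : V) {S : V →ₗ[ℚ] V ⊗[ℚ] V}
    (hS : S = map γ .id ∘ₗ (h + kflip γ γ ∘ₗ h)) :
    lft S (S x) + kcyc (-γ) (lft S (S x)) + kcyc (-γ) (kcyc (-γ) (lft S (S x))) = 0 := by
  have e := 𝔥.coJacobi_even x
  have e' := congrArg (map .id (map γ .id)) e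
  rw [map_add, map_add, ← kcyc_neg_γ 𝔥.γ_γ, ← kcyc_neg_γ 𝔥.γ_γ, ← kcyc_neg_γ 𝔥.γ_γ, map_zero] at e'
  rw [hS, comp_apply, lft_γ_comp 𝔥.γ_bracket 𝔥.γ_γ, map_neg, map_neg, ← neg_add, ← neg_add, e',
    neg_zero]

/-- The cobracket is a coderivation of the coproduct up to the homotopy `kcyc γ ∘ₗ H`. -/
theorem coderivation (x : V) : lft v ((h + kflip γ γ ∘ₗ h) x)
      - (flipR γ (lft (h + kflip γ γ ∘ₗ h) (v x)) + map γ (h + kflip γ γ ∘ₗ h) (v x))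
    = tb₃ γ b (kcyc γ (H x)) - kcyc γ (H (b x)) := by
  have e : map .id v (h x) = (tb₃ γ b (H x) - H (b x))
      + flipR γ (lft h (kflip γ γ (v x))) + lft h (v x) := by rw [𝔥.b_H]; abel
  rw [LinearMap.add_apply, map_add, 𝔥.coder, comp_apply, lft_kflip_even 𝔥.γ_γ 𝔥.γ_v, e, map_add,
    map_add, map_sub, tb₃_kcyc 𝔥.γ_γ 𝔥.γ_b, lft_kflip_odd 𝔥.γ_γ 𝔥.γ_h, kcyc_flipR_kcyc 𝔥.γ_γ,
    kcyc_eq_flipR_kswap 𝔥.γ_γ (lft h (v x)), ← lft_kflip_comp, flipR_map, lft_add, map_add,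
    map_add_right, LinearMap.add_apply]
  abel

end HomotopyGerstenhaber

end

namespace KModel

/-! #### Naturality -/

section

variable {A A' B B' D D' : Type*} [AddCommGroup A] [Module ℚ A] [AddCommGroup A'] [Module ℚ A']
  [AddCommGroup B] [Module ℚ B] [AddCommGroup B'] [Module ℚ B'] [AddCommGroup D] [Module ℚ D]
  [AddCommGroup D'] [Module ℚ D']

theorem kflip_map {γA : A →ₗ[ℚ] A} {γA' : A' →ₗ[ℚ] A'} {γB : B →ₗ[ℚ] B} {γB' : B' →ₗ[ℚ] B'}
    {f : A →ₗ[ℚ] A'} {g : B →ₗ[ℚ] B'} (hf : ∀ x, γA' (f x) = f (γA x))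
    (hg : ∀ x, γB' (g x) = g (γB x)) (t : A ⊗[ℚ] B) :
    kflip γA' γB' (map f g t) = map g f (kflip γA γB t) := by
  induction t with
  | zero => simp only [map_zero]
  | add s t hs ht => simp only [map_add, hs, ht]
  | tmul x y => simp [kflip, koszul, hf, hg]

theorem kswap_map {γA : A →ₗ[ℚ] A} {γA' : A' →ₗ[ℚ] A'} {γB : B →ₗ[ℚ] B} {γB' : B' →ₗ[ℚ] B'}
    {f : A →ₗ[ℚ] A'} {g : B →ₗ[ℚ] B'} (k : D →ₗ[ℚ] D') (hf : ∀ x, γA' (f x) = f (γA x))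
    (hg : ∀ x, γB' (g x) = g (γB x)) (t : A ⊗[ℚ] (B ⊗[ℚ] D)) :
    kswap γA' γB' D' (map f (map g k) t)
      = map g (map f k) (kswap γA γB D t) := by
  induction t with
  | zero => simp only [map_zero]
  | add s t hs ht => simp only [map_add, hs, ht]
  | tmul x s =>
    induction s with
    | zero => simp only [tmul_zero, map_zero]
    | add s t hs ht => simp only [tmul_add, map_add, hs, ht]
    | tmul y z => simp [kswap, kflip, koszul, hf, hg, add_tmul, sub_tmul, ← smul_tmul']

end

variable {X U X' U' : Type*} [AddCommGroup X] [Module ℚ X] [AddCommGroup U] [Module ℚ U]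
  [AddCommGroup X'] [Module ℚ X'] [AddCommGroup U'] [Module ℚ U']

/-- The map of words induced by a map of letters. -/
def wordMap (f : U →ₗ[ℚ] U') : Wd U →ₗ[ℚ] Wd U' :=
  (TensorAlgebra.lift ℚ (TensorAlgebra.ι ℚ ∘ₗ f)).toLinearMap

/-- The map `g ⊗ T(f)`. -/
abbrev ceMap (g : X →ₗ[ℚ] X') (f : U →ₗ[ℚ] U') : Ce X U →ₗ[ℚ] Ce X' U' :=
  map g (wordMap f)

theorem wordMap_one (f : U →ₗ[ℚ] U') : wordMap f 1 = 1 := by simp [wordMap]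

theorem wordMap_mul (f : U →ₗ[ℚ] U') (u v : Wd U) :
    wordMap f (u * v) = wordMap f u * wordMap f v := by simp [wordMap]

theorem wordMap_ι (f : U →ₗ[ℚ] U') (a : U) :
    wordMap f (TensorAlgebra.ι ℚ a) = TensorAlgebra.ι ℚ (f a) := by simp [wordMap]

theorem wordMap_wordPos (f : U →ₗ[ℚ] U') (u : Wd U) :
    wordPos U' (wordMap f u) = wordMap f (wordPos U u) := by
  refine LinearMap.congr_fun (f := wordPos U' ∘ₗ wordMap f) (g := wordMap f ∘ₗ wordPos U)
    (word_ext (by simp [wordMap_one, wordPos_one]) fun a u _ => ?_) u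
  simp [wordMap_mul, wordMap_ι, wordPos_ι_mul]

theorem wordMap_wordMap {U'' : Type*} [AddCommGroup U''] [Module ℚ U''] (f : U →ₗ[ℚ] U')
    (f' : U' →ₗ[ℚ] U'') (u : Wd U) : wordMap f' (wordMap f u) = wordMap (f' ∘ₗ f) u := by
  refine LinearMap.congr_fun (f := wordMap f' ∘ₗ wordMap f) (g := wordMap (f' ∘ₗ f))
    (word_ext (by simp [wordMap_one]) fun a u h => ?_) u
  rw [comp_apply] at h ⊢
  rw [wordMap_mul, wordMap_mul, wordMap_mul, h, wordMap_ι, wordMap_ι, wordMap_ι]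
  rfl

theorem wordMap_id (u : Wd U) : wordMap LinearMap.id u = u := by
  refine LinearMap.congr_fun (f := wordMap LinearMap.id) (g := LinearMap.id)
    (word_ext (by simp [wordMap_one]) fun a u h => ?_) u
  rw [wordMap_mul, h, wordMap_ι]
  rfl

theorem pos_ceMap (g : X →ₗ[ℚ] X') (f : U →ₗ[ℚ] U') (t : Ce X U) :
    pos X' U' (ceMap g f t) = ceMap g f (pos X U t) := by
  rw [pos, map_map, pos, map_map]
  congr 2
  exact LinearMap.ext (wordMap_wordPos f)

theorem map_wordMap_smul {V V' : Type*} [AddCommGroup V] [Module ℚ V] [AddCommGroup V']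
    [Module ℚ V'] (f : U →ₗ[ℚ] U') (k : V →ₗ[ℚ] V') (w : Wd U) (t : Wd U ⊗[ℚ] V) :
    map (wordMap f) k (w • t)
      = wordMap f w • map (wordMap f) k t := by
  induction t with
  | zero => simp only [smul_zero, map_zero]
  | add s t hs ht => simp only [smul_add, map_add, hs, ht]
  | tmul a b => simp [smul_tmul', wordMap_mul]

theorem wordCut_wordMap (f : U →ₗ[ℚ] U') (u : Wd U) : wordCut U' (wordMap f u)
    = map (wordMap f) (map f (wordMap f)) (wordCut U u) := by
  refine LinearMap.congr_fun (f := wordCut U' ∘ₗ wordMap f) (g := map (wordMap f)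
    (map f (wordMap f)) ∘ₗ wordCut U)
    (word_ext (by simp [wordMap_one, wordCut_one]) fun a u h => ?_) u
  rw [comp_apply, comp_apply] at h ⊢
  rw [wordMap_mul, wordMap_ι, wordCut_ι_mul, wordCut_ι_mul, h, map_add, map_wordMap_smul, wordMap_ι,
    map_tmul, map_tmul, wordMap_one]

/-- A pair of maps which preserves signs and products. -/
structure IsMap (Ψ : KModel X U) (Ψ' : KModel X' U') (g : X →ₗ[ℚ] X') (f : U →ₗ[ℚ] U') :
    Prop where
  γX : ∀ x, Ψ'.γX (g x) = g (Ψ.γX x)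
  γU : ∀ a, Ψ'.γU (f a) = f (Ψ.γU a)
  κ : ∀ a c, Ψ'.κ (f a) (f c) = g (Ψ.κ a c)

namespace IsMap

variable {Ψ : KModel X U} {Ψ' : KModel X' U'} {g g' : X →ₗ[ℚ] X'} {f : U →ₗ[ℚ] U'}
  (φ : IsMap Ψ Ψ' g f)

include φ

theorem γW (u : Wd U) : Ψ'.γW (wordMap f u) = wordMap f (Ψ.γW u) := by
  refine LinearMap.congr_fun (f := Ψ'.γW ∘ₗ wordMap f) (g := wordMap f ∘ₗ Ψ.γW)
    (word_ext (by simp [wordMap_one, wordPar_one]) fun a u h => ?_) u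
  rw [comp_apply, comp_apply] at h ⊢
  rw [wordMap_mul, wordPar_mul, wordPar_mul, wordMap_mul, h, wordMap_ι, wordPar_ι, wordPar_ι,
    wordMap_ι, φ.γU]

theorem γc (hg' : ∀ x, Ψ'.γX (g' x) = g' (Ψ.γX x)) (t : Ce X U) :
    Ψ'.γc (ceMap g' f t) = ceMap g' f (Ψ.γc t) := by
  rw [map_map, map_map]
  congr 2
  · exact LinearMap.ext hg'
  · exact LinearMap.ext φ.γW

theorem Q (a : U) (s : Om U) :
    Ψ'.Q (f a ⊗ₜ map (wordMap f) (map f (wordMap f)) s)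
      = map (ceMap g f) (wordMap f) (Ψ.Q (a ⊗ₜ s)) := by
  simp only [KModel.Q, comp_apply, map_tmul, id_apply, kswap_map (wordMap f) φ.γW φ.γU]
  generalize kswap Ψ.γW Ψ.γU (Wd U) s = t
  induction t with
  | zero => simp only [tmul_zero, map_zero]
  | add s t hs ht => simp only [tmul_add, map_add, hs, ht]
  | tmul c t =>
    induction t with
    | zero => simp only [tmul_zero, map_zero]
    | add s t hs ht => simp only [tmul_add, map_add, hs, ht]
    | tmul M R => simp [φ.κ, wordMap_wordPos]

theorem Qf (a : U) (s : Om U) :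
    Ψ'.Qf (f a) (map (wordMap f) (map f (wordMap f)) s)
      = map (wordMap f) (ceMap g f) (Ψ.Qf a s) := by
  rw [Qf_apply, Qf_apply, φ.Q, kflip_map (φ.γc φ.γX) φ.γW]

theorem N (u : Wd U) :
    Ψ'.N (wordMap f u) = map (wordMap f) (ceMap g f) (Ψ.N u) := by
  refine LinearMap.congr_fun (f := Ψ'.N ∘ₗ wordMap f)
    (g := map (wordMap f) (ceMap g f) ∘ₗ Ψ.N)
    (word_ext (by simp [wordMap_one, N_one]) fun a u h => ?_) u
  rw [comp_apply, comp_apply] at h ⊢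
  rw [wordMap_mul, wordMap_ι, N_lt_mul', N_lt_mul', wordCut_wordMap, φ.Qf, h, map_add,
    map_wordMap_smul, wordMap_ι, φ.γU]

theorem NL (t : Wd U ⊗[ℚ] Ce X U) : Ψ'.NL (map (wordMap f) (ceMap g f) t)
    = map (wordMap f) (map (ceMap g f) (ceMap g f)) (Ψ.NL t) := by
  induction t with
  | zero => simp only [map_zero]
  | add s t hs ht => simp only [map_add, hs, ht]
  | tmul u B =>
    rw [map_tmul, NL_tmul, NL_tmul, φ.N]
    generalize Ψ.N u = n
    induction n with
    | zero => simp only [zero_tmul, map_zero]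
    | add s t hs ht => simp only [add_tmul, map_add, hs, ht]
    | tmul L B' => rfl

theorem N₂ (u : Wd U) : Ψ'.N₂ (wordMap f u)
    = map (wordMap f) (map (ceMap g f) (ceMap g f)) (Ψ.N₂ u) := by
  refine LinearMap.congr_fun (f := Ψ'.N₂ ∘ₗ wordMap f)
    (g := map (wordMap f) (map (ceMap g f) (ceMap g f)) ∘ₗ Ψ.N₂)
    (word_hom_ext Ψ.γU_γU (by simp [wordMap_one, N₂_apply, E_one]) fun p _ a u ha _ h => ?_) u
  rw [comp_apply, comp_apply] at h ⊢
  have : HasPar Ψ'.γU (f a) p := ⟨by rw [φ.γU, ha.eq, map_smul]⟩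
  rw [wordMap_mul, wordMap_ι, N₂_lt_mul, N₂_lt_mul, wordCut_wordMap, φ.Qf, h, map_add,
    map_wordMap_smul, wordMap_ι, φ.NL]
  congr 1
  rw [map_map, map_map]
  congr 2
  exact LinearMap.ext fun t => kflip_map (φ.γc φ.γX) (φ.γc φ.γX) t

theorem h (hg' : ∀ x, Ψ'.γX (g' x) = g' (Ψ.γX x)) (t : Ce X U) :
    Ψ'.h (ceMap g' f t) = map (ceMap g' f) (ceMap g f) (Ψ.h t) := by
  induction t using TensorProduct.induction_on with
  | zero => simp only [map_zero]
  | add s t hs ht => simp only [map_add, hs, ht]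
  | tmul x u =>
    rw [map_tmul, h_tmul, h_tmul, K_eq, K_eq, ← N_apply, ← N_apply, φ.N, hg']
    generalize Ψ.N u = n
    induction n with
    | zero => simp only [tmul_zero, map_zero]
    | add s t hs ht => simp only [tmul_add, map_add, hs, ht]
    | tmul L B' => rfl

theorem H₀ (t : Ce X U) : Ψ'.H₀ (ceMap g' f t)
    = map (ceMap g' f) (map (ceMap g f) (ceMap g f)) (Ψ.H₀ t) := by
  induction t using TensorProduct.induction_on with
  | zero => simp only [map_zero]
  | add s t hs ht => simp only [map_add, hs, ht]
  | tmul x u =>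
    rw [map_tmul, H₀_tmul, H₀_tmul, φ.N₂]
    generalize Ψ.N₂ u = n
    induction n with
    | zero => simp only [tmul_zero, map_zero]
    | add s t hs ht => simp only [tmul_add, map_add, hs, ht]
    | tmul L B' => rfl

theorem hP (hg' : ∀ x, Ψ'.γX (g' x) = g' (Ψ.γX x)) (t : Ce X U) :
    Ψ'.hP (ceMap g' f t) = map (ceMap g' f) (ceMap g f) (Ψ.hP t) := by
  rw [KModel.hP, comp_apply, φ.h hg', KModel.hP, comp_apply, pos₂, pos₂, map_map, map_map]
  congr 2 <;> exact LinearMap.ext (pos_ceMap _ f)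

theorem HP (t : Ce X U) : Ψ'.HP (ceMap g' f t)
    = map (ceMap g' f) (map (ceMap g f) (ceMap g f)) (Ψ.HP t) := by
  rw [KModel.HP, comp_apply, φ.H₀, KModel.HP, comp_apply, pos₃, pos₃, pos₂, pos₂, map_map, map_map,
    ← map_comp, ← map_comp,
    show pos X' U' ∘ₗ ceMap g f = ceMap g f ∘ₗ pos X U from LinearMap.ext (pos_ceMap _ f),
    show pos X' U' ∘ₗ ceMap g' f = ceMap g' f ∘ₗ pos X U from LinearMap.ext (pos_ceMap _ f)]

end IsMap

end KModel

/-! ### The model of an open Frobenius algebra -/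

section

variable {A : Type*} [AddCommGroup A] [Module ℚ A] (F : ℤ → Submodule ℚ A)
  [DirectSum.Decomposition F]

/-- The operator `x ↦ c^|x| x` of an internally graded module. -/
def scale (c : ℚ) : A →ₗ[ℚ] A :=
  DirectSum.toModule ℚ ℤ A (fun i => c ^ i • (F i).subtype) ∘ₗ
    (DirectSum.decomposeLinearEquiv F).toLinearMap

theorem parity_eq_scale : parity F = scale F (-1) := rfl

variable {F}

theorem scale_of_mem (c : ℚ) {i : ℤ} {x : A} (hx : x ∈ F i) : scale F c x = c ^ i • x := by
  rw [scale, comp_apply, LinearEquiv.coe_coe, DirectSum.decomposeLinearEquiv_apply,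
    DirectSum.decompose_of_mem F hx]
  exact DirectSum.toModule_lof ℚ i _

theorem graded_ext {M : Type*} [AddCommGroup M] [Module ℚ M] {f g : A →ₗ[ℚ] M}
    (h : ∀ i, ∀ x ∈ F i, f x = g x) : f = g :=
  LinearMap.ext fun x => DirectSum.Decomposition.inductionOn F (motive := fun x => f x = g x)
    (by simp) (fun x => h _ x x.2) (fun x y hx hy => by rw [map_add, map_add, hx, hy]) x

theorem tdeg_induction {B M : Type*} [AddCommGroup B] [Module ℚ B] [AddCommGroup M] [Module ℚ M]
    {F : ℤ → Submodule ℚ A} {G : ℤ → Submodule ℚ B} {k : ℤ} {f g : A ⊗[ℚ] B →ₗ[ℚ] M}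
    (h : ∀ i, ∀ x ∈ F i, ∀ y ∈ G (k - i), f (x ⊗ₜ y) = g (x ⊗ₜ y)) {t : A ⊗[ℚ] B}
    (ht : t ∈ tdeg F G k) : f t = g t := by
  suffices e : tdeg F G k ≤ LinearMap.eqLocus f g from e ht
  refine iSup_le fun i => ?_
  rintro _ ⟨s, rfl⟩
  induction s with
  | zero => simp
  | add s t hs ht => rw [map_add]; exact add_mem hs ht
  | tmul x y => exact h i x x.2 y y.2

theorem map_scale_of_mem {B : Type*} [AddCommGroup B] [Module ℚ B] {F : ℤ → Submodule ℚ A}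
    {G : ℤ → Submodule ℚ B} {c : ℚ} (hc : c ≠ 0) {f : A →ₗ[ℚ] A} {g : B →ₗ[ℚ] B}
    (hf : ∀ i, ∀ x ∈ F i, f x = c ^ i • x) (hg : ∀ i, ∀ x ∈ G i, g x = c ^ i • x) {k : ℤ}
    {t : A ⊗[ℚ] B} (ht : t ∈ tdeg F G k) : map f g t = c ^ k • t := by
  refine tdeg_induction (g := c ^ k • LinearMap.id) (fun i x hx y hy => ?_) ht
  rw [map_tmul, hf i x hx, hg _ y hy, smul_tmul_smul, ← zpow_add₀ hc, add_sub_cancel]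
  rfl

theorem scale_one (x : A) : scale F 1 x = x :=
  LinearMap.congr_fun (g := LinearMap.id) (graded_ext fun i x hx => by
    rw [scale_of_mem _ hx, one_zpow, one_smul]; rfl) x

theorem scale_scale (c c' : ℚ) (x : A) : scale F c (scale F c' x) = scale F (c * c') x :=
  LinearMap.congr_fun (f := scale F c ∘ₗ scale F c') (graded_ext fun i x hx => by
    rw [comp_apply, scale_of_mem _ hx, map_smul, scale_of_mem _ hx, scale_of_mem _ hx, smul_smul,
      mul_zpow, mul_comm]) x

theorem parity_parity (x : A) : parity F (parity F x) = x := by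
  rw [parity_eq_scale, scale_scale, neg_mul_neg, one_mul, scale_one]

theorem HasPar.of_mem {i : ℤ} {x : A} (hx : x ∈ F i) : HasPar (parity F) x i :=
  ⟨by rw [parity_eq_scale, scale_of_mem _ hx, neg_one_zpow_eq_sgn]⟩

theorem map_neg_left {A' B B' : Type*} [AddCommGroup A'] [Module ℚ A'] [AddCommGroup B] [Module ℚ B]
    [AddCommGroup B'] [Module ℚ B'] (f : A →ₗ[ℚ] A') (g : B →ₗ[ℚ] B') (t : A ⊗[ℚ] B) :
    map (-f) g t = -map f g t := by
  rw [← neg_one_smul ℚ f, map_smul_left, LinearMap.smul_apply, neg_one_smul]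

theorem kflip_smul_smul {V : Type*} [AddCommGroup V] [Module ℚ V] {γ : V →ₗ[ℚ] V}
    (hγ : ∀ x, γ (γ x) = x) (n : ℤ) (t : V ⊗[ℚ] V) :
    kflip ((-1 : ℚ) ^ n • γ) ((-1 : ℚ) ^ n • γ) (map (gpow γ n) .id t)
      = (-1 : ℚ) ^ n • map (gpow γ n) .id (kflip γ γ t) := by
  rcases Int.even_or_odd n with hn | hn
  · simp [gpow, hn, hn.neg_one_zpow]
  · rw [gpow, if_neg (Int.not_even_iff_odd.2 hn), hn.neg_one_zpow, neg_one_smul, neg_one_smul,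
      kflip_neg_γ hγ]

end

namespace OpenFrobenius

variable {C : Type*} [AddCommGroup C] [Module ℚ C] [Coalgebra ℚ C] {m : ℤ}
  {𝒞 : ℤ → Submodule ℚ C} [DirectSum.Decomposition 𝒞] (Φ : OpenFrobenius m 𝒞)

/-- The coproduct. -/
local notation "Δ" => Coalgebra.comul (R := ℚ) (A := C)

/-- The sign operator of `C`. -/
local notation "γ" => parity 𝒞

include Φ in
theorem scale_comul {c : ℚ} (hc : c ≠ 0) (x : C) :
    map (scale 𝒞 c) (scale 𝒞 c) (Δ x) = Δ (scale 𝒞 c x) :=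
  LinearMap.congr_fun (f := map (scale 𝒞 c) (scale 𝒞 c) ∘ₗ Δ)
    (g := Δ ∘ₗ scale 𝒞 c) (graded_ext fun i x hx => by
      rw [comp_apply, comp_apply, scale_of_mem _ hx, map_smul]
      exact map_scale_of_mem hc (fun _ _ => scale_of_mem c) (fun _ _ => scale_of_mem c)
        (Φ.comul_mem i x hx)) x

theorem scale_mul {c : ℚ} (hc : c ≠ 0) (x y : C) :
    Φ.mul (scale 𝒞 c x) (scale 𝒞 c y) = c ^ m • scale 𝒞 c (Φ.mul x y) :=
  LinearMap.congr_fun₂ (f := Φ.mul.compl₁₂ (scale 𝒞 c) (scale 𝒞 c))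
    (g := Φ.mul.compr₂ (c ^ m • scale 𝒞 c)) (graded_ext fun i x hx => graded_ext fun j y hy => by
      rw [LinearMap.compl₁₂_apply, LinearMap.compr₂_apply, LinearMap.smul_apply, scale_of_mem _ hx,
        scale_of_mem _ hy, scale_of_mem _ (Φ.mul_mem i j x hx y hy), map_smul, map_smul,
        LinearMap.smul_apply, smul_smul, smul_smul, ← zpow_add₀ hc, ← zpow_add₀ hc]
      congr 2; ring) x y

include Φ in
theorem counit_scale {c : ℚ} (x : C) :
    Coalgebra.counit (R := ℚ) (scale 𝒞 c x) = Coalgebra.counit (R := ℚ) x :=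
  LinearMap.congr_fun (f := Coalgebra.counit ∘ₗ scale 𝒞 c) (graded_ext fun i x hx => by
    rw [comp_apply, scale_of_mem _ hx, map_smul]
    by_cases hi : i = 0
    · rw [hi, zpow_zero, one_smul]
    · rw [Φ.counit_mem i hi x hx, smul_zero]) x

theorem scale_e (c : ℚ) : scale 𝒞 c Φ.e = Φ.e := by
  rw [scale_of_mem _ Φ.e_mem, zpow_zero, one_smul]

theorem parity_d (x : C) : γ (Φ.d x) = -Φ.d (γ x) :=
  LinearMap.congr_fun (f := γ ∘ₗ Φ.d) (g := -(Φ.d ∘ₗ γ)) (graded_ext fun i x hx => by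
    rw [comp_apply, LinearMap.neg_apply, comp_apply, parity_eq_scale,
      scale_of_mem _ hx, scale_of_mem _ (Φ.d_mem i x hx), map_smul, zpow_sub₀ (by norm_num), zpow_one, div_neg,
      div_one, neg_smul]) x

theorem comul_d (x : C) : Δ (Φ.d x)
    = map Φ.d .id (Δ x) + map γ Φ.d (Δ x) :=
  LinearMap.congr_fun Φ.d_comul x

include Φ in
theorem comul_parity (x : C) : Δ (γ x) = map γ γ (Δ x) :=
  (Φ.scale_comul (c := -1) (by norm_num) x).symm

include Φ in
theorem kflip_comul (x : C) : kflip γ γ (Δ x) = Δ x := LinearMap.congr_fun Φ.cocomm x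

include Φ in
theorem coassoc_parity {c : ℚ} (hc : c * c = 1) (x : C) :
    assoc C C C (map (map (c • γ) .id ∘ₗ Δ)
        LinearMap.id (map (c • γ) .id (Δ x)))
      = -map (c • γ) (map (-γ) .id ∘ₗ Δ)
        (map (c • γ) .id (Δ x)) := by
  have e := congrArg (map .id (map γ .id))
    (Coalgebra.coassoc_apply (R := ℚ) x)
  refine Eq.trans ?_ (e.trans ?_)
  · generalize Δ x = t
    induction t with
    | zero => simp only [map_zero]
    | add s t hs ht => simp only [map_add, hs, ht]
    | tmul y z =>
      rw [map_tmul, map_tmul, LinearMap.rTensor_tmul, comp_apply, LinearMap.smul_apply, map_smul,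
        comul_parity Φ]
      generalize Δ y = t
      induction t with
      | zero => simp only [map_zero, smul_zero, zero_tmul]
      | add s t hs ht => simp only [map_add, smul_add, add_tmul, hs, ht]
      | tmul a b => simp [parity_parity, ← smul_tmul', smul_smul, hc]
  · rw [LinearMap.lTensor, map_map, map_map, eq_neg_iff_add_eq_zero]
    generalize Δ x = t
    induction t with
    | zero => simp only [map_zero, add_zero]
    | add s t hs ht =>
      rw [map_add, map_add, add_add_add_comm, hs, ht, add_zero]
    | tmul y z =>
      simp only [map_tmul, comp_apply, LinearMap.smul_apply, map_smul, smul_smul, hc, one_smul,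
        parity_parity, id_apply]
      rw [map_neg_left, tmul_neg, add_neg_cancel]

theorem d_coact {c : ℚ} (hc : c * c = 1) (x : C) :
    map (c • Φ.d) .id (map (c • γ) .id (Δ x))
      + map (c • γ) (-Φ.d) (map (c • γ) .id (Δ x))
      + map (c • γ) .id (Δ ((c • Φ.d) x)) = 0 := by
  simp only [LinearMap.smul_apply, map_smul, comul_d]
  generalize Δ x = t
  induction t with
  | zero => simp
  | add s t hs ht =>
    simp only [map_add, smul_add] at hs ht ⊢
    rw [← add_zero (0 : C ⊗[ℚ] C)]
    nth_rw 1 [← hs]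
    rw [← ht]
    abel
  | tmul a b =>
    simp only [map_tmul, LinearMap.smul_apply, id_apply, parity_parity, parity_d, ← smul_tmul',
      map_smul, map_add, smul_add, smul_smul, hc, one_smul, neg_tmul, tmul_neg, LinearMap.neg_apply,
      smul_neg]
    abel

/-- The sign `(-1)^(m-1)`. -/
def ε (m : ℤ) : ℚ := (-1 : ℚ) ^ (m - 1)

theorem ε_cases (m : ℤ) : (ε m = 1 ∧ ¬Even m ∧ Even (m - 1)) ∨ (ε m = -1 ∧ Even m ∧ ¬Even (m - 1)) := by
  rcases Int.even_or_odd m with hm | hm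
  · have h : Odd (m - 1) := hm.sub_odd odd_one
    exact Or.inr ⟨h.neg_one_zpow, hm, Int.not_even_iff_odd.2 h⟩
  · have h : Even (m - 1) := hm.sub_odd odd_one
    exact Or.inl ⟨h.neg_one_zpow, Int.not_even_iff_odd.2 hm, h⟩

theorem ε_mul_ε (m : ℤ) : ε m * ε m = 1 := by
  rcases ε_cases m with h | h <;> simp [h.1]

theorem neg_one_zpow_eq (m : ℤ) : (-1 : ℚ) ^ m = -ε m := by
  rw [ε, zpow_sub₀ (by norm_num), zpow_one, div_neg, div_one, neg_neg]

theorem parity_mul (x y : C) : γ (Φ.mul x y) = -ε m • Φ.mul (γ x) (γ y) := by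
  have e := Φ.scale_mul (c := -1) (by norm_num) x y
  rw [parity_eq_scale, e, smul_smul, neg_one_zpow_eq, neg_mul_neg, ε_mul_ε, one_smul]

theorem d_mul_parity (x y : C) :
    Φ.d (Φ.mul x y) = -ε m • (Φ.mul (Φ.d x) y + Φ.mul (γ x) (Φ.d y)) :=
  LinearMap.congr_fun (f := Φ.d ∘ₗ Φ.mul.flip y)
    (g := -ε m • (Φ.mul.flip y ∘ₗ Φ.d + Φ.mul.flip (Φ.d y) ∘ₗ γ)) (graded_ext fun i x hx => by
      rw [comp_apply, LinearMap.flip_apply, Φ.d_mul i x hx, neg_one_zpow_eq, LinearMap.smul_apply,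
        LinearMap.add_apply, comp_apply, comp_apply, LinearMap.flip_apply, LinearMap.flip_apply,
        parity_eq_scale, scale_of_mem _ hx, map_smul, LinearMap.smul_apply]) x

theorem mul_flip (a c : C) :
    TensorProduct.lift (Φ.mul ∘ₗ γ) (kflip (-γ) (-γ) (a ⊗ₜ c)) = ε m • Φ.mul (γ a) c := by
  refine LinearMap.congr_fun₂ (f := (TensorProduct.mk ℚ C C).compr₂
    (TensorProduct.lift (Φ.mul ∘ₗ γ) ∘ₗ kflip (-γ) (-γ))) (g := ε m • Φ.mul ∘ₗ γ)
    (graded_ext (F := 𝒞) fun i a ha => graded_ext (F := 𝒞) fun j c hc => ?_) a c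
  have h1 := HasPar.of_mem ha
  have h2 := HasPar.of_mem hc
  have h3 : HasPar (-γ) a (i + 1) :=
    ⟨by rw [LinearMap.neg_apply, h1.eq, sgn_add, sgn_one, mul_neg_one, neg_smul]⟩
  have h4 : HasPar (-γ) c (j + 1) :=
    ⟨by rw [LinearMap.neg_apply, h2.eq, sgn_add, sgn_one, mul_neg_one, neg_smul]⟩
  rw [LinearMap.compr₂_apply, comp_apply, mk_apply, kflip_tmul_sgn, map_smul,
    TensorProduct.lift.tmul, comp_apply, LinearMap.smul_apply, LinearMap.smul_apply, comp_apply,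
    h1.eq, h2.eq, map_smul, map_smul, LinearMap.smul_apply, LinearMap.smul_apply,
    Φ.mul_comm i j a ha c hc, neg_one_zpow_eq_sgn, ε, neg_one_zpow_eq_sgn]
  simp only [smul_smul, ← sgn_add]
  push_cast
  congr 2; grind

theorem comul_mul_right (x y : C) : map .id (Φ.mul.flip y) (Δ x)
    = map (gpow γ m) .id (Δ (Φ.mul x y)) := by
  rw [Φ.frob_right, map_map]
  congr 2
  refine (LinearMap.ext fun z => ?_).symm
  rcases ε_cases m with h | h <;> simp [gpow, h.2.1, parity_parity]

theorem kflip_γ_neg {V : Type*} [AddCommGroup V] [Module ℚ V] {g : V →ₗ[ℚ] V}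
    (hg : ∀ x, g (g x) = x) (t : V ⊗[ℚ] V) :
    kflip g (-g) (map g .id t) = kflip g g t := by
  induction t with
  | zero => simp only [map_zero]
  | add s t hs ht => simp only [map_add, hs, ht]
  | tmul x y =>
    simp only [kflip, koszul, comp_apply, LinearMap.smul_apply, LinearMap.sub_apply,
      LinearMap.add_apply, map_tmul, id_apply, LinearMap.neg_apply, hg, tmul_neg]
    congr 2; abel

theorem coact_mul_left (a b : C) :
    kflip (ε m • γ) (-γ) (map (ε m • γ) .id (Δ (ε m • Φ.mul (γ a) b)))
      = map (-γ) ((ε m • Φ.mul ∘ₗ γ).flip b)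
        (map (-γ) .id (Δ a)) := by
  have key : ∀ t : C ⊗[ℚ] C, kflip (ε m • γ) (-γ) (map γ .id t)
      = ε m • map (gpow γ (m - 1)) LinearMap.id (kflip γ γ t) := by
    intro t
    rcases ε_cases m with h | h
    · rw [h.1, one_smul, one_smul, kflip_γ_neg parity_parity, gpow, if_pos h.2.2,
        TensorProduct.map_id]
      rfl
    · rw [h.1, neg_one_smul, neg_one_smul, kflip_neg_γ parity_parity, gpow, if_neg h.2.2]
  rw [map_smul_left, LinearMap.smul_apply, map_smul, map_smul, map_smul, map_smul, smul_smul,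
    ε_mul_ε, one_smul, key, kflip_comul Φ, Φ.frob_right, comul_parity Φ]
  generalize Δ a = t
  induction t with
  | zero => simp only [map_zero, smul_zero]
  | add s t hs ht => simp only [map_add, smul_add, hs, ht]
  | tmul y z =>
    rcases ε_cases m with h | h <;>
      simp [gpow, h.1, h.2.1, h.2.2, parity_parity, tmul_neg]

theorem coact_symm (x a : C) :
    kflip (ε m • γ) (ε m • γ) (map (ε m • γ) ((ε m • Φ.mul ∘ₗ γ).flip a)
        (map (ε m • γ) .id (Δ x)))
      = map (ε m • γ) (TensorProduct.lift (ε m • Φ.mul ∘ₗ γ) ∘ₗ kflip (-γ) (-γ) ∘ₗ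
          (TensorProduct.mk ℚ C C).flip a) (map (ε m • γ) .id (Δ x)) := by
  have γγ : (ε m • γ) ∘ₗ (ε m • γ) = (LinearMap.id : C →ₗ[ℚ] C) := LinearMap.ext fun x => by
    simp [parity_parity, smul_smul, ε_mul_ε]
  have e1 : map .id ((ε m • Φ.mul ∘ₗ γ).flip a) (Δ x)
      = ε m • map (gpow γ (m - 1)) LinearMap.id (Δ (Φ.mul (γ x) a)) := by
    have e := congrArg (map γ .id) (Φ.comul_mul_right (γ x) a)
    rw [map_map, map_map, show γ ∘ₗ gpow γ m = gpow γ (m - 1) from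
      LinearMap.ext fun x => by
        rcases ε_cases m with h | h <;> simp [gpow, h.2.1, h.2.2, parity_parity]] at e
    simp only [LinearMap.comp_id, LinearMap.id_comp] at e
    rw [← e, comul_parity Φ]
    generalize Δ x = t
    induction t with
    | zero => simp only [map_zero, smul_zero]
    | add s t hs ht => simp only [map_add, smul_add, hs, ht]
    | tmul y z => simp [parity_parity]
  have e2 : TensorProduct.lift (ε m • Φ.mul ∘ₗ γ) ∘ₗ kflip (-γ) (-γ) ∘ₗ
      (TensorProduct.mk ℚ C C).flip a = ε m • (ε m • Φ.mul ∘ₗ γ).flip a := by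
    refine LinearMap.ext fun z => ?_
    have e := Φ.mul_flip z a
    simp only [comp_apply, LinearMap.flip_apply, mk_apply, LinearMap.smul_apply]
    rw [← e, ← LinearMap.smul_apply]
    congr 1
    exact TensorProduct.ext' fun _ _ => rfl
  rw [e2, map_map, map_map, γγ, LinearMap.comp_id, LinearMap.comp_id, map_smul_right,
    LinearMap.smul_apply, e1, map_smul, ε, kflip_smul_smul parity_parity, kflip_comul Φ]

/-- The model of an open Frobenius algebra. -/
def model : KModel C C where
  γX := ε m • γ
  γU := -γ
  dX := ε m • Φ.d
  dU := -Φ.d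
  δ := map (ε m • γ) .id ∘ₗ Δ
  ς := map (-γ) .id ∘ₗ Δ
  κ := ε m • Φ.mul ∘ₗ γ
  γX_γX x := by simp [parity_parity, smul_smul, ε_mul_ε]
  γU_γU x := by simp [parity_parity]
  γX_dX x := by simp [parity_d]
  γU_dU x := by simp [parity_d]
  γ_δ x := by
    simp only [comp_apply, LinearMap.smul_apply, map_smul, comul_parity Φ]
    generalize Δ x = t
    induction t with
    | zero => simp
    | add s t hs ht => simp only [map_add, smul_add, neg_add, hs, ht]
    | tmul a b => simp [parity_parity, ← smul_tmul', tmul_neg]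
  γ_ς x := by
    simp only [comp_apply, LinearMap.neg_apply, map_neg, comul_parity Φ]
    generalize Δ x = t
    induction t with
    | zero => simp
    | add s t hs ht => simp only [map_add, neg_add, hs, ht]
    | tmul a b => simp [parity_parity, tmul_neg, neg_tmul]
  γ_κ a b := by simp [parity_mul, parity_parity, smul_smul, ε_mul_ε]
  dX_dX x := by simp [Φ.d_d]
  dU_dU x := by simp [Φ.d_d]
  d_δ x := Φ.d_coact (ε_mul_ε m) x
  d_ς x := by
    have e := Φ.d_coact (c := -1) (by norm_num) x
    rwa [neg_one_smul, neg_one_smul] at e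
  d_κ a b := by
    simp [d_mul_parity, parity_parity, parity_d, smul_smul, ε_mul_ε]
  coassoc_δ x := Φ.coassoc_parity (ε_mul_ε m) x
  coassoc_ς x := by
    have e := Φ.coassoc_parity (c := -1) (by norm_num) x
    rwa [neg_one_smul] at e
  anti_ς x := by
    rw [comp_apply, map_neg_left, map_neg, kflip_neg_γ parity_parity, kflip_comul Φ]
  frob_right a b := by
    simp only [comp_apply, LinearMap.smul_apply, map_smul, Φ.frob_left]
    generalize Δ b = t
    induction t with
    | zero => simp
    | add s t hs ht => simp only [map_add, smul_add, neg_add, hs, ht]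
    | tmul y z =>
      simp [parity_parity, parity_mul, ← smul_tmul', smul_smul, neg_tmul, ε_mul_ε]
  frob_left a b := Φ.coact_mul_left a b
  symm x a := Φ.coact_symm x a

end OpenFrobenius

namespace OpenFrobenius

variable {C : Type*} [AddCommGroup C] [Module ℚ C] [Coalgebra ℚ C] {m : ℤ}
  {𝒞 : ℤ → Submodule ℚ C} [DirectSum.Decomposition 𝒞] (Φ : OpenFrobenius m 𝒞)

local notation "Δ" => Coalgebra.comul (R := ℚ) (A := C)

local notation "γ" => parity 𝒞

theorem incl_proj (x : C) : incl (Φ.proj x) = x - Coalgebra.counit (R := ℚ) x • Φ.e := rfl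

theorem incl_injective : Function.Injective (incl (C := C)) := Subtype.val_injective

theorem proj_incl (a : Cbar C) : Φ.proj (incl a) = a :=
  incl_injective (by
    rw [incl_proj, show Coalgebra.counit (R := ℚ) (incl a) = 0 from a.2, zero_smul, sub_zero])

theorem incl_γbar (a : Cbar C) : incl (Φ.γbar a) = γ (incl a) := by
  rw [γbar, comp_apply, comp_apply, incl_proj, parity_eq_scale, counit_scale Φ,
    show Coalgebra.counit (R := ℚ) (incl a) = 0 from a.2, zero_smul, sub_zero]

theorem γbar_γbar (a : Cbar C) : Φ.γbar (Φ.γbar a) = a :=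
  incl_injective (by rw [incl_γbar, incl_γbar, parity_parity])

/-- The model with letters in `C̄` and only the product. -/
def barModel : KModel C (Cbar C) where
  γX := ε m • γ
  γU := -Φ.γbar
  dX := 0
  dU := 0
  δ := 0
  ς := 0
  κ := (ε m • Φ.mul ∘ₗ γ).compl₁₂ incl incl
  γX_γX x := by simp [parity_parity, smul_smul, ε_mul_ε]
  γU_γU x := by simp [γbar_γbar]
  γX_dX x := by simp
  γU_dU x := by simp
  γ_δ x := by simp
  γ_ς x := by simp
  γ_κ a b := by
    simp only [LinearMap.compl₁₂_apply, map_neg, LinearMap.neg_apply, neg_neg, incl_γbar]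
    exact (Φ.model.γ_κ (incl a) (incl b)).trans (by simp [model])
  dX_dX x := by simp
  dU_dU x := by simp
  d_δ x := by simp
  d_ς x := by simp
  d_κ a b := by simp
  coassoc_δ x := by simp
  coassoc_ς x := by simp
  anti_ς x := by simp
  frob_right a b := by simp
  frob_left a b := by simp
  symm x a := by simp

theorem isMap_incl : KModel.IsMap Φ.barModel Φ.model LinearMap.id incl where
  γX _ := rfl
  γU a := (congrArg Neg.neg (Φ.incl_γbar a).symm).trans (map_neg (incl (C := C)) _).symm
  κ _ _ := rfl

/-- The inclusion of the complex into the complex with letters in `C`. -/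
def emb (C : Type*) [AddCommGroup C] [Module ℚ C] [Coalgebra ℚ C] : Cell C →ₗ[ℚ] KModel.Ce C C :=
  KModel.ceMap LinearMap.id incl

theorem emb_tmul (x : C) (u : Word C) : emb C (x ⊗ₜ u) = x ⊗ₜ KModel.wordMap incl u := rfl

theorem ceMap_proj_emb (t : Cell C) : KModel.ceMap LinearMap.id Φ.proj (emb C t) = t := by
  rw [emb, map_map, LinearMap.comp_id, show KModel.wordMap Φ.proj ∘ₗ
    KModel.wordMap incl = LinearMap.id from LinearMap.ext fun u => by
      rw [comp_apply, KModel.wordMap_wordMap,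
        show Φ.proj ∘ₗ incl = LinearMap.id from LinearMap.ext Φ.proj_incl, KModel.wordMap_id]
      rfl, TensorProduct.map_id]
  rfl

theorem γs_eq : Φ.γs = Φ.barModel.γc := (map_smul_left _ _ _).symm

theorem emb_γs (t : Cell C) : Φ.model.γc (emb C t) = emb C (Φ.γs t) := by
  rw [γs_eq]
  exact Φ.isMap_incl.γc (g' := LinearMap.id) (fun _ => rfl) t

theorem cut_eq (u : Word C) : cut u = wordCut (Cbar C) u := by
  refine LinearMap.congr_fun (f := cut) (g := wordCut (Cbar C))
    (word_ext (by rw [cut_one, wordCut_one]) fun a u h => ?_) u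
  rw [cut_letter_mul, wordCut_ι_mul, h]
  rfl

/-! #### The differential -/

theorem comul_counit (x : C) : TensorProduct.rid ℚ C
    (map .id Coalgebra.counit (Δ x)) = x := by
  have e := Coalgebra.lTensor_counit_comul (R := ℚ) x
  rw [LinearMap.lTensor] at e
  rw [e, TensorProduct.rid_tmul, one_smul]

theorem counit_comul (x : C) : TensorProduct.lid ℚ C
    (map Coalgebra.counit .id (Δ x)) = x := by
  have e := Coalgebra.rTensor_counit_comul (R := ℚ) x
  rw [LinearMap.rTensor] at e
  rw [e, TensorProduct.lid_tmul, one_smul]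

theorem sp_ς (a : Cbar C) : KModel.sp (Φ.model.ς (incl a))
    = KModel.wordMap incl (Φ.splitLetter a) - KModel.lt Φ.e * KModel.lt (incl a)
      - KModel.lt (γ (incl a)) * KModel.lt Φ.e := by
  have key : ∀ t : C ⊗[ℚ] C, KModel.sp (map (-γ) .id t)
      = KModel.wordMap incl (LinearMap.mul' ℚ (Word C) (map
          (letter ∘ₗ (-Φ.γbar) ∘ₗ Φ.proj) (letter ∘ₗ Φ.proj) t))
        - KModel.lt Φ.e * KModel.lt (TensorProduct.lid ℚ C
          (map Coalgebra.counit .id t))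
        - KModel.lt (γ (TensorProduct.rid ℚ C
          (map .id Coalgebra.counit t))) * KModel.lt Φ.e
        + (TensorProduct.lid ℚ ℚ (map Coalgebra.counit Coalgebra.counit t)) •
          (KModel.lt Φ.e * KModel.lt Φ.e) := by
    intro t
    induction t with
    | zero => simp
    | add s t hs ht => simp only [map_add, hs, ht, mul_add, add_mul, add_smul]; abel
    | tmul y z =>
      simp only [map_tmul, KModel.sp_tmul, LinearMap.mul'_apply, comp_apply, KModel.wordMap_mul,
        letter, KModel.wordMap_ι, LinearMap.neg_apply, map_neg, incl_γbar, incl_proj, map_sub,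
        map_smul, parity_eq_scale, scale_e, TensorProduct.lid_tmul, TensorProduct.rid_tmul,
        id_apply, neg_mul, sub_mul, mul_sub, smul_mul_assoc, mul_smul_comm, smul_sub, smul_smul,
        smul_eq_mul]
      rw [_root_.mul_comm (Coalgebra.counit (R := ℚ) z)]
      abel
  have e : TensorProduct.lid ℚ ℚ (map Coalgebra.counit Coalgebra.counit
      (Δ (incl a))) = 0 := by
    have h := congrArg (Coalgebra.counit (R := ℚ)) (comul_counit (incl a))
    rw [show Coalgebra.counit (R := ℚ) (incl a) = 0 from a.2] at h
    rw [← h]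
    generalize Δ (incl a) = t
    induction t with
    | zero => simp
    | add s t hs ht => simp only [map_add, hs, ht]
    | tmul y z => simp [_root_.mul_comm]
  rw [model, comp_apply, key, counit_comul, comul_counit, e, zero_smul, add_zero]
  rfl

theorem D_wordMap (u : Word C) : Φ.model.D (KModel.wordMap incl u)
    = KModel.wordMap incl (oddDer Φ.γword (-(letter ∘ₗ Φ.proj ∘ₗ Φ.d ∘ₗ incl)) u
        + oddDer Φ.γword Φ.splitLetter u) - KModel.lt Φ.e * KModel.wordMap incl u
      + Φ.model.γW (KModel.wordMap incl u) * KModel.lt Φ.e := by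
  refine LinearMap.congr_fun (f := Φ.model.D ∘ₗ KModel.wordMap incl) (g := KModel.wordMap incl ∘ₗ
    (oddDer Φ.γword (-(letter ∘ₗ Φ.proj ∘ₗ Φ.d ∘ₗ incl)) + oddDer Φ.γword Φ.splitLetter)
    - LinearMap.mulLeft ℚ (KModel.lt Φ.e) ∘ₗ KModel.wordMap incl
    + LinearMap.mulRight ℚ (KModel.lt Φ.e) ∘ₗ Φ.model.γW ∘ₗ KModel.wordMap incl)
    (word_ext ?_ fun a u h => ?_) u
  · simp [KModel.wordMap_one, KModel.D_one, wordPar_one, oddDer_one]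
  · have hd : incl (Φ.proj (Φ.d (incl a))) = Φ.d (incl a) := by
      rw [incl_proj, Φ.d_counit, zero_smul, sub_zero]
    have hγ : Φ.γword (letter a) = letter (-Φ.γbar a) := wordPar_ι (-Φ.γbar) a
    have hγ' : KModel.lt (Φ.model.γU (incl a)) = -KModel.lt (γ (incl a)) := map_neg KModel.lt _
    have hd' : KModel.lt (Φ.model.dU (incl a)) = -KModel.lt (Φ.d (incl a)) := map_neg KModel.lt _
    simp only [comp_apply, LinearMap.add_apply, LinearMap.sub_apply, LinearMap.mulLeft_apply,
      LinearMap.mulRight_apply] at h ⊢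
    rw [oddDer_letter_mul, oddDer_letter_mul, KModel.wordMap_mul, KModel.D_mul, KModel.wordMap_ι,
      KModel.D_lt, wordPar_mul, wordPar_ι, h, KModel.dl_apply, sp_ς, hγ, hγ', hd']
    simp only [map_add, KModel.wordMap_mul, LinearMap.neg_apply, comp_apply, map_neg, letter,
      KModel.wordMap_ι, hd, incl_γbar]
    simp only [add_mul, mul_add, sub_mul, mul_sub, neg_mul, _root_.mul_assoc]
    abel

/-- The part of the differential which moves a letter from `C` to either end of the word. -/
theorem ins_emb (x : C) (u : Word C) :
    KModel.insL (Φ.model.δ x ⊗ₜ KModel.wordMap incl u)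
        - Φ.model.insR (Φ.model.δ x ⊗ₜ KModel.wordMap incl u)
      = emb C (ε m • (map .id (LinearMap.mul' ℚ (Word C)) (Φ.pull (x ⊗ₜ u))
          - map .id
            (LinearMap.mul' ℚ (Word C) ∘ₗ kflip Φ.γword Φ.γword) (Φ.pull (x ⊗ₜ u))))
        + Φ.model.γX x ⊗ₜ (KModel.lt Φ.e * KModel.wordMap incl u
          - Φ.model.γW (KModel.wordMap incl u) * KModel.lt Φ.e) := by
  have he : ∀ w : KModel.Wd C, kflip (-γ) Φ.model.γW (Φ.e ⊗ₜ w) = Φ.model.γW w ⊗ₜ Φ.e := by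
    intro w
    simp only [kflip, koszul, comp_apply, LinearMap.smul_apply, LinearMap.sub_apply,
      LinearMap.add_apply, map_tmul, id_apply, LinearMap.neg_apply, parity_eq_scale, scale_e,
      neg_tmul, map_smul, map_sub, map_add, map_neg, LinearEquiv.coe_coe, TensorProduct.comm_tmul]
    module
  have hγ : ∀ y : Word C, Φ.model.γW (KModel.wordMap incl y) = KModel.wordMap incl (Φ.γword y) :=
    Φ.isMap_incl.γW
  have hfl : ∀ (y : Cbar C), map .id KModel.lt
      (kflip (-γ) Φ.model.γW (incl y ⊗ₜ KModel.wordMap incl u))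
      = map (KModel.wordMap incl) (KModel.wordMap incl)
        (kflip Φ.γword Φ.γword (letter y ⊗ₜ u)) := by
    intro y
    have e1 := KModel.kflip_map (γA := -Φ.γbar) (γA' := Φ.γword) (γB := Φ.γword) (γB' := Φ.γword)
      (f := letter) (g := LinearMap.id) (wordPar_ι (-Φ.γbar)) (fun _ => rfl) (y ⊗ₜ u)
    have e2 := KModel.kflip_map (γA := -Φ.γbar) (γA' := -γ) (γB := Φ.γword) (γB' := Φ.model.γW)
      (f := incl) (g := KModel.wordMap incl) Φ.isMap_incl.γU hγ (y ⊗ₜ u)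
    rw [map_tmul] at e1 e2
    rw [e2, id_apply] at *
    rw [e1, map_map, map_map]
    congr 2
    exact LinearMap.ext fun a => (KModel.wordMap_ι incl a).symm
  have key : ∀ t : C ⊗[ℚ] C,
      KModel.insL (map (ε m • γ) .id t ⊗ₜ KModel.wordMap incl u)
        - Φ.model.insR (map (ε m • γ) .id t ⊗ₜ KModel.wordMap incl u)
      = emb C (ε m • (map .id (LinearMap.mul' ℚ (Word C))
            (assoc C (Word C) (Word C)
              (map γ (letter ∘ₗ Φ.proj) t ⊗ₜ u))
          - map .id
            (LinearMap.mul' ℚ (Word C) ∘ₗ kflip Φ.γword Φ.γword)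
            (assoc C (Word C) (Word C)
              (map γ (letter ∘ₗ Φ.proj) t ⊗ₜ u))))
        + (ε m • γ) (TensorProduct.rid ℚ C (map .id Coalgebra.counit t)) ⊗ₜ
          (KModel.lt Φ.e * KModel.wordMap incl u
            - Φ.model.γW (KModel.wordMap incl u) * KModel.lt Φ.e) := by
    intro t
    induction t with
    | zero => simp
    | add s t hs ht =>
      simp only [map_add, add_tmul, smul_add, smul_sub, map_sub, add_sub_add_comm, hs,
        ht] at hs ht ⊢
      abel
    | tmul y z =>
      have hm : ∀ s : Word C ⊗[ℚ] Word C, KModel.wordMap incl (LinearMap.mul' ℚ _ s)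
          = LinearMap.mul' ℚ _ (map (KModel.wordMap (incl (C := C)))
            (KModel.wordMap incl) s) := by
        intro s
        induction s with
        | zero => simp
        | add s t hs ht => simp only [map_add, hs, ht]
        | tmul y z => simp [KModel.wordMap_mul]
      have hz : z = incl (Φ.proj z) + Coalgebra.counit (R := ℚ) z • Φ.e := by
        rw [incl_proj, sub_add_cancel]
      have hR : ∀ z' : C, Φ.model.insR (((ε m • γ) y ⊗ₜ z') ⊗ₜ KModel.wordMap incl u)
          = (ε m • γ) y ⊗ₜ (LinearMap.mul' ℚ _ (map .id KModel.lt
            (kflip (-γ) Φ.model.γW (z' ⊗ₜ KModel.wordMap incl u)))) := fun z' => rfl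
      rw [map_tmul, id_apply, KModel.insL_tmul, hR]
      conv_lhs => rw [hz]
      simp only [map_tmul, assoc_tmul, comp_apply, id_apply, map_smul, map_sub, emb_tmul, hm, ← hfl,
        LinearMap.mul'_apply, KModel.wordMap_mul, letter, KModel.wordMap_ι, map_add, add_tmul,
        ← smul_tmul', he, TensorProduct.rid_tmul, add_mul, smul_mul_assoc, tmul_add, tmul_sub,
        tmul_smul, smul_sub, smul_add, LinearMap.smul_apply]
      abel
  have e := key (Δ x)
  rw [comul_counit] at e
  exact e

theorem b_emb (t : Cell C) : Φ.model.b (emb C t) = emb C ((Φ.bIntS + Φ.bExtS) t) := by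
  induction t using TensorProduct.induction_on with
  | zero => simp only [map_zero]
  | add s t hs ht => simp only [map_add, hs, ht]
  | tmul x u =>
    rw [emb_tmul, KModel.b_tmul, add_sub_assoc, ins_emb, D_wordMap, LinearMap.add_apply, bIntS,
      bExtS, LinearMap.smul_apply, LinearMap.smul_apply, bInt, bExt, ← ε]
    simp only [LinearMap.add_apply, LinearMap.sub_apply, comp_apply, map_tmul, map_add, map_sub,
      map_smul, smul_add, smul_sub, emb_tmul, tmul_add, tmul_sub, id_apply]
    simp only [model, LinearMap.smul_apply, ← smul_tmul']
    abel

end OpenFrobenius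

section

variable {V W : Type*} [AddCommGroup V] [Module ℚ V] [AddCommGroup W] [Module ℚ W]
  {γ b : V →ₗ[ℚ] V} {γ' b' : W →ₗ[ℚ] W} {J : V →ₗ[ℚ] W}

theorem tb₂_map (hγ : ∀ x, γ' (J x) = J (γ x)) (hb : ∀ x, b' (J x) = J (b x)) (t : V ⊗[ℚ] V) :
    tb₂ γ' b' (map J J t) = map J J (tb₂ γ b t) := by
  induction t with
  | zero => simp only [map_zero]
  | add s t hs ht => simp only [map_add, hs, ht]
  | tmul x y => simp only [map_tmul, tb₂_tmul, map_add, hγ, hb]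

theorem tb₃_map (hγ : ∀ x, γ' (J x) = J (γ x)) (hb : ∀ x, b' (J x) = J (b x))
    (t : V ⊗[ℚ] (V ⊗[ℚ] V)) : tb₃ γ' b' (map J (map J J) t)
      = map J (map J J) (tb₃ γ b t) := by
  induction t with
  | zero => simp only [map_zero]
  | add s t hs ht => simp only [map_add, hs, ht]
  | tmul x y => simp only [map_tmul, tb₃_tmul, map_add, hγ, hb, tb₂_map hγ hb]

theorem assoc_map {A A' B B' D D' : Type*} [AddCommGroup A] [Module ℚ A] [AddCommGroup A']
    [Module ℚ A'] [AddCommGroup B] [Module ℚ B] [AddCommGroup B'] [Module ℚ B'] [AddCommGroup D]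
    [Module ℚ D] [AddCommGroup D'] [Module ℚ D'] (f : A →ₗ[ℚ] A') (g : B →ₗ[ℚ] B')
    (k : D →ₗ[ℚ] D') (t : (A ⊗[ℚ] B) ⊗[ℚ] D) :
    assoc A' B' D' (map (map f g) k t)
      = map f (map g k) (assoc A B D t) :=
  LinearMap.congr_fun (f := (assoc A' B' D').toLinearMap ∘ₗ
    map (map f g) k) (g := map f (map g k) ∘ₗ
      (assoc A B D).toLinearMap)
    (TensorProduct.ext_threefold fun _ _ _ => rfl) t

theorem lft_map {φ : V →ₗ[ℚ] V ⊗[ℚ] V} {φ' : W →ₗ[ℚ] W ⊗[ℚ] W}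
    (h : ∀ x, φ' (J x) = map J J (φ x)) (t : V ⊗[ℚ] V) :
    lft φ' (map J J t) = map J (map J J) (lft φ t) := by
  rw [lft, comp_apply, map_map, lft, comp_apply, LinearEquiv.coe_coe, LinearEquiv.coe_coe,
    ← assoc_map, map_map, show φ' ∘ₗ J = map J J ∘ₗ φ from LinearMap.ext h, LinearMap.id_comp,
    LinearMap.comp_id]

theorem rgt_map {φ : V →ₗ[ℚ] V ⊗[ℚ] V} {φ' : W →ₗ[ℚ] W ⊗[ℚ] W} {f : V →ₗ[ℚ] V} {f' : W →ₗ[ℚ] W}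
    (hf : ∀ x, f' (J x) = J (f x)) (h : ∀ x, φ' (J x) = map J J (φ x))
    (t : V ⊗[ℚ] V) : map f' φ' (map J J t)
      = map J (map J J) (map f φ t) := by
  rw [map_map, map_map, show φ' ∘ₗ J = map J J ∘ₗ φ from LinearMap.ext h,
    show f' ∘ₗ J = J ∘ₗ f from LinearMap.ext hf]

theorem flipR_cube_map (hγ : ∀ x, γ' (J x) = J (γ x)) (t : V ⊗[ℚ] (V ⊗[ℚ] V)) :
    flipR γ' (map J (map J J) t)
      = map J (map J J) (flipR γ t) := by
  rw [flipR, flipR, map_map, map_map,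
    show kflip γ' γ' ∘ₗ map J J = map J J ∘ₗ kflip γ γ from LinearMap.ext (KModel.kflip_map hγ hγ)]
  rfl

/-- Restriction of the structure to a subcomplex. -/
theorem HomotopyGerstenhaber.of_leftInverse {v h : V →ₗ[ℚ] V ⊗[ℚ] V}
    {H : V →ₗ[ℚ] V ⊗[ℚ] (V ⊗[ℚ] V)} {v' h' : W →ₗ[ℚ] W ⊗[ℚ] W} {H' : W →ₗ[ℚ] W ⊗[ℚ] (W ⊗[ℚ] W)}
    (𝔥 : HomotopyGerstenhaber γ' b' v' h' H') {R : W →ₗ[ℚ] V} (hR : ∀ x, R (J x) = x)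
    (hγ : ∀ x, γ' (J x) = J (γ x)) (hb : ∀ x, b' (J x) = J (b x))
    (hv : ∀ x, v' (J x) = map J J (v x))
    (hh : ∀ x, h' (J x) = map J J (h x))
    (hH : ∀ x, H' (J x) = map J (map J J) (H x)) :
    HomotopyGerstenhaber γ b v h H := by
  have hRJ : R ∘ₗ J = LinearMap.id := LinearMap.ext hR
  have i₁ : Function.Injective J := Function.LeftInverse.injective hR
  have i₂ : Function.Injective (map J J) :=
    Function.LeftInverse.injective (g := map R R) fun t => by
      rw [map_map, hRJ, TensorProduct.map_id, id_apply]
  have i₃ : Function.Injective (map J (map J J)) :=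
    Function.LeftInverse.injective (g := map R (map R R)) fun t => by
      rw [map_map, ← map_comp, hRJ, TensorProduct.map_id, TensorProduct.map_id, id_apply]
  have fl := KModel.kflip_map hγ hγ
  have hγγ : ∀ t, map γ' γ' (map J J t)
      = map J J (map γ γ t) := fun t => by
    rw [map_map, map_map, show γ' ∘ₗ J = J ∘ₗ γ from LinearMap.ext hγ]
  have lv := lft_map hv
  have lh := lft_map hh
  have rh := rgt_map hγ hh
  have rv := rgt_map (J := J) (f := LinearMap.id) (f' := LinearMap.id) (fun _ => rfl) hv
  exact
    { γ_γ x := i₁ (by rw [← hγ, ← hγ, 𝔥.γ_γ])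
      γ_b x := i₁ (by rw [← hγ, ← hb, 𝔥.γ_b, map_neg, ← hb, hγ])
      γ_v x := i₂ (by rw [← hγγ, ← hv, 𝔥.γ_v, ← hv, hγ])
      γ_h x := i₂ (by rw [← hγγ, ← hh, 𝔥.γ_h, map_neg, ← hh, hγ])
      b_b x := i₁ (by rw [← hb, ← hb, 𝔥.b_b, map_zero])
      b_v x := i₂ (by rw [← tb₂_map hγ hb, ← hv, 𝔥.b_v, ← hv, hb])
      b_h x := i₂ (by rw [map_add, ← tb₂_map hγ hb, ← hh, ← hh, ← hb, 𝔥.b_h, hv, fl, map_sub])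
      coassoc x := i₃ (by rw [← lv, ← hv, 𝔥.coassoc, hv, rv])
      coder x := i₃ (by
        rw [← lv, ← hh, 𝔥.coder, hv, lh, rh, flipR_cube_map hγ, map_add])
      b_H x := i₃ (by
        rw [map_sub, ← tb₃_map hγ hb, ← hH, ← hH, ← hb, 𝔥.b_H, hv, hh, rv, fl, lh, lh,
          flipR_cube_map hγ, map_sub, map_sub])
      preLie x := i₃ (by
        rw [← flipR_cube_map hγ, map_add (map J (map J J)), ← lh, ← rh, ← hh, 𝔥.preLie, map_neg,
          map_add (map J (map J J)), hh, lh, rh]) }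

end

namespace OpenFrobenius

variable {C : Type*} [AddCommGroup C] [Module ℚ C] [Coalgebra ℚ C] {m : ℤ}
  {𝒞 : ℤ → Submodule ℚ C} [DirectSum.Decomposition 𝒞] (Φ : OpenFrobenius m 𝒞)

local notation "Δ" => Coalgebra.comul (R := ℚ) (A := C)

local notation "γ" => parity 𝒞

open KModel

theorem hasPar_neg {V : Type*} [AddCommGroup V] [Module ℚ V] {g : V →ₗ[ℚ] V} {x : V} {p : ZMod 2}
    (h : HasPar g x p) : HasPar (-g) x (p + 1) :=
  ⟨by rw [LinearMap.neg_apply, h.eq, sgn_add, sgn_one, mul_neg_one, neg_smul]⟩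

theorem hasPar_ε {V : Type*} [AddCommGroup V] [Module ℚ V] {g : V →ₗ[ℚ] V} {x : V} {p : ZMod 2}
    (h : HasPar g x p) : HasPar (ε m • g) x (p + (m + 1)) :=
  ⟨by
    rw [LinearMap.smul_apply, h.eq, sgn_add, smul_smul, _root_.mul_comm, ε, neg_one_zpow_eq_sgn]
    push_cast
    rw [show (m : ZMod 2) - 1 = m + 1 by grind]⟩

theorem gpow_sgn {V : Type*} [AddCommGroup V] [Module ℚ V] {g : V →ₗ[ℚ] V} {x : V} {p : ZMod 2}
    (h : HasPar g x p) (n : ℤ) : gpow g n x = sgn (n * p) • x := by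
  rw [gpow_apply h.zpow, neg_one_zpow_eq_sgn]; simp

theorem mul_comm_sgn (x y : C) {p q : ZMod 2} [hx : HasPar γ x p] [hy : HasPar γ y q] :
    Φ.mul x y = sgn (p * q + m) • Φ.mul y x := by
  have e := Φ.mul_flip x y
  have h1 := hasPar_neg hx
  have h2 := hasPar_neg hy
  rw [kflip_tmul_sgn, map_smul, TensorProduct.lift.tmul, comp_apply, hx.eq, hy.eq, map_smul,
    map_smul, LinearMap.smul_apply, LinearMap.smul_apply, ε, neg_one_zpow_eq_sgn] at e
  have e' := congrArg (fun z => sgn p • sgn ((m - 1 : ℤ) : ZMod 2) • z) e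
  simp only [smul_smul, ← sgn_add] at e'
  push_cast at e'
  rw [show p + ((m : ZMod 2) - 1 + (m - 1 + p)) = 0 by grind, sgn_zero, one_smul] at e'
  rw [← e']
  congr 2; grind

instance (x y : C) {p q : ZMod 2} [hx : HasPar γ x p] [hy : HasPar γ y q] :
    HasPar γ (Φ.mul x y) (p + q + m) :=
  ⟨by
    rw [parity_mul, hx.eq, hy.eq, map_smul, map_smul, LinearMap.smul_apply, ← neg_one_zpow_eq,
      neg_one_zpow_eq_sgn, smul_smul, smul_smul, ← sgn_add, ← sgn_add]
    congr 2; grind⟩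

variable {Φ} in
theorem hasPar_incl {a : Cbar C} {p : ZMod 2} (h : HasPar Φ.γbar a p) : HasPar γ (a : C) p :=
  ⟨(Φ.incl_γbar a).symm.trans ((congrArg incl h.eq).trans (map_smul incl _ _))⟩

theorem susp_tmul (x y : C) (u w : Word C) {p q : ZMod 2} [HasPar γ x p] [HasPar Φ.γword u q] :
    map (gpow Φ.γcell (m - 1)) LinearMap.id ((x ⊗ₜ[ℚ] u) ⊗ₜ[ℚ] (y ⊗ₜ[ℚ] w))
      = sgn ((m + 1) * (p + q)) • ((x ⊗ₜ[ℚ] u) ⊗ₜ[ℚ] (y ⊗ₜ[ℚ] w)) := by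
  have h : HasPar Φ.γcell (x ⊗ₜ[ℚ] u) (p + q) := HasPar.tmul x u
  rw [map_tmul, gpow_sgn h, id_apply, ← smul_tmul']
  push_cast
  congr 2; grind

/-! #### The homotopy `h` -/

theorem hTerm_eq (x : C) (L M R : Word C) (a c : Cbar C) {p l j μ i ρ : ZMod 2} [hx : HasPar γ x p]
    [hL : HasPar Φ.γword L l] [ha : HasPar Φ.γbar a j] [hM : HasPar Φ.γword M μ]
    [hc : HasPar Φ.γbar c i] [hR : HasPar Φ.γword R ρ] :
    Φ.barModel.K (x ⊗ₜ (Φ.barModel.γW L ⊗ₜ Φ.barModel.Q (a ⊗ₜ (M ⊗ₜ (c ⊗ₜ R)))))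
      = map .id (pos C (Cbar C)) (map (gpow Φ.γcell (m - 1))
        LinearMap.id (Φ.hTerm (x ⊗ₜ (L ⊗ₜ (a ⊗ₜ (M ⊗ₜ (c ⊗ₜ R))))))) := by
  have ha' : HasPar Φ.barModel.γU a (j + 1) := hasPar_neg ha
  have hc' : HasPar Φ.barModel.γU c (i + 1) := hasPar_neg hc
  have hM' : HasPar Φ.barModel.γW M μ := hM
  have hL' : HasPar Φ.barModel.γW L l := hL
  have hR' : HasPar Φ.barModel.γW R ρ := hR
  have hx' : HasPar Φ.barModel.γX x (p + (m + 1)) := hasPar_ε hx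
  have hLR : HasPar Φ.γword (L * R) (l + ρ) := HasPar.word_mul (-Φ.γbar) L R (hu := hL) (hv := hR)
  have haC := hasPar_incl ha
  have hcC := hasPar_incl hc
  have hac : HasPar γ (Φ.mul (a : C) (c : C)) (j + i + m) := inferInstance
  have hκ : Φ.barModel.κ a c = sgn (m + 1 + j) • Φ.mul (a : C) (c : C) := by
    have e : Φ.barModel.κ a c = ε m • Φ.mul (γ (a : C)) (c : C) := rfl
    rw [e, haC.eq, map_smul, LinearMap.smul_apply, smul_smul, ε, neg_one_zpow_eq_sgn, ← sgn_add]
    push_cast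
    congr 2; grind
  rw [Φ.hTerm_tmul hx.zpow hL.zpow ha.zpow hM.zpow hc.zpow hR.zpow hac.zpow, map_smul, susp_tmul,
    map_smul, map_smul, map_tmul, pos_tmul, id_apply, Q_tmul, tmul_smul, γW_apply, ← smul_tmul',
    tmul_smul, tmul_smul, map_smul, map_smul, K_tmul, hκ, neg_one_zpow_eq_sgn]
  simp only [← smul_tmul', tmul_smul, smul_smul, ← sgn_add]
  push_cast
  simp only [ZMod.natCast_val, ZMod.cast_id', id_eq]
  congr 2
  have := zmod_two_mul_self (m : ZMod 2)
  grind

theorem h_barModel (t : Cell C) : Φ.barModel.h t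
    = map .id (pos C (Cbar C)) (Φ.susp Φ.h t) := by
  have hγX : ∀ x : C, γ (γ x) = x := parity_parity
  have hγW : ∀ u : Word C, Φ.γword (Φ.γword u) = u := Φ.barModel.γW_γW
  induction t using TensorProduct.induction_on with
  | zero => simp only [map_zero]
  | add s t hs ht => simp only [map_add, hs, ht]
  | tmul x u =>
    rw [h_tmul, susp, comp_apply, h, comp_apply, map_tmul, comp_apply, E, comp_apply, id_apply,
      ← cut_eq, show wordCut (Cbar C) = cut from LinearMap.ext fun u => (cut_eq u).symm]
    induction x using hasPar_induction hγX with
    | add x y hx hy => simp only [add_tmul, map_add, hx, hy]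
    | h p x hx =>
    generalize cut u = t
    induction t using tensor_induction hγW (map_map_self Φ.γbar_γbar hγW) with
    | zero => simp only [tmul_zero, map_zero]
    | add s t hs ht => simp only [tmul_add, map_add, hs, ht]
    | h l _ L s hL hs =>
      clear hs
      induction s using tensor_induction Φ.γbar_γbar hγW with
      | zero => simp only [tmul_zero, map_zero]
      | add s t hs ht => simp only [tmul_add, map_add, hs, ht]
      | h j _ a w ha _ =>
        simp only [map_tmul, comp_apply, id_apply]
        generalize cut w = t
        induction t using tensor_induction hγW (map_map_self Φ.γbar_γbar hγW) with
        | zero => simp only [tmul_zero, map_zero]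
        | add s t hs ht => simp only [tmul_add, map_add, hs, ht]
        | h μ _ M s hM hs =>
          clear hs
          induction s using tensor_induction Φ.γbar_γbar hγW with
          | zero => simp only [tmul_zero, map_zero]
          | add s t hs ht => simp only [tmul_add, map_add, hs, ht]
          | h i ρ c R hc hR => exact Φ.hTerm_eq x L M R a c

theorem hP_eq : Φ.barModel.hP = pos₂ C (Cbar C) ∘ₗ Φ.susp Φ.h := by
  refine LinearMap.ext fun t => ?_
  rw [hP, comp_apply, h_barModel, pos₂, map_map, LinearMap.comp_id,
    show pos C (Cbar C) ∘ₗ pos C (Cbar C) = pos C (Cbar C) from LinearMap.ext pos_pos]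
  rfl

/-- The truncated cobracket. -/
theorem SS_eq : pos₂ C (Cbar C) ∘ₗ Φ.SS
    = Φ.barModel.hP + kflip Φ.γs Φ.γs ∘ₗ Φ.barModel.hP := by
  have e : Φ.SS = Φ.susp Φ.h + kflip Φ.γs Φ.γs ∘ₗ Φ.susp Φ.h := by
    refine LinearMap.ext fun t => ?_
    have hγ : ∀ x, Φ.γcell (Φ.γcell x) = x :=
      map_map_self parity_parity Φ.barModel.γW_γW
    have hsgn : (-1 : ℚ) ^ (2 - m) = -(-1 : ℚ) ^ (m - 1) := by
      rw [neg_one_zpow_eq_sgn, neg_one_zpow_eq_sgn, ← neg_one_mul, ← sgn_one, ← sgn_add]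
      push_cast
      congr 1; grind
    rw [SS, susp, comp_apply, S, LinearMap.sub_apply, map_sub, comp_apply, shiftFlip,
      LinearMap.smul_apply, map_smul, LinearMap.add_apply, comp_apply, susp, comp_apply, γs,
      kflip_smul_smul hγ, hsgn, neg_smul, sub_neg_eq_add]
  rw [e, hP_eq, LinearMap.comp_add, γs_eq]
  congr 1
  exact LinearMap.ext fun t => Φ.barModel.pos₂_kflip _

/-! #### The coproduct -/

theorem veeTerm_eq (x : C) (L R : Word C) (a : Cbar C) {l j : ZMod 2} [hL : HasPar Φ.γword L l]
    [ha : HasPar Φ.γbar a j] :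
    Φ.model.vT (Φ.model.δ x ⊗ₜ (wordMap incl L ⊗ₜ (incl a ⊗ₜ wordMap incl R)))
      = map (emb C) (emb C) (map .id (pos C (Cbar C))
        (map (gpow Φ.γcell (m - 1)) LinearMap.id
          (Φ.veeTerm (x ⊗ₜ (L ⊗ₜ (a ⊗ₜ R)))))) := by
  have haU : HasPar Φ.model.γU (incl a) (j + 1) := hasPar_neg (hasPar_incl ha)
  have haN : HasPar (-Φ.γbar) a (j + 1) := hasPar_neg ha
  have hL' : HasPar Φ.model.γW (wordMap incl L) l :=
    ⟨(Φ.isMap_incl.γW L).trans ((congrArg (wordMap incl) hL.eq).trans (map_smul _ _ _))⟩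
  have hd : Φ.model.δ x = map (ε m • γ) .id (Δ x) := rfl
  have hv : Φ.veeTerm (x ⊗ₜ (L ⊗ₜ (a ⊗ₜ R))) = sgn (l * (j + 1)) •
      (assoc C (Word C) (C ⊗[ℚ] Word C)).symm (map .id
        (kswap γ Φ.γword (Word C)) (assoc C C (Word C ⊗[ℚ] Word C)
          (map (gpow γ m) (Φ.mul.flip (a : C)) (map γ γ (Δ x))
            ⊗ₜ (L ⊗ₜ R)))) := by
    simp only [veeTerm, comp_apply, LinearEquiv.coe_coe, map_tmul, kswap_tmul_sgn, id_apply,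
      tmul_smul, map_smul, assoc_symm_tmul, TensorProduct.lift.tmul, Submodule.subtype_apply,
      Φ.frob_right, comul_parity Φ]
  rw [hv, hd]
  generalize Δ x = t
  induction t using tensor_induction (γA := γ) (γB := γ) parity_parity parity_parity with
  | zero => simp only [zero_tmul, map_zero, smul_zero]
  | add s t hs ht => simp only [map_add, add_tmul, smul_add, hs, ht]
  | h p q y z hy hz =>
    have hyX : HasPar Φ.model.γX y (p + (m + 1)) := hasPar_ε hy
    have hzU : HasPar Φ.model.γU z (q + 1) := hasPar_neg hz
    have haC : HasPar γ (incl a) j := hasPar_incl ha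
    have hκ : Φ.model.κ (incl a) z = sgn (1 + j + j * q) • Φ.mul z (incl a) := by
      have e : Φ.model.κ (incl a) z = ε m • Φ.mul (γ (incl a)) z := rfl
      rw [e, haC.eq, map_smul, LinearMap.smul_apply, Φ.mul_comm_sgn (incl a) z, smul_smul,
        smul_smul, ε, neg_one_zpow_eq_sgn, ← sgn_add, ← sgn_add]
      push_cast
      congr 2; grind
    have hyε : (ε m • γ) y = sgn (m + 1 + p) • y := by
      rw [(hasPar_ε (m := m) hy).eq]; congr 2; ring
    rw [map_tmul, hyε, ← smul_tmul', ← smul_tmul', map_smul, id_apply, vT_tmul, hκ, map_tmul,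
      map_tmul, hy.eq, hz.eq]
    have hmul : HasPar γ (Φ.mul z (incl a)) (q + j + m) := inferInstance
    have hmul' : HasPar γ (Φ.mul z ↑a) (q + j + m) := hmul
    have hyL : HasPar Φ.γcell (y ⊗ₜ[ℚ] L) (p + l) := HasPar.tmul y L
    simp only [← smul_tmul', tmul_smul, map_smul, gpow_sgn hy, LinearMap.flip_apply, assoc_tmul,
      map_tmul, kswap_tmul_sgn, id_apply, assoc_symm_tmul, gpow_sgn hyL, pos_tmul, emb_tmul,
      smul_smul, ← sgn_add]
    rw [wordMap_wordPos]
    push_cast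
    congr 2
    have := zmod_two_mul_self (m : ZMod 2)
    grind

theorem veeP_emb (t : Cell C) : Φ.model.veeP (emb C t)
    = map (emb C) (emb C) (pos₂ C (Cbar C) (Φ.veeS t)) := by
  have hγW : ∀ u : Word C, Φ.γword (Φ.γword u) = u := Φ.barModel.γW_γW
  have key : Φ.model.vee (emb C t) = map (emb C) (emb C)
      (map .id (pos C (Cbar C)) (Φ.veeS t)) := by
    induction t using TensorProduct.induction_on with
    | zero => simp only [map_zero]
    | add s t hs ht => simp only [map_add, hs, ht]
    | tmul x u =>
      rw [emb_tmul, vee_tmul, wordCut_wordMap, ← cut_eq, veeS, susp, comp_apply, vee, comp_apply,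
        map_tmul, id_apply]
      generalize cut u = t
      induction t using tensor_induction hγW (map_map_self Φ.γbar_γbar hγW) with
      | zero => simp only [tmul_zero, map_zero]
      | add s t hs ht => simp only [tmul_add, map_add, hs, ht]
      | h l _ L s hL hs =>
        clear hs
        induction s using tensor_induction Φ.γbar_γbar hγW with
        | zero => simp only [tmul_zero, map_zero]
        | add s t hs ht => simp only [tmul_add, map_add, hs, ht]
        | h j _ a R ha _ => exact Φ.veeTerm_eq x L R a
  have e : pos C C ∘ₗ emb C = emb C ∘ₗ pos C (Cbar C) :=
    LinearMap.ext (pos_ceMap LinearMap.id incl)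
  rw [veeP, comp_apply, key, pos₂, pos₂, map_map, map_map, map_map, e, LinearMap.comp_id,
    LinearMap.comp_assoc,
    show pos C (Cbar C) ∘ₗ pos C (Cbar C) = pos C (Cbar C) from LinearMap.ext pos_pos]

/-- The complex of an open Frobenius algebra. -/
theorem homotopyGerstenhaber : HomotopyGerstenhaber Φ.γs (Φ.bIntS + Φ.bExtS)
    (pos₂ C (Cbar C) ∘ₗ Φ.veeS) Φ.barModel.hP Φ.barModel.HP :=
  HomotopyGerstenhaber.of_leftInverse (J := emb C) Φ.model.homotopyGerstenhaber Φ.ceMap_proj_emb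
    Φ.emb_γs Φ.b_emb Φ.veeP_emb (Φ.isMap_incl.hP (g' := LinearMap.id) fun _ => rfl)
    Φ.isMap_incl.HP

end OpenFrobenius

theorem scale_parity {A : Type*} [AddCommGroup A] [Module ℚ A] {F : ℤ → Submodule ℚ A}
    [DirectSum.Decomposition F] {c : ℚ} (x : A) :
    scale F c (parity F x) = parity F (scale F c x) := by
  rw [parity_eq_scale, scale_scale, scale_scale, mul_comm]

namespace OpenFrobenius

open KModel

variable {C : Type*} [AddCommGroup C] [Module ℚ C] [Coalgebra ℚ C] {m : ℤ}
  {𝒞 : ℤ → Submodule ℚ C} [DirectSum.Decomposition 𝒞] (Φ : OpenFrobenius m 𝒞)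

local notation "Δ" => Coalgebra.comul (R := ℚ) (A := C)

local notation "γ" => parity 𝒞

/-! ### Dilations

The operators `a₀[a₁|⋯|aₙ] ↦ c^(|a₀|+⋯+|aₙ|) a^n a₀[a₁|⋯|aₙ]` detect the degree and the length of
words; the structure maps commute with them up to a factor. -/

/-- The operator `x ↦ c^|x| x` of `C̄`. -/
def scaleBar (c : ℚ) : Cbar C →ₗ[ℚ] Cbar C := Φ.proj ∘ₗ scale 𝒞 c ∘ₗ incl

theorem incl_scaleBar (c : ℚ) (a : Cbar C) : incl (Φ.scaleBar c a) = scale 𝒞 c (incl a) := by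
  rw [scaleBar, comp_apply, comp_apply, incl_proj, counit_scale Φ,
    show Coalgebra.counit (R := ℚ) (incl a) = 0 from a.2, zero_smul, sub_zero]

theorem scaleBar_proj (c : ℚ) (x : C) : Φ.scaleBar c (Φ.proj x) = Φ.proj (scale 𝒞 c x) :=
  incl_injective (by
    rw [incl_scaleBar, incl_proj, incl_proj, map_sub, map_smul, scale_e, counit_scale Φ])

/-- The dilation with factors `c` for the degree and `a` for the length. -/
def dil (c a : ℚ) : Cell C →ₗ[ℚ] Cell C := ceMap (scale 𝒞 c) (a • Φ.scaleBar c)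

variable {c a : ℚ}

theorem γbar_smul_scaleBar (x : Cbar C) :
    Φ.γbar ((a • Φ.scaleBar c) x) = (a • Φ.scaleBar c) (Φ.γbar x) :=
  incl_injective (by
    rw [incl_γbar, LinearMap.smul_apply, LinearMap.smul_apply, map_smul, map_smul, map_smul,
      incl_scaleBar, incl_scaleBar, incl_γbar, scale_parity])

theorem isMap_dil (hc : c ≠ 0) :
    IsMap Φ.barModel Φ.barModel ((a * a * c ^ m) • scale 𝒞 c) (a • Φ.scaleBar c) where
  γX x := by
    change ε m • γ ((a * a * c ^ m) • scale 𝒞 c x) = (a * a * c ^ m) • scale 𝒞 c (ε m • γ x)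
    rw [map_smul, map_smul, scale_parity, smul_comm]
  γU x := by
    change -Φ.γbar ((a • Φ.scaleBar c) x) = (a • Φ.scaleBar c) (-Φ.γbar x)
    rw [γbar_smul_scaleBar, map_neg]
  κ x y := by
    change ε m • Φ.mul (γ (incl (a • Φ.scaleBar c x))) (incl (a • Φ.scaleBar c y))
      = (a * a * c ^ m) • scale 𝒞 c (ε m • Φ.mul (γ (incl x)) (incl y))
    simp only [map_smul, incl_scaleBar, ← scale_parity, LinearMap.smul_apply, Φ.scale_mul hc,
      smul_smul]
    congr 1; ring

theorem γs_dil (hc : c ≠ 0) (t : Cell C) : Φ.γs (Φ.dil c a t) = Φ.dil c a (Φ.γs t) := by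
  rw [γs_eq]
  refine (Φ.isMap_dil (a := a) hc).γc (g' := scale 𝒞 c) (fun x => ?_) t
  change ε m • γ (scale 𝒞 c x) = scale 𝒞 c (ε m • γ x)
  rw [map_smul, scale_parity]

theorem γword_dil (hc : c ≠ 0) (u : Word C) : Φ.γword (wordMap (a • Φ.scaleBar c) u)
    = wordMap (a • Φ.scaleBar c) (Φ.γword u) := (Φ.isMap_dil (a := a) hc).γW u

theorem dil_hP (hc : c ≠ 0) (t : Cell C) : (a * a * c ^ m) •
    map (Φ.dil c a) (Φ.dil c a) (Φ.barModel.hP t) = Φ.barModel.hP (Φ.dil c a t) := by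
  have e := (Φ.isMap_dil (a := a) hc).hP (g' := scale 𝒞 c) (fun x => by
    change ε m • γ (scale 𝒞 c x) = scale 𝒞 c (ε m • γ x)
    rw [map_smul, scale_parity]) t
  rw [dil, e, ceMap, ceMap, map_smul_left, map_smul_right, LinearMap.smul_apply]

theorem dil_HP (hc : c ≠ 0) (t : Cell C) : ((a * a * c ^ m) * (a * a * c ^ m)) •
    map (Φ.dil c a) (map (Φ.dil c a) (Φ.dil c a)) (Φ.barModel.HP t)
      = Φ.barModel.HP (Φ.dil c a t) := by
  have e := (Φ.isMap_dil (a := a) hc).HP (g' := scale 𝒞 c) t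
  rw [dil, e, ceMap, ceMap, map_smul_left, map_smul_right, map_smul_left, smul_smul, map_smul_right,
    LinearMap.smul_apply]

theorem oddDer_wordMap {f : Cbar C →ₗ[ℚ] Cbar C} (hf : ∀ x, Φ.γbar (f x) = f (Φ.γbar x)) {ρ : ℚ}
    {φ : Cbar C →ₗ[ℚ] Word C} (hφ : ∀ x, ρ • wordMap f (φ x) = φ (f x)) (u : Word C) :
    ρ • wordMap f (oddDer Φ.γword φ u) = oddDer Φ.γword φ (wordMap f u) := by
  refine LinearMap.congr_fun (f := ρ • wordMap f ∘ₗ oddDer Φ.γword φ)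
    (g := oddDer Φ.γword φ ∘ₗ wordMap f) (word_ext ?_ fun a u h => ?_) u
  · simp [oddDer_one, wordMap_one]
  · have hγ : ∀ x, Φ.γword (letter x) = -letter (Φ.γbar x) := fun x => by simp [γword]
    rw [LinearMap.smul_apply, comp_apply, comp_apply] at h ⊢
    rw [oddDer_letter_mul, map_add, wordMap_mul, wordMap_mul, wordMap_mul, wordMap_ι,
      oddDer_letter_mul, ← hφ, ← h, hγ, hγ, hf, map_neg, wordMap_ι, smul_add, smul_mul_assoc,
      mul_smul_comm]

theorem scale_d (hc : c ≠ 0) (x : C) : c • scale 𝒞 c (Φ.d x) = Φ.d (scale 𝒞 c x) :=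
  LinearMap.congr_fun (f := c • scale 𝒞 c ∘ₗ Φ.d) (g := Φ.d ∘ₗ scale 𝒞 c)
    (graded_ext (F := 𝒞) fun i x hx => by
      rw [LinearMap.smul_apply, comp_apply, comp_apply, scale_of_mem _ hx,
        scale_of_mem _ (Φ.d_mem i x hx), map_smul, smul_smul, ← zpow_one_add₀ hc]
      congr 2; ring) x

theorem dil_bInt (hc : c ≠ 0) (t : Cell C) : c • Φ.dil c a (Φ.bInt t) = Φ.bInt (Φ.dil c a t) := by
  have hφ : ∀ x : Cbar C, c • wordMap (a • Φ.scaleBar c)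
      ((-(letter ∘ₗ Φ.proj ∘ₗ Φ.d ∘ₗ incl) : Cbar C →ₗ[ℚ] Word C) x)
      = (-(letter ∘ₗ Φ.proj ∘ₗ Φ.d ∘ₗ incl) : Cbar C →ₗ[ℚ] Word C) ((a • Φ.scaleBar c) x) := by
    intro x
    simp only [LinearMap.neg_apply, comp_apply, map_neg, wordMap_ι, smul_neg, LinearMap.smul_apply,
      map_smul, incl_scaleBar, ← Φ.scale_d hc, scaleBar_proj]
    rw [smul_comm]
  induction t using TensorProduct.induction_on with
  | zero => simp only [map_zero, smul_zero]
  | add s t hs ht => simp only [map_add, smul_add, hs, ht]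
  | tmul x u =>
    simp only [dil, bInt, LinearMap.add_apply, map_tmul, map_add, id_apply, ← Φ.scale_d hc,
      ← Φ.oddDer_wordMap Φ.γbar_smul_scaleBar hφ, smul_add, scale_parity, tmul_smul, ← smul_tmul']

theorem splitLetter_dil (hc : c ≠ 0) (ha : a ≠ 0) (x : Cbar C) :
    a⁻¹ • wordMap (a • Φ.scaleBar c) (Φ.splitLetter x) = Φ.splitLetter ((a • Φ.scaleBar c) x) := by
  simp only [splitLetter, comp_apply, LinearMap.smul_apply, map_smul, incl_scaleBar,
    ← Φ.scale_comul hc]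
  generalize Δ (incl x) = t
  induction t with
  | zero => simp only [map_zero, smul_zero]
  | add s t hs ht => simp only [map_add, smul_add, hs, ht]
  | tmul y z =>
    have e : Φ.γbar (Φ.scaleBar c (Φ.proj y)) = Φ.scaleBar c (Φ.γbar (Φ.proj y)) := by
      simpa using Φ.γbar_smul_scaleBar (a := 1) (c := c) (Φ.proj y)
    simp only [map_tmul, comp_apply, LinearMap.mul'_apply, wordMap_mul, wordMap_ι,
      LinearMap.smul_apply, LinearMap.neg_apply, map_neg, map_smul, ← scaleBar_proj, e,
      smul_mul_assoc, mul_smul_comm, neg_mul, smul_neg, smul_smul]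
    rw [← _root_.mul_assoc, inv_mul_cancel₀ ha, one_mul]

theorem pull_dil (hc : c ≠ 0) (ha : a ≠ 0) (t : Cell C) :
    a⁻¹ • map (scale 𝒞 c) (map (wordMap (a • Φ.scaleBar c))
      (wordMap (a • Φ.scaleBar c))) (Φ.pull t) = Φ.pull (Φ.dil c a t) := by
  induction t using TensorProduct.induction_on with
  | zero => simp only [map_zero, smul_zero]
  | add s t hs ht => simp only [map_add, smul_add, hs, ht]
  | tmul x u =>
    simp only [pull, dil, comp_apply, map_tmul, id_apply, ← Φ.scale_comul hc]
    generalize Δ x = t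
    induction t with
    | zero => simp only [map_zero, smul_zero, zero_tmul]
    | add s t hs ht => simp only [map_add, smul_add, hs, ht, add_tmul]
    | tmul y z =>
      simp only [map_tmul, LinearEquiv.coe_coe, assoc_tmul, comp_apply, wordMap_ι,
        LinearMap.smul_apply, map_smul, scaleBar_proj, scale_parity, ← smul_tmul', tmul_smul,
        smul_smul, inv_mul_cancel₀ ha, one_smul]

theorem dil_bExt (hc : c ≠ 0) (ha : a ≠ 0) (t : Cell C) :
    a⁻¹ • Φ.dil c a (Φ.bExt t) = Φ.bExt (Φ.dil c a t) := by
  have e₁ : ∀ t : Word C ⊗[ℚ] Word C, wordMap (a • Φ.scaleBar c) (LinearMap.mul' ℚ (Word C) t)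
      = LinearMap.mul' ℚ (Word C) (map (wordMap (a • Φ.scaleBar c))
        (wordMap (a • Φ.scaleBar c)) t) := fun t => by
    induction t with
    | zero => simp only [map_zero]
    | add s t hs ht => simp only [map_add, hs, ht]
    | tmul u v => simp only [LinearMap.mul'_apply, map_tmul, wordMap_mul]
  have e₂ : ∀ f : Word C ⊗[ℚ] Word C →ₗ[ℚ] Word C, (∀ t, wordMap (a • Φ.scaleBar c) (f t)
      = f (map (wordMap (a • Φ.scaleBar c)) (wordMap (a • Φ.scaleBar c)) t)) →
      a⁻¹ • Φ.dil c a (map .id f (Φ.pull t))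
        = map .id f (Φ.pull (Φ.dil c a t)) := fun f hf => by
    rw [← Φ.pull_dil hc ha, map_smul, dil, map_map, map_map, LinearMap.comp_id, LinearMap.id_comp]
    congr 3
    exact LinearMap.ext hf
  have e₃ : a⁻¹ • Φ.dil c a (map γ (oddDer Φ.γword Φ.splitLetter) t)
      = map γ (oddDer Φ.γword Φ.splitLetter) (Φ.dil c a t) := by
    rw [dil, map_map, map_map, ← LinearMap.smul_apply, ← map_smul_right]
    congr 2
    · exact LinearMap.ext scale_parity
    · exact LinearMap.ext (Φ.oddDer_wordMap Φ.γbar_smul_scaleBar (Φ.splitLetter_dil hc ha))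
  simp only [bExt, LinearMap.add_apply, LinearMap.sub_apply, map_add, map_sub, smul_add, smul_sub,
    e₃]
  rw [comp_apply, comp_apply, comp_apply, comp_apply, e₂ _ e₁, e₂ _ fun t => ?_]
  rw [comp_apply, comp_apply, e₁, kflip_map (Φ.γword_dil hc) (Φ.γword_dil hc)]

theorem dil_veeS (hc : c ≠ 0) (t : Cell C) : (a * c ^ m) •
    map (Φ.dil c a) (Φ.dil c a) (Φ.veeS t) = Φ.veeS (Φ.dil c a t) := by
  have hγ : ∀ t, Φ.γcell (Φ.dil c a t) = Φ.dil c a (Φ.γcell t) := fun t => by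
    have e := Φ.γs_dil (a := a) hc t
    simp only [γs, LinearMap.smul_apply, map_smul] at e
    exact smul_right_injective _ (zpow_ne_zero _ (by norm_num : (-1 : ℚ) ≠ 0)) e
  have hg : ∀ t, gpow Φ.γcell (m - 1) (Φ.dil c a t) = Φ.dil c a (gpow Φ.γcell (m - 1) t) := by
    intro t
    rw [gpow]
    split_ifs
    · rfl
    · exact hγ t
  have key : (a * c ^ m) • map (Φ.dil c a) (Φ.dil c a) (Φ.vee t)
      = Φ.vee (Φ.dil c a t) := by
    induction t using TensorProduct.induction_on with
    | zero => simp only [map_zero, smul_zero]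
    | add s t hs ht => simp only [map_add, smul_add, hs, ht]
    | tmul x u =>
      rw [vee, comp_apply, comp_apply, dil, map_tmul, map_tmul, map_tmul, id_apply, id_apply,
        cut_eq, cut_eq, wordCut_wordMap]
      generalize wordCut (Cbar C) u = t
      have hs : ∀ x : Cbar C, (-Φ.γbar) ((a • Φ.scaleBar c) x) = (a • Φ.scaleBar c) ((-Φ.γbar) x) :=
        fun x => by rw [LinearMap.neg_apply, LinearMap.neg_apply, γbar_smul_scaleBar, map_neg]
      simp only [veeTerm, comp_apply, map_tmul, id_apply,
        kswap_map (wordMap (a • Φ.scaleBar c)) (Φ.γword_dil hc) hs]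
      generalize kswap Φ.γword (-Φ.γbar) (Word C) t = t
      induction t with
      | zero => simp only [map_zero, smul_zero, tmul_zero]
      | add s t hs ht => simp only [map_add, smul_add, hs, ht, tmul_add]
      | tmul y s =>
        simp only [map_tmul, LinearEquiv.coe_coe, assoc_symm_tmul, comp_apply,
          TensorProduct.lift.tmul, id_apply, LinearMap.smul_apply, map_smul, incl_scaleBar,
          ← scale_parity, Φ.scale_mul hc, smul_smul, ← Φ.scale_comul hc]
        rw [← smul_tmul']
        simp only [map_smul]
        congr 1
        generalize Δ (Φ.mul (γ x) (incl y)) = t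
        induction t with
        | zero => simp only [map_zero, zero_tmul]
        | add s t hs ht => simp only [map_add, hs, ht, add_tmul]
        | tmul y z =>
          simp only [map_tmul, assoc_tmul, id_apply]
          rw [← map_tmul (scale 𝒞 c) _ z s,
            kswap_map (wordMap (a • Φ.scaleBar c)) (fun x => (scale_parity x).symm) (Φ.γword_dil hc)]
          generalize kswap γ Φ.γword (Word C) (z ⊗ₜ s) = t
          induction t with
          | zero => simp only [map_zero, tmul_zero]
          | add s t hs ht => simp only [map_add, hs, ht, tmul_add]
          | tmul y z =>
            simp only [map_tmul, assoc_symm_tmul]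
  rw [veeS, susp, comp_apply, comp_apply, ← key, map_smul, map_map, map_map, LinearMap.comp_id,
    LinearMap.id_comp,
    show gpow Φ.γcell (m - 1) ∘ₗ Φ.dil c a = Φ.dil c a ∘ₗ gpow Φ.γcell (m - 1) from LinearMap.ext hg]

end OpenFrobenius

section

section

variable {A B : Type*} [AddCommGroup A] [Module ℚ A] [AddCommGroup B] [Module ℚ B]
  {F : ℤ → Submodule ℚ A} {G : ℤ → Submodule ℚ B}

theorem tmul_mem_tdeg {i j k : ℤ} {x : A} {y : B} (hx : x ∈ F i) (hy : y ∈ G j) (h : i + j = k) :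
    x ⊗ₜ[ℚ] y ∈ tdeg F G k := by
  obtain rfl : j = k - i := by omega
  exact Submodule.mem_iSup_of_mem i ⟨⟨x, hx⟩ ⊗ₜ ⟨y, hy⟩, by simp [mapIncl]⟩

theorem map_mem_iSup_tdeg {A' B' : Type*} [AddCommGroup A'] [Module ℚ A'] [AddCommGroup B']
    [Module ℚ B'] {f : A' →ₗ[ℚ] A} {g : B' →ₗ[ℚ] B} (hf : ∀ x, f x ∈ ⨆ k, F k)
    (hg : ∀ x, g x ∈ ⨆ k, G k) (t : A' ⊗[ℚ] B') :
    map f g t ∈ ⨆ k, tdeg F G k := by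
  induction t with
  | zero => rw [map_zero]; exact zero_mem _
  | add s t hs ht => rw [map_add]; exact add_mem hs ht
  | tmul x y =>
    rw [map_tmul]
    generalize hw : g y = w
    have hw : w ∈ ⨆ k, G k := hw ▸ hg y
    refine Submodule.iSup_induction F (motive := fun u => u ⊗ₜ[ℚ] w ∈ ⨆ k, tdeg F G k) (hf x)
      (fun i u hu => ?_) (by rw [zero_tmul]; exact zero_mem _)
      fun u u' h h' => by rw [add_tmul]; exact add_mem h h'
    exact Submodule.iSup_induction G (motive := fun w => u ⊗ₜ[ℚ] w ∈ ⨆ k, tdeg F G k) hw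
      (fun j w hw => Submodule.mem_iSup_of_mem (i + j) (tmul_mem_tdeg hu hw rfl))
      (by rw [tmul_zero]; exact zero_mem _)
      fun u u' h h' => by rw [tmul_add]; exact add_mem h h'

/-- A sum of homogeneous elements which is an eigenvector of the scaling operator is
homogeneous. -/
theorem mem_of_scale_eq {s : A →ₗ[ℚ] A} (hs : ∀ k, ∀ x ∈ F k, s x = (2 : ℚ) ^ k • x) {x : A}
    (hx : x ∈ ⨆ k, F k) {k : ℤ} (h : s x = (2 : ℚ) ^ k • x) : x ∈ F k := by
  have hF : ∀ k, F k ≤ Module.End.eigenspace s ((2 : ℚ) ^ k) := fun k x hx =>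
    Module.End.mem_eigenspace_iff.2 (hs k x hx)
  have hsup : x ∈ F k ⊔ ⨆ (j) (_ : j ≠ k), F j := by
    refine (iSup_le fun j => ?_ : (⨆ k, F k) ≤ _) hx
    rcases eq_or_ne j k with rfl | hj
    · exact le_sup_left
    · exact le_sup_of_le_right (le_iSup₂_of_le j hj le_rfl)
  obtain ⟨u, hu, w, hw, rfl⟩ := Submodule.mem_sup.1 hsup
  have hw0 : w = 0 := by
    have h1 : w ∈ Module.End.eigenspace s ((2 : ℚ) ^ k) := by
      have := sub_mem (Module.End.mem_eigenspace_iff.2 h) (hF k hu)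
      rwa [add_sub_cancel_left] at this
    have h2 : w ∈ ⨆ (μ) (_ : μ ≠ (2 : ℚ) ^ k), Module.End.eigenspace s μ :=
      (iSup₂_le fun j hj => (hF j).trans (le_iSup₂_of_le ((2 : ℚ) ^ j)
        (fun e => hj (zpow_right_injective₀ (by norm_num) (by norm_num) e)) le_rfl) :
          (⨆ (j) (_ : j ≠ k), F j) ≤ _) hw
    exact Submodule.disjoint_def.1 (Module.End.eigenspaces_iSupIndep s ((2 : ℚ) ^ k)) w h1 h2
  rwa [hw0, add_zero]

end

variable {C : Type*} [AddCommGroup C] [Module ℚ C] [Coalgebra ℚ C]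

/-- The projection to words of length `n`, if `n ≥ 1`, and zero for `n = 0`. -/
def lenPos (C : Type*) [AddCommGroup C] [Module ℚ C] [Coalgebra ℚ C] (n : ℕ) :
    Cell C →ₗ[ℚ] Cell C := if n = 0 then 0 else len C n

local notation "π" => lenPos C

/-- The homogeneous tensors of length `n` and degree `k`. -/
def homogCell (𝒞 : ℤ → Submodule ℚ C) (n : ℕ) (k : ℤ) : Set (Cell C) :=
  {x | ∃ (i : ℤ) (a : C) (δ : Fin n → ℤ) (w : Fin n → Cbar C),
      a ∈ 𝒞 i ∧ (∀ l, (w l : C) ∈ 𝒞 (δ l)) ∧ i + ∑ l, (δ l - 1) = k ∧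
      x = a ⊗ₜ[ℚ] TensorAlgebra.tprod ℚ (Cbar C) n w}

theorem tprod_mem_pow (n : ℕ) (w : Fin n → Cbar C) : TensorAlgebra.tprod ℚ (Cbar C) n w
    ∈ LinearMap.range (TensorAlgebra.ι ℚ (M := Cbar C)) ^ n := by
  rw [TensorAlgebra.tprod_apply]
  induction n with
  | zero => simp
  | succ n ih =>
    rw [List.ofFn_succ, List.prod_cons, pow_succ']
    exact Submodule.mul_mem_mul ⟨_, rfl⟩ (ih _)

theorem len_of_homogCell {𝒞 : ℤ → Submodule ℚ C} {n n' : ℕ} {k : ℤ} {x : Cell C}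
    (hx : x ∈ homogCell 𝒞 n' k) : len C n x = if n = n' then x else 0 := by
  obtain ⟨i, a, δ, w, -, -, -, rfl⟩ := hx
  rw [len, map_tmul, GradedAlgebra.proj_apply, id_apply]
  split_ifs with h
  · rw [h, DirectSum.decompose_of_mem_same _ (tprod_mem_pow n' w)]
  · rw [DirectSum.decompose_of_mem_ne _ (tprod_mem_pow n' w) (Ne.symm h), tmul_zero]

namespace OpenFrobenius

open KModel

variable {m : ℤ} {𝒞 : ℤ → Submodule ℚ C} [DirectSum.Decomposition 𝒞] (Φ : OpenFrobenius m 𝒞)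

include Φ in
/-- Linear maps which agree on homogeneous tensors are equal. -/
theorem cell_ext {M : Type*} [AddCommGroup M] [Module ℚ M] {f g : Cell C →ₗ[ℚ] M}
    (h : ∀ n k, ∀ x ∈ homogCell 𝒞 n k, f x = g x) : f = g := by
  let S : Submodule ℚ (Word C) := Submodule.span ℚ {u | ∃ (n : ℕ) (δ : Fin n → ℤ)
    (w : Fin n → Cbar C), (∀ l, (w l : C) ∈ 𝒞 (δ l)) ∧ u = TensorAlgebra.tprod ℚ (Cbar C) n w}
  have hS : ∀ u, u ∈ S := fun u => by
    rw [← Submodule.Quotient.mk_eq_zero]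
    refine LinearMap.congr_fun (f := S.mkQ) (g := 0) (word_ext ?_ fun a u hu => ?_) u
    · exact (Submodule.Quotient.mk_eq_zero S).2 (Submodule.subset_span
        ⟨0, fun _ => 0, fun _ => 0, fun l => l.elim0, by simp [TensorAlgebra.tprod_apply]⟩)
    · have hu : u ∈ S := (Submodule.Quotient.mk_eq_zero S).1 hu
      have ha : S.mkQ ∘ₗ LinearMap.mulRight ℚ u ∘ₗ letter ∘ₗ Φ.proj = 0 :=
        graded_ext (F := 𝒞) fun i x hx => by
          have hx : incl (Φ.proj x) ∈ 𝒞 i := by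
            rw [incl_proj]
            rcases eq_or_ne i 0 with rfl | hi
            · exact sub_mem hx (Submodule.smul_mem _ _ Φ.e_mem)
            · rwa [Φ.counit_mem i hi x hx, zero_smul, sub_zero]
          refine (Submodule.Quotient.mk_eq_zero S).2 ?_
          change letter (Φ.proj x) * u ∈ S
          refine Submodule.span_induction (p := fun u _ => letter (Φ.proj x) * u ∈ S) ?_
            (by rw [mul_zero]; exact zero_mem _)
            (fun u v _ _ h h' => by rw [mul_add]; exact add_mem h h')
            (fun c u _ h => by rw [mul_smul_comm]; exact S.smul_mem c h) hu
          rintro _ ⟨n, δ, w, hw, rfl⟩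
          refine Submodule.subset_span ⟨n + 1, Fin.cons i δ, Fin.cons (Φ.proj x) w,
            Fin.cases hx hw, ?_⟩
          simp [TensorAlgebra.tprod_apply, List.ofFn_succ]
      have := LinearMap.congr_fun ha (incl a)
      simpa [show Φ.proj ↑a = a from Φ.proj_incl a] using this
  refine TensorProduct.ext (graded_ext (F := 𝒞) fun i a ha => LinearMap.ext fun u => ?_)
  refine Submodule.span_induction (p := fun u _ => f (a ⊗ₜ u) = g (a ⊗ₜ u)) ?_ (by simp)
    (fun u v _ _ h h' => by rw [tmul_add, map_add, map_add, h, h'])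
    (fun c u _ h => by rw [tmul_smul, map_smul, map_smul, h]) (hS u)
  rintro _ ⟨n, δ, w, hw, rfl⟩
  exact h n _ _ ⟨i, a, δ, w, ha, hw, rfl, rfl⟩

theorem dil_of_homogCell {c a : ℚ} (hc : c ≠ 0) {n : ℕ} {k : ℤ} {x : Cell C}
    (hx : x ∈ homogCell 𝒞 n k) : Φ.dil c a x = (c ^ (k + n) * a ^ n) • x := by
  obtain ⟨i, x, δ, w, hx, hw, rfl, rfl⟩ := hx
  have h : wordMap (a • Φ.scaleBar c) (TensorAlgebra.tprod ℚ (Cbar C) n w)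
      = (∏ l, a * c ^ δ l) • TensorAlgebra.tprod ℚ (Cbar C) n w := by
    rw [← MultilinearMap.map_smul_univ, TensorAlgebra.tprod_apply, TensorAlgebra.tprod_apply,
      wordMap, AlgHom.toLinearMap_apply, map_list_prod, List.map_ofFn]
    congr 2
    refine funext fun l => ?_
    rw [Function.comp_apply, TensorAlgebra.lift_ι_apply, comp_apply]
    congr 1
    refine incl_injective ?_
    rw [LinearMap.smul_apply, map_smul, map_smul, incl_scaleBar,
      scale_of_mem _ (show incl (w l) ∈ _ from hw l), smul_smul]
  rw [dil, map_tmul, h, scale_of_mem _ hx, tmul_smul, ← smul_tmul', smul_smul,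
    Finset.prod_mul_distrib, Finset.prod_const, Finset.card_univ, Fintype.card_fin,
    Finset.sum_sub_distrib, Finset.sum_const, Finset.card_univ, Fintype.card_fin, nsmul_eq_mul,
    mul_one, add_sub_assoc', sub_add_cancel, zpow_add₀ hc]
  have hz : ∀ s : Finset (Fin n), ∏ l ∈ s, c ^ δ l = c ^ ∑ l ∈ s, δ l := fun s => by
    induction s using Finset.cons_induction with
    | empty => simp
    | cons l s hl ih => rw [Finset.prod_cons, Finset.sum_cons, zpow_add₀ hc, ih]
  rw [hz]
  congr 1; ring

theorem len_dil {c a : ℚ} (hc : c ≠ 0) (n : ℕ) (x : Cell C) :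
    len C n (Φ.dil c a x) = Φ.dil c a (len C n x) := by
  refine LinearMap.congr_fun (f := len C n ∘ₗ Φ.dil c a) (g := Φ.dil c a ∘ₗ len C n)
    (Φ.cell_ext fun n' k x hx => ?_) x
  rw [comp_apply, comp_apply, Φ.dil_of_homogCell hc hx, map_smul, len_of_homogCell hx]
  split_ifs
  · rw [Φ.dil_of_homogCell hc hx]
  · rw [map_zero, smul_zero]

include Φ in
theorem len_len (n n' : ℕ) (x : Cell C) : len C n (len C n' x) = if n = n' then len C n x else 0 := by
  refine LinearMap.congr_fun (f := len C n ∘ₗ len C n') (g := if n = n' then len C n else 0)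
    (Φ.cell_ext fun l k x hx => ?_) x |>.trans (by split_ifs <;> rfl)
  rw [comp_apply, len_of_homogCell hx]
  split_ifs with h h' h'
  · rw [h']
  · rw [len_of_homogCell hx, if_neg (h ▸ h')]; rfl
  · rw [map_zero, len_of_homogCell hx, if_neg (h' ▸ h)]
  · rw [map_zero]; rfl

theorem dil_len (a : ℚ) (n : ℕ) (x : Cell C) : Φ.dil 1 a (len C n x) = a ^ n • len C n x := by
  refine LinearMap.congr_fun (f := Φ.dil 1 a ∘ₗ len C n) (g := a ^ n • len C n)
    (Φ.cell_ext fun l k x hx => ?_) x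
  rw [comp_apply, LinearMap.smul_apply, len_of_homogCell hx]
  split_ifs with h
  · rw [Φ.dil_of_homogCell one_ne_zero hx, one_zpow, one_mul, h]
  · rw [map_zero, smul_zero]

include Φ in
theorem sub_pos_eq (x : Cell C) : x - pos C (Cbar C) x = len C 0 x := by
  refine LinearMap.congr_fun (f := LinearMap.id - pos C (Cbar C)) (g := len C 0)
    (Φ.cell_ext fun l k x hx => ?_) x
  rw [len_of_homogCell hx]
  obtain ⟨i, x, δ, w, hx, hw, rfl, rfl⟩ := hx
  rw [LinearMap.sub_apply, id_apply, pos_tmul, TensorAlgebra.tprod_apply]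
  cases l with
  | zero => simp [wordPos_one]
  | succ l =>
    rw [List.ofFn_succ, List.prod_cons, wordPos_ι_mul, sub_self, if_neg (Nat.succ_ne_zero l).symm]

/-- If `f` commutes up to a factor with the dilations and `Q` projects to an eigenspace, then
`Q ∘ f` depends on one length only. -/
theorem proj_comp_len {W W' : Type*} [AddCommGroup W] [Module ℚ W] [AddCommGroup W'] [Module ℚ W']
    {B : W →ₗ[ℚ] W} {f : Cell C →ₗ[ℚ] W} {Q : W →ₗ[ℚ] W'} {ρ β : ℚ} {n : ℕ}
    (hf : ∀ x, ρ • B (f x) = f (Φ.dil 1 2 x)) (hQ : ∀ w, Q (B w) = β • Q w)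
    (hn : ρ * β = 2 ^ n) (x : Cell C) : Q (f x) = Q (f (len C n x)) := by
  refine LinearMap.congr_fun (f := Q ∘ₗ f) (g := Q ∘ₗ f ∘ₗ len C n)
    (Φ.cell_ext fun l k x hx => ?_) x
  simp only [comp_apply]
  rw [len_of_homogCell hx]
  split_ifs with h
  · rfl
  · have e := congrArg Q (hf x)
    rw [Φ.dil_of_homogCell one_ne_zero hx, one_zpow, one_mul, map_smul, map_smul, map_smul, hQ,
      smul_smul, hn] at e
    have e' : ((2 : ℚ) ^ n - 2 ^ l) • Q (f x) = 0 := by rw [sub_smul, e, sub_self]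
    have hne : (2 : ℚ) ^ n - 2 ^ l ≠ 0 :=
      sub_ne_zero.2 fun e => h (pow_right_injective₀ (by norm_num) (by norm_num) e)
    rw [map_zero, map_zero]
    exact (smul_eq_zero.1 e').resolve_left hne

/-! ### Degrees -/

omit [DirectSum.Decomposition 𝒞] in
theorem cellDeg_induction {n : ℕ} {k : ℤ} {M : Type*} [AddCommGroup M] [Module ℚ M]
    {f g : Cell C →ₗ[ℚ] M} (h : n ≠ 0 → ∀ x ∈ homogCell 𝒞 n k, f x = g x) {x : Cell C}
    (hx : x ∈ cellDeg 𝒞 n k) : f x = g x := by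
  rw [cellDeg] at hx
  split_ifs at hx with hn
  · rw [(Submodule.mem_bot ℚ).1 hx, map_zero, map_zero]
  · exact (Submodule.span_le.2 (h hn) : _ ≤ LinearMap.eqLocus f g) hx

omit [DirectSum.Decomposition 𝒞] in
theorem lenPos_of_mem {n n' : ℕ} {k : ℤ} {x : Cell C} (hx : x ∈ cellDeg 𝒞 n' k) :
    π n x = if n = n' then x else 0 := by
  refine cellDeg_induction (f := π n) (g := if n = n' then LinearMap.id else 0) (fun hn x hx => ?_)
    hx |>.trans (by split_ifs <;> rfl)
  rw [lenPos]
  split_ifs with h h' h'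
  · exact absurd (h' ▸ h) hn
  · rfl
  · rw [len_of_homogCell hx, if_pos h']; rfl
  · rw [len_of_homogCell hx, if_neg h']; rfl

include Φ in
theorem lenPos_mem_iSup (n : ℕ) (x : Cell C) : π n x ∈ ⨆ k, cellDeg 𝒞 n k := by
  rw [← Submodule.Quotient.mk_eq_zero]
  refine LinearMap.congr_fun (f := (⨆ k, cellDeg 𝒞 n k).mkQ ∘ₗ π n) (g := 0)
    (Φ.cell_ext fun n' k x hx => ?_) x
  refine (Submodule.Quotient.mk_eq_zero _).2 ?_
  rw [lenPos]
  split_ifs with hn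
  · exact zero_mem _
  · rw [len_of_homogCell hx]
    split_ifs with h
    · refine Submodule.mem_iSup_of_mem k ?_
      rw [cellDeg, if_neg hn]
      subst h
      exact Submodule.subset_span hx
    · exact zero_mem _

/-- The operator `x ↦ 2^|x| x`. -/
abbrev degScale : Cell C →ₗ[ℚ] Cell C := Φ.dil 2 2⁻¹

theorem degScale_of_mem {n : ℕ} {k : ℤ} {x : Cell C} (hx : x ∈ cellDeg 𝒞 n k) :
    Φ.degScale x = (2 : ℚ) ^ k • x :=
  cellDeg_induction (f := Φ.degScale) (g := (2 : ℚ) ^ k • LinearMap.id) (fun _ x hx => by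
    rw [Φ.dil_of_homogCell two_ne_zero hx, zpow_add₀ two_ne_zero, inv_pow, zpow_natCast,
      _root_.mul_assoc, mul_inv_cancel₀ (by positivity), mul_one]
    rfl) hx

theorem lenPos_dil {c a : ℚ} (hc : c ≠ 0) (n : ℕ) (x : Cell C) :
    π n (Φ.dil c a x) = Φ.dil c a (π n x) := by
  rw [lenPos]
  split_ifs
  · rw [LinearMap.zero_apply, LinearMap.zero_apply, map_zero]
  · exact Φ.len_dil hc n x

theorem degScale_lenPos (n : ℕ) : Φ.degScale ∘ₗ π n = π n ∘ₗ Φ.degScale :=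
  LinearMap.ext fun x => (Φ.lenPos_dil two_ne_zero n x).symm

theorem map_lenPos_mem {k : ℤ} {y : Cell C ⊗[ℚ] Cell C}
    (hy : map Φ.degScale Φ.degScale y = (2 : ℚ) ^ k • y) (p q : ℕ) :
    map (π p) (π q) y ∈ tdeg (cellDeg 𝒞 p) (cellDeg 𝒞 q) k := by
  refine mem_of_scale_eq (s := map Φ.degScale Φ.degScale)
    (fun k x hx => map_scale_of_mem two_ne_zero (fun _ _ => Φ.degScale_of_mem)
      (fun _ _ => Φ.degScale_of_mem) hx)
    (map_mem_iSup_tdeg (Φ.lenPos_mem_iSup p) (Φ.lenPos_mem_iSup q) y) ?_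
  rw [← map_smul, ← hy, map_map, map_map, degScale_lenPos, degScale_lenPos]

theorem map_map_lenPos_mem {k : ℤ} {y : Cell C ⊗[ℚ] (Cell C ⊗[ℚ] Cell C)}
    (hy : map Φ.degScale (map Φ.degScale Φ.degScale) y
      = (2 : ℚ) ^ k • y) (p q r : ℕ) :
    map (π p) (map (π q) (π r)) y
      ∈ tdeg (cellDeg 𝒞 p) (tdeg (cellDeg 𝒞 q) (cellDeg 𝒞 r)) k := by
  refine mem_of_scale_eq
    (s := map Φ.degScale (map Φ.degScale Φ.degScale))
    (fun k x hx => map_scale_of_mem two_ne_zero (fun _ _ => Φ.degScale_of_mem)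
      (fun k x hx => map_scale_of_mem two_ne_zero (fun _ _ => Φ.degScale_of_mem)
        (fun _ _ => Φ.degScale_of_mem) hx) hx)
    (map_mem_iSup_tdeg (Φ.lenPos_mem_iSup p) (map_mem_iSup_tdeg (Φ.lenPos_mem_iSup q)
      (Φ.lenPos_mem_iSup r)) y) ?_
  rw [← map_smul, ← hy, map_map, map_map, ← map_comp, ← map_comp, degScale_lenPos, degScale_lenPos,
    degScale_lenPos]

end OpenFrobenius

end

namespace OpenFrobenius

open KModel

variable {C : Type*} [AddCommGroup C] [Module ℚ C] [Coalgebra ℚ C] {m : ℤ}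
  {𝒞 : ℤ → Submodule ℚ C} [DirectSum.Decomposition 𝒞] (Φ : OpenFrobenius m 𝒞)

local notation "π" => lenPos C

/-- The differential of `CC[1-m]` before completion. -/
abbrev bS : Cell C →ₗ[ℚ] Cell C := Φ.bIntS + Φ.bExtS

/-- `∨` on `CC[1-m]` before completion, truncated to words of positive length. -/
abbrev veeP : Cell C →ₗ[ℚ] Cell C ⊗[ℚ] Cell C := pos₂ C (Cbar C) ∘ₗ Φ.veeS

/-- `S` on `CC[1-m]` before completion, truncated to words of positive length. -/
abbrev SP : Cell C →ₗ[ℚ] Cell C ⊗[ℚ] Cell C :=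
  Φ.barModel.hP + kflip Φ.γs Φ.γs ∘ₗ Φ.barModel.hP

/-! ### The differential and the length -/

theorem pos_bS (x : Cell C) : pos C (Cbar C) (Φ.bS x) = Φ.bS (pos C (Cbar C) x) := by
  have e : ∀ x, pos C C (emb C x) = emb C (pos C (Cbar C) x) := pos_ceMap LinearMap.id incl
  refine (Function.LeftInverse.injective Φ.ceMap_proj_emb :) ?_
  rw [← e, ← Φ.b_emb, Φ.model.pos_b, ← Φ.b_emb, e]

include Φ in
theorem len_pos (n : ℕ) (x : Cell C) : len C n (pos C (Cbar C) x) = π n x := by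
  rw [← sub_sub_cancel x (pos C (Cbar C) x), Φ.sub_pos_eq, map_sub, Φ.len_len, lenPos]
  split_ifs with h
  · rw [sub_self]; rfl
  · rw [sub_zero]

include Φ in
/-- An eigenvector of the dilation is homogeneous in the length. -/
theorem len_of_dil_eq {n : ℕ} {y : Cell C} (hy : Φ.dil 1 2 y = (2 : ℚ) ^ n • y) :
    len C n y = y := by
  let F : ℤ → Submodule ℚ (Cell C) := fun k =>
    LinearMap.range (if 0 ≤ k then len C k.toNat else 0)
  have hF : ∀ k, ∀ x ∈ F k, Φ.dil 1 2 x = (2 : ℚ) ^ k • x := by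
    rintro k _ ⟨x, rfl⟩
    split_ifs with hk
    · rw [Φ.dil_len, ← zpow_natCast, Int.toNat_of_nonneg hk]
    · rw [LinearMap.zero_apply, map_zero, smul_zero]
  have hsup : y ∈ ⨆ k, F k := by
    rw [← Submodule.Quotient.mk_eq_zero]
    refine LinearMap.congr_fun (f := (⨆ k, F k).mkQ) (g := 0) (Φ.cell_ext fun l k x hx => ?_) y
    refine (Submodule.Quotient.mk_eq_zero _).2 (Submodule.mem_iSup_of_mem (l : ℤ) ⟨x, ?_⟩)
    rw [if_pos (Int.natCast_nonneg l), Int.toNat_natCast, len_of_homogCell hx, if_pos rfl]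
  obtain ⟨x, hx⟩ := mem_of_scale_eq hF hsup (k := n) (by rw [hy, zpow_natCast])
  rw [if_pos (Int.natCast_nonneg n), Int.toNat_natCast] at hx
  rw [← hx, Φ.len_len, if_pos rfl]

include Φ in
theorem len_comp {f : Cell C →ₗ[ℚ] Cell C} {r : ℕ}
    (hf : ∀ x, ((2 : ℚ) ^ r)⁻¹ • Φ.dil 1 2 (f x) = f (Φ.dil 1 2 x)) (n : ℕ) (x : Cell C) :
    len C (n + r) (f x) = f (len C n x) := by
  rw [Φ.proj_comp_len (B := Φ.dil 1 2) (β := 2 ^ (n + r)) (n := n) hf (fun w => by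
    rw [Φ.len_dil one_ne_zero, Φ.dil_len]) (by rw [pow_add]; field_simp)]
  refine Φ.len_of_dil_eq ?_
  have e := hf (len C n x)
  rw [Φ.dil_len, map_smul] at e
  rw [pow_add, _root_.mul_comm, ← smul_smul, ← e, smul_smul, mul_inv_cancel₀ (by positivity), one_smul]

theorem lenPos_bS (n : ℕ) : π n ∘ₗ Φ.bS
    = Φ.bIntS ∘ₗ π n + Φ.bExtS ∘ₗ (if n = 0 then 0 else π (n - 1)) := by
  cases n with
  | zero => simp [lenPos]
  | succ n =>
    refine LinearMap.ext fun x => ?_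
    have e₁ := Φ.len_comp (f := Φ.bInt) (r := 0) (fun x => by
      rw [← Φ.dil_bInt one_ne_zero]; simp) (n + 1) (pos C (Cbar C) x)
    have e₂ := Φ.len_comp (f := Φ.bExt) (r := 1) (fun x => by
      rw [← Φ.dil_bExt one_ne_zero two_ne_zero]; simp) n (pos C (Cbar C) x)
    rw [comp_apply, ← Φ.len_pos, pos_bS, if_neg n.succ_ne_zero, LinearMap.add_apply,
      LinearMap.add_apply, comp_apply, comp_apply, bIntS, bExtS, map_add, LinearMap.smul_apply,
      LinearMap.smul_apply, map_smul, map_smul, e₂, Φ.len_pos]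
    rw [add_zero] at e₁
    rw [e₁, Φ.len_pos]
    rfl

theorem degScale_bS (x : Cell C) : Φ.bS (Φ.degScale x) = Φ.degScale (((2 : ℚ) • Φ.bS) x) := by
  have h₁ := Φ.dil_bInt (a := 2⁻¹) two_ne_zero x
  have h₂ := Φ.dil_bExt (a := 2⁻¹) two_ne_zero (by norm_num) x
  rw [inv_inv] at h₂
  simp only [bS, bIntS, bExtS, LinearMap.add_apply, LinearMap.smul_apply, map_add, map_smul, ← h₁,
    ← h₂, smul_add, smul_comm (2 : ℚ)]

theorem lenPos_γs (n : ℕ) : π n ∘ₗ Φ.γs = Φ.γs ∘ₗ π n := by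
  refine Φ.cell_ext fun l k x hx => ?_
  obtain ⟨c, hc⟩ : ∃ c : ℚ, Φ.γs x = c • x := ⟨_, by
    rw [γs, LinearMap.smul_apply,
      show Φ.γcell = Φ.dil (-1) (-1) from congrArg (map _) (congrArg wordMap (neg_one_smul ℚ _).symm),
      Φ.dil_of_homogCell (by norm_num) hx, smul_smul]⟩
  rw [comp_apply, comp_apply, hc, map_smul, lenPos]
  split_ifs
  · rw [LinearMap.zero_apply, map_zero, smul_zero]
  · rw [len_of_homogCell hx]
    split_ifs
    · exact hc.symm
    · rw [map_zero, smul_zero]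

/-! ### Homogeneous operators -/

/-- `φ` has degree `d` and shortens words by `r` letters. -/
structure Homog (r : ℕ) (d : ℤ) (φ : Cell C →ₗ[ℚ] Cell C ⊗[ℚ] Cell C) : Prop where
  len : ∀ x, (2 : ℚ) ^ r • map (Φ.dil 1 2) (Φ.dil 1 2) (φ x) = φ (Φ.dil 1 2 x)
  deg : ∀ x, φ (Φ.degScale x) = map Φ.degScale Φ.degScale (((2 : ℚ) ^ (-d) • φ) x)

variable {Φ}

theorem map_pos_dil {c a : ℚ} (t : Cell C ⊗[ℚ] Cell C) : map (Φ.dil c a) (Φ.dil c a)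
    (pos₂ C (Cbar C) t) = pos₂ C (Cbar C) (map (Φ.dil c a) (Φ.dil c a) t) := by
  rw [pos₂, map_map, map_map,
    show Φ.dil c a ∘ₗ pos C (Cbar C) = pos C (Cbar C) ∘ₗ Φ.dil c a from LinearMap.ext fun x => (pos_ceMap _ _ x).symm]

theorem homog_veeP : Φ.Homog 1 (1 - m) Φ.veeP where
  len x := by
    rw [comp_apply, comp_apply, ← Φ.dil_veeS one_ne_zero, map_smul, map_pos_dil, one_zpow, mul_one,
      pow_one]
  deg x := by
    rw [LinearMap.smul_apply, map_smul, comp_apply, comp_apply, ← Φ.dil_veeS two_ne_zero, map_smul,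
      map_pos_dil]
    congr 1
    rw [neg_sub, zpow_sub_one₀ two_ne_zero, _root_.mul_comm]

theorem homog_hP : Φ.Homog 2 (2 - m) Φ.barModel.hP where
  len x := by rw [← Φ.dil_hP one_ne_zero, one_zpow, mul_one, sq]
  deg x := by
    rw [LinearMap.smul_apply, map_smul, ← Φ.dil_hP two_ne_zero]
    congr 1
    rw [neg_sub, zpow_sub₀ two_ne_zero]
    norm_num
    ring

theorem Homog.add_kflip {r : ℕ} {d : ℤ} {φ : Cell C →ₗ[ℚ] Cell C ⊗[ℚ] Cell C}
    (h : Φ.Homog r d φ) : Φ.Homog r d (φ + kflip Φ.γs Φ.γs ∘ₗ φ) where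
  len x := by
    simp only [LinearMap.add_apply, map_add, comp_apply, smul_add, ← h.len, map_smul,
      kflip_map (Φ.γs_dil one_ne_zero) (Φ.γs_dil one_ne_zero)]
  deg x := by
    simp only [LinearMap.add_apply, map_add, comp_apply, smul_add, h.deg, map_smul,
      LinearMap.smul_apply, kflip_map (Φ.γs_dil two_ne_zero) (Φ.γs_dil two_ne_zero)]

theorem Homog.γs_comp {r : ℕ} {d : ℤ} {φ : Cell C →ₗ[ℚ] Cell C ⊗[ℚ] Cell C}
    (h : Φ.Homog r d φ) : Φ.Homog r d (map Φ.γs .id ∘ₗ φ) := by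
  have e : ∀ {c a : ℚ}, c ≠ 0 → ∀ t, map Φ.γs .id (map (Φ.dil c a) (Φ.dil c a) t)
      = map (Φ.dil c a) (Φ.dil c a) (map Φ.γs .id t) := fun hc t => by
    rw [map_map, map_map,
      show Φ.γs ∘ₗ Φ.dil _ _ = Φ.dil _ _ ∘ₗ Φ.γs from LinearMap.ext (Φ.γs_dil hc)]
    rfl
  refine ⟨fun x => ?_, fun x => ?_⟩
  · simp only [comp_apply, ← h.len, map_smul, e one_ne_zero]
  · simp only [comp_apply, h.deg, map_smul, LinearMap.smul_apply, e two_ne_zero]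

theorem homog_SP : Φ.Homog 2 (2 - m) Φ.SP := homog_hP.add_kflip

theorem lenPos_dil_two (p : ℕ) : π p ∘ₗ Φ.dil 1 2 = (2 : ℚ) ^ p • π p := by
  rw [lenPos]
  split_ifs
  · rw [LinearMap.zero_comp, smul_zero]
  · exact LinearMap.ext fun x => by
      rw [comp_apply, Φ.len_dil one_ne_zero, Φ.dil_len]; rfl

theorem Homog.map_lenPos {r : ℕ} {d : ℤ} {φ : Cell C →ₗ[ℚ] Cell C ⊗[ℚ] Cell C}
    (h : Φ.Homog r d φ) (p q : ℕ) :
    map (π p) (π q) ∘ₗ φ = map (π p) (π q) ∘ₗ φ ∘ₗ π (p + q + r) := by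
  rcases eq_or_ne p 0 with rfl | hp
  · simp [lenPos]
  · refine LinearMap.ext fun x => ?_
    rw [comp_apply, Φ.proj_comp_len (Q := map (π p) (π q)) (n := p + q + r) h.len
      (fun w => by rw [map_map, lenPos_dil_two, lenPos_dil_two, map_smul_left, map_smul_right,
        smul_smul, LinearMap.smul_apply]) (by rw [pow_add, pow_add]; ring),
      comp_apply, comp_apply, lenPos.eq_1 C (p + q + r), if_neg (by omega)]

/-! ### Finite representatives

A component of an element of the completed complex depends on finitely many components of its
argument, so identities can be checked on elements of `Cell C` and its tensor powers. -/

variable (Φ)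

/-- `x` agrees with `α` up to length `N`. -/
structure Rep1 (k : ℤ) (N : ℕ) (α : Ch1 C) (x : Cell C) : Prop where
  deg : Φ.degScale x = (2 : ℚ) ^ k • x
  eq : ∀ n ≤ N, π n x = α n

/-- `y` agrees with `ξ` up to total length `N`. -/
structure Rep2 (k : ℤ) (N : ℕ) (ξ : Ch2 C) (y : Cell C ⊗[ℚ] Cell C) : Prop where
  deg : map Φ.degScale Φ.degScale y = (2 : ℚ) ^ k • y
  eq : ∀ p q, p + q ≤ N → map (π p) (π q) y = ξ p q

/-- `z` agrees with `ζ` up to total length `N`. -/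
structure Rep3 (k : ℤ) (N : ℕ) (ζ : Ch3 C) (z : Cell C ⊗[ℚ] (Cell C ⊗[ℚ] Cell C)) : Prop where
  deg : map Φ.degScale (map Φ.degScale Φ.degScale) z = (2 : ℚ) ^ k • z
  eq : ∀ p q r, p + q + r ≤ N → map (π p) (map (π q) (π r)) z = ζ p q r

variable {Φ} {k k' d : ℤ} {N r : ℕ} {α : Ch1 C} {ξ : Ch2 C} {ζ : Ch3 C} {x : Cell C}
  {y : Cell C ⊗[ℚ] Cell C} {z : Cell C ⊗[ℚ] (Cell C ⊗[ℚ] Cell C)}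
  {φ : Cell C →ₗ[ℚ] Cell C ⊗[ℚ] Cell C}

theorem exists_rep1 (hα : α ∈ cc1 𝒞 k) (N : ℕ) :
    Φ.Rep1 k N α (∑ n ∈ Finset.range (N + 1), α n) where
  deg := by
    rw [map_sum, Finset.smul_sum]
    exact Finset.sum_congr rfl fun n _ => Φ.degScale_of_mem (hα n trivial)
  eq n hn := by
    rw [map_sum, Finset.sum_eq_single n, lenPos_of_mem (hα n trivial), if_pos rfl]
    · exact fun n' _ h => by rw [lenPos_of_mem (hα n' trivial), if_neg h.symm]
    · exact fun h => absurd (Finset.mem_range.2 (by omega)) h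

omit [DirectSum.Decomposition 𝒞] in
theorem map_lenPos_of_mem {p q p' q' : ℕ} (hy : y ∈ tdeg (cellDeg 𝒞 p') (cellDeg 𝒞 q') k) :
    map (π p) (π q) y = if p = p' ∧ q = q' then y else 0 := by
  refine (tdeg_induction (f := map (π p) (π q)) (g := if p = p' ∧ q = q' then LinearMap.id else 0)
    (fun i a ha b hb => ?_) hy).trans (by split_ifs <;> rfl)
  rw [map_tmul, lenPos_of_mem ha, lenPos_of_mem hb]
  split_ifs <;> simp_all

theorem exists_rep2 (hξ : ξ ∈ cc2 𝒞 k) (N : ℕ) :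
    Φ.Rep2 k N ξ (∑ p ∈ Finset.range (N + 1), ∑ q ∈ Finset.range (N + 1), ξ p q) where
  deg := by
    simp only [map_sum, Finset.smul_sum]
    exact Finset.sum_congr rfl fun p _ => Finset.sum_congr rfl fun q _ =>
      map_scale_of_mem two_ne_zero (fun _ _ => Φ.degScale_of_mem) (fun _ _ => Φ.degScale_of_mem)
        (hξ p trivial q trivial)
  eq p q h := by
    simp only [map_sum]
    rw [Finset.sum_eq_single p, Finset.sum_eq_single q, map_lenPos_of_mem (hξ p trivial q trivial),
      if_pos ⟨rfl, rfl⟩]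
    · exact fun q' _ h => by
        rw [map_lenPos_of_mem (hξ p trivial q' trivial), if_neg fun e => h e.2.symm]
    · exact fun h => absurd (Finset.mem_range.2 (by omega)) h
    · exact fun p' _ h => Finset.sum_eq_zero fun q' _ => by
        rw [map_lenPos_of_mem (hξ p' trivial q' trivial), if_neg fun e => h e.1.symm]
    · exact fun h => absurd (Finset.mem_range.2 (by omega)) h

theorem Rep1.mono {N' : ℕ} (h : Φ.Rep1 k N α x) (hN : N' ≤ N) : Φ.Rep1 k N' α x :=
  ⟨h.deg, fun n hn => h.eq n (hn.trans hN)⟩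

theorem mem_cc2 (hk : k = k') (h : ∀ N, ∃ y, Φ.Rep2 k N ξ y) : ξ ∈ cc2 𝒞 k' := by
  intro p _ q _
  obtain ⟨y, hy⟩ := h (p + q)
  change ξ p q ∈ _
  rw [← hy.eq p q le_rfl, ← hk]
  exact Φ.map_lenPos_mem hy.deg p q

theorem mem_cc3 (hk : k = k') (h : ∀ N, ∃ z, Φ.Rep3 k N ζ z) : ζ ∈ cc3 𝒞 k' := by
  intro p _ q _ r _
  obtain ⟨z, hz⟩ := h (p + q + r)
  change ζ p q r ∈ _
  rw [← hz.eq p q r le_rfl, ← hk]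
  exact Φ.map_map_lenPos_mem hz.deg p q r

theorem op_eq (p q : ℕ) : op r φ α p q = map (π p) (π q) (φ (α (p + q + r))) := by
  rw [op]
  split_ifs with h
  · rcases h with rfl | rfl <;> simp [lenPos]
  · rw [lenPos, lenPos, if_neg (fun e => h (Or.inl e)), if_neg (fun e => h (Or.inr e))]

theorem opLeft_eq (p q t : ℕ) : opLeft r φ ξ p q t = assoc _ _ _
    (map (map (π p) (π q) ∘ₗ φ) LinearMap.id (ξ (p + q + r) t)) := by
  rw [opLeft]
  split_ifs with h
  · rcases h with rfl | rfl <;> simp [lenPos]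
  · rw [lenPos, lenPos, if_neg (fun e => h (Or.inl e)), if_neg (fun e => h (Or.inr e))]

theorem opRight_eq (g : Cell C →ₗ[ℚ] Cell C) (p q t : ℕ) : opRight r g φ ξ p q t
    = map g (map (π q) (π t) ∘ₗ φ) (ξ p (q + t + r)) := by
  rw [opRight]
  split_ifs with h
  · rcases h with rfl | rfl <;> simp [lenPos]
  · rw [lenPos, lenPos, if_neg (fun e => h (Or.inl e)), if_neg (fun e => h (Or.inr e))]

theorem Rep1.op (hφ : Φ.Homog r d φ) (h : Φ.Rep1 k (N + r) α x) :
    Φ.Rep2 (k + d) N (op r φ α) (φ x) where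
  deg := by
    have e := hφ.deg x
    rw [h.deg, map_smul, LinearMap.smul_apply, map_smul] at e
    rw [zpow_add₀ two_ne_zero, _root_.mul_comm, ← smul_smul, e, smul_smul, ← zpow_add₀ two_ne_zero,
      add_neg_cancel, zpow_zero, one_smul]
  eq p q hpq := by
    rw [op_eq, ← h.eq _ (by omega)]
    exact LinearMap.congr_fun (hφ.map_lenPos p q) x

theorem Rep1.b1S (h : Φ.Rep1 k N α x) : Φ.Rep1 (k - 1) N (Φ.b1S α) (Φ.bS x) where
  deg := by
    have e := Φ.degScale_bS x
    rw [h.deg, map_smul, LinearMap.smul_apply, map_smul] at e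
    rw [zpow_sub_one₀ two_ne_zero, _root_.mul_comm, ← smul_smul, e, smul_smul,
      inv_mul_cancel₀ two_ne_zero, one_smul]
  eq n hn := by
    refine (LinearMap.congr_fun (Φ.lenPos_bS n) x).trans ?_
    simp only [LinearMap.add_apply, comp_apply, OpenFrobenius.b1S, LinearMap.smul_apply,
      Pi.smul_apply, b1, LinearMap.pi_apply, smul_add, bIntS, bExtS, h.eq n hn,
      LinearMap.proj_apply, prev]
    split_ifs with h0
    · simp
    · rw [h.eq (n - 1) (by omega)]; rfl

theorem Rep2.prev_left (h : Φ.Rep2 k N ξ y) {p q : ℕ} (hN : p + q ≤ N) :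
    map (if p = 0 then 0 else π (p - 1)) (π q) y = prev _ p ξ q := by
  rw [prev]
  split_ifs
  · simp
  · exact h.eq _ _ (by omega)

theorem Rep2.prev_right (h : Φ.Rep2 k N ξ y) {p q : ℕ} (hN : p + q ≤ N) :
    map (π p) (if q = 0 then 0 else π (q - 1)) y = prev _ q (ξ p) := by
  rw [prev]
  split_ifs
  · simp
  · exact h.eq _ _ (by omega)

theorem Rep2.b2S (h : Φ.Rep2 k N ξ y) : Φ.Rep2 (k - 1) N (Φ.b2S ξ) (tb₂ Φ.γs Φ.bS y) where
  deg := by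
    have e := tb₂_map (Φ.γs_dil two_ne_zero) Φ.degScale_bS y
    have e' : tb₂ Φ.γs ((2 : ℚ) • Φ.bS) y = (2 : ℚ) • tb₂ Φ.γs Φ.bS y := by
      rw [tb₂, map_smul_left, map_smul_right, ← smul_add]; rfl
    rw [e', h.deg, map_smul, map_smul] at e
    rw [zpow_sub_one₀ two_ne_zero, _root_.mul_comm, ← smul_smul, e, smul_smul,
      inv_mul_cancel₀ two_ne_zero, one_smul]
  eq p q hpq := by
    have e : map (π p) (π q) ∘ₗ tb₂ Φ.γs Φ.bS = map (π p ∘ₗ Φ.bS) (π q)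
        + map (π p ∘ₗ Φ.γs) (π q ∘ₗ Φ.bS) := by
      rw [tb₂, LinearMap.comp_add, ← map_comp, ← map_comp, LinearMap.comp_id]
    have e' : ∀ f g : Cell C →ₗ[ℚ] Cell C, map (f ∘ₗ g) (π q) = map f .id ∘ₗ map g (π q) :=
      fun f g => by rw [← map_comp, LinearMap.id_comp]
    rw [← comp_apply, e, lenPos_bS, lenPos_bS, lenPos_γs, map_add_left, map_add_right,
      map_comp Φ.γs, map_comp Φ.γs, e', e']
    simp only [LinearMap.add_apply, comp_apply, h.eq p q hpq, h.prev_left hpq, h.prev_right hpq,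
      OpenFrobenius.b2S, LinearMap.pi_apply, LinearMap.proj_apply]
    abel

theorem map_tb₃ {V : Type*} [AddCommGroup V] [Module ℚ V] {g b c c' f₁ f₁' f₂ f₂' f₃ f₃' : V →ₗ[ℚ] V}
    (h₁ : f₁ ∘ₗ b = c ∘ₗ f₁ + c' ∘ₗ f₁') (h₂ : f₂ ∘ₗ b = c ∘ₗ f₂ + c' ∘ₗ f₂')
    (h₃ : f₃ ∘ₗ b = c ∘ₗ f₃ + c' ∘ₗ f₃') (g₁ : f₁ ∘ₗ g = g ∘ₗ f₁) (g₂ : f₂ ∘ₗ g = g ∘ₗ f₂)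
    (z : V ⊗[ℚ] (V ⊗[ℚ] V)) : map f₁ (map f₂ f₃) (tb₃ g b z)
      = (map c .id + map g (map c .id) + map g (map g c) :
          V ⊗[ℚ] (V ⊗[ℚ] V) →ₗ[ℚ] V ⊗[ℚ] (V ⊗[ℚ] V)) (map f₁ (map f₂ f₃) z)
        + map c' .id (map f₁' (map f₂ f₃) z)
        + map g (map c' .id) (map f₁ (map f₂' f₃) z)
        + map g (map g c') (map f₁ (map f₂ f₃') z) := by
  refine cube_ext (γ := LinearMap.id) (fun _ => rfl) (f := map f₁ (map f₂ f₃) ∘ₗ tb₃ g b)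
    (g := (map c .id + map g (map c .id) + map g (map g c)) ∘ₗ
          map f₁ (map f₂ f₃) + map c' .id ∘ₗ map f₁' (map f₂ f₃)
        + map g (map c' .id) ∘ₗ map f₁ (map f₂' f₃)
        + map g (map g c') ∘ₗ map f₁ (map f₂ f₃')) 
    (fun _ _ _ x y w _ _ _ => ?_) z
  have h₁ := LinearMap.congr_fun h₁ x
  have h₂ := LinearMap.congr_fun h₂ y
  have h₃ := LinearMap.congr_fun h₃ w
  have g₁ := LinearMap.congr_fun g₁ x
  have g₂ := LinearMap.congr_fun g₂ y
  simp only [comp_apply, LinearMap.add_apply] at h₁ h₂ h₃ g₁ g₂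
  simp only [comp_apply, LinearMap.add_apply, tb₃_tmul, tb₂_tmul, map_add, map_tmul, tmul_add,
    add_tmul, id_apply, h₁, h₂, h₃, g₁, g₂]
  abel

theorem Rep3.b3S (h : Φ.Rep3 k N ζ z) : Φ.Rep3 (k - 1) N (Φ.b3S ζ) (tb₃ Φ.γs Φ.bS z) where
  deg := by
    have e := tb₃_map (Φ.γs_dil two_ne_zero) Φ.degScale_bS z
    have e' : tb₃ Φ.γs ((2 : ℚ) • Φ.bS) z = (2 : ℚ) • tb₃ Φ.γs Φ.bS z := by
      rw [tb₃, tb₂, map_smul_left, map_smul_left, map_smul_right, ← smul_add, map_smul_right,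
        ← smul_add]
      rfl
    rw [e', h.deg, map_smul, map_smul] at e
    rw [zpow_sub_one₀ two_ne_zero, _root_.mul_comm, ← smul_smul, e, smul_smul,
      inv_mul_cancel₀ two_ne_zero, one_smul]
  eq p q r hN := by
    have h₁ : map (if p = 0 then 0 else π (p - 1)) (map (π q) (π r)) z = prev _ p ζ q r := by
      rw [prev]
      split_ifs
      · simp
      · exact h.eq _ _ _ (by omega)
    have h₂ : map (π p) (map (if q = 0 then 0 else π (q - 1)) (π r)) z = prev _ q (ζ p) r := by
      rw [prev]
      split_ifs
      · simp
      · exact h.eq _ _ _ (by omega)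
    have h₃ : map (π p) (map (π q) (if r = 0 then 0 else π (r - 1))) z = prev _ r (ζ p q) := by
      rw [prev]
      split_ifs
      · simp
      · exact h.eq _ _ _ (by omega)
    rw [map_tb₃ (Φ.lenPos_bS p) (Φ.lenPos_bS q) (Φ.lenPos_bS r) (Φ.lenPos_γs p) (Φ.lenPos_γs q),
      h.eq p q r hN, h₁, h₂, h₃]
    rfl

theorem Rep2.opLeft (hφ : Φ.Homog r d φ) (h : Φ.Rep2 k (N + r) ξ y) :
    Φ.Rep3 (k + d) N (opLeft r φ ξ) (lft φ y) where
  deg := by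
    have e := lft_map hφ.deg y
    have e' : lft ((2 : ℚ) ^ (-d) • φ) y = (2 : ℚ) ^ (-d) • lft φ y := by
      rw [lft, map_smul_left, LinearMap.comp_smul]; rfl
    rw [h.deg, map_smul, e', map_smul] at e
    rw [zpow_add₀ two_ne_zero, _root_.mul_comm, ← smul_smul, e, smul_smul, ← zpow_add₀ two_ne_zero,
      add_neg_cancel, zpow_zero, one_smul]
  eq p q t hN := by
    rw [opLeft_eq, ← h.eq _ _ (by omega), map_map, LinearMap.id_comp, LinearMap.comp_assoc,
      ← hφ.map_lenPos, lft, comp_apply, LinearEquiv.coe_coe, ← assoc_map, map_map,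
      LinearMap.comp_id]

theorem Rep2.opRight {g : Cell C →ₗ[ℚ] Cell C} (hφ : Φ.Homog r d φ)
    (hg : ∀ n, π n ∘ₗ g = g ∘ₗ π n) (hg' : ∀ x, g (Φ.degScale x) = Φ.degScale (g x))
    (h : Φ.Rep2 k (N + r) ξ y) : Φ.Rep3 (k + d) N (opRight r g φ ξ) (map g φ y) where
  deg := by
    have e := rgt_map hg' hφ.deg y
    rw [h.deg, map_smul, map_smul_right, LinearMap.smul_apply, map_smul] at e
    rw [zpow_add₀ two_ne_zero, _root_.mul_comm, ← smul_smul, e, smul_smul, ← zpow_add₀ two_ne_zero,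
      add_neg_cancel, zpow_zero, one_smul]
  eq p q t hN := by
    rw [opRight_eq, ← h.eq _ _ (by omega), map_map, map_map, LinearMap.comp_assoc,
      ← hφ.map_lenPos, hg]

theorem Rep2.flip2 {g : Cell C →ₗ[ℚ] Cell C} (hg : ∀ n, π n ∘ₗ g = g ∘ₗ π n)
    (hg' : ∀ x, g (Φ.degScale x) = Φ.degScale (g x)) (h : Φ.Rep2 k N ξ y) :
    Φ.Rep2 k N (flip2 g ξ) (kflip g g y) where
  deg := by rw [← kflip_map hg' hg', h.deg, map_smul]
  eq p q hN := by
    rw [HochCog.flip2, ← h.eq q p (by omega), kflip_map (fun x => (LinearMap.congr_fun (hg q) x).symm)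
      fun x => (LinearMap.congr_fun (hg p) x).symm]

theorem Rep3.flip23 {g : Cell C →ₗ[ℚ] Cell C} (hg : ∀ n, π n ∘ₗ g = g ∘ₗ π n)
    (hg' : ∀ x, g (Φ.degScale x) = Φ.degScale (g x)) (h : Φ.Rep3 k N ζ z) :
    Φ.Rep3 k N (flip23 g ζ) (flipR g z) where
  deg := by rw [← flipR_cube_map hg', h.deg, map_smul]
  eq p q r hN := by
    rw [HochCog.flip23, ← h.eq p r q (by omega), flipR, map_map, map_map, LinearMap.id_comp,
      LinearMap.comp_id]
    congr 2
    exact LinearMap.ext fun t => (kflip_map (fun x => (LinearMap.congr_fun (hg r) x).symm)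
      (fun x => (LinearMap.congr_fun (hg q) x).symm) t).symm

theorem kcyc_map {A A' : Type*} [AddCommGroup A] [Module ℚ A] [AddCommGroup A'] [Module ℚ A']
    {g : A →ₗ[ℚ] A} {g' : A' →ₗ[ℚ] A'} {f₁ f₂ f₃ : A →ₗ[ℚ] A'} (h₁ : ∀ x, g' (f₁ x) = f₁ (g x))
    (h₂ : ∀ x, g' (f₂ x) = f₂ (g x)) (h₃ : ∀ x, g' (f₃ x) = f₃ (g x)) (t : A ⊗[ℚ] (A ⊗[ℚ] A)) :
    kcyc g' (map f₁ (map f₂ f₃) t) = map f₂ (map f₃ f₁) (kcyc g t) := by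
  rw [kcyc, comp_apply, kflip_map (γB := map g g) h₁ fun t => ?_, LinearEquiv.coe_coe, assoc_map]
  · rfl
  · rw [map_map, map_map, show g' ∘ₗ f₂ = f₂ ∘ₗ g from LinearMap.ext h₂,
      show g' ∘ₗ f₃ = f₃ ∘ₗ g from LinearMap.ext h₃]

theorem Rep3.cyc3 {g : Cell C →ₗ[ℚ] Cell C} (hg : ∀ n, π n ∘ₗ g = g ∘ₗ π n)
    (hg' : ∀ x, g (Φ.degScale x) = Φ.degScale (g x)) (h : Φ.Rep3 k N ζ z) :
    Φ.Rep3 k N (cyc3 g ζ) (kcyc g z) where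
  deg := by rw [← kcyc_map hg' hg' hg', h.deg, map_smul]
  eq p q r hN := by
    have hg₁ : ∀ n x, g (π n x) = π n (g x) := fun n x => (LinearMap.congr_fun (hg n) x).symm
    rw [HochCog.cyc3, ← h.eq r p q (by omega), kcyc_map (hg₁ r) (hg₁ p) (hg₁ q)]

end OpenFrobenius

namespace OpenFrobenius

open KModel

variable {C : Type*} [AddCommGroup C] [Module ℚ C] [Coalgebra ℚ C] {m : ℤ}
  {𝒞 : ℤ → Submodule ℚ C} [DirectSum.Decomposition 𝒞] {Φ : OpenFrobenius m 𝒞}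

local notation "π" => lenPos C

section

variable {r : ℕ} {φ ψ : Cell C →ₗ[ℚ] Cell C ⊗[ℚ] Cell C} (h : pos₂ C (Cbar C) ∘ₗ φ = ψ)

include Φ in
theorem map_lenPos_pos₂ (p q : ℕ) : map (π p) (π q) ∘ₗ pos₂ C (Cbar C) = map (π p) (π q) := by
  have e : ∀ p, π p ∘ₗ pos C (Cbar C) = π p := fun p => LinearMap.ext fun x => by
    rw [comp_apply, ← Φ.len_pos, pos_pos, Φ.len_pos]
  rw [pos₂, ← map_comp, e, e]

include Φ h

theorem op_congr (α : Ch1 C) : op r φ α = op r ψ α := by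
  funext p q
  rw [op_eq, op_eq, ← h]
  exact (LinearMap.congr_fun (map_lenPos_pos₂ (Φ := Φ) p q) _).symm

theorem opLeft_congr (ξ : Ch2 C) : opLeft r φ ξ = opLeft r ψ ξ := by
  funext p q t
  rw [opLeft_eq, opLeft_eq, ← h, ← LinearMap.comp_assoc, map_lenPos_pos₂ (Φ := Φ)]

theorem opRight_congr (g : Cell C →ₗ[ℚ] Cell C) (ξ : Ch2 C) :
    opRight r g φ ξ = opRight r g ψ ξ := by
  funext p q t
  rw [opRight_eq, opRight_eq, ← h, ← LinearMap.comp_assoc, map_lenPos_pos₂ (Φ := Φ)]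

end

theorem pos₂_SL : pos₂ C (Cbar C) ∘ₗ Φ.SL = map Φ.γs .id ∘ₗ Φ.SP := by
  rw [SL, ← LinearMap.comp_assoc, SP, ← Φ.SS_eq, ← LinearMap.comp_assoc, pos₂, ← map_comp, ← map_comp,
    show pos C (Cbar C) ∘ₗ Φ.γs = Φ.γs ∘ₗ pos C (Cbar C) by
      rw [γs_eq]; exact LinearMap.ext Φ.barModel.pos_γc]
  rfl

variable {k : ℤ} {N : ℕ} {α : Ch1 C} {x : Cell C}

/-- The homotopy for the coderivation property. -/
theorem Rep1.HP (h : Φ.Rep1 k (N + 4) α x) : Φ.Rep3 (k + 2 * (2 - m)) N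
    (fun p q r => map (π p) (map (π q) (π r)) (kcyc Φ.γs (Φ.barModel.HP (α (p + q + r + 4)))))
    (kcyc Φ.γs (Φ.barModel.HP x)) where
  deg := by
    have e := Φ.dil_HP (a := 2⁻¹) two_ne_zero x
    rw [h.deg, map_smul] at e
    have hγ := Φ.γs_dil (a := 2⁻¹) two_ne_zero
    rw [← kcyc_map hγ hγ hγ, ← map_smul]
    congr 1
    rw [zpow_add₀ two_ne_zero, _root_.mul_comm, ← smul_smul, ← e, smul_smul]
    conv_lhs => rw [← one_smul ℚ (map _ _ _)]
    congr 1
    rw [show (2⁻¹ * 2⁻¹ * 2 ^ m : ℚ) = 2 ^ (m - 2) by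
        rw [zpow_sub₀ two_ne_zero]; norm_num; ring,
      ← zpow_add₀ two_ne_zero, ← zpow_add₀ two_ne_zero,
      show 2 * (2 - m) + (m - 2 + (m - 2)) = 0 by ring, zpow_zero]
  eq p q r hN := by
    have hγ := Φ.γs_dil (a := 2) one_ne_zero
    have e := Φ.proj_comp_len (f := kcyc Φ.γs ∘ₗ Φ.barModel.HP)
      (Q := map (π p) (map (π q) (π r))) (B := map (Φ.dil 1 2) (map (Φ.dil 1 2) (Φ.dil 1 2)))
      (ρ := 2 ^ 4) (β := 2 ^ (p + q + r)) (n := p + q + r + 4) (fun x => by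
        rw [comp_apply, comp_apply, ← Φ.dil_HP one_ne_zero, map_smul, kcyc_map hγ hγ hγ]
        norm_num) (fun w => by
        rw [map_map, ← map_comp, lenPos_dil_two, lenPos_dil_two, lenPos_dil_two, map_smul_left,
          map_smul_left, map_smul_right, smul_smul, map_smul_right, map_smul_right, smul_smul,
          LinearMap.smul_apply, pow_add, pow_add]) (by rw [pow_add _ (p + q + r)]; ring) x
    rw [comp_apply] at e
    rw [e, ← h.eq _ (by omega), lenPos.eq_1 C (p + q + r + 4), if_neg (by omega)]
    rfl

theorem op_zero {r : ℕ} {φ : Cell C →ₗ[ℚ] Cell C ⊗[ℚ] Cell C} : op r φ 0 = 0 := by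
  funext p q
  rw [op_eq, Pi.zero_apply, map_zero, map_zero]
  rfl

theorem b1S_of_mem_cycles (hα : α ∈ Φ.cycles k) : Φ.b1S α = 0 := by
  rw [b1S, LinearMap.smul_apply, show Φ.b1 α = 0 from hα.2, smul_zero]

variable (Φ)

set_option maxHeartbeats 1000000 in
/-- The Gerstenhaber coalgebra identities hold for the completed tensor powers. -/
theorem completedGerstenhaber : Φ.CompletedGerstenhaber := by
  have 𝔥 : HomotopyGerstenhaber Φ.γs Φ.bS Φ.veeP Φ.barModel.hP Φ.barModel.HP :=
    Φ.homotopyGerstenhaber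
  have hb : ∀ x, tb₂ Φ.γs Φ.bS (Φ.SP x) = -Φ.SP (Φ.bS x) := 𝔥.b_bracket
  have hγS : ∀ x, map Φ.γs Φ.γs (Φ.SP x) = -Φ.SP (Φ.γs x) := 𝔥.γ_bracket
  have hv := homog_veeP (Φ := Φ)
  have hS := homog_SP (Φ := Φ)
  have hL := hS.γs_comp
  have hγ := Φ.lenPos_γs
  have hγd := Φ.γs_dil (a := 2⁻¹) two_ne_zero
  have hn : ∀ n, π n ∘ₗ (-Φ.γs) = (-Φ.γs) ∘ₗ π n := fun n => by
    rw [LinearMap.comp_neg, LinearMap.neg_comp, hγ]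
  have hnd : ∀ x, (-Φ.γs) (Φ.degScale x) = Φ.degScale ((-Φ.γs) x) := fun x => by
    rw [LinearMap.neg_apply, LinearMap.neg_apply, map_neg, hγd]
  have hi : ∀ n, π n ∘ₗ LinearMap.id = LinearMap.id ∘ₗ π n := fun n => rfl
  have hid : ∀ x, (LinearMap.id : Cell C →ₗ[ℚ] Cell C) (Φ.degScale x)
      = Φ.degScale ((LinearMap.id : Cell C →ₗ[ℚ] Cell C) x) := fun x => rfl
  have v₁ := op_congr (Φ := Φ) (r := 1) (rfl : _ = Φ.veeP)
  have v₂ := opLeft_congr (Φ := Φ) (r := 1) (rfl : _ = Φ.veeP)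
  have v₃ := opRight_congr (Φ := Φ) (r := 1) (rfl : _ = Φ.veeP)
  have s₁ := op_congr (Φ := Φ) (r := 2) Φ.SS_eq
  have s₂ := opLeft_congr (Φ := Φ) (r := 2) Φ.SS_eq
  have s₃ := opRight_congr (Φ := Φ) (r := 2) Φ.SS_eq
  have l₁ := op_congr (Φ := Φ) (r := 2) Φ.pos₂_SL
  have l₂ := opLeft_congr (Φ := Φ) (r := 2) Φ.pos₂_SL
  constructor
  all_goals simp only [v₁, v₂, v₃, s₁, s₂, s₃, l₁, l₂]
  · exact fun k α hα => mem_cc2 (by ring) fun N => ⟨_, (exists_rep1 hα (N + 1)).op hv⟩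
  · exact fun k α hα => mem_cc2 (by ring) fun N => ⟨_, (exists_rep1 hα (N + 2)).op hS⟩
  · intro k α hα
    funext p q
    have h := exists_rep1 (Φ := Φ) hα (p + q + 1)
    rw [← (h.op hv).b2S.eq p q le_rfl, ← (h.b1S.op hv).eq p q le_rfl, 𝔥.b_v]
  · intro k α hα
    funext p q
    have h := exists_rep1 (Φ := Φ) hα (p + q + 2)
    rw [Pi.neg_apply, Pi.neg_apply, ← (h.op hS).b2S.eq p q le_rfl, ← (h.b1S.op hS).eq p q le_rfl,
      hb, map_neg]
  · exact fun k ξ hξ => mem_cc3 (by ring) fun N => ⟨_, (exists_rep2 hξ (N + 1)).opLeft hv⟩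
  · exact fun k ξ hξ => mem_cc3 (by ring) fun N => ⟨_, (exists_rep2 hξ (N + 1)).opRight hv hi hid⟩
  · exact fun k ξ hξ => mem_cc3 (by ring) fun N => ⟨_, (exists_rep2 hξ (N + 2)).opLeft hS⟩
  · exact fun k ξ hξ => mem_cc3 (by ring) fun N => ⟨_, (exists_rep2 hξ (N + 2)).opRight hS hγ hγd⟩
  · intro k ξ hξ
    funext p q t
    have h := exists_rep2 (Φ := Φ) hξ (p + q + t + 1)
    rw [← (h.opLeft hv).b3S.eq p q t le_rfl, ← (h.b2S.opLeft hv).eq p q t le_rfl,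
      tb₃_lft_even 𝔥.γ_v 𝔥.b_v]
  · intro k ξ hξ
    funext p q t
    have h := exists_rep2 (Φ := Φ) hξ (p + q + t + 1)
    rw [← (h.opRight hv hi hid).b3S.eq p q t le_rfl, ← (h.b2S.opRight hv hi hid).eq p q t le_rfl,
      tb₃_rgt_even 𝔥.b_v]
  · intro k ξ hξ
    funext p q t
    have h := exists_rep2 (Φ := Φ) hξ (p + q + t + 2)
    rw [Pi.neg_apply, Pi.neg_apply, Pi.neg_apply, ← (h.opLeft hS).b3S.eq p q t le_rfl,
      ← (h.b2S.opLeft hS).eq p q t le_rfl, tb₃_lft_odd hγS hb, map_neg]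
  · intro k ξ hξ
    funext p q t
    have h := exists_rep2 (Φ := Φ) hξ (p + q + t + 2)
    rw [Pi.neg_apply, Pi.neg_apply, Pi.neg_apply, ← (h.opRight hS hγ hγd).b3S.eq p q t le_rfl,
      ← (h.b2S.opRight hS hγ hγd).eq p q t le_rfl, tb₃_rgt_odd 𝔥.γ_b hb, map_neg]
  · refine fun k α hα => ⟨0, zero_mem _, ?_⟩
    rw [map_zero, sub_eq_zero]
    funext p q t
    have h := exists_rep1 (Φ := Φ) hα.1 (p + q + t + 1 + 1)
    rw [← ((h.op hv).opLeft hv).eq p q t le_rfl, ← ((h.op hv).opRight hv hi hid).eq p q t le_rfl,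
      𝔥.coassoc]
  · refine fun k α hα => ⟨op 2 Φ.barModel.hP α,
      mem_cc2 (by ring) fun N => ⟨_, (exists_rep1 hα.1 (N + 2)).op homog_hP⟩, ?_⟩
    funext p q
    have h := exists_rep1 (Φ := Φ) hα.1 (p + q + 2)
    have h₁ := h.mono (N' := p + q + 1) (by omega)
    have e := (h.b1S.op homog_hP).eq p q le_rfl
    rw [b1S_of_mem_cycles hα, op_zero] at e
    rw [Pi.sub_apply, Pi.sub_apply, ← ((h₁.op hv).flip2 hγ hγd).eq p q le_rfl,
      ← (h₁.op hv).eq p q le_rfl, ← (h.op homog_hP).b2S.eq p q le_rfl, ← map_sub, ← 𝔥.b_h, map_add,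
      e]
    exact add_zero _
  · intro k α hα
    funext p q
    have h := exists_rep1 (Φ := Φ) hα (p + q + 2)
    rw [Pi.neg_apply, Pi.neg_apply, ← ((h.op hL).flip2 hn hnd).eq p q le_rfl,
      ← (h.op hL).eq p q le_rfl, comp_apply, 𝔥.skew, map_neg]
  · intro k α hα
    funext p q t
    have h := ((exists_rep1 (Φ := Φ) hα (p + q + t + 2 + 2)).op hL).opLeft hL
    have h₁ := h.cyc3 hn hnd
    rw [Pi.add_apply, Pi.add_apply, Pi.add_apply, Pi.add_apply, Pi.add_apply, Pi.add_apply,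
      ← h.eq p q t le_rfl, ← h₁.eq p q t le_rfl, ← (h₁.cyc3 hn hnd).eq p q t le_rfl, ← map_add,
      ← map_add, 𝔥.coJacobi _ rfl, map_zero]
    rfl
  · refine fun k α hα => ⟨_, mem_cc3 (k := k + 1 - m + 2 * (2 - m)) (by ring)
      fun N => ⟨_, (exists_rep1 (Φ := Φ) hα.1 (N + 4)).HP⟩, ?_⟩
    funext p q t
    have h := exists_rep1 (Φ := Φ) hα.1 (p + q + t + 4)
    have h₁ := h.mono (N' := p + q + t + 1 + 2) (by omega)
    have h₂ := h.mono (N' := p + q + t + 2 + 1) (by omega)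
    have e := h.b1S.HP.eq p q t le_rfl
    simp only [b1S_of_mem_cycles hα, Pi.zero_apply, map_zero] at e
    rw [Pi.sub_apply, Pi.sub_apply, Pi.sub_apply, Pi.add_apply, Pi.add_apply, Pi.add_apply,
      ← ((h₁.op hS).opLeft hv).eq p q t le_rfl,
      ← (((h₂.op hv).opLeft hS).flip23 hγ hγd).eq p q t le_rfl,
      ← ((h₂.op hv).opRight hS hγ hγd).eq p q t le_rfl, ← h.HP.b3S.eq p q t le_rfl, ← map_add,
      ← map_sub, 𝔥.coderivation, map_sub, e, sub_zero]

end OpenFrobenius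

/-! ### Homotopies of graded complexes -/

section

variable {V W : Type*} [AddCommGroup V] [Module ℚ V] [AddCommGroup W] [Module ℚ W]
  {E : ℤ → Submodule ℚ V}

theorem exists_quasiInverse (f : V →ₗ[ℚ] W) : ∃ g : W →ₗ[ℚ] V, ∀ x, f (g (f x)) = f x := by
  obtain ⟨r, hr⟩ := f.rangeRestrict.exists_rightInverse_of_surjective f.range_rangeRestrict
  obtain ⟨g, hg⟩ := r.exists_extend
  refine ⟨g, fun x => ?_⟩
  have e : g (f x) = r (f.rangeRestrict x) := LinearMap.congr_fun hg (f.rangeRestrict x)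
  rw [e]
  exact congrArg Subtype.val (LinearMap.congr_fun hr (f.rangeRestrict x))

/-- Linear maps on independent submodules have a common extension. -/
theorem exists_glue (hE : iSupIndep E) (f : ∀ k, E k →ₗ[ℚ] W) :
    ∃ F : V →ₗ[ℚ] W, ∀ k, ∀ x (hx : x ∈ E k), F x = f k ⟨x, hx⟩ := by
  obtain ⟨ρ, hρ⟩ := (DirectSum.coeLinearMap E).exists_leftInverse_of_injective
    (LinearMap.ker_eq_bot.2 hE.dfinsupp_lsum_injective)
  refine ⟨DirectSum.toModule ℚ ℤ W f ∘ₗ ρ, fun k x hx => ?_⟩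
  have e := LinearMap.congr_fun hρ (DirectSum.lof ℚ ℤ (fun k => E k) k ⟨x, hx⟩)
  rw [comp_apply, DirectSum.coeLinearMap_lof] at e
  exact (congrArg _ e).trans (DirectSum.toModule_lof ℚ k _)

/-- A homotopy `s` of a graded complex with `b s b = b`, and `p = 1 - b s - s b`. -/
structure IsRetraction (E : ℤ → Submodule ℚ V) (γ b s p : V →ₗ[ℚ] V) : Prop where
  γ_mem : ∀ j, ∀ x ∈ E j, γ x = (-1 : ℚ) ^ j • x
  b_mem : ∀ j, ∀ x ∈ E j, b x ∈ E (j - 1)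
  s_mem : ∀ j, ∀ x ∈ E j, s x ∈ E (j + 1)
  b_b : ∀ x, b (b x) = 0
  b_s_b : ∀ j, ∀ x ∈ E j, b (s (b x)) = b x
  p_eq : p = LinearMap.id - b ∘ₗ s - s ∘ₗ b

theorem exists_isRetraction (hE : iSupIndep E) {γ b : V →ₗ[ℚ] V}
    (hγ : ∀ j, ∀ x ∈ E j, γ x = (-1 : ℚ) ^ j • x) (hb : ∀ j, ∀ x ∈ E j, b x ∈ E (j - 1))
    (hbb : ∀ x, b (b x) = 0) : ∃ s p, IsRetraction E γ b s p := by
  have hb' : ∀ j, ∀ x ∈ E (j + 1), b x ∈ E j := fun j x hx => by simpa using hb _ x hx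
  choose g hg using fun j => exists_quasiInverse (b.restrict (hb' j))
  obtain ⟨s, hs⟩ := exists_glue hE fun j => (E (j + 1)).subtype ∘ₗ g j
  refine ⟨s, _, hγ, hb, fun j x hx => ?_, hbb, fun j x hx => ?_, rfl⟩
  · rw [hs j x hx]
    exact (g j ⟨x, hx⟩).2
  · obtain ⟨j, rfl⟩ : ∃ i, j = i + 1 := ⟨j - 1, by ring⟩
    rw [hs j _ (hb' j x hx)]
    exact congrArg Subtype.val (hg j ⟨x, hx⟩)

theorem map_mem_of_mem_tdeg {F G : ℤ → Submodule ℚ V} {S : Submodule ℚ W} {k : ℤ}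
    {f : V ⊗[ℚ] V →ₗ[ℚ] W} (h : ∀ i j, i + j = k → ∀ x ∈ F i, ∀ y ∈ G j, f (x ⊗ₜ y) ∈ S)
    {t : V ⊗[ℚ] V} (ht : t ∈ tdeg F G k) : f t ∈ S := by
  rw [← Submodule.Quotient.mk_eq_zero]
  exact tdeg_induction (f := S.mkQ ∘ₗ f) (g := 0) (fun i x hx y hy =>
    (Submodule.Quotient.mk_eq_zero S).2 (h i _ (by ring) x hx y hy)) ht

/-- The homotopy of the tensor square. -/
def sqHomotopy (γ s p : V →ₗ[ℚ] V) : V ⊗[ℚ] V →ₗ[ℚ] V ⊗[ℚ] V :=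
  map s .id + map (p ∘ₗ γ) s

namespace IsRetraction

variable {γ b s p : V →ₗ[ℚ] V} (h : IsRetraction E γ b s p) {j k : ℤ} {x : V}

include h

theorem p_apply (x : V) : p x = x - b (s x) - s (b x) := by rw [h.p_eq]; rfl

theorem p_mem (hx : x ∈ E j) : p x ∈ E j := by
  rw [h.p_apply]
  refine sub_mem (sub_mem hx ?_) ?_
  · simpa using h.b_mem _ _ (h.s_mem j x hx)
  · simpa using h.s_mem _ _ (h.b_mem j x hx)

theorem b_p (hx : x ∈ E j) : b (p x) = 0 := by
  rw [h.p_apply, map_sub, map_sub, h.b_b, h.b_s_b j x hx, sub_zero, sub_self]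

theorem p_b (hx : x ∈ E j) : p (b x) = 0 := by
  rw [h.p_apply, h.b_s_b j x hx, h.b_b, map_zero, sub_self, sub_zero]

theorem tb₂_homotopy {t : V ⊗[ℚ] V} (ht : t ∈ tdeg E E k) :
    t - map p p t = tb₂ γ b (sqHomotopy γ s p t) + sqHomotopy γ s p (tb₂ γ b t) := by
  refine tdeg_induction (f := LinearMap.id - map p p)
    (g := tb₂ γ b ∘ₗ sqHomotopy γ s p + sqHomotopy γ s p ∘ₗ tb₂ γ b) (fun i x hx y hy => ?_) ht
  have hσ : ((-1 : ℚ) ^ i) * (-1) ^ i = 1 := by rw [← mul_zpow]; simp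
  have e₁ : γ (s x) = -((-1 : ℚ) ^ i • s x) := by
    rw [h.γ_mem _ _ (h.s_mem i x hx), zpow_add_one₀ (by norm_num), mul_neg_one, neg_smul]
  have e₂ : p (γ (b x)) = 0 := by
    rw [h.γ_mem _ _ (h.b_mem i x hx), map_smul, h.p_b hx, smul_zero]
  have e₃ : γ (p x) = (-1 : ℚ) ^ i • p x := h.γ_mem _ _ (h.p_mem hx)
  have e₄ : γ x = (-1 : ℚ) ^ i • x := h.γ_mem i x hx
  have ex : x = p x + b (s x) + s (b x) := by rw [h.p_apply]; abel
  have ey : y = p y + b (s y) + s (b y) := by rw [h.p_apply]; abel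
  simp only [sqHomotopy, LinearMap.sub_apply, LinearMap.add_apply, comp_apply, id_apply, map_tmul,
    map_add, tb₂_tmul, e₁, e₂, e₃, e₄, map_smul, h.b_p hx, smul_zero, zero_tmul, ← smul_tmul',
    smul_smul, hσ, one_smul, neg_tmul]
  have h₁ : x ⊗ₜ[ℚ] y = p x ⊗ₜ[ℚ] y + b (s x) ⊗ₜ[ℚ] y + s (b x) ⊗ₜ[ℚ] y := by
    rw [← add_tmul, ← add_tmul, ← ex]
  have h₂ : p x ⊗ₜ[ℚ] y = p x ⊗ₜ[ℚ] p y + p x ⊗ₜ[ℚ] b (s y) + p x ⊗ₜ[ℚ] s (b y) := by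
    rw [← tmul_add, ← tmul_add, ← ey]
  rw [h₁, h₂]
  match_scalars <;> first | ring1 | linear_combination hσ | linear_combination -hσ

theorem homotopy_mem {t : V ⊗[ℚ] V} (ht : t ∈ tdeg E E k) :
    sqHomotopy γ s p t ∈ tdeg E E (k + 1) := by
  refine map_mem_of_mem_tdeg (fun i j hij x hx y hy => ?_) ht
  rw [sqHomotopy, LinearMap.add_apply, map_tmul, map_tmul]
  refine add_mem (tmul_mem_tdeg (h.s_mem i x hx) hy (by omega))
    (tmul_mem_tdeg (i := i) ?_ (h.s_mem j y hy) (by omega))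
  rw [comp_apply, h.γ_mem i x hx, map_smul]
  exact Submodule.smul_mem _ _ (h.p_mem hx)

end IsRetraction

/-- Maps which agree on tensors of cycles and vanish on boundaries agree on cycles. -/
theorem IsRetraction.eq_of_cycles {γ b s p : V →ₗ[ℚ] V} (h : IsRetraction E γ b s p) {k : ℤ}
    {f g : V ⊗[ℚ] V →ₗ[ℚ] W} (hf : ∀ t, f (tb₂ γ b t) = 0) (hg : ∀ t, g (tb₂ γ b t) = 0)
    (hfg : ∀ i j, ∀ x ∈ E i, b x = 0 → ∀ y ∈ E j, b y = 0 → f (x ⊗ₜ y) = g (x ⊗ₜ y))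
    {t : V ⊗[ℚ] V} (ht : t ∈ tdeg E E k) (hb : tb₂ γ b t = 0) : f t = g t := by
  have e := h.tb₂_homotopy ht
  rw [hb, map_zero, add_zero, sub_eq_iff_eq_add] at e
  rw [e, map_add, map_add, hf, hg, zero_add, zero_add]
  exact tdeg_induction (f := f ∘ₗ map p p) (g := g ∘ₗ map p p) (fun i x hx y hy =>
    hfg i _ _ (h.p_mem hx) (h.b_p hx) _ (h.p_mem hy) (h.b_p hy)) ht

end

/-! ### Induced maps on homology -/

section

variable {V : Type*} [AddCommGroup V] [Module ℚ V] {T : ℤ → Type*} [∀ k, AddCommGroup (T k)]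
  [∀ k, Module ℚ (T k)] {E : ℤ → Submodule ℚ V} {γ b s p : V →ₗ[ℚ] V}
  {v h : V →ₗ[ℚ] V ⊗[ℚ] V} {H : V →ₗ[ℚ] V ⊗[ℚ] (V ⊗[ℚ] V)}

theorem totPar_of_mem {j : ℤ} {x : Tot T} (hx : x ∈ totDeg T j) : totPar T x = (-1 : ℚ) ^ j • x := by
  obtain ⟨x, rfl⟩ := hx
  exact DirectSum.toModule_lof ℚ j x

theorem ext_of_surj {M : Type*} [AddCommGroup M] [Module ℚ M] {f g : Tot T →ₗ[ℚ] M}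
    {P : V →ₗ[ℚ] Tot T} (hsurj : ∀ j, ∀ y ∈ totDeg T j, ∃ x ∈ E j, b x = 0 ∧ P x = y)
    (hfg : ∀ j, ∀ x ∈ E j, b x = 0 → f (P x) = g (P x)) : f = g :=
  DirectSum.linearMap_ext ℚ fun j => LinearMap.ext fun y => by
    obtain ⟨x, hx, hbx, e⟩ := hsurj j _ ⟨y, rfl⟩
    rw [comp_apply, comp_apply, ← e]
    exact hfg j x hx hbx

/-- A complex with a Gerstenhaber coalgebra structure up to homotopy induces a Gerstenhaber
coalgebra structure on its homology. -/
theorem HomotopyGerstenhaber.isGerstenhaberCoalgebra (𝔥 : HomotopyGerstenhaber γ b v h H)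
    (hR : IsRetraction E γ b s p) (hv : ∀ j, ∀ x ∈ E j, v x ∈ tdeg E E j)
    (hS : ∀ j, ∀ x ∈ E j, (h + kflip γ γ ∘ₗ h) x ∈ tdeg E E (j + 1)) {P : V →ₗ[ℚ] Tot T}
    (hP : ∀ j, ∀ x ∈ E j, P x ∈ totDeg T j) (hPb : ∀ x, P (b x) = 0)
    (hPγ : ∀ x, totPar T (P x) = P (γ x))
    (hsurj : ∀ j, ∀ y ∈ totDeg T j, ∃ x ∈ E j, b x = 0 ∧ P x = y)
    {v' S' : Tot T →ₗ[ℚ] Tot T ⊗[ℚ] Tot T}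
    (hv' : ∀ j, ∀ x ∈ E j, b x = 0 → v' (P x) = map P P (v x))
    (hS' : ∀ j, ∀ x ∈ E j, b x = 0 → S' (P x) = map P P ((h + kflip γ γ ∘ₗ h) x)) :
    IsGerstenhaberCoalgebra T v' S' := by
  set S := h + kflip γ γ ∘ₗ h with hSdef
  have hbS : ∀ x, tb₂ γ b (S x) = -S (b x) := 𝔥.b_bracket
  have hγS : ∀ x, map γ γ (S x) = -S (γ x) := 𝔥.γ_bracket
  have hPb₂ : ∀ t, map P P (tb₂ γ b t) = 0 := fun t => by
    rw [tb₂, LinearMap.add_apply, map_add, map_map, map_map, show P ∘ₗ b = 0 from LinearMap.ext hPb]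
    simp
  have hPb₃ : ∀ t, map P (map P P) (tb₃ γ b t) = 0 := fun t => by
    rw [tb₃, LinearMap.add_apply, map_add, map_map, map_map, show P ∘ₗ b = 0 from LinearMap.ext hPb,
      show map P P ∘ₗ tb₂ γ b = 0 from LinearMap.ext hPb₂]
    simp
  have hvb : ∀ {x}, b x = 0 → tb₂ γ b (v x) = 0 := fun hx => by rw [𝔥.b_v, hx, map_zero]
  have hSb : ∀ {x}, b x = 0 → tb₂ γ b (S x) = 0 := fun hx => by rw [hbS, hx, map_zero, neg_zero]
  have hlft : ∀ {φ : V →ₗ[ℚ] V ⊗[ℚ] V} {φ' : Tot T →ₗ[ℚ] Tot T ⊗[ℚ] Tot T} {k : ℤ} {t : V ⊗[ℚ] V}, (∀ j, ∀ x ∈ E j, b x = 0 →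
      φ' (P x) = map P P (φ x)) → (∀ t, map P (map P P) (lft φ (tb₂ γ b t)) = 0) →
      t ∈ tdeg E E k → tb₂ γ b t = 0 → lft φ' (map P P t) = map P (map P P) (lft φ t) := by
    intro φ φ' k t hφ h₀ ht htb
    refine hR.eq_of_cycles (f := lft φ' ∘ₗ map P P) (g := map P (map P P) ∘ₗ lft φ)
      (fun t => by rw [comp_apply, hPb₂, map_zero]) h₀
      (fun i j x hx hbx y hy hby => ?_) ht htb
    rw [comp_apply, comp_apply, map_tmul, lft_tmul, lft_tmul, hφ i x hx hbx, ← assoc_map, map_tmul]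
  have hrgt : ∀ {φ : V →ₗ[ℚ] V ⊗[ℚ] V} {φ' : Tot T →ₗ[ℚ] Tot T ⊗[ℚ] Tot T} {k : ℤ} {t : V ⊗[ℚ] V} {g : V →ₗ[ℚ] V}
      {g' : Tot T →ₗ[ℚ] Tot T}, (∀ j, ∀ x ∈ E j, b x = 0 →
      φ' (P x) = map P P (φ x)) → (∀ x, g' (P x) = P (g x)) →
      (∀ t, map P (map P P) (map g φ (tb₂ γ b t)) = 0) →
      t ∈ tdeg E E k → tb₂ γ b t = 0 → map g' φ' (map P P t) = map P (map P P) (map g φ t) := by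
    intro φ φ' k t g g' hφ hg h₀ ht htb
    refine hR.eq_of_cycles (f := map g' φ' ∘ₗ map P P) (g := map P (map P P) ∘ₗ map g φ)
      (fun t => by rw [comp_apply, hPb₂, map_zero]) h₀
      (fun i j x hx hbx y hy hby => ?_) ht htb
    rw [comp_apply, comp_apply, map_tmul, map_tmul, map_tmul, map_tmul, hφ j y hy hby, hg]
  have lv := fun t => (tb₃_lft_even 𝔥.γ_v 𝔥.b_v t).symm
  have lS : ∀ t, lft S (tb₂ γ b t) = -tb₃ γ b (lft S t) := fun t => by
    rw [tb₃_lft_odd hγS hbS, neg_neg]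
  have rS : ∀ t, map γ S (tb₂ γ b t) = -tb₃ γ b (map γ S t) := fun t => by
    rw [tb₃_rgt_odd 𝔥.γ_b hbS, neg_neg]
  have hnγ : ∀ x, (-totPar T) (P x) = P ((-γ) x) := fun x => by
    rw [LinearMap.neg_apply, hPγ, LinearMap.neg_apply, map_neg]
  have hL : ∀ t, map (totPar T) .id (map P P t) = map P P (map γ .id t) :=
    fun t => by rw [map_map, map_map, show totPar T ∘ₗ P = P ∘ₗ γ from LinearMap.ext hPγ]; rfl
  refine ⟨⟨fun k y hy => ?_, ext_of_surj hsurj fun j x hx hbx => ?_, ext_of_surj hsurj fun j x hx hbx => ?_⟩,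
    ⟨fun k y hy => ?_, ext_of_surj hsurj fun j x hx hbx => ?_, ext_of_surj hsurj fun j x hx hbx => ?_⟩,
    ext_of_surj hsurj fun j x hx hbx => ?_⟩
  · obtain ⟨x, hx, hbx, rfl⟩ := hsurj k y hy
    rw [hv' k x hx hbx]
    exact map_mem_of_mem_tdeg (fun i j hij x hx y hy =>
      tmul_mem_tdeg (hP i x hx) (hP j y hy) hij) (hv k x hx)
  · change lft v' (v' (P x)) = map .id v' (v' (P x))
    rw [hv' j x hx hbx, hlft hv' (fun t => by rw [lv, hPb₃]) (hv j x hx) (hvb hbx), 𝔥.coassoc,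
      hrgt hv' (fun x => rfl) (fun t => by rw [← tb₃_rgt_even 𝔥.b_v, hPb₃]) (hv j x hx) (hvb hbx)]
  · rw [comp_apply, hv' j x hx hbx, KModel.kflip_map hPγ hPγ]
    have e := 𝔥.b_h x
    rw [hbx, map_zero, add_zero, eq_comm, sub_eq_iff_eq_add] at e
    rw [e, map_add, hPb₂, zero_add]
  · obtain ⟨x, hx, hbx, rfl⟩ := hsurj _ y hy
    rw [comp_apply, hS' _ x hx hbx, hL, map_map]
    refine map_mem_of_mem_tdeg (fun i j hij x hx y hy => tmul_mem_tdeg (i := i - 1) (j := j - 1)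
      ?_ ?_ (by omega)) (hS _ x hx)
    · rw [comp_apply, hR.γ_mem i x hx, map_smul, sub_add_cancel]
      exact Submodule.smul_mem _ _ (hP i x hx)
    · rw [sub_add_cancel]; exact hP j y hy
  · rw [comp_apply, comp_apply, hS' j x hx hbx, hL, KModel.kflip_map hnγ hnγ, 𝔥.skew, map_neg, ← hL,
      ← hS' j x hx hbx]
    rfl
  · have hγ' : ∀ y, totPar T (totPar T y) = y := fun y =>
      LinearMap.congr_fun (f := totPar T ∘ₗ totPar T) (g := LinearMap.id) (ext_of_surj hsurj fun j x _ _ => by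
        rw [comp_apply, hPγ, hPγ, 𝔥.γ_γ]; rfl) y
    have hγS' : ∀ y, map (totPar T) (totPar T) (S' y) = -S' (totPar T y) := fun y =>
      LinearMap.congr_fun (f := map (totPar T) (totPar T) ∘ₗ S') (g := -(S' ∘ₗ totPar T))
        (ext_of_surj hsurj fun j x hx hbx => by
          have hbx' : b (γ x) = 0 := by rw [hR.γ_mem j x hx, map_smul, hbx, smul_zero]
          have hx' : γ x ∈ E j := by
            rw [hR.γ_mem j x hx]; exact Submodule.smul_mem _ _ hx
          rw [comp_apply, LinearMap.neg_apply, comp_apply, hPγ, hS' j _ hx' hbx', hS' j x hx hbx,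
            map_map, show totPar T ∘ₗ P = P ∘ₗ γ from LinearMap.ext hPγ, map_comp, comp_apply, hγS,
            map_neg]) y
    have hc := OpenFrobenius.kcyc_map hnγ hnγ hnγ
    have e : lft (map (totPar T) .id ∘ₗ S') ((map (totPar T) .id ∘ₗ S') (P x))
        = map P (map P P) (lft (map γ .id ∘ₗ S) ((map γ .id ∘ₗ S) x)) := by
      rw [comp_apply, comp_apply, lft_γ_comp hγS' hγ', lft_γ_comp hγS 𝔥.γ_γ,
        hS' j x hx hbx, hlft hS' (fun t => by rw [lS, map_neg, hPb₃, neg_zero]) (hS j x hx)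
        (hSb hbx), map_neg, map_map, map_map, ← map_comp, ← map_comp,
        show totPar T ∘ₗ P = P ∘ₗ γ from LinearMap.ext hPγ]
      rfl
    have e' := congrArg (map P (map P P)) (𝔥.coJacobi x rfl)
    rw [map_add, map_add, ← hc, ← hc, ← hc, ← hSdef, ← e, map_zero] at e'
    exact e'
  · have e := congrArg (map P (map P P)) (𝔥.coderivation x)
    rw [hbx, map_zero, map_zero, sub_zero, hPb₃, map_sub, sub_eq_zero, map_add, ← hSdef,
      ← flipR_cube_map hPγ,
      ← hlft hv' (fun t => by rw [lv, hPb₃]) (hS j x hx) (hSb hbx),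
      ← hlft hS' (fun t => by rw [lS, map_neg, hPb₃, neg_zero]) (hv j x hx) (hvb hbx),
      ← hrgt hS' hPγ (fun t => by rw [rS, map_neg, hPb₃, neg_zero]) (hv j x hx) (hvb hbx),
      ← hS' j x hx hbx, ← hv' j x hx hbx] at e
    exact e

end

namespace OpenFrobenius

open KModel

variable {C : Type*} [AddCommGroup C] [Module ℚ C] [Coalgebra ℚ C] {m : ℤ}
  {𝒞 : ℤ → Submodule ℚ C}

local notation "π" => lenPos C

/-- The degree `j` part of `CC[1-m]`, before completion. -/
def shiftDeg (𝒞 : ℤ → Submodule ℚ C) (m j : ℤ) : Submodule ℚ (Cell C) :=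
  ⨆ n, cellDeg 𝒞 n (j + 1 - m)

local notation "𝓔" => shiftDeg 𝒞 m

/-- The components of an element. -/
def comps (C : Type*) [AddCommGroup C] [Module ℚ C] [Coalgebra ℚ C] : Cell C →ₗ[ℚ] Ch1 C :=
  LinearMap.pi (lenPos C)

/-- The components of an element of the tensor square. -/
def comps₂ (C : Type*) [AddCommGroup C] [Module ℚ C] [Coalgebra ℚ C] :
    Cell C ⊗[ℚ] Cell C →ₗ[ℚ] Ch2 C :=
  LinearMap.pi fun p => LinearMap.pi fun q => map (lenPos C p) (lenPos C q)

variable [DirectSum.Decomposition 𝒞] (Φ : OpenFrobenius m 𝒞) {j k δ : ℤ} {x : Cell C}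

omit [DirectSum.Decomposition 𝒞] in
theorem shiftDeg_induction {M : Type*} [AddCommGroup M] [Module ℚ M] {f g : Cell C →ₗ[ℚ] M}
    (h : ∀ n ≠ 0, ∀ x ∈ homogCell 𝒞 n (j + 1 - m), f x = g x) (hx : x ∈ 𝓔 j) : f x = g x :=
  (iSup_le fun n _ hx => cellDeg_induction (h n) hx : 𝓔 j ≤ LinearMap.eqLocus f g) hx

theorem degScale_of_shiftDeg (hx : x ∈ 𝓔 j) : Φ.degScale x = (2 : ℚ) ^ (j + 1 - m) • x :=
  (iSup_le fun _ _ hx => Module.End.mem_eigenspace_iff.2 (Φ.degScale_of_mem hx) :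
    𝓔 j ≤ Module.End.eigenspace Φ.degScale _) hx |> Module.End.mem_eigenspace_iff.1

include Φ in
theorem pos_of_shiftDeg (hx : x ∈ 𝓔 j) : pos C (Cbar C) x = x := by
  refine shiftDeg_induction (f := pos C (Cbar C)) (g := LinearMap.id) (fun n hn x hx => ?_) hx
  rw [← sub_sub_cancel x (pos C (Cbar C) x), Φ.sub_pos_eq, len_of_homogCell hx, if_neg hn.symm,
    sub_zero, id_apply]

theorem γs_of_shiftDeg (hx : x ∈ 𝓔 j) : Φ.γs x = (-1 : ℚ) ^ j • x := by
  refine shiftDeg_induction (f := Φ.γs) (g := (-1 : ℚ) ^ j • LinearMap.id) (fun n hn x hx => ?_) hx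
  rw [γs, LinearMap.smul_apply,
    show Φ.γcell = Φ.dil (-1) (-1) from congrArg (map _) (congrArg wordMap (neg_one_smul ℚ _).symm),
    Φ.dil_of_homogCell (by norm_num) hx, smul_smul, ← zpow_natCast, ← zpow_add₀ (by norm_num),
    ← zpow_add₀ (by norm_num), show m - 1 + (j + 1 - m + n + n) = j + 2 * n by ring,
    zpow_add₀ (by norm_num), zpow_mul]
  simp

include Φ in
theorem pos_mem_iSup (x : Cell C) : pos C (Cbar C) x ∈ ⨆ j, 𝓔 j := by
  rw [← Submodule.Quotient.mk_eq_zero]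
  refine LinearMap.congr_fun (f := (⨆ j, 𝓔 j).mkQ ∘ₗ pos C (Cbar C)) (g := 0)
    (Φ.cell_ext fun n k x hx => ?_) x
  refine (Submodule.Quotient.mk_eq_zero _).2 ?_
  rw [← sub_sub_cancel x (pos C (Cbar C) x), Φ.sub_pos_eq, len_of_homogCell hx]
  split_ifs with h
  · rw [sub_self]; exact zero_mem _
  · rw [sub_zero]
    refine Submodule.mem_iSup_of_mem (k + m - 1) (Submodule.mem_iSup_of_mem n ?_)
    rw [cellDeg, if_neg (Ne.symm h), show k + m - 1 + 1 - m = k by ring]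
    exact Submodule.subset_span hx

/-- The operator `x ↦ 2^|x| x` of `CC[1-m]`. -/
abbrev shiftScale : Cell C →ₗ[ℚ] Cell C := (2 : ℚ) ^ (m - 1) • Φ.degScale

theorem shiftScale_of_mem (j : ℤ) (x : Cell C) (hx : x ∈ 𝓔 j) :
    Φ.shiftScale x = (2 : ℚ) ^ j • x := by
  rw [LinearMap.smul_apply, Φ.degScale_of_shiftDeg hx, smul_smul, ← zpow_add₀ two_ne_zero,
    show m - 1 + (j + 1 - m) = j by ring]

theorem mem_shiftDeg (h : pos C (Cbar C) x = x)
    (hx : Φ.degScale x = (2 : ℚ) ^ (j + 1 - m) • x) : x ∈ 𝓔 j :=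
  mem_of_scale_eq Φ.shiftScale_of_mem (h ▸ Φ.pos_mem_iSup x) (by
    rw [LinearMap.smul_apply, hx, smul_smul, ← zpow_add₀ two_ne_zero,
      show m - 1 + (j + 1 - m) = j by ring])

theorem shiftScale_map (t : Cell C ⊗[ℚ] Cell C) : map Φ.shiftScale Φ.shiftScale t
    = (2 : ℚ) ^ (2 * (m - 1)) • map Φ.degScale Φ.degScale t := by
  rw [map_smul_left, map_smul_right, smul_smul, ← zpow_add₀ two_ne_zero, ← two_mul]; rfl

theorem degScale_of_tdeg {t : Cell C ⊗[ℚ] Cell C} (ht : t ∈ tdeg 𝓔 𝓔 k) :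
    map Φ.degScale Φ.degScale t = (2 : ℚ) ^ (k + 2 * (1 - m)) • t := by
  have e := map_scale_of_mem two_ne_zero Φ.shiftScale_of_mem Φ.shiftScale_of_mem ht
  rw [shiftScale_map] at e
  rw [zpow_add₀ two_ne_zero, _root_.mul_comm, ← smul_smul, ← e, smul_smul,
    ← zpow_add₀ two_ne_zero, show 2 * (1 - m) + 2 * (m - 1) = 0 by ring, zpow_zero, one_smul]

theorem mem_tdeg {t : Cell C ⊗[ℚ] Cell C} (h : pos₂ C (Cbar C) t = t)
    (ht : map Φ.degScale Φ.degScale t = (2 : ℚ) ^ (k + 2 * (1 - m)) • t) : t ∈ tdeg 𝓔 𝓔 k :=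
  mem_of_scale_eq (s := map Φ.shiftScale Φ.shiftScale)
    (fun _ _ => map_scale_of_mem two_ne_zero Φ.shiftScale_of_mem Φ.shiftScale_of_mem)
    (h ▸ map_mem_iSup_tdeg Φ.pos_mem_iSup Φ.pos_mem_iSup t) (by
      rw [shiftScale_map, ht, smul_smul, ← zpow_add₀ two_ne_zero,
        show 2 * (m - 1) + (k + 2 * (1 - m)) = k by ring])

include Φ in
theorem iSupIndep_shiftDeg : iSupIndep 𝓔 :=
  ((Module.End.eigenspaces_iSupIndep Φ.shiftScale).comp (f := fun j : ℤ => (2 : ℚ) ^ j)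
    (zpow_right_injective₀ (by norm_num) (by norm_num))).mono fun j x hx =>
      Module.End.mem_eigenspace_iff.2 (Φ.shiftScale_of_mem j x hx)

variable {Φ}

theorem rep1_comps (hx : x ∈ 𝓔 j) (N : ℕ) : Φ.Rep1 (j + 1 - m) N (comps C x) x :=
  ⟨Φ.degScale_of_shiftDeg hx, fun _ _ => rfl⟩

theorem rep2_comps {t : Cell C ⊗[ℚ] Cell C} (ht : t ∈ tdeg 𝓔 𝓔 k) (N : ℕ) :
    Φ.Rep2 (k + 2 * (1 - m)) N (comps₂ C t) t :=
  ⟨Φ.degScale_of_tdeg ht, fun _ _ _ => rfl⟩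

theorem bS_mem (j : ℤ) (x : Cell C) (hx : x ∈ 𝓔 j) : Φ.bS x ∈ 𝓔 (j - 1) :=
  Φ.mem_shiftDeg (by rw [pos_bS, Φ.pos_of_shiftDeg hx]) (by
    have e := (rep1_comps (Φ := Φ) hx 0).b1S.deg
    rwa [show j + 1 - m - 1 = j - 1 + 1 - m by ring] at e)

theorem b1S_comps (hx : x ∈ 𝓔 j) : Φ.b1S (comps C x) = comps C (Φ.bS x) :=
  funext fun n => ((rep1_comps hx n).b1S.eq n le_rfl).symm

theorem b2S_comps₂ {t : Cell C ⊗[ℚ] Cell C} (ht : t ∈ tdeg 𝓔 𝓔 k) :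
    Φ.b2S (comps₂ C t) = comps₂ C (tb₂ Φ.γs Φ.bS t) :=
  funext fun p => funext fun q => ((rep2_comps ht (p + q)).b2S.eq p q le_rfl).symm

theorem op_comps {r : ℕ} {φ : Cell C →ₗ[ℚ] Cell C ⊗[ℚ] Cell C} (hφ : Φ.Homog r δ φ)
    (hx : x ∈ 𝓔 j) : op r φ (comps C x) = comps₂ C (φ x) :=
  funext fun p => funext fun q =>
    (((rep1_comps (Φ := Φ) hx (p + q + r)).op hφ).eq p q le_rfl).symm

theorem Homog.mem_tdeg {r : ℕ} {φ : Cell C →ₗ[ℚ] Cell C ⊗[ℚ] Cell C}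
    (hφ : Φ.Homog r (δ + 1 - m) φ) (h : pos₂ C (Cbar C) ∘ₗ φ = φ) (hx : x ∈ 𝓔 j) :
    φ x ∈ tdeg 𝓔 𝓔 (j + δ) :=
  Φ.mem_tdeg (LinearMap.congr_fun h x) (by
    have e := ((rep1_comps (Φ := Φ) hx (0 + r)).op hφ).deg
    rwa [show j + 1 - m + (δ + 1 - m) = j + δ + 2 * (1 - m) by ring] at e)

include Φ in
theorem comps_mem (hx : x ∈ 𝓔 j) : comps C x ∈ cc1 𝒞 (j + 1 - m) := fun n _ =>
  mem_of_scale_eq (fun _ _ => Φ.degScale_of_mem) (Φ.lenPos_mem_iSup n x) (by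
    rw [← map_smul, ← Φ.degScale_of_shiftDeg hx]
    exact LinearMap.congr_fun (Φ.degScale_lenPos n) x)

end OpenFrobenius

namespace OpenFrobenius

open KModel

variable {C : Type*} [AddCommGroup C] [Module ℚ C] [Coalgebra ℚ C] {m : ℤ}
  {𝒞 : ℤ → Submodule ℚ C} [DirectSum.Decomposition 𝒞] (Φ : OpenFrobenius m 𝒞)
  {j k δ : ℤ} {x : Cell C}

local notation "π" => lenPos C
local notation "𝓔" => shiftDeg 𝒞 m

/-! ### Injectivity of the components -/

include Φ in
theorem eventually_sum_lenPos (x : Cell C) :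
    ∀ᶠ K in Filter.atTop, (∑ n ∈ Finset.range K, π n) x = pos C (Cbar C) x := by
  let S : Submodule ℚ (Cell C) :=
    { carrier := {x | ∀ᶠ K in Filter.atTop, (∑ n ∈ Finset.range K, π n) x = pos C (Cbar C) x}
      zero_mem' := Filter.Eventually.of_forall fun K => by rw [map_zero, map_zero]
      add_mem' := fun h h' => by
        filter_upwards [h, h'] with K e e'
        rw [map_add, map_add, e, e']
      smul_mem' := fun c _ h => by
        filter_upwards [h] with K e
        rw [map_smul, map_smul, e] }
  refine (Submodule.Quotient.mk_eq_zero S).1 (LinearMap.congr_fun (f := S.mkQ) (g := 0)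
    (Φ.cell_ext fun n k x hx => (Submodule.Quotient.mk_eq_zero S).2 ?_) x)
  filter_upwards [Filter.eventually_gt_atTop n] with K hK
  rw [← sub_sub_cancel x (pos C (Cbar C) x), Φ.sub_pos_eq, LinearMap.sum_apply,
    Finset.sum_eq_single n (fun l _ hl => ?_) fun h => absurd (Finset.mem_range.2 hK) h]
  · rw [lenPos, len_of_homogCell hx]
    split_ifs with h h' h'
    · rw [sub_self]; rfl
    · exact absurd h.symm h'
    · exact absurd h'.symm h
    · rw [len_of_homogCell hx, if_pos rfl, sub_zero]
  · rw [lenPos]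
    split_ifs
    · rfl
    · rw [len_of_homogCell hx, if_neg hl]

include Φ in
theorem pos_eq_zero (h : comps C x = 0) : pos C (Cbar C) x = 0 := by
  obtain ⟨K, hK⟩ := (Φ.eventually_sum_lenPos x).exists
  rw [← hK, LinearMap.sum_apply]
  exact Finset.sum_eq_zero fun n _ => congrFun h n

include Φ in
theorem pos₂_eq_zero {t : Cell C ⊗[ℚ] Cell C} (h : comps₂ C t = 0) : pos₂ C (Cbar C) t = 0 := by
  have key : ∀ t : Cell C ⊗[ℚ] Cell C, ∀ᶠ K in Filter.atTop,
      map (∑ n ∈ Finset.range K, π n) (∑ n ∈ Finset.range K, π n) t = pos₂ C (Cbar C) t :=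
    fun t => by
      induction t with
      | zero => exact Filter.Eventually.of_forall fun K => by rw [map_zero, map_zero]
      | add s t h h' =>
        filter_upwards [h, h'] with K e e'
        rw [map_add, map_add, e, e']
      | tmul x y =>
        filter_upwards [Φ.eventually_sum_lenPos x, Φ.eventually_sum_lenPos y] with K e e'
        rw [map_tmul, e, e', pos₂, map_tmul]
  obtain ⟨K, hK⟩ := (key t).exists
  rw [← hK, ← mapBilinear_apply (R := ℚ), map_sum, LinearMap.sum_apply]
  refine Finset.sum_eq_zero fun q _ => ?_
  rw [map_sum, LinearMap.sum_apply, LinearMap.sum_apply]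
  exact Finset.sum_eq_zero fun p _ => congrFun (congrFun h p) q

include Φ in
theorem eq_of_comps_eq {y : Cell C} (hx : x ∈ 𝓔 j) (hy : y ∈ 𝓔 j) (h : comps C x = comps C y) :
    x = y := by
  rw [← sub_eq_zero, ← Φ.pos_of_shiftDeg (sub_mem hx hy)]
  exact Φ.pos_eq_zero (by rw [map_sub, h, sub_self])

/-! ### Simply connected algebras -/

/-- The sum of the components of a sequence of degree `k`. -/
def total (C : Type*) [AddCommGroup C] [Module ℚ C] [Coalgebra ℚ C] (k : ℤ) :
    Ch1 C →ₗ[ℚ] Cell C := ∑ n ∈ Finset.range (k.toNat + 1), LinearMap.proj n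

omit [DirectSum.Decomposition 𝒞] in
theorem total_mem {α : Ch1 C} (hα : α ∈ cc1 𝒞 (j + 1 - m)) : total C (j + 1 - m) α ∈ 𝓔 j := by
  rw [total, LinearMap.sum_apply]
  exact sum_mem fun n _ => Submodule.mem_iSup_of_mem n (hα n trivial)

section

variable (hsc : ∀ i ≤ 1, ∀ x ∈ 𝒞 i, Coalgebra.counit (R := ℚ) x = 0 → x = 0)

include Φ hsc

theorem eq_zero_of_lt {n : ℕ} (hk : k < n) (hx : x ∈ cellDeg 𝒞 n k) : x = 0 := by
  refine cellDeg_induction (f := LinearMap.id) (g := 0) (fun _ x hx => ?_) hx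
  obtain ⟨i, a, δ, w, ha, hw, rfl, rfl⟩ := hx
  rw [id_apply, LinearMap.zero_apply]
  rcases lt_or_ge i 0 with hi | hi
  · rw [hsc i (by omega) a ha (Φ.counit_mem i hi.ne a ha), zero_tmul]
  · obtain ⟨l, hl⟩ : ∃ l, δ l ≤ 1 := by
      by_contra! h
      have := Finset.card_nsmul_le_sum Finset.univ (fun l => δ l - 1) 1 fun l _ => by
        have := h l; omega
      rw [Finset.card_univ, Fintype.card_fin, nsmul_eq_mul, mul_one] at this
      omega
    rw [MultilinearMap.map_coord_zero _ l (Subtype.ext (hsc _ hl _ (hw l) (w l).2)), tmul_zero]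

theorem rep1_total {α : Ch1 C} (hα : α ∈ cc1 𝒞 k) (N : ℕ) : Φ.Rep1 k N α (total C k α) := by
  have h : Φ.Rep1 k k.toNat α (total C k α) := by
    rw [total, LinearMap.sum_apply]
    exact exists_rep1 hα k.toNat
  refine ⟨h.deg, fun n _ => ?_⟩
  rcases le_or_gt n k.toNat with hn | hn
  · exact h.eq n hn
  · rw [Φ.eq_zero_of_lt hsc (by omega) (hα n trivial)]
    refine Φ.eq_zero_of_lt hsc (k := k) (n := n) (by omega) ?_
    exact mem_of_scale_eq (fun _ _ => Φ.degScale_of_mem) (Φ.lenPos_mem_iSup n _) (by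
      rw [← map_smul, ← h.deg]
      exact LinearMap.congr_fun (Φ.degScale_lenPos n) _)

theorem eq_zero_of_lt₂ {p q : ℕ} {t : Cell C ⊗[ℚ] Cell C} (hk : k < p + q)
    (ht : t ∈ tdeg (cellDeg 𝒞 p) (cellDeg 𝒞 q) k) : t = 0 := by
  refine tdeg_induction (f := LinearMap.id) (g := 0) (fun i x hx y hy => ?_) ht
  rw [id_apply, LinearMap.zero_apply]
  rcases lt_or_ge i p with hi | hi
  · rw [Φ.eq_zero_of_lt hsc hi hx, zero_tmul]
  · rw [Φ.eq_zero_of_lt hsc (by omega) hy, tmul_zero]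

theorem exists_rep2_of_mem {ξ : Ch2 C} (hξ : ξ ∈ cc2 𝒞 k) : ∃ t, ∀ N, Φ.Rep2 k N ξ t := by
  have h := exists_rep2 (Φ := Φ) hξ k.toNat
  refine ⟨_, fun N => ⟨h.deg, fun p q _ => ?_⟩⟩
  rcases le_or_gt (p + q) k.toNat with hn | hn
  · exact h.eq p q hn
  · rw [Φ.eq_zero_of_lt₂ hsc (by omega) (hξ p trivial q trivial)]
    exact Φ.eq_zero_of_lt₂ hsc (k := k) (by omega) (Φ.map_lenPos_mem h.deg p q)

theorem comps_total {α : Ch1 C} (hα : α ∈ cc1 𝒞 k) : comps C (total C k α) = α :=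
  funext fun n => (Φ.rep1_total hsc hα n).eq n le_rfl

theorem bS_total {α : Ch1 C} (hα : α ∈ Φ.cycles (j + 1 - m)) :
    Φ.bS (total C (j + 1 - m) α) = 0 := by
  have hx := total_mem hα.1
  refine Φ.eq_of_comps_eq (bS_mem j _ hx) (zero_mem _) ?_
  rw [← b1S_comps hx, Φ.comps_total hsc hα.1, b1S_of_mem_cycles hα, map_zero]

end

theorem comps_mem_cycles (hx : x ∈ 𝓔 j) (hb : Φ.bS x = 0) :
    comps C x ∈ Φ.cycles (j + 1 - m) := by
  refine ⟨comps_mem (Φ := Φ) hx, ?_⟩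
  have e := b1S_comps (Φ := Φ) hx
  rw [hb, map_zero, b1S, LinearMap.smul_apply] at e
  exact (smul_eq_zero.1 e).resolve_left (zpow_ne_zero _ (by norm_num))

theorem cls_eq_of_sub_eq {α β : Φ.cycles (j + 1 - m)} {ζ : Ch1 C} (hζ : ζ ∈ cc1 𝒞 (j + 1 + 1 - m))
    (h : (α - β : Ch1 C) = Φ.b1S ζ) : Φ.cls j α = Φ.cls j β := by
  have e : (α - β : Ch1 C) ∈ (cc1 𝒞 (j + 1 - m + 1)).map Φ.b1 := by
    refine ⟨(-1 : ℚ) ^ (m - 1) • ζ, ?_, ?_⟩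
    · rw [show j + 1 - m + 1 = j + 1 + 1 - m by ring]
      exact Submodule.smul_mem _ _ hζ
    · rw [map_smul]; exact h.symm
  exact congrArg (DirectSum.lof ℚ ℤ Φ.HHs j) ((Submodule.Quotient.eq _).2 e)

end OpenFrobenius

namespace OpenFrobenius

open KModel

variable {C : Type*} [AddCommGroup C] [Module ℚ C] [Coalgebra ℚ C] {m : ℤ}
  {𝒞 : ℤ → Submodule ℚ C} [DirectSum.Decomposition 𝒞] (Φ : OpenFrobenius m 𝒞)
  {j k δ : ℤ} {x : Cell C} {s p : Cell C →ₗ[ℚ] Cell C} {P : Cell C →ₗ[ℚ] Tot Φ.HHs}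

local notation "𝓔" => shiftDeg 𝒞 m

/-- `P` takes an element of `CC[1-m]` to the class of its image under the retraction `p`. -/
structure IsClassMap (s p : Cell C →ₗ[ℚ] Cell C) (P : Cell C →ₗ[ℚ] Tot Φ.HHs) : Prop where
  retr : IsRetraction 𝓔 Φ.γs Φ.bS s p
  pos : ∀ x, P (pos C (Cbar C) x) = P x
  apply : ∀ j x (hx : x ∈ 𝓔 j),
    P x = Φ.cls j ⟨comps C (p x), Φ.comps_mem_cycles (retr.p_mem hx) (retr.b_p hx)⟩

theorem exists_isClassMap : ∃ s p P, Φ.IsClassMap s p P := by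
  have hbb : ∀ x, Φ.bS (Φ.bS x) = 0 := Φ.homotopyGerstenhaber.b_b
  obtain ⟨s, p, hR⟩ := exists_isRetraction Φ.iSupIndep_shiftDeg
    (fun j x => Φ.γs_of_shiftDeg) (bS_mem (Φ := Φ)) hbb
  obtain ⟨P, hP⟩ := exists_glue Φ.iSupIndep_shiftDeg fun j =>
    DirectSum.lof ℚ ℤ Φ.HHs j ∘ₗ Submodule.mkQ _ ∘ₗ
      (comps C ∘ₗ p ∘ₗ (𝓔 j).subtype).codRestrict (Φ.cycles (j + 1 - m)) fun x =>
        Φ.comps_mem_cycles (hR.p_mem x.2) (hR.b_p x.2)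
  refine ⟨s, p, P ∘ₗ KModel.pos C (Cbar C), hR, fun x => ?_, fun j x hx => ?_⟩
  · rw [comp_apply, comp_apply, pos_pos]
  · rw [comp_apply, Φ.pos_of_shiftDeg hx, hP j x hx]
    rfl

include Φ in
theorem ext_of_pos {f g : Cell C →ₗ[ℚ] Tot Φ.HHs} (hf : ∀ x, f (KModel.pos C (Cbar C) x) = f x)
    (hg : ∀ x, g (KModel.pos C (Cbar C) x) = g x) (h : ∀ j, ∀ x ∈ 𝓔 j, f x = g x) (x : Cell C) :
    f x = g x := by
  rw [← hf, ← hg]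
  exact (iSup_le fun j x hx => h j x hx : ⨆ j, 𝓔 j ≤ LinearMap.eqLocus f g) (Φ.pos_mem_iSup x)

namespace IsClassMap

variable {Φ} (hP : Φ.IsClassMap s p P)

include hP

theorem eq_cls (hx : x ∈ 𝓔 j) (hb : Φ.bS x = 0) :
    P x = Φ.cls j ⟨comps C x, Φ.comps_mem_cycles hx hb⟩ := by
  have hs := hP.retr.s_mem j x hx
  rw [hP.apply j x hx]
  refine Φ.cls_eq_of_sub_eq (ζ := -comps C (s x)) (neg_mem (comps_mem (Φ := Φ) hs)) ?_
  rw [map_neg, b1S_comps hs]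
  change comps C (p x) - comps C x = _
  rw [hP.retr.p_apply, hb, map_zero, sub_zero, map_sub, sub_sub_cancel_left]

theorem mem (j : ℤ) (x : Cell C) (hx : x ∈ 𝓔 j) : P x ∈ totDeg Φ.HHs j := by
  rw [hP.apply j x hx]
  exact ⟨_, rfl⟩

theorem apply_b (x : Cell C) : P (Φ.bS x) = 0 := by
  refine Φ.ext_of_pos (f := P ∘ₗ Φ.bS) (g := 0) (fun x => ?_) (fun _ => rfl) (fun j x hx => ?_) x
  · rw [comp_apply, ← pos_bS, hP.pos]; rfl
  · rw [comp_apply, hP.apply _ _ (bS_mem j x hx)]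
    simp only [hP.retr.p_b hx, map_zero]
    exact map_zero (DirectSum.lof ℚ ℤ Φ.HHs (j - 1) ∘ₗ Submodule.mkQ _)

theorem totPar_apply (x : Cell C) : totPar Φ.HHs (P x) = P (Φ.γs x) := by
  refine Φ.ext_of_pos (f := totPar Φ.HHs ∘ₗ P) (g := P ∘ₗ Φ.γs) (fun x => ?_) (fun x => ?_)
    (fun j x hx => ?_) x
  · rw [comp_apply, hP.pos]; rfl
  · rw [comp_apply, γs_eq, ← Φ.barModel.pos_γc, hP.pos]; rfl
  · rw [comp_apply, comp_apply, totPar_of_mem (hP.mem j x hx), Φ.γs_of_shiftDeg hx, map_smul]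

theorem map_tb₂ (t : Cell C ⊗[ℚ] Cell C) : map P P (tb₂ Φ.γs Φ.bS t) = 0 := by
  rw [tb₂, LinearMap.add_apply, map_add, map_map, map_map,
    show P ∘ₗ Φ.bS = 0 from LinearMap.ext hP.apply_b]
  simp

theorem represents {t : Cell C ⊗[ℚ] Cell C} (ht : t ∈ tdeg 𝓔 𝓔 k) (hb : tb₂ Φ.γs Φ.bS t = 0) :
    Φ.Represents k (map P P t) (comps₂ C t) := by
  have hS := map_mem_of_mem_tdeg (f := (map P P).prod (comps₂ C ∘ₗ map p p))
    (S := Submodule.span ℚ (Set.range fun q : Σ i : ℤ × ℤ,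
      Φ.cycles (i.1 + 1 - m) × Φ.cycles (i.2 + 1 - m) =>
        (Φ.cls q.1.1 q.2.1 ⊗ₜ[ℚ] Φ.cls q.1.2 q.2.2, cross (q.2.1 : Ch1 C) (q.2.2 : Ch1 C))))
    (fun i j _ x hx y hy => Submodule.subset_span
      ⟨⟨(i, j), ⟨_, Φ.comps_mem_cycles (hP.retr.p_mem hx) (hP.retr.b_p hx)⟩,
        ⟨_, Φ.comps_mem_cycles (hP.retr.p_mem hy) (hP.retr.b_p hy)⟩⟩, by
          refine Prod.ext (Eq.symm ?_) rfl
          change P x ⊗ₜ[ℚ] P y = _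
          rw [hP.apply i x hx, hP.apply j y hy]⟩) ht
  obtain ⟨n, c, g, e⟩ := Submodule.mem_span_set'.1 hS
  choose q hq using fun l => (g l).2
  refine ⟨n, fun l => (q l).1.1, fun l => (q l).1.2, fun l => c l • (q l).2.1,
    fun l => (q l).2.2, ?_, -comps₂ C (sqHomotopy Φ.γs s p t), neg_mem ?_, ?_⟩
  · have e' := congrArg Prod.fst e
    rw [Prod.fst_sum] at e'
    refine e'.symm.trans (Finset.sum_congr rfl fun l _ => ?_)
    rw [Prod.smul_fst, ← hq, smul_tmul']
    exact congrArg (· ⊗ₜ[ℚ] _)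
      (map_smul (DirectSum.lof ℚ ℤ Φ.HHs _ ∘ₗ Submodule.mkQ _) (c l) (q l).2.1).symm
  · exact mem_cc2 (Φ := Φ) rfl fun N => ⟨_, rep2_comps (hP.retr.homotopy_mem ht) N⟩
  · have e' := congrArg Prod.snd e
    rw [Prod.snd_sum] at e'
    have e'' : ∑ l, cross ((c l • (q l).2.1 : Φ.cycles _) : Ch1 C) ((q l).2.2 : Ch1 C)
        = comps₂ C (map p p t) := by
      refine Eq.trans (Finset.sum_congr rfl fun l _ => ?_) e'
      rw [Prod.smul_snd, ← hq]
      rfl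
    have e₃ := hP.retr.tb₂_homotopy ht
    rw [hb, map_zero, add_zero] at e₃
    rw [e'', map_neg, b2S_comps₂ (hP.retr.homotopy_mem ht), ← e₃, map_sub, neg_sub]

theorem represents_op {r : ℕ} {φ : Cell C →ₗ[ℚ] Cell C ⊗[ℚ] Cell C} {c : ℚ} (hc : c ≠ 0)
    (hφ : Φ.Homog r (δ + 1 - m) φ) (hpos : pos₂ C (Cbar C) ∘ₗ φ = φ)
    (hφb : ∀ x, φ (Φ.bS x) = c • tb₂ Φ.γs Φ.bS (φ x)) (hx : x ∈ 𝓔 j) (hb : Φ.bS x = 0) :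
    Φ.Represents (j + δ) (map P P (φ x)) (op r φ (comps C x)) := by
  rw [op_comps hφ hx]
  refine hP.represents (hφ.mem_tdeg hpos hx) ?_
  have e := hφb x
  rw [hb, map_zero] at e
  exact (smul_eq_zero.1 e.symm).resolve_left hc

variable (hsc : ∀ i ≤ 1, ∀ x ∈ 𝒞 i, Coalgebra.counit (R := ℚ) x = 0 → x = 0)

include hsc

theorem apply_total (α : Φ.cycles (j + 1 - m)) : P (total C (j + 1 - m) α) = Φ.cls j α := by
  rw [hP.eq_cls (total_mem α.2.1) (Φ.bS_total hsc α.2)]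
  congr 1
  exact Subtype.ext (Φ.comps_total hsc α.2.1)

theorem exists_cycle (j : ℤ) (y : Tot Φ.HHs) (hy : y ∈ totDeg Φ.HHs j) :
    ∃ x ∈ 𝓔 j, Φ.bS x = 0 ∧ P x = y := by
  obtain ⟨y, rfl⟩ := hy
  obtain ⟨α, rfl⟩ := Submodule.Quotient.mk_surjective _ y
  exact ⟨_, total_mem α.2.1, Φ.bS_total hsc α.2, hP.apply_total hsc α⟩

theorem eq_of_represents {t : Tot Φ.HHs ⊗[ℚ] Tot Φ.HHs} {u : Cell C ⊗[ℚ] Cell C}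
    (h : Φ.Represents k t (comps₂ C u)) : t = map P P u := by
  obtain ⟨n, i, j, x, y, rfl, ζ, hζ, e⟩ := h
  obtain ⟨z, hz⟩ := Φ.exists_rep2_of_mem hsc hζ
  have hz' : Φ.b2S ζ = comps₂ C (tb₂ Φ.γs Φ.bS z) :=
    funext fun p => funext fun q => ((hz (p + q)).b2S.eq p q le_rfl).symm
  have hc : ∀ l, cross (x l : Ch1 C) (y l : Ch1 C)
      = comps₂ C (total C (i l + 1 - m) (x l) ⊗ₜ[ℚ] total C (j l + 1 - m) (y l)) := fun l => by
    conv_lhs => rw [← Φ.comps_total hsc (x l).2.1, ← Φ.comps_total hsc (y l).2.1]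
    rfl
  rw [Finset.sum_congr rfl fun l _ => hc l, ← map_sum, hz', ← map_sub, ← sub_eq_zero,
    ← map_sub] at e
  have e' := congrArg (map P P) (Φ.pos₂_eq_zero e)
  rw [pos₂, map_map, show P ∘ₗ KModel.pos C (Cbar C) = P from LinearMap.ext hP.pos, map_zero,
    map_sub, hP.map_tb₂, sub_zero, map_sub, sub_eq_zero, map_sum] at e'
  rw [← e']
  refine Finset.sum_congr rfl fun l _ => ?_
  rw [map_tmul, hP.apply_total hsc, hP.apply_total hsc]

/-- The map on homology induced by an operator on `CC[1-m]`. -/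
theorem exists_induced {r : ℕ} {φ : Cell C →ₗ[ℚ] Cell C ⊗[ℚ] Cell C} {c : ℚ} (hc : c ≠ 0)
    (hφ : Φ.Homog r (δ + 1 - m) φ) (hpos : pos₂ C (Cbar C) ∘ₗ φ = φ)
    (hφb : ∀ x, φ (Φ.bS x) = c • tb₂ Φ.γs Φ.bS (φ x)) :
    ∃ v : Tot Φ.HHs →ₗ[ℚ] Tot Φ.HHs ⊗[ℚ] Tot Φ.HHs, ∀ (k : ℤ) (α : Φ.cycles (k + 1 - m)),
      Φ.Represents (k + δ) (v (Φ.cls k α)) (op r φ (α : Ch1 C)) := by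
  have hf : ∀ j, ∃ f : Φ.HHs j →ₗ[ℚ] Tot Φ.HHs ⊗[ℚ] Tot Φ.HHs, ∀ α : Φ.cycles (j + 1 - m),
      f (Submodule.Quotient.mk α) = map P P (φ (total C (j + 1 - m) α)) := fun j => by
    refine ⟨Submodule.liftQ _ (map P P ∘ₗ φ ∘ₗ total C (j + 1 - m) ∘ₗ
      (Φ.cycles (j + 1 - m)).subtype) ?_, fun α => rfl⟩
    rintro ⟨α, hα⟩ ⟨β, hβ, rfl⟩
    rw [show j + 1 - m + 1 = j + 1 + 1 - m by ring] at hβ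
    have hw := total_mem hβ
    have e : total C (j + 1 - m) (Φ.b1S β) = Φ.bS (total C (j + 1 + 1 - m) β) := by
      have hb : Φ.b1S β ∈ cc1 𝒞 (j + 1 - m) := Submodule.smul_mem _ _ hα.1
      refine Φ.eq_of_comps_eq (total_mem hb) (by simpa using bS_mem (j + 1) _ hw) ?_
      rw [Φ.comps_total hsc hb, ← b1S_comps hw, Φ.comps_total hsc hβ]
    rw [b1S, LinearMap.smul_apply, map_smul] at e
    have e' := congrArg (fun x => map P P (φ x)) e
    simp only [map_smul, hφb, hP.map_tb₂, smul_zero] at e'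
    exact (smul_eq_zero.1 e').resolve_left (zpow_ne_zero _ (by norm_num))
  choose f hf using hf
  refine ⟨DirectSum.toModule ℚ ℤ _ f, fun k α => ?_⟩
  have h := hP.represents_op hc hφ hpos hφb (total_mem α.2.1) (Φ.bS_total hsc α.2)
  rw [Φ.comps_total hsc α.2.1, ← hf] at h
  exact (DirectSum.toModule_lof ℚ k (φ := f) (Submodule.Quotient.mk α)) ▸ h

end IsClassMap

theorem induced_spec (hsc : ∀ i ≤ 1, ∀ x ∈ 𝒞 i, Coalgebra.counit (R := ℚ) x = 0 → x = 0) :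
    (∃! p : (Tot Φ.HHs →ₗ[ℚ] Tot Φ.HHs ⊗[ℚ] Tot Φ.HHs) ×
        (Tot Φ.HHs →ₗ[ℚ] Tot Φ.HHs ⊗[ℚ] Tot Φ.HHs), Φ.Induced p.1 p.2) ∧
      ∀ v S : Tot Φ.HHs →ₗ[ℚ] Tot Φ.HHs ⊗[ℚ] Tot Φ.HHs,
        Φ.Induced v S → IsGerstenhaberCoalgebra Φ.HHs v S := by
  obtain ⟨s, p, P, hP⟩ := Φ.exists_isClassMap
  have 𝔥 : HomotopyGerstenhaber Φ.γs Φ.bS Φ.veeP Φ.barModel.hP Φ.barModel.HP :=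
    Φ.homotopyGerstenhaber
  have v₁ := op_congr (Φ := Φ) (r := 1) (rfl : _ = Φ.veeP)
  have s₁ := op_congr (Φ := Φ) (r := 2) Φ.SS_eq
  have hv : Φ.Homog 1 (0 + 1 - m) Φ.veeP := by rw [zero_add]; exact homog_veeP
  have hS : Φ.Homog 2 (1 + 1 - m) Φ.SP := homog_SP
  have hpp : ∀ t, pos₂ C (Cbar C) (pos₂ C (Cbar C) t) = pos₂ C (Cbar C) t := fun t => by
    rw [pos₂, map_map,
      show KModel.pos C (Cbar C) ∘ₗ KModel.pos C (Cbar C) = KModel.pos C (Cbar C) from LinearMap.ext pos_pos]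
  have hvp : pos₂ C (Cbar C) ∘ₗ Φ.veeP = Φ.veeP := LinearMap.ext fun x => hpp _
  have hSp : pos₂ C (Cbar C) ∘ₗ Φ.SP = Φ.SP := by
    rw [SP, ← Φ.SS_eq]; exact LinearMap.ext fun x => hpp _
  have key : ∀ {v S : Tot Φ.HHs →ₗ[ℚ] Tot Φ.HHs ⊗[ℚ] Tot Φ.HHs}, Φ.Induced v S →
      (∀ j, ∀ x ∈ 𝓔 j, Φ.bS x = 0 → v (P x) = map P P (Φ.veeP x)) ∧
      (∀ j, ∀ x ∈ 𝓔 j, Φ.bS x = 0 → S (P x) = map P P (Φ.SP x)) := by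
    refine fun h => ⟨fun j x hx hb => ?_, fun j x hx hb => ?_⟩
    · have e := (h j ⟨_, Φ.comps_mem_cycles hx hb⟩).1
      rw [v₁, op_comps hv hx, ← hP.eq_cls hx hb] at e
      exact hP.eq_of_represents hsc e
    · have e := (h j ⟨_, Φ.comps_mem_cycles hx hb⟩).2
      rw [s₁, op_comps hS hx, ← hP.eq_cls hx hb] at e
      exact hP.eq_of_represents hsc e
  have hsurj := hP.exists_cycle hsc
  refine ⟨?_, fun v S h => 𝔥.isGerstenhaberCoalgebra hP.retr (fun j x hx => by
    simpa using hv.mem_tdeg hvp hx) (fun j x => hS.mem_tdeg hSp) hP.mem hP.apply_b hP.totPar_apply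
    hsurj (key h).1 (key h).2⟩
  obtain ⟨v, hv'⟩ := hP.exists_induced hsc one_ne_zero hv hvp fun x => by rw [𝔥.b_v, one_smul]
  obtain ⟨S, hS'⟩ := hP.exists_induced hsc (c := -1) (by norm_num) hS hSp fun x => by
    rw [neg_one_smul, eq_neg_iff_add_eq_zero, add_comm, ← eq_neg_iff_add_eq_zero]
    exact 𝔥.b_bracket x
  have hI : Φ.Induced v S := fun k α => by
    rw [v₁, s₁]
    exact ⟨by simpa using hv' k α, hS' k α⟩
  refine ⟨(v, S), hI, fun q hq => Prod.ext ?_ ?_⟩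
  · exact ext_of_surj hsurj fun j x hx hb => by rw [(key hq).1 j x hx hb, (key hI).1 j x hx hb]
  · exact ext_of_surj hsurj fun j x hx hb => by rw [(key hq).2 j x hx hb, (key hI).2 j x hx hb]

end OpenFrobenius

end HochCog

end

theorem theorem5p4 {C : Type*} [AddCommGroup C] [Module ℚ C] [Coalgebra ℚ C] (m : ℤ)
    (𝒞 : ℤ → Submodule ℚ C) [DirectSum.Decomposition 𝒞] (Φ : HochCog.OpenFrobenius m 𝒞) :
    Φ.CompletedGerstenhaber ∧
    ((∀ i ≤ 1, ∀ x ∈ 𝒞 i, Coalgebra.counit (R := ℚ) x = 0 → x = 0) →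
      (∃! p : (HochCog.Tot Φ.HHs →ₗ[ℚ] HochCog.Tot Φ.HHs ⊗[ℚ] HochCog.Tot Φ.HHs) ×
          (HochCog.Tot Φ.HHs →ₗ[ℚ] HochCog.Tot Φ.HHs ⊗[ℚ] HochCog.Tot Φ.HHs),
        Φ.Induced p.1 p.2) ∧
      ∀ v S : HochCog.Tot Φ.HHs →ₗ[ℚ] HochCog.Tot Φ.HHs ⊗[ℚ] HochCog.Tot Φ.HHs,
        Φ.Induced v S → HochCog.IsGerstenhaberCoalgebra Φ.HHs v S) :=
  ⟨Φ.completedGerstenhaber, Φ.induced_spec⟩
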